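/- **Theorem.** Let $k$ be a field of characteristic $p>0$. *Conventions.* Let $\mathcal A$ be the category of Artinian local $k$-algebras with residue field $k$. A deformation of a $k$-scheme $X$ over $A\in\mathcal A$ is a flat, surjective, separated $A$-scheme $\mathcal X$ of finite type with an identification of $X$ with its closed fibre $\mathcal X\times_{\operatorname{Spec}A}\operatorname{Spec}k$; an isomorphism of deformations is an $A$-isomorphism compatible with the inclusions of $X$. A deformation is trivial if it is isomorphic to $X\times_k\operatorname{Spec}A$, and locally trivial if it is trivial on the members of an open cover of $X$. Let $\operatorname{Def}'_X(A)$ be the set of isomorphism classes of locally trivial deformations, a functor $\mathcal A\to(\mathrm{sets})$ by pullback. A functor $F$ on $\mathcal A$ satisfies $(H_1)$ if $F(A''\times_AA')\to F(A'')\times_{F(A)}F(A')$ is surjective for all $A''\to A\leftarrow A'$ in $\mathcal A$ such that $A''\to A$ is surjective with one-dimensional kernel. A rational double point is a normal two-dimensional point of multiplicity $2$ that has an affine open neighbourhood $U$ with a resolution $f:Z\to U$ such that $H^1(Z,\mathcal O_Z)=0$ (i.e. $R^1f_*\mathcal O_Z=0$). *The surface.* Let $R_0=k[x,y,z]/(xz-y^p)$,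 embed $U_0=\operatorname{Spec}R_0$ in $\mathbb P^9_k$ by $$\bigl(1: x: x^{p(p+1)+1}y^{p+1}: yz: z: y: x^{p+1}y: x^{p^2+1}y^p: x^{p(p+1)}y^{p+1}: y^{p+1}\bigr),$$ and let $X_0$ be the closure of $U_0$ with the reduced subscheme structure. Denote these coordinates by $\varphi_0,\dots,\varphi_9$. For $0\le i\le 4$ let $R_i\subset k[x^{\pm1},y^{\pm1}]\subset\operatorname{Frac}R_0$ (where $z=x^{-1}y^p$) be the $k$-algebra generated by all $\varphi_j/\varphi_i$, and let $R_{ij}$ be the $k$-algebra generated by $R_i$ and $R_j$. *Claim.* (1) $X_0$ is a normal integral projective surface over $k$, birational over $k$ to the affine plane; it has a rational double point $P$, and $X_0\setminus\{P\}$ is regular and smooth over $k$. (2) The open subschemes $U_i=X_0\cap\{T_i\ne0\}$, $0\le i\le4$, cover $X_0$ and are $\operatorname{Spec}R_i$, with $T_j/T_i=\varphi_j/\varphi_i$. Let $k[\lambda]$, $k[\varepsilon]$ be defined by $\lambda^{p+1}=0$, $\varepsilon^p=0$, let $\pi:k[\lambda]\to k[\varepsilon]$, $\lambda\mapsto\varepsilon$,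 and let $\bar A=k[\lambda]\times_{k[\varepsilon]}k[\lambda]$ (both maps being $\pi$). Let $\psi_{ij}$ ($i<j$) be the $k[\lambda]$-automorphisms of $R_{ij}[\lambda]=R_{ij}\otimes_kk[\lambda]$ given by $$\psi_{01},\psi_{02},\psi_{03}:(x,y)\mapsto(x,y+\lambda),\qquad \psi_{04}:(xy^{-p},y)\mapsto(xy^{-p},y+\lambda),$$ $$\psi_{12}=\psi_{13}=\psi_{23}=\mathrm{id},\qquad \psi_{14},\psi_{24}:(x,y)\mapsto\bigl(x(1+\tfrac{\lambda}{y})^p,y\bigr),$$ $$\psi_{34}=\psi_{43}^{-1},\quad \psi_{43}:(x,y)\mapsto\bigl(x(1-\tfrac{\lambda}{y})^p,y\bigr).$$ Then the $\operatorname{Spec}R_i[\lambda]$ glue along $\operatorname{Spec}R_j[\lambda]\supset\operatorname{Spec}R_{ij}[\lambda]\xrightarrow{\operatorname{Spec}\psi_{ij}}\operatorname{Spec}R_{ij}[\lambda]\subset\operatorname{Spec}R_i[\lambda]$ to a deformation $X''$ of $X_0$ over $k[\lambda]$. This $X''$ is locally trivial, and its pullback along $\pi$ is isomorphic to the pullback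 along $\pi$ of the trivial deformation $X'=X_0\times_k\operatorname{Spec}k[\lambda]$. There is no locally trivial deformation of $X_0$ over $\bar A$ whose pullbacks along the first and second projections $\bar A\to k[\lambda]$ are isomorphic to $X''$ and $X'$, respectively. (3) $\operatorname{Def}'_{X_0}$ does not satisfy $(H_1)$. -/

import Mathlib

open CategoryTheory CategoryTheory.Limits AlgebraicGeometry TopologicalSpace
open scoped TensorProduct

universe u

noncomputable section

namespace LocTrivDef

/-! ### Artinian local algebras with residue field `k` -/

/-- Artinian local `k`-algebras with residue field `k`. -/
structure ArtAlg (k : Type u) [Field k] where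
  carrier : Type u
  [commRing : CommRing carrier]
  [algebra : Algebra k carrier]
  [isLocalRing : IsLocalRing carrier]
  [isArtinianRing : IsArtinianRing carrier]
  residue_bijective : Function.Bijective (algebraMap k (IsLocalRing.ResidueField carrier))

attribute [instance] ArtAlg.commRing ArtAlg.algebra ArtAlg.isLocalRing ArtAlg.isArtinianRing

variable {k : Type u} [Field k]

/-- Morphisms are the `k`-algebra homomorphisms; they are automatically local, see
`ArtAlg.isLocalHom`. -/
instance : Category (ArtAlg k) where
  Hom A B := A.carrier →ₐ[k] B.carrier
  id A := AlgHom.id k A.carrier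
  comp f g := AlgHom.comp g f

namespace ArtAlg

/-- A morphism as an algebra homomorphism. -/
def Hom.toAlgHom {A B : ArtAlg k} (f : A ⟶ B) : A.carrier →ₐ[k] B.carrier := f

theorem isLocalHom {A B : ArtAlg k} (f : A ⟶ B) : IsLocalHom (Hom.toAlgHom f).toRingHom := by
  refine ⟨fun a ha => ?_⟩
  by_contra h
  have h1 : a ∈ IsLocalRing.maximalIdeal A.carrier := h
  obtain ⟨n, hn⟩ := IsArtinianRing.isNilpotent_jacobson_bot (R := A.carrier)
  rw [IsLocalRing.jacobson_eq_maximalIdeal ⊥ bot_ne_top] at hn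
  have h2 : a ^ n = 0 := by
    have := Ideal.pow_mem_pow h1 n
    rwa [hn] at this
  have h3 := ha.pow n
  rw [← map_pow, h2, map_zero] at h3
  exact not_isUnit_zero h3

/-- The augmentation `A → A/𝔪 = k`. -/
def aug (A : ArtAlg k) : A.carrier →ₐ[k] k :=
  ((AlgEquiv.ofBijective (Algebra.ofId k (IsLocalRing.ResidueField A.carrier))
    A.residue_bijective).symm : IsLocalRing.ResidueField A.carrier →ₐ[k] k).comp
    (IsScalarTower.toAlgHom k A.carrier (IsLocalRing.ResidueField A.carrier))

theorem aug_eq_zero_iff (A : ArtAlg k) (a : A.carrier) : A.aug a = 0 ↔ ¬ IsUnit a := by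
  rw [← mem_nonunits_iff, ← IsLocalRing.mem_maximalIdeal, ← IsLocalRing.residue_eq_zero_iff]
  simp only [aug, AlgHom.comp_apply]
  exact map_eq_zero_iff _ (AlgEquiv.injective _)

theorem aug_comp {A B : ArtAlg k} (f : A ⟶ B) : B.aug.comp (Hom.toAlgHom f) = A.aug := by
  ext a
  have h : A.aug (a - algebraMap k _ (A.aug a)) = 0 := by simp
  rw [aug_eq_zero_iff] at h
  have h2 : ¬ IsUnit (Hom.toAlgHom f (a - algebraMap k _ (A.aug a))) := fun h' =>
    h ((isLocalHom f).map_nonunit _ h')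
  rw [← aug_eq_zero_iff] at h2
  simpa [sub_eq_zero] using h2

/-- A finite-dimensional `k`-algebra with an augmentation whose kernel consists of nilpotents is an
object of the category. -/
def ofAug (B : Type u) [CommRing B] [Algebra k B] [Module.Finite k B] (ε : B →ₐ[k] k)
    (hε : ∀ b, ε b = 0 → IsNilpotent b) : ArtAlg k :=
  have hu : ∀ b, ε b ≠ 0 → IsUnit b := fun b hb => by
    have h1 : IsNilpotent (b - algebraMap k B (ε b)) := hε _ (by simp)
    have h2 : IsUnit (algebraMap k B (ε b)) := (IsUnit.mk0 _ hb).map _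
    have := IsNilpotent.isUnit_add_left_of_commute h1 h2 (Commute.all _ _)
    simpa using this
  have hn : ∀ b, b ∈ nonunits B ↔ ε b = 0 := fun b =>
    ⟨fun h => by_contra fun h' => h (hu b h'), fun h h' => (h'.map ε).ne_zero h⟩
  haveI : Nontrivial B := ε.toRingHom.domain_nontrivial
  haveI : IsLocalRing B := IsLocalRing.of_nonunits_add fun a b ha hb => by
    rw [hn] at *
    simp [ha, hb]
  haveI : IsArtinianRing B := IsArtinianRing.of_finite k B
  { carrier := B
    residue_bijective := by
      refine ⟨RingHom.injective _, fun x => ?_⟩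
      obtain ⟨b, rfl⟩ := IsLocalRing.residue_surjective x
      refine ⟨ε b, ?_⟩
      rw [IsScalarTower.algebraMap_apply k B (IsLocalRing.ResidueField B),
        IsLocalRing.ResidueField.algebraMap_eq, ← sub_eq_zero, ← map_sub,
        IsLocalRing.residue_eq_zero_iff, IsLocalRing.mem_maximalIdeal, hn]
      simp }

/-- The truncated polynomial ring `k[t]/(t^n)`. -/
abbrev Trunc (k : Type u) [Field k] (n : ℕ) : Type u :=
  AdjoinRoot ((Polynomial.X : Polynomial k) ^ n)

theorem trunc_root_pow (n : ℕ) :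
    (AdjoinRoot.root ((Polynomial.X : Polynomial k) ^ n)) ^ n = 0 := by
  have := AdjoinRoot.eval₂_root ((Polynomial.X : Polynomial k) ^ n)
  simpa using this

instance (n : ℕ) : Module.Finite k (Trunc k n) :=
  (Polynomial.monic_X_pow n).finite_adjoinRoot

/-- `k[t]/(t^n)`, `n ≥ 1`, as an object of the category. -/
def trunc (k : Type u) [Field k] (n : ℕ) [NeZero n] : ArtAlg k :=
  ofAug (Trunc k n) (AdjoinRoot.liftAlgHom _ (AlgHom.id k k) 0 (by simp [NeZero.ne n])) (by
    intro b hb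
    obtain ⟨f, rfl⟩ := AdjoinRoot.mk_surjective b
    have h0 : Polynomial.eval 0 f = 0 := by
      simpa [Polynomial.eval] using hb
    obtain ⟨g, rfl⟩ := Polynomial.X_dvd_iff.mpr
      (by rwa [← Polynomial.coeff_zero_eq_eval_zero] at h0)
    refine ⟨n, ?_⟩
    rw [map_mul, mul_pow, AdjoinRoot.mk_X, trunc_root_pow, zero_mul])

instance (n : ℕ) [NeZero n] : Module.Finite k (trunc k n).carrier :=
  inferInstanceAs (Module.Finite k (Trunc k n))

/-- The class of `t` in `k[t]/(t^n)`. -/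
def t (k : Type u) [Field k] (n : ℕ) [NeZero n] : (trunc k n).carrier :=
  AdjoinRoot.root ((Polynomial.X : Polynomial k) ^ n)

theorem t_pow (n : ℕ) [NeZero n] : t k n ^ n = 0 := trunc_root_pow n

/-- The truncation `k[t]/(t^(n+1)) → k[t]/(t^n)`, `t ↦ t`. -/
def truncMap (k : Type u) [Field k] (n : ℕ) [NeZero n] : trunc k (n + 1) ⟶ trunc k n :=
  (AdjoinRoot.liftAlgHom _ (Algebra.ofId k (Trunc k n)) (AdjoinRoot.root _) (by
    rw [Polynomial.eval₂_pow, Polynomial.eval₂_X, pow_succ, trunc_root_pow, zero_mul]) :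
    Trunc k (n + 1) →ₐ[k] Trunc k n)

section FibreProduct

variable {A'' A' A : ArtAlg k} (f : A'' ⟶ A) (g : A' ⟶ A)

/-- The fibre product `{(a, b) | f a = g b}` as a `k`-algebra. -/
abbrev fibreProdSubalgebra : Subalgebra k (A''.carrier × A'.carrier) :=
  AlgHom.equalizer ((Hom.toAlgHom f).comp (AlgHom.fst k A''.carrier A'.carrier))
    ((Hom.toAlgHom g).comp (AlgHom.snd k A''.carrier A'.carrier))

variable [Module.Finite k A''.carrier] [Module.Finite k A'.carrier]

/-- The fibre product `A'' ×_A A'` as an object of the category. -/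
def fibreProd : ArtAlg k :=
  haveI : Module.Finite k (fibreProdSubalgebra f g) :=
    inferInstanceAs (Module.Finite k (Subalgebra.toSubmodule (fibreProdSubalgebra f g)))
  ofAug (fibreProdSubalgebra f g)
    (A''.aug.comp ((AlgHom.fst k A''.carrier A'.carrier).comp (fibreProdSubalgebra f g).val)) (by
      have nil : ∀ (B : ArtAlg k) (b : B.carrier), B.aug b = 0 → IsNilpotent b := by
        intro B b hb
        rw [aug_eq_zero_iff, ← mem_nonunits_iff, ← IsLocalRing.mem_maximalIdeal] at hb
        obtain ⟨n, hn⟩ := IsArtinianRing.isNilpotent_jacobson_bot (R := B.carrier)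
        rw [IsLocalRing.jacobson_eq_maximalIdeal ⊥ bot_ne_top] at hn
        exact ⟨n, by simpa [hn] using Ideal.pow_mem_pow hb n⟩
      rintro ⟨⟨a, b⟩, hab⟩ h
      replace hab : Hom.toAlgHom f a = Hom.toAlgHom g b := hab
      replace h : A''.aug a = 0 := h
      have hb : A'.aug b = 0 := by
        rw [← aug_comp g, AlgHom.comp_apply, ← hab, ← AlgHom.comp_apply, aug_comp f, h]
      obtain ⟨m, hm⟩ := nil _ _ h
      obtain ⟨n, hn⟩ := nil _ _ hb
      refine ⟨m + n, Subtype.ext (Prod.ext ?_ ?_)⟩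
      · change a ^ (m + n) = 0
        rw [pow_add, hm, zero_mul]
      · change b ^ (m + n) = 0
        rw [pow_add, hn, mul_zero])

/-- The first projection `A'' ×_A A' → A''`. -/
def fibreProdFst : fibreProd f g ⟶ A'' :=
  ((AlgHom.fst k A''.carrier A'.carrier).comp (fibreProdSubalgebra f g).val :
    fibreProdSubalgebra f g →ₐ[k] A''.carrier)

/-- The second projection `A'' ×_A A' → A'`. -/
def fibreProdSnd : fibreProd f g ⟶ A' :=
  ((AlgHom.snd k A''.carrier A'.carrier).comp (fibreProdSubalgebra f g).val :
    fibreProdSubalgebra f g →ₐ[k] A'.carrier)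

theorem fibreProd_isPullback : IsPullback (fibreProdFst f g) (fibreProdSnd f g) f g := by
  refine ⟨⟨AlgHom.ext fun x => x.2⟩, ⟨PullbackCone.IsLimit.mk _ (fun c =>
    (AlgHom.codRestrict (AlgHom.prod (Hom.toAlgHom c.fst) (Hom.toAlgHom c.snd))
      (fibreProdSubalgebra f g) (fun x => DFunLike.congr_fun (F := c.pt.carrier →ₐ[k] A.carrier)
        c.condition x) : c.pt.carrier →ₐ[k] fibreProdSubalgebra f g)) ?_ ?_ ?_⟩⟩
  · intro c
    rfl
  · intro c
    rfl
  · intro c m h1 h2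
    refine AlgHom.ext fun x => Subtype.ext (Prod.ext ?_ ?_)
    · exact DFunLike.congr_fun (F := c.pt.carrier →ₐ[k] A''.carrier) h1 x
    · exact DFunLike.congr_fun (F := c.pt.carrier →ₐ[k] A'.carrier) h2 x

end FibreProduct

/-- The spectrum of an object. -/
abbrev spec (A : ArtAlg k) : Scheme.{u} := Spec (.of A.carrier)

/-- The morphism of spectra attached to a morphism. -/
def specMap {A B : ArtAlg k} (f : A ⟶ B) : B.spec ⟶ A.spec :=
  Spec.map (CommRingCat.ofHom (Hom.toAlgHom f).toRingHom)

/-- The structure morphism `Spec A → Spec k`. -/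
def toSpecK (A : ArtAlg k) : A.spec ⟶ Spec (.of k) :=
  Spec.map (CommRingCat.ofHom (algebraMap k A.carrier))

/-- The closed point `Spec k → Spec A`. -/
def pt (A : ArtAlg k) : Spec (.of k) ⟶ A.spec :=
  Spec.map (CommRingCat.ofHom A.aug.toRingHom)

theorem specMap_id (A : ArtAlg k) : specMap (𝟙 A) = 𝟙 A.spec := by
  exact Spec.map_id _

theorem specMap_comp {A B C : ArtAlg k} (f : A ⟶ B) (g : B ⟶ C) :
    specMap (f ≫ g) = specMap g ≫ specMap f := by
  exact Spec.map_comp (CommRingCat.ofHom (Hom.toAlgHom f).toRingHom)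
    (CommRingCat.ofHom (Hom.toAlgHom g).toRingHom)

theorem pt_specMap {A B : ArtAlg k} (f : A ⟶ B) : B.pt ≫ specMap f = A.pt := by
  rw [specMap, pt, pt, ← aug_comp f]
  exact (Spec.map_comp _ _).symm

theorem specMap_toSpecK {A B : ArtAlg k} (f : A ⟶ B) : specMap f ≫ A.toSpecK = B.toSpecK := by
  rw [specMap, toSpecK, toSpecK, ← AlgHom.comp_algebraMap (Hom.toAlgHom f)]
  exact (Spec.map_comp _ _).symm

theorem pt_toSpecK (A : ArtAlg k) : A.pt ≫ A.toSpecK = 𝟙 _ := by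
  have h : CommRingCat.ofHom (algebraMap k A.carrier) ≫ CommRingCat.ofHom A.aug.toRingHom =
      𝟙 (CommRingCat.of k) := by
    ext x
    exact A.aug.commutes x
  rw [pt, toSpecK, ← Spec.map_id, ← h]
  exact (Spec.map_comp _ _).symm

end ArtAlg

/-! ### Deformations -/

/-- A deformation over `A` of a `k`-scheme `s : X → Spec k`: a cartesian square exhibiting `X` as
the closed fibre of a flat surjective `A`-scheme which is separated and of finite type (over `A`
or over `k`, which is the same since `A` is finite-dimensional over `k`). -/
structure Deformation {X : Scheme.{u}} (s : X ⟶ Spec (.of k)) (A : ArtAlg k) where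
  total : Scheme.{u}
  toBase : total ⟶ A.spec
  incl : X ⟶ total
  flat : Flat toBase
  surjective : Surjective toBase
  separated : IsSeparated toBase
  locallyOfFiniteType : LocallyOfFiniteType toBase
  quasiCompact : QuasiCompact toBase
  isPullback : IsPullback incl s toBase A.pt

/-- Triviality of a family `toBase : Y → Spec A` with closed fibre `incl : X → Y`: there is a
retraction `Y → X` which, together with `Y → Spec A`, identifies `Y` with `X ×_k Spec A`. -/
def IsTrivialFamily {X Y : Scheme.{u}} (s : X ⟶ Spec (.of k)) {A : ArtAlg k} (toBase : Y ⟶ A.spec)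
    (incl : X ⟶ Y) : Prop :=
  ∃ r : Y ⟶ X, incl ≫ r = 𝟙 X ∧ IsPullback r toBase s A.toSpecK

namespace Deformation

variable {X : Scheme.{u}} {s : X ⟶ Spec (.of k)} {A B C : ArtAlg k}

/-- Isomorphism of deformations. -/
def Isomorphic (D E : Deformation s A) : Prop :=
  ∃ e : D.total ≅ E.total, D.incl ≫ e.hom = E.incl ∧ e.hom ≫ E.toBase = D.toBase

/-- `D` is trivial. -/
def IsTrivial (D : Deformation s A) : Prop := IsTrivialFamily s D.toBase D.incl

/-- `D` is locally trivial: `X` is covered by open subsets `U` such that the restriction of `D` to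
`U` (that is, to the open `W` of the total space with the same underlying space) is trivial. -/
def IsLocallyTrivial (D : Deformation s A) : Prop :=
  ∀ x : X, ∃ (U : X.Opens) (W : D.total.Opens) (h : U = D.incl ⁻¹ᵁ W), x ∈ U ∧
    IsTrivialFamily (U.ι ≫ s) (W.ι ≫ D.toBase) (D.incl.resLE W U h.le)

/-- The trivial deformation `X ×_k Spec A`. -/
def trivial (s : X ⟶ Spec (.of k)) [Surjective s] [IsSeparated s] [LocallyOfFiniteType s]
    [QuasiCompact s] (A : ArtAlg k) : Deformation s A where
  total := pullback s A.toSpecK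
  toBase := pullback.snd s A.toSpecK
  incl := pullback.lift (𝟙 X) (s ≫ A.pt) (by simp [ArtAlg.pt_toSpecK])
  flat := by
    infer_instance
  surjective := inferInstance
  separated := inferInstance
  locallyOfFiniteType := inferInstance
  quasiCompact := inferInstance
  isPullback := by
    refine IsPullback.of_right (h₁₂ := pullback.fst s A.toSpecK) (v₁₃ := s) (h₂₂ := A.toSpecK)
      ?_ (pullback.lift_snd _ _ _) (IsPullback.of_hasPullback s A.toSpecK)
    simp only [ArtAlg.pt_toSpecK, pullback.lift_fst]
    exact IsPullback.of_horiz_isIso ⟨by simp⟩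

/-- The pullback of a deformation along `A → B`. -/
def baseChange (D : Deformation s A) (f : A ⟶ B) : Deformation s B where
  total := pullback D.toBase (ArtAlg.specMap f)
  toBase := pullback.snd _ _
  incl := pullback.lift D.incl (s ≫ B.pt) (by
    rw [Category.assoc, ArtAlg.pt_specMap, D.isPullback.w])
  flat := by have := D.flat; infer_instance
  surjective := by have := D.surjective; infer_instance
  separated := by have := D.separated; infer_instance
  locallyOfFiniteType := by have := D.locallyOfFiniteType; infer_instance
  quasiCompact := by have := D.quasiCompact; infer_instance
  isPullback := by
    refine IsPullback.of_right (h₁₂ := pullback.fst D.toBase (ArtAlg.specMap f))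
      (v₁₃ := D.toBase) (h₂₂ := ArtAlg.specMap f) ?_ (pullback.lift_snd _ _ _)
      (IsPullback.of_hasPullback _ _)
    simp only [ArtAlg.pt_specMap, pullback.lift_fst]
    exact D.isPullback

theorem Isomorphic.refl (D : Deformation s A) : Isomorphic D D := ⟨Iso.refl _, by simp, by simp⟩

theorem Isomorphic.symm {D E : Deformation s A} : Isomorphic D E → Isomorphic E D := by
  rintro ⟨e, h1, h2⟩
  exact ⟨e.symm, by simp [← h1], by simp [← h2]⟩

theorem Isomorphic.trans {D E F : Deformation s A} :
    Isomorphic D E → Isomorphic E F → Isomorphic D F := by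
  rintro ⟨e, h1, h2⟩ ⟨e', h1', h2'⟩
  exact ⟨e ≪≫ e', by simp [reassoc_of% h1, h1'], by simp [h2, h2']⟩

instance setoid (s : X ⟶ Spec (.of k)) (A : ArtAlg k) : Setoid (Deformation s A) where
  r := Isomorphic
  iseqv := ⟨Isomorphic.refl, Isomorphic.symm, Isomorphic.trans⟩

/-- The projection from the pullback of `D` to `D`. -/
def proj (D : Deformation s A) (f : A ⟶ B) : (D.baseChange f).total ⟶ D.total :=
  pullback.fst D.toBase (ArtAlg.specMap f)

theorem baseChange_incl_proj (D : Deformation s A) (f : A ⟶ B) :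
    (D.baseChange f).incl ≫ D.proj f = D.incl :=
  pullback.lift_fst _ _ _

theorem baseChange_isPullback (D : Deformation s A) (f : A ⟶ B) :
    IsPullback (D.proj f) (D.baseChange f).toBase D.toBase (ArtAlg.specMap f) :=
  IsPullback.of_hasPullback _ _

/-- Two deformations over `B` whose total spaces are cartesian over `D` along the same morphism
and compatibly with the embeddings of the closed fibre are isomorphic. -/
theorem Isomorphic.of_isPullback {D : Deformation s A} {E F : Deformation s B} {f : A ⟶ B}
    {p : E.total ⟶ D.total} {q : F.total ⟶ D.total}
    (hp : IsPullback p E.toBase D.toBase (ArtAlg.specMap f))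
    (hq : IsPullback q F.toBase D.toBase (ArtAlg.specMap f))
    (hp' : E.incl ≫ p = D.incl) (hq' : F.incl ≫ q = D.incl) : Isomorphic E F := by
  refine ⟨hp.isoIsPullback _ _ hq, ?_, ?_⟩
  · apply hq.hom_ext
    · rw [Category.assoc, IsPullback.isoIsPullback_hom_fst, hp', hq']
    · rw [Category.assoc, IsPullback.isoIsPullback_hom_snd, E.isPullback.w, F.isPullback.w]
  · rw [IsPullback.isoIsPullback_hom_snd]

theorem Isomorphic.baseChange {D E : Deformation s A} (h : Isomorphic D E) (f : A ⟶ B) :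
    Isomorphic (D.baseChange f) (E.baseChange f) := by
  obtain ⟨e, h1, h2⟩ := h
  have h3 : IsPullback e.hom D.toBase E.toBase (𝟙 _) := IsPullback.of_horiz_isIso ⟨by simp [h2]⟩
  have h4 := (D.baseChange_isPullback f).paste_horiz h3
  rw [Category.comp_id] at h4
  exact Isomorphic.of_isPullback h4 (E.baseChange_isPullback f)
    (by rw [← Category.assoc, baseChange_incl_proj, h1]) (E.baseChange_incl_proj f)

theorem baseChange_id (D : Deformation s A) : Isomorphic (D.baseChange (𝟙 A)) D := by
  have h : IsPullback (𝟙 D.total) D.toBase D.toBase (ArtAlg.specMap (𝟙 A)) := by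
    rw [ArtAlg.specMap_id]
    exact IsPullback.of_horiz_isIso ⟨by simp⟩
  exact Isomorphic.of_isPullback (D.baseChange_isPullback (𝟙 A)) h (D.baseChange_incl_proj _)
    (Category.comp_id _)

theorem baseChange_comp (D : Deformation s A) (f : A ⟶ B) (g : B ⟶ C) :
    Isomorphic (D.baseChange (f ≫ g)) ((D.baseChange f).baseChange g) := by
  have hp := ((D.baseChange f).baseChange_isPullback g).paste_horiz (D.baseChange_isPullback f)
  rw [← ArtAlg.specMap_comp] at hp
  exact Isomorphic.of_isPullback (D.baseChange_isPullback (f ≫ g)) hp (D.baseChange_incl_proj _)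
    (by rw [← Category.assoc, baseChange_incl_proj, baseChange_incl_proj])

theorem IsLocallyTrivial.baseChange {D : Deformation s A} (h : D.IsLocallyTrivial) (f : A ⟶ B) :
    (D.baseChange f).IsLocallyTrivial := by
  intro x
  obtain ⟨U, W, hU, hx, r, hr, hp⟩ := h x
  let q : (D.baseChange f).total ⟶ D.total := D.proj f
  have hq : (D.baseChange f).incl ≫ q = D.incl := D.baseChange_incl_proj f
  have hU' : U = (D.baseChange f).incl ⁻¹ᵁ (q ⁻¹ᵁ W) := by
    rw [← Scheme.Hom.comp_preimage, hq, hU]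
  refine ⟨U, q ⁻¹ᵁ W, hU', hx, q.resLE W (q ⁻¹ᵁ W) le_rfl ≫ r, ?_, ?_⟩
  · rw [← Category.assoc, Scheme.Hom.resLE_comp_resLE]
    simp only [hq]
    exact hr
  · have h1 := (isPullback_morphismRestrict q W).paste_vert (D.baseChange_isPullback f)
    rw [← ArtAlg.specMap_toSpecK f, Scheme.Hom.resLE_eq_morphismRestrict]
    exact h1.paste_horiz hp

end Deformation

/-- The deformation functor of `X`. -/
def Def {X : Scheme.{u}} (s : X ⟶ Spec (.of k)) : ArtAlg k ⥤ Type (u + 1) where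
  obj A := Quotient (Deformation.setoid s A)
  map f := ↾(Quotient.map (fun D => D.baseChange f) fun _ _ h => h.baseChange f)
  map_id A := by
    ext q
    induction q using Quotient.inductionOn with
    | h D => exact Quotient.sound D.baseChange_id
  map_comp f g := by
    ext q
    induction q using Quotient.inductionOn with
    | h D => exact Quotient.sound (D.baseChange_comp f g)

/-- The locally trivial deformation functor of `X`, as a subfunctor of the deformation functor. -/
def DefLT {X : Scheme.{u}} (s : X ⟶ Spec (.of k)) : Subfunctor (Def s) where
  obj A := {q | ∃ D : Deformation s A, D.IsLocallyTrivial ∧ (⟦D⟧ : Quotient _) = q}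
  map f := by
    rintro _ ⟨D, hD, rfl⟩
    exact ⟨D.baseChange f, hD.baseChange f, rfl⟩

/-- A small extension: a surjection whose kernel is one-dimensional over `k`. -/
def IsSmallExtension {A B : ArtAlg k} (f : A ⟶ B) : Prop :=
  Function.Surjective (ArtAlg.Hom.toAlgHom f) ∧
    Module.finrank k (LinearMap.ker (ArtAlg.Hom.toAlgHom f).toLinearMap) = 1

/-- Schlessinger's condition `(H₁)`: for every cartesian square with `A'' → A` a small extension,
`F(Ā) → F(A'') ×_{F(A)} F(A')` is surjective. -/
def SchlessingerH1 (F : ArtAlg k ⥤ Type*) : Prop :=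
  ∀ ⦃Ab A'' A' A : ArtAlg k⦄ (q'' : Ab ⟶ A'') (q' : Ab ⟶ A') (f : A'' ⟶ A) (g : A' ⟶ A),
    IsPullback q'' q' f g → IsSmallExtension f →
    ∀ (a'' : F.obj A'') (a' : F.obj A'), F.map f a'' = F.map g a' →
      ∃ a : F.obj Ab, F.map q'' a = a'' ∧ F.map q' a = a'

/-! ### Projective space and the surface -/

attribute [local instance] MvPolynomial.gradedAlgebra

/-- Projective `n`-space over `k`. -/
abbrev ProjSpace (k : Type u) [Field k] (n : ℕ) : Scheme.{u} :=
  Proj (MvPolynomial.homogeneousSubmodule (Fin (n + 1)) k)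

/-- The structure morphism of projective space. -/
def ProjSpace.toSpecK (k : Type u) [Field k] (n : ℕ) : ProjSpace k n ⟶ Spec (.of k) :=
  Proj.toSpecZero (MvPolynomial.homogeneousSubmodule (Fin (n + 1)) k) ≫
    Spec.map (CommRingCat.ofHom
      (algebraMap k (MvPolynomial.homogeneousSubmodule (Fin (n + 1)) k 0)))

theorem algebraMap_degreeZero_bijective (k : Type u) [Field k] (n : ℕ) : Function.Bijective
    (algebraMap k (MvPolynomial.homogeneousSubmodule (Fin (n + 1)) k 0)) := by
  refine ⟨fun a b h => ?_, fun ⟨f, hf⟩ => ?_⟩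
  · exact MvPolynomial.C_injective _ _ (congrArg Subtype.val h)
  · rw [MvPolynomial.mem_homogeneousSubmodule] at hf
    refine ⟨MvPolynomial.coeff 0 f, Subtype.ext ?_⟩
    have := MvPolynomial.totalDegree_eq_zero_iff_eq_C.mp
      (Nat.le_zero.mp hf.totalDegree_le)
    exact this.symm

instance (k : Type u) [Field k] (n : ℕ) : IsProper (ProjSpace.toSpecK k n) := by
  have : IsIso (CommRingCat.ofHom
      (algebraMap k (MvPolynomial.homogeneousSubmodule (Fin (n + 1)) k 0))) :=
    (ConcreteCategory.isIso_iff_bijective _).mpr (algebraMap_degreeZero_bijective k n)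
  have : Algebra.FiniteType (MvPolynomial.homogeneousSubmodule (Fin (n + 1)) k 0)
      (MvPolynomial (Fin (n + 1)) k) :=
    have : IsScalarTower k (MvPolynomial.homogeneousSubmodule (Fin (n + 1)) k 0)
      (MvPolynomial (Fin (n + 1)) k) := ⟨fun a b c => smul_mul_assoc a b.1 c⟩
    Algebra.FiniteType.of_restrictScalars_finiteType k _ _
  unfold ProjSpace.toSpecK
  infer_instance

/-- The morphism `Spec B → ℙⁿ` with homogeneous coordinates `(v 0 : ⋯ : v n)`, where `v i = 1`
for some `i`. It lands in the standard affine open `V_i`, where it is given by the homomorphism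
`T_j / T_i ↦ v j`. -/
def projPoint {k : Type u} [Field k] {n : ℕ} {B : Type u} [CommRing B] [Algebra k B]
    (v : Fin (n + 1) → B) (i : Fin (n + 1)) (hv : v i = 1) : Spec (.of B) ⟶ ProjSpace k n :=
  Proj.fromOfGlobalSections (MvPolynomial.homogeneousSubmodule (Fin (n + 1)) k)
    ((Scheme.ΓSpecIso (.of B)).inv.hom.comp (MvPolynomial.aeval v).toRingHom) (by
      rw [Ideal.eq_top_iff_one]
      have h : (MvPolynomial.X i : MvPolynomial (Fin (n + 1)) k) ∈ (HomogeneousIdeal.irrelevant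
          (MvPolynomial.homogeneousSubmodule (Fin (n + 1)) k)).toIdeal := by
        rw [HomogeneousIdeal.mem_iff, HomogeneousIdeal.mem_irrelevant_iff,
          GradedRing.proj_apply]
        exact DirectSum.decompose_of_mem_ne _ (MvPolynomial.isHomogeneous_X k i) one_ne_zero
      have := Ideal.mem_map_of_mem ((Scheme.ΓSpecIso (.of B)).inv.hom.comp
        (MvPolynomial.aeval (R := k) v).toRingHom) h
      simpa [hv] using this)

section Surface

variable (k) (p : ℕ)

/-- The coordinate ring `R₀ = k[x, y, z]/(xz - y^p)` of the embedded surface `xz = y^p`. -/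
abbrev R0 : Type u :=
  MvPolynomial (Fin 3) k ⧸ Ideal.span
    {(MvPolynomial.X 0 * MvPolynomial.X 2 - MvPolynomial.X 1 ^ p : MvPolynomial (Fin 3) k)}

/-- The classes of `x`, `y`, `z` in `R₀`. -/
def R0.var (i : Fin 3) : R0 k p := Ideal.Quotient.mk _ (MvPolynomial.X i)

/-- The affine coordinates `(1, φ(ζ₀₁), …, φ(ζ₀₉))` of the embedding of `U₀ = Spec R₀`. -/
def coords : Fin 10 → R0 k p :=
  let x := R0.var k p 0
  let y := R0.var k p 1
  let z := R0.var k p 2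
  ![1, x, x ^ (p * (p + 1) + 1) * y ^ (p + 1), y * z, z, y, x ^ (p + 1) * y,
    x ^ (p ^ 2 + 1) * y ^ p, x ^ (p * (p + 1)) * y ^ (p + 1), y ^ (p + 1)]

/-- The embedding `U₀ = Spec R₀ → V₀ ⊂ ℙ⁹`. -/
def embU0 : Spec (.of (R0 k p)) ⟶ ProjSpace k 9 := projPoint (coords k p) 0 rfl

/-- The ideal sheaf of the closure of `U₀` with its reduced structure. -/
def idealX0 : (ProjSpace k 9).IdealSheafData :=
  Scheme.IdealSheafData.vanishingIdeal ⟨closure (Set.range (embU0 k p)), isClosed_closure⟩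

/-- The surface `X₀`: the closure of `U₀` in `ℙ⁹` with the reduced subscheme structure. -/
def X0 : Scheme.{u} := (idealX0 k p).subscheme

/-- The inclusion `X₀ → ℙ⁹`. -/
def X0.ι : X0 k p ⟶ ProjSpace k 9 := (idealX0 k p).subschemeι

/-- The structure morphism `X₀ → Spec k`. -/
def X0.toSpecK : X0 k p ⟶ Spec (.of k) := X0.ι k p ≫ ProjSpace.toSpecK k 9

instance : IsClosedImmersion (X0.ι k p) :=
  inferInstanceAs (IsClosedImmersion (idealX0 k p).subschemeι)

instance : IsProper (X0.toSpecK k p) := by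
  unfold X0.toSpecK
  infer_instance

theorem X0_nonempty [NeZero p] : Nonempty (X0 k p) := by
  have : Nontrivial (R0 k p) := by
    refine Ideal.Quotient.nontrivial_iff.mpr fun h => ?_
    have h1 : Ideal.span {(MvPolynomial.X 0 * MvPolynomial.X 2 - MvPolynomial.X 1 ^ p :
        MvPolynomial (Fin 3) k)} ≤ RingHom.ker (MvPolynomial.aeval (R := k) (0 : Fin 3 → k)) := by
      rw [Ideal.span_singleton_le_iff_mem, RingHom.mem_ker]
      simp [NeZero.ne p]
    rw [h, top_le_iff] at h1
    exact RingHom.ker_ne_top _ h1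
  obtain ⟨q⟩ : Nonempty (PrimeSpectrum (R0 k p)) := inferInstance
  have hq : embU0 k p q ∈ Set.range (X0.ι k p) := by
    change _ ∈ Set.range (idealX0 k p).subschemeι
    rw [Scheme.IdealSheafData.range_subschemeι]
    have h := (Scheme.IdealSheafData.le_support_iff_le_vanishingIdeal (I := idealX0 k p)
      (Z := ⟨closure (Set.range (embU0 k p)), isClosed_closure⟩)).mpr le_rfl
    exact h (subset_closure ⟨q, rfl⟩)
  obtain ⟨x, -⟩ := hq
  exact ⟨x⟩

instance [NeZero p] : Surjective (X0.toSpecK k p) := by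
  have := X0_nonempty k p
  infer_instance

end Surface

/-! ### Notions for surfaces -/

/-- A scheme over `k` is projective if it is a closed subscheme of some projective space. -/
def IsProjectiveOver {X : Scheme.{u}} (s : X ⟶ Spec (.of k)) : Prop :=
  ∃ (n : ℕ) (i : X ⟶ ProjSpace k n), IsClosedImmersion i ∧ i ≫ ProjSpace.toSpecK k n = s

/-- A scheme is normal if its local rings are integrally closed domains. -/
def IsNormalScheme (X : Scheme.{u}) : Prop :=
  ∀ x : X, IsDomain (X.presheaf.stalk x) ∧ IsIntegrallyClosed (X.presheaf.stalk x)

/-- A scheme is regular if its local rings are regular. -/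
def IsRegularScheme (X : Scheme.{u}) : Prop := ∀ x : X, IsRegularLocalRing (X.presheaf.stalk x)

/-- Restriction of sections of the structure sheaf. -/
def restr {Z : Scheme.{u}} {U V : Z.Opens} (h : U ≤ V) (a : Γ(Z, V)) : Γ(Z, U) :=
  Z.presheaf.map (homOfLE h).op a

/-- Vanishing of `H¹(Z, 𝒪_Z)` for a (separated) scheme `Z`, by means of the Čech complex of a
finite affine open cover. -/
def H1Vanishes (Z : Scheme.{u}) : Prop :=
  ∃ (n : ℕ) (V : Fin n → Z.Opens), (∀ i, IsAffineOpen (V i)) ∧ (⨆ i, V i = ⊤) ∧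
    ∀ c : (i j : Fin n) → Γ(Z, V i ⊓ V j),
      (∀ i j l, restr (U := V i ⊓ V j ⊓ V l)
          (le_inf (inf_le_left.trans inf_le_right) inf_le_right) (c j l)
        - restr (le_inf (inf_le_left.trans inf_le_left) inf_le_right) (c i l)
        + restr inf_le_left (c i j) = 0) →
      ∃ b : (i : Fin n) → Γ(Z, V i), ∀ i j,
        c i j = restr inf_le_right (b j) - restr inf_le_left (b i)

/-- A resolution of singularities: `Z` is regular and `f` is proper and birational, i.e. an
isomorphism over a dense open subset with dense preimage. -/
structure IsResolution {Z Y : Scheme.{u}} (f : Z ⟶ Y) : Prop where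
  regular : IsRegularScheme Z
  proper : IsProper f
  birational : ∃ V : Y.Opens, Dense (V : Set Y) ∧ Dense ((f ⁻¹ᵁ V : Z.Opens) : Set Z) ∧
    IsIso (f ∣_ V)

/-- A rational double point: a normal two-dimensional point of multiplicity two which is a rational
singularity, i.e. which has an affine open neighbourhood with a resolution `f : Z → U` such that
`R¹f_* 𝒪_Z = 0`, equivalently (as `U` is affine) `H¹(Z, 𝒪_Z) = 0`. -/
structure IsRationalDoublePoint (X : Scheme.{u}) (P : X) : Prop where
  noetherian : IsNoetherianRing (X.presheaf.stalk P)
  domain : IsDomain (X.presheaf.stalk P)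
  integrallyClosed : IsIntegrallyClosed (X.presheaf.stalk P)
  dim_eq_two : ringKrullDim (X.presheaf.stalk P) = 2
  /-- The Hilbert–Samuel multiplicity `lim 2! · length(𝒪/𝔪ⁿ) / n²` equals `2`. -/
  multiplicity_eq_two : Filter.Tendsto
    (fun n : ℕ => 2 * ((Module.length (X.presheaf.stalk P) (X.presheaf.stalk P ⧸
      IsLocalRing.maximalIdeal (X.presheaf.stalk P) ^ n)).toNat : ℝ) / (n : ℝ) ^ 2)
    Filter.atTop (nhds 2)
  rational : ∃ U : X.Opens, P ∈ U ∧ IsAffineOpen U ∧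
    ∃ (Z : Scheme.{u}) (f : Z ⟶ U.toScheme), IsResolution f ∧ H1Vanishes Z

/-! ### Affine charts -/

section Charts

variable (k) (p : ℕ)

/-- The Laurent polynomial ring `k[x, x⁻¹, y, y⁻¹]`, which is a subring of `Frac R₀ = k(x, y)`
containing `R₀`, by `z = x⁻¹ y^p`. -/
abbrev Laurent : Type u := AddMonoidAlgebra k (ℤ × ℤ)

/-- The monomial `x^a y^b`. -/
def mono (m : ℤ × ℤ) : Laurent k := AddMonoidAlgebra.single m 1

/-- The exponents of the monomials `1, φ(ζ₀₁), …, φ(ζ₀₉)`, where `z = x⁻¹ y^p`. -/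
def expo : Fin 10 → ℤ × ℤ :=
  ![(0, 0), (1, 0), (p * (p + 1) + 1, p + 1), (-1, p + 1), (-1, p), (0, 1), (p + 1, 1),
    (p ^ 2 + 1, p), (p * (p + 1), p + 1), (0, p + 1)]

/-- The index of the `i`-th chart, `0 ≤ i ≤ 4`, as an index of a homogeneous coordinate. -/
abbrev idx (i : Fin 5) : Fin 10 := Fin.castLE (by norm_num) i

/-- The monomial `φ(ζ₀ⱼ)/φ(ζ₀ᵢ)`, i.e. the function `T_j / T_i`. -/
def coordMono (i : Fin 5) (j : Fin 10) : Laurent k := mono k (expo p j - expo p (idx i))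

/-- The ring `R_i`, generated by the quotients `φ(ζ₀ⱼ)/φ(ζ₀ᵢ)` for `0 ≤ j ≤ 9`. -/
def chartRing (i : Fin 5) : Subalgebra k (Laurent k) :=
  Algebra.adjoin k (Set.range (coordMono k p i))

/-- The ring `R_ij`, generated by `R_i` and `R_j`. -/
def overlapRing (i j : Fin 5) : Subalgebra k (Laurent k) := chartRing k p i ⊔ chartRing k p j

/-- The embedding `Spec R_i → V_i ⊂ ℙ⁹`, `T_j / T_i ↦ φ(ζ₀ⱼ)/φ(ζ₀ᵢ)`. -/
def chart (i : Fin 5) : Spec (.of (chartRing k p i)) ⟶ ProjSpace k 9 :=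
  projPoint (fun j => (⟨coordMono k p i j, Algebra.subset_adjoin ⟨j, rfl⟩⟩ : chartRing k p i)) (idx i) (by
    refine Subtype.ext ?_
    simp only [coordMono, mono, sub_self]
    rfl)

/-- The morphisms `c i : Spec R_i → X₀`, `0 ≤ i ≤ 4`, are the affine charts of `X₀`: they identify
`Spec R_i` with `U_i = X₀ ∩ V_i` compatibly with the embeddings in `ℙ⁹`, and the `U_i` cover `X₀`. -/
structure IsCharts (c : (i : Fin 5) → (Spec (.of (chartRing k p i)) ⟶ X0 k p)) : Prop where
  comp_ι : ∀ i, c i ≫ X0.ι k p = chart k p i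
  isOpenImmersion : ∀ i, IsOpenImmersion (c i)
  range_eq : ∀ i, Set.range (c i) = X0.ι k p ⁻¹'
    (Proj.basicOpen (MvPolynomial.homogeneousSubmodule (Fin 10) k) (MvPolynomial.X (idx i)) :
      Set (ProjSpace k 9))
  covers : ∀ x : X0 k p, ∃ i, x ∈ Set.range (c i)

end Charts

/-! ### Gluing -/

section Gluing

variable (k) (p : ℕ)

/-- The Artinian algebra `k[λ]`, `λ^(p+1) = 0`. -/
abbrev kl : ArtAlg k := ArtAlg.trunc k (p + 1)

/-- `S[λ] = S ⊗_k k[λ]`. -/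
abbrev Adj (S : Type u) [CommRing S] [Algebra k S] : Type u := S ⊗[k] (kl k p).carrier

/-- The element `λ`. -/
def lam : Adj k p (Laurent k) := 1 ⊗ₜ ArtAlg.t k (p + 1)

theorem lam_nilpotent : IsNilpotent (lam k p) :=
  ⟨p + 1, by rw [lam, Algebra.TensorProduct.tmul_pow, ArtAlg.t_pow, TensorProduct.tmul_zero]⟩

/-- The monomial `x^a y^b` as a unit of `k[x, x⁻¹, y, y⁻¹][λ]`. -/
def monoUnit (m : ℤ × ℤ) : (Adj k p (Laurent k))ˣ where
  val := mono k m ⊗ₜ 1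
  inv := mono k (-m) ⊗ₜ 1
  val_inv := by
    simp [mono, AddMonoidAlgebra.single_mul_single, ← AddMonoidAlgebra.one_def,
      ← Algebra.TensorProduct.one_def]
  inv_val := by
    simp [mono, AddMonoidAlgebra.single_mul_single, ← AddMonoidAlgebra.one_def,
      ← Algebra.TensorProduct.one_def]

/-- The unit `x`. -/
abbrev ux : (Adj k p (Laurent k))ˣ := monoUnit k p (1, 0)

/-- The unit `y`. -/
abbrev uy : (Adj k p (Laurent k))ˣ := monoUnit k p (0, 1)

/-- The unit `y + λ`. -/
def uyAdd : (Adj k p (Laurent k))ˣ :=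
  ((lam_nilpotent k p).isUnit_add_left_of_commute (uy k p).isUnit (Commute.all _ _)).unit

theorem uyAdd_val : (uyAdd k p : Adj k p (Laurent k)) = uy k p + lam k p :=
  rfl

/-- The unit `1 + λ/y = (y + λ)/y`. -/
def uOneAdd : (Adj k p (Laurent k))ˣ := uyAdd k p * (uy k p)⁻¹

/-- The unit `1 - λ/y`. -/
def uOneSub : (Adj k p (Laurent k))ˣ :=
  ((Commute.all (lam k p) ↑(uy k p)⁻¹).isNilpotent_mul_right
    (lam_nilpotent k p)).isUnit_one_sub.unit

/-- The endomorphism of the `k[λ]`-algebra `k[x, x⁻¹, y, y⁻¹][λ]` with `x ↦ u` and `y ↦ v`. -/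
def subst (u v : (Adj k p (Laurent k))ˣ) : Adj k p (Laurent k) →ₐ[k] Adj k p (Laurent k) :=
  Algebra.TensorProduct.lift
    (AddMonoidAlgebra.lift k (Adj k p (Laurent k)) (ℤ × ℤ)
      { toFun := fun m => ((u ^ m.toAdd.1 * v ^ m.toAdd.2 : (Adj k p (Laurent k))ˣ) :
          Adj k p (Laurent k))
        map_one' := by simp
        map_mul' := fun a b => by
          simp only [toAdd_mul, Prod.fst_add, Prod.snd_add, zpow_add, ← Units.val_mul]
          congr 1
          exact mul_mul_mul_comm _ _ _ _ })
    Algebra.TensorProduct.includeRight (fun _ _ => Commute.all _ _)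

/-- The extension to `k[x, x⁻¹, y, y⁻¹][λ]` of the transition automorphism `ψ_ij`, `i < j`:
* `ψ₀₁, ψ₀₂, ψ₀₃ : (x, y) ↦ (x, y + λ)`;
* `ψ₀₄ : (x y⁻ᵖ, y) ↦ (x y⁻ᵖ, y + λ)`, i.e. `(x, y) ↦ (x (1 + λ/y)^p, y + λ)`;
* `ψ₁₂, ψ₁₃, ψ₂₃` are the identity;
* `ψ₁₄, ψ₂₄ : (x, y) ↦ (x (1 + λ/y)^p, y)`;
* `ψ₃₄` is the inverse of `ψ₄₃ : (x, y) ↦ (x (1 - λ/y)^p, y)`. -/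
def psiExt : Fin 5 → Fin 5 → (Adj k p (Laurent k) →ₐ[k] Adj k p (Laurent k))
  | 0, 4 => subst k p (ux k p * uOneAdd k p ^ p) (uyAdd k p)
  | 0, _ => subst k p (ux k p) (uyAdd k p)
  | 1, 4 => subst k p (ux k p * uOneAdd k p ^ p) (uy k p)
  | 2, 4 => subst k p (ux k p * uOneAdd k p ^ p) (uy k p)
  | 3, 4 => subst k p (ux k p * (uOneSub k p ^ p)⁻¹) (uy k p)
  | _, _ => AlgHom.id k _

/-- The inclusion `S[λ] → T[λ]` of subalgebras `S ≤ T`. -/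
def inclLam {S T : Subalgebra k (Laurent k)} (h : S ≤ T) : Adj k p S →ₐ[k] Adj k p T :=
  Algebra.TensorProduct.map (Subalgebra.inclusion h) (AlgHom.id k _)

/-- The inclusion `S[λ] → k[x, x⁻¹, y, y⁻¹][λ]`. -/
def valLam (S : Subalgebra k (Laurent k)) : Adj k p S →ₐ[k] Adj k p (Laurent k) :=
  Algebra.TensorProduct.map S.val (AlgHom.id k _)

/-- `ψ` is the automorphism `ψ_ij` of `R_ij[λ]`. -/
def IsPsi (i j : Fin 5) (ψ : Adj k p (overlapRing k p i j) ≃ₐ[k] Adj k p (overlapRing k p i j)) : Prop :=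
  ∀ a, valLam k p (overlapRing k p i j) (ψ a) = psiExt k p i j (valLam k p (overlapRing k p i j) a)

/-- The reduction `S[λ] → S`, `λ ↦ 0`. -/
def redLam (S : Type u) [CommRing S] [Algebra k S] : Adj k p S →ₐ[k] S :=
  Algebra.TensorProduct.lift (AlgHom.id k S) ((Algebra.ofId k S).comp (kl k p).aug)
    (fun _ _ => Commute.all _ _)

/-- `Spec` of an algebra homomorphism. -/
abbrev specAlg {S T : Type u} [CommRing S] [CommRing T] [Algebra k S] [Algebra k T]
    (f : S →ₐ[k] T) : Spec (.of T) ⟶ Spec (.of S) := Spec.map (CommRingCat.ofHom f.toRingHom)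

/-- The deformation `D` of `X₀` over `k[λ]` is obtained by gluing the `U_i[λ] = Spec R_i[λ]`,
`0 ≤ i ≤ 4`, along `U_j[λ] ⊃ Spec R_ij[λ] → Spec R_ij[λ] ⊂ U_i[λ]`, where the arrow is `Spec ψ_ij`,
for `i < j`: there are open immersions `g i : U_i[λ] → D` over `k[λ]` which extend the charts `c i`
of `X₀`, cover `D`, and intersect as prescribed. -/
def IsGluedDeformation (c : (i : Fin 5) → (Spec (.of (chartRing k p i)) ⟶ X0 k p))
    (D : Deformation (X0.toSpecK k p) (kl k p)) : Prop :=
  ∃ g : (i : Fin 5) → (Spec (.of (Adj k p (chartRing k p i))) ⟶ D.total),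
    (∀ i, IsOpenImmersion (g i)) ∧
    (∀ z : D.total, ∃ i, z ∈ Set.range (g i)) ∧
    (∀ i, g i ≫ D.toBase = specAlg k Algebra.TensorProduct.includeRight) ∧
    (∀ i, c i ≫ D.incl = specAlg k (redLam k p (chartRing k p i)) ≫ g i) ∧
    ∀ i j, i < j → ∃ ψ, IsPsi k p i j ψ ∧
      IsPullback (specAlg k (inclLam k p (le_sup_right : chartRing k p j ≤ overlapRing k p i j)))
        (specAlg k ψ.toAlgHom ≫ specAlg k (inclLam k p (le_sup_left : chartRing k p i ≤ overlapRing k p i j)))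
        (g j) (g i)

end Gluing

end LocTrivDef

end

open LocTrivDef

/-! The surface is toric. The ten coordinates are monomials, and `chartRing_eq` identifies `R_i`
with the algebra spanned by the monomials whose exponents lie in `cone p i`. These five cones are
dual to the maximal cones of the fan with rays (0,1), (-1,p), (0,-1), (1,0), (p,1). The cones 1 to 4
are spanned by lattice bases, so those charts are affine planes. The zeroth chart is xz = y^p.
Questions about charts and overlaps thereby become questions about lattice points in cones and half
planes.

The origin P of the zeroth chart is the only singular point. Normality holds there because `R_0` is
the intersection of `R_01` and `R_04`, both localizations of polynomial rings. Its n-th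
Hilbert–Samuel length is exactly n² (`R0.length_quotient_originIdeal_pow`), so the multiplicity is
2. Subdividing the zeroth cone by the rays (i,1), 0 ≤ i ≤ p, gives a toric resolution; the valuative
criterion shows that it is proper, and its first Čech cohomology vanishes monomial by monomial
(`exists_coboundary`).

The glued deformation exists because the transition maps are a coboundary on the torus: ψ_j4 ∘ ψ_ij
= ψ_i4 (`psiExt_comp`). Replacing `R_i[λ]` by its image under ψ_i4 turns the twisted gluing into a
gluing of subalgebras of k[x^±1, y^±1][λ] along inclusions (`exists_glue`). Local triviality is then
visible on the charts. Modulo λ^p the factor (1 + λ/y)^p = 1 + λ^p/y^p becomes 1, and the remaining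
translation y ↦ y + ε extends to the zeroth chart because (y + ε)^p = y^p. It therefore gives an
isomorphism with the trivial deformation over k[ε] (`IsGluedDeformation.baseChange_isomorphic`).

This isomorphism moves the singular point, and no other choice avoids that: for every morphism from
the trivial deformation over k[ε] to the glued one that is cartesian over the base and the identity
on X₀, the constant section at P acquires the coordinates x = 0, y = ε (`IsTransition.evEps_x`,
`IsTransition.evEps_y`). Suppose both deformations came from a locally trivial one over the fibre
product. A local product structure around P would carry the constant section over k[λ] to a section
of the glued deformation over k[λ] extending the moved section
(`Deformation.IsLocallyTrivial.exists_section`). Its coordinates would be x = λ^p b, y = λ + λ^p b',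
z = λ c, so that xz = 0 while y^p = λ^p ≠ 0 (`IsTransition.false_of_section`). Since k[λ] → k[ε] is
a small extension, `(H₁)` fails. -/

noncomputable section

namespace LocTrivDef

/-! ### Gluing morphisms and schemes along open covers -/

section Glue

variable {ι : Type} {Y Z : Scheme.{u}} {U : ι → Scheme.{u}}

/-- A jointly surjective family of open immersions as an open cover. -/
def coverOf (g : ∀ i, U i ⟶ Y) (ho : ∀ i, IsOpenImmersion (g i))
    (hc : ∀ z : Y, ∃ i, z ∈ Set.range (g i)) : Y.OpenCover where
  I₀ := ι
  X := U
  f := g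
  mem₀ := by
    rw [Scheme.presieve₀_mem_precoverage_iff]
    exact ⟨hc, ho⟩

theorem hom_ext_of_cover (g : ∀ i, U i ⟶ Y) (ho : ∀ i, IsOpenImmersion (g i))
    (hc : ∀ z : Y, ∃ i, z ∈ Set.range (g i)) {f f' : Y ⟶ Z} (h : ∀ i, g i ≫ f = g i ≫ f') :
    f = f' :=
  (coverOf g ho hc).hom_ext _ _ h

/-- Compatibility is needed only for i < j, which is how the transition maps are given: the reverse
order follows by symmetry of the fibre product, and on the diagonal the two projections agree
because an open immersion is a monomorphism. -/
theorem exists_desc_of_cover [LinearOrder ι] (g : ∀ i, U i ⟶ Y) (ho : ∀ i, IsOpenImmersion (g i))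
    (hc : ∀ z : Y, ∃ i, z ∈ Set.range (g i)) {W : ι → ι → Scheme.{u}} {a : ∀ i j, W i j ⟶ U i}
    {b : ∀ i j, W i j ⟶ U j} (hp : ∀ i j, i < j → IsPullback (a i j) (b i j) (g i) (g j))
    (h : ∀ i, U i ⟶ Z) (hh : ∀ i j, i < j → a i j ≫ h i = b i j ≫ h j) :
    ∃ f : Y ⟶ Z, ∀ i, g i ≫ f = h i := by
  have key : ∀ i j, i < j → pullback.fst (g i) (g j) ≫ h i = pullback.snd (g i) (g j) ≫ h j := by
    intro i j hij
    have h1 := hh i j hij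
    rw [← cancel_epi (hp i j hij).isoPullback.hom]
    simpa using h1
  refine ⟨(coverOf g ho hc).glueMorphisms h ?_, fun i => (coverOf g ho hc).ι_glueMorphisms h _ i⟩
  intro (i : ι) (j : ι)
  change pullback.fst (g i) (g j) ≫ h i = pullback.snd (g i) (g j) ≫ h j
  rcases lt_trichotomy i j with hij | rfl | hij
  · exact key i j hij
  · have : Mono (g i) := inferInstance
    rw [(cancel_mono (g i)).mp (pullback.condition (f := g i) (g := g i))]
  · have h1 := key j i hij
    have h2 : (pullbackSymmetry (g i) (g j)).hom ≫ pullback.fst (g j) (g i) ≫ h j =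
        (pullbackSymmetry (g i) (g j)).hom ≫ pullback.snd (g j) (g i) ≫ h i := by rw [h1]
    simpa using h2.symm

theorem isIso_of_cover {f : Z ⟶ Y} (g : ∀ i, U i ⟶ Y) (ho : ∀ i, IsOpenImmersion (g i))
    (hc : ∀ z : Y, ∃ i, z ∈ Set.range (g i)) (q : ∀ i, U i ⟶ Z)
    (hp : ∀ i, IsPullback (q i) (𝟙 _) f (g i)) : IsIso f := by
  refine (MorphismProperty.isomorphisms Scheme).of_zeroHypercover_target (coverOf g ho hc) fun i => ?_
  change IsIso (pullback.snd f (g i))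
  rw [← (hp i).isoPullback_inv_snd]
  infer_instance

/-- Cartesian squares may be checked on an open cover. -/
theorem isPullback_of_cover {X S T : Scheme.{u}} {i : X ⟶ Y} {s : X ⟶ S} {t : Y ⟶ T} {r : S ⟶ T}
    (g : ∀ i, U i ⟶ Y) (ho : ∀ i, IsOpenImmersion (g i))
    (hc : ∀ z : Y, ∃ i, z ∈ Set.range (g i)) (w : i ≫ t = s ≫ r)
    {V : ι → Scheme.{u}} (c : ∀ j, V j ⟶ X) (f : ∀ j, V j ⟶ U j)
    (h1 : ∀ j, IsPullback (c j) (f j) i (g j))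
    (h2 : ∀ j, IsPullback (f j) (c j ≫ s) (g j ≫ t) r) : IsPullback i s t r := by
  -- It suffices that the comparison map to the fibre product is an isomorphism. The `V j` also form
  -- an open cover of the fibre product, and over each of them the comparison map is the identity.
  let φ : X ⟶ pullback t r := pullback.lift i s w
  let q : ∀ j, V j ⟶ pullback t r := fun j => c j ≫ φ
  have hq1 : ∀ j, q j ≫ pullback.fst t r = f j ≫ g j := fun j => by
    simp only [q, φ, Category.assoc, pullback.lift_fst]
    exact (h1 j).w
  have hq2 : ∀ j, q j ≫ pullback.snd t r = c j ≫ s := fun j => by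
    simp only [q, φ, Category.assoc, pullback.lift_snd]
  have h3 : ∀ j, IsPullback (q j) (f j) (pullback.fst t r) (g j) := fun j => by
    refine (IsPullback.of_bot (h₁₁ := f j) (v₁₁ := q j) (v₁₂ := g j) (h₂₁ := pullback.fst t r)
      (v₂₁ := pullback.snd t r) (v₂₂ := t) (h₃₁ := r) ?_ (hq1 j).symm
      (IsPullback.of_hasPullback t r)).flip
    rw [hq2]
    exact h2 j
  have hφ : IsIso φ := isIso_of_cover (U := V) q
    (fun j => MorphismProperty.of_isPullback (P := @IsOpenImmersion) (h3 j).flip (ho j)) (fun z => by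
      obtain ⟨j, u, hu⟩ := hc (pullback.fst t r z)
      obtain ⟨v, hv, -⟩ := Scheme.exists_preimage_of_isPullback (h3 j) z u hu.symm
      exact ⟨j, v, hv⟩) c fun j => by
    have h6 : IsPullback (c j) (𝟙 _ ≫ f j) (φ ≫ pullback.fst t r) (g j) := by
      rw [Category.id_comp, pullback.lift_fst]
      exact h1 j
    exact IsPullback.of_right (h₁₁ := 𝟙 _) (h₁₂ := f j) (h₂₁ := φ) (h₂₂ := pullback.fst t r)
      h6.flip (Category.id_comp _) (h3 j).flip |>.flip
  exact IsPullback.of_iso_pullback ⟨w⟩ (asIso φ) (pullback.lift_fst _ _ _) (pullback.lift_snd _ _ _)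

/-- For open immersions, a commutative square whose corner covers the intersection of the images is
cartesian. -/
theorem isPullback_of_isOpenImmersion {W U V : Scheme.{u}} {a : W ⟶ U} {b : W ⟶ V} {g : U ⟶ Y}
    {h : V ⟶ Y} [IsOpenImmersion a] [IsOpenImmersion g] [IsOpenImmersion h] (w : a ≫ g = b ≫ h)
    (hr : Set.range g ∩ Set.range h ⊆ Set.range (a ≫ g)) : IsPullback a b g h := by
  let φ : W ⟶ pullback g h := pullback.lift a b w
  have h1 : φ ≫ pullback.fst g h = a := pullback.lift_fst _ _ _
  have : IsOpenImmersion φ := by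
    have : IsOpenImmersion (φ ≫ pullback.fst g h) := by rw [h1]; infer_instance
    exact IsOpenImmersion.of_comp φ (pullback.fst g h)
  have : Surjective φ := by
    refine ⟨fun z => ?_⟩
    have hz : (pullback.fst g h ≫ g) z ∈ Set.range (a ≫ g) := by
      refine hr ⟨⟨pullback.fst g h z, rfl⟩, ⟨pullback.snd g h z, ?_⟩⟩
      rw [pullback.condition]; rfl
    obtain ⟨w', hw'⟩ := hz
    refine ⟨w', ?_⟩
    apply (pullback.fst g h ≫ g).isOpenEmbedding.injective
    rw [← hw', ← h1]
    simp
  have : Epi φ.base := (TopCat.epi_iff_surjective _).mpr φ.surjective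
  have : IsIso φ := IsOpenImmersion.isIso φ
  exact IsPullback.of_iso_pullback ⟨w⟩ (asIso φ) (pullback.lift_fst _ _ _) (pullback.lift_snd _ _ _)

/-- The diagonal may be checked to be a closed immersion over the products of the charts; there it
restricts to `W i j`, because `W i j` is the intersection of the two charts. -/
theorem isSeparated_of_cover {f : Y ⟶ Z} (g : ∀ i, U i ⟶ Y) (ho : ∀ i, IsOpenImmersion (g i))
    (hc : ∀ z : Y, ∃ i, z ∈ Set.range (g i)) {W : ι → ι → Scheme.{u}} {a : ∀ i j, W i j ⟶ U i}
    {b : ∀ i j, W i j ⟶ U j} (hp : ∀ i j, IsPullback (a i j) (b i j) (g i) (g j))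
    (h : ∀ i, U i ⟶ Z) (hh : ∀ i, g i ≫ f = h i)
    (hcl : ∀ i j (w : a i j ≫ h i = b i j ≫ h j),
      IsClosedImmersion (pullback.lift (a i j) (b i j) w)) : IsSeparated f := by
  refine ⟨?_⟩
  obtain rfl : (fun i => g i ≫ f) = h := funext hh
  have key : ∀ i j, ∀ (l : W i j ⟶ pullback (g i ≫ f) (g j ≫ f))
      (m : pullback (g i ≫ f) (g j ≫ f) ⟶ pullback f f), l ≫ pullback.fst _ _ = a i j →
      l ≫ pullback.snd _ _ = b i j → m ≫ pullback.fst _ _ = pullback.fst _ _ ≫ g i →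
      m ≫ pullback.snd _ _ = pullback.snd _ _ ≫ g j →
      IsPullback (a i j ≫ g i) l (pullback.diagonal f) m := by
    intro i j l m hl1 hl2 hm1 hm2
    have hc1 : ∀ c : PullbackCone (pullback.diagonal f) m,
        c.fst = c.snd ≫ pullback.fst _ _ ≫ g i := fun c => by
      have h1 := congr($(c.condition) ≫ pullback.fst _ _)
      simpa [hm1] using h1
    have hc2 : ∀ c : PullbackCone (pullback.diagonal f) m,
        c.fst = c.snd ≫ pullback.snd _ _ ≫ g j := fun c => by
      have h1 := congr($(c.condition) ≫ pullback.snd _ _)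
      simpa [hm2] using h1
    refine ⟨⟨?_⟩, ⟨PullbackCone.IsLimit.mk _ (fun c => (hp i j).lift
      (c.snd ≫ pullback.fst _ _) (c.snd ≫ pullback.snd _ _) ?_) ?_ ?_ ?_⟩⟩
    · apply pullback.hom_ext
      · simp [hm1, reassoc_of% hl1]
      · simp [hm2, reassoc_of% hl2, (hp i j).w]
    · rw [Category.assoc, Category.assoc, ← hc1, ← hc2]
    · intro c
      rw [IsPullback.lift_fst_assoc, Category.assoc, ← hc1]
    · intro c
      apply pullback.hom_ext
      · rw [Category.assoc, hl1, IsPullback.lift_fst]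
      · rw [Category.assoc, hl2, IsPullback.lift_snd]
    · intro c m h1 h2
      apply (hp i j).hom_ext
      · rw [IsPullback.lift_fst, ← h2, Category.assoc, hl1]
      · rw [IsPullback.lift_snd, ← h2, Category.assoc, hl2]
  refine MorphismProperty.of_zeroHypercover_target (P := @IsClosedImmersion)
    (Scheme.Pullback.openCoverOfLeftRight (coverOf g ho hc) (coverOf g ho hc) f f) ?_
  rintro ⟨i, j⟩
  change IsClosedImmersion (pullback.snd _
    (pullback.map (g i ≫ f) (g j ≫ f) f f (g i) (g j) (𝟙 _) (by simp) (by simp)))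
  have hw : a i j ≫ g i ≫ f = b i j ≫ g j ≫ f := by rw [reassoc_of% (hp i j).w]
  rw [← (key i j (pullback.lift (a i j) (b i j) hw) _ (pullback.lift_fst _ _ _)
    (pullback.lift_snd _ _ _) (pullback.lift_fst _ _ _) (pullback.lift_snd _ _ _)).isoPullback_inv_snd]
  have := hcl i j hw
  infer_instance

end Glue

/-! ### Gluing spectra of subalgebras of a ring -/

section LocStep
variable {A T : Type u} [CommRing A] [CommRing T] [Algebra A T]

/-- `C` is obtained from the subalgebra `B` by inverting one element of `B`. -/
def IsLocStep (B C : Subalgebra A T) : Prop :=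
  B ≤ C ∧ ∃ f ∈ B, ∃ g ∈ C, f * g = 1 ∧ ∀ c ∈ C, ∃ n : ℕ, f ^ n * c ∈ B

/-- The elements of `T` which some power of `f ∈ B` multiplies into `B`. -/
def saturation (B : Subalgebra A T) (f : T) (hf : f ∈ B) : Subalgebra A T where
  carrier := {c | ∃ n : ℕ, f ^ n * c ∈ B}
  mul_mem' := by
    rintro a b ⟨m, hm⟩ ⟨n, hn⟩
    exact ⟨m + n, by rw [pow_add, mul_mul_mul_comm]; exact B.mul_mem hm hn⟩
  add_mem' := by
    rintro a b ⟨m, hm⟩ ⟨n, hn⟩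
    refine ⟨m + n, ?_⟩
    have h : f ^ (m + n) * (a + b) = f ^ n * (f ^ m * a) + f ^ m * (f ^ n * b) := by ring
    rw [h]
    exact B.add_mem (B.mul_mem (B.pow_mem hf _) hm) (B.mul_mem (B.pow_mem hf _) hn)
  algebraMap_mem' r := ⟨0, by simp⟩

theorem le_saturation (B : Subalgebra A T) (f : T) (hf : f ∈ B) : B ≤ saturation B f hf :=
  fun c hc => ⟨0, by simpa using hc⟩

theorem IsLocStep.refl (B : Subalgebra A T) : IsLocStep B B :=
  ⟨le_rfl, 1, B.one_mem, 1, B.one_mem, by simp, fun c hc => ⟨0, by simpa using hc⟩⟩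

/-- The saturation of `B ⊔ D` is a subalgebra containing both `C` and `D`, so denominators need only
be cleared on generators. -/
theorem IsLocStep.sup_right {B C : Subalgebra A T} (h : IsLocStep B C) (D : Subalgebra A T) :
    IsLocStep (B ⊔ D) (C ⊔ D) := by
  obtain ⟨hle, f, hf, g, hg, hfg, hs⟩ := h
  have hf' : f ∈ B ⊔ D := (le_sup_left : B ≤ B ⊔ D) hf
  refine ⟨sup_le_sup_right hle D, f, hf', g, (le_sup_left : C ≤ C ⊔ D) hg, hfg, ?_⟩
  have : C ⊔ D ≤ saturation (B ⊔ D) f hf' := by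
    refine sup_le (fun c hc => ?_) (le_sup_right.trans (le_saturation _ _ _))
    obtain ⟨n, hn⟩ := hs c hc
    exact ⟨n, (le_sup_left : B ≤ B ⊔ D) hn⟩
  exact fun c hc => this hc

/-- The second element `f'` lies in `C` but perhaps not in `B`, so it is replaced by `f ^ n * f'`.
Inverting the single element `f * (f ^ n * f')` of `B` inverts both. -/
theorem IsLocStep.trans {B C D : Subalgebra A T} (h : IsLocStep B C) (h' : IsLocStep C D) :
    IsLocStep B D := by
  obtain ⟨hle, f, hf, g, hg, hfg, hs⟩ := h
  obtain ⟨hle', f', hf', g', hg', hfg', hs'⟩ := h'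
  obtain ⟨n, hn⟩ := hs f' hf'
  refine ⟨hle.trans hle', f * (f ^ n * f'), B.mul_mem hf hn, g ^ (n + 1) * g',
    D.mul_mem (D.pow_mem (hle' hg) _) hg', ?_, fun d hd => ?_⟩
  · calc f * (f ^ n * f') * (g ^ (n + 1) * g') = (f * g) ^ (n + 1) * (f' * g') := by ring
      _ = 1 := by rw [hfg, hfg']; simp
  · obtain ⟨m, hm⟩ := hs' d hd
    obtain ⟨l, hl⟩ := hs _ hm
    refine ⟨m + l, ?_⟩
    have h : (f * (f ^ n * f')) ^ (m + l) * d =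
        f ^ (n * m + m) * (f ^ n * f') ^ l * (f ^ l * (f' ^ m * d)) := by
      simp only [mul_pow, ← pow_mul, pow_add]; ring
    rw [h]
    exact B.mul_mem (B.mul_mem (B.pow_mem hf _) (B.pow_mem hn _)) hl

/-- `Spec` of the inclusion of subalgebras. -/
abbrev specIncl {B C : Subalgebra A T} (h : B ≤ C) : Spec (.of C) ⟶ Spec (.of B) :=
  Spec.map (CommRingCat.ofHom (Subalgebra.inclusion h).toRingHom)

theorem isLocalization_of_isLocStep {B C : Subalgebra A T} (hle : B ≤ C) {f g : T} (hf : f ∈ B)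
    (hg : g ∈ C) (hfg : f * g = 1) (hs : ∀ c ∈ C, ∃ n : ℕ, f ^ n * c ∈ B) :
    letI := (Subalgebra.inclusion hle).toRingHom.toAlgebra
    IsLocalization.Away (⟨f, hf⟩ : B) C := by
  let _ := (Subalgebra.inclusion hle).toRingHom.toAlgebra
  have hu : IsUnit (algebraMap B C ⟨f, hf⟩) :=
    IsUnit.of_mul_eq_one ⟨g, hg⟩ (Subtype.ext hfg)
  refine ⟨?_, ?_, ?_⟩
  · rintro ⟨_, n, rfl⟩
    rw [map_pow]
    exact hu.pow n
  · rintro ⟨c, hc⟩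
    obtain ⟨n, hn⟩ := hs c hc
    refine ⟨⟨⟨_, hn⟩, ⟨_, n, rfl⟩⟩, Subtype.ext ?_⟩
    change c * (((⟨f, hf⟩ : B) ^ n : B) : T) = f ^ n * c
    rw [SubmonoidClass.coe_pow, mul_comm]
  · intro x y hxy
    refine ⟨1, ?_⟩
    have : (x : T) = y := congrArg (fun c : C => (c : T)) hxy
    simp [Subtype.ext this]

theorem specIncl_isLocStep {B C : Subalgebra A T} (hle : B ≤ C) {f g : T} (hf : f ∈ B)
    (hg : g ∈ C) (hfg : f * g = 1) (hs : ∀ c ∈ C, ∃ n : ℕ, f ^ n * c ∈ B) :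
    IsOpenImmersion (specIncl hle) ∧
      Set.range (specIncl hle) = (PrimeSpectrum.basicOpen (⟨f, hf⟩ : B) : Set (PrimeSpectrum B)) := by
  let _ := (Subalgebra.inclusion hle).toRingHom.toAlgebra
  have := isLocalization_of_isLocStep hle hf hg hfg hs
  exact ⟨IsOpenImmersion.of_isLocalization (R := B) (S := C) (⟨f, hf⟩ : B),
    PrimeSpectrum.localization_away_comap_range C (⟨f, hf⟩ : B)⟩

/-- This is the affine form of the separatedness criterion: the map into the fibre product is `Spec`
of the multiplication map out of the tensor product. -/
theorem isClosedImmersion_lift_of_surjective {A B C D : Type u} [CommRing A] [CommRing B]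
    [CommRing C] [CommRing D] [Algebra A B] [Algebra A C] [Algebra A D] (φ : B →ₐ[A] D)
    (ψ : C →ₐ[A] D)
    (hs : Function.Surjective (Algebra.TensorProduct.lift φ ψ fun _ _ => Commute.all _ _))
    (w : Spec.map (CommRingCat.ofHom φ.toRingHom) ≫ Spec.map (CommRingCat.ofHom (algebraMap A B)) =
      Spec.map (CommRingCat.ofHom ψ.toRingHom) ≫ Spec.map (CommRingCat.ofHom (algebraMap A C))) :
    IsClosedImmersion (pullback.lift _ _ w) := by
  have h : pullback.lift _ _ w = Spec.map (CommRingCat.ofHom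
      (Algebra.TensorProduct.lift φ ψ fun _ _ => Commute.all _ _).toRingHom) ≫
      (pullbackSpecIso A B C).inv := by
    apply pullback.hom_ext
    · rw [pullback.lift_fst, Category.assoc, pullbackSpecIso_inv_fst, ← Spec.map_comp]
      congr 1
      ext x
      simp
    · rw [pullback.lift_snd, Category.assoc, pullbackSpecIso_inv_snd, ← Spec.map_comp]
      congr 1
      ext x
      simp
  rw [h]
  have : IsClosedImmersion (Spec.map (CommRingCat.ofHom
      (Algebra.TensorProduct.lift φ ψ fun _ _ => Commute.all _ _).toRingHom)) :=
    IsClosedImmersion.spec_of_surjective _ hs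
  infer_instance

/-- Enlarge `K` one index at a time. Any i in `K` already makes the passage to `S i ⊔ S j` a
localization, and this persists after adjoining the remaining subalgebras; hence `K` must be
nonempty. -/
theorem IsLocStep.finset_sup {ι : Type} [DecidableEq ι] {S : ι → Subalgebra A T}
    (hS : ∀ i j, IsLocStep (S i) (S i ⊔ S j)) {K L : Finset ι} (hK : K.Nonempty) (hKL : K ⊆ L) :
    IsLocStep (K.sup S) (L.sup S) := by
  have key : ∀ M : Finset ι, IsLocStep (K.sup S) ((K ∪ M).sup S) := by
    intro M
    induction M using Finset.induction with
    | empty => simpa using IsLocStep.refl _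
    | insert j M hj ih =>
      obtain ⟨i, hi⟩ := hK
      refine ih.trans ?_
      have h1 := (hS i j).sup_right ((K ∪ M).sup S)
      have h2 : S i ≤ (K ∪ M).sup S := Finset.le_sup (Finset.mem_union_left _ hi)
      rw [sup_eq_right.mpr h2, sup_right_comm, sup_eq_right.mpr h2, sup_comm] at h1
      rwa [Finset.union_insert, Finset.sup_insert]
  have := key L
  rwa [Finset.union_eq_right.mpr hKL] at this

theorem specIncl_comp {B C D : Subalgebra A T} (h : B ≤ C) (h' : C ≤ D) :
    specIncl h' ≫ specIncl h = specIncl (h.trans h') := by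
  rw [← Spec.map_comp]
  rfl

theorem specIncl_self {B : Subalgebra A T} (h : B ≤ B) : specIncl h = 𝟙 _ :=
  Spec.map_id _

theorem isIso_specIncl {B C : Subalgebra A T} (h : B ≤ C) (h' : C ≤ B) : IsIso (specIncl h) :=
  ⟨specIncl h', by rw [specIncl_comp, specIncl_self], by rw [specIncl_comp, specIncl_self]⟩

/-- The diagram of the spectra of the subalgebras generated by nonempty subfamilies. -/
def glueDiagram {ι : Type} (S : ι → Subalgebra A T) :
    {s : Finset ι // s.Nonempty}ᵒᵈ ⥤ Scheme.{u} where
  obj s := Spec (.of ((OrderDual.ofDual s).1.sup S : Subalgebra A T))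
  map {s t} f := specIncl (Finset.sup_mono (show (OrderDual.ofDual t).1 ⊆ (OrderDual.ofDual s).1 from
    leOfHom f))
  map_id s := Spec.map_id _
  map_comp f g := by
    rw [← Spec.map_comp]
    rfl

/-- Spectra of subalgebras `S i` of a ring can be glued along the spectra of the subalgebras
`S i ⊔ S j` if these are localizations. -/
theorem exists_glue {ι : Type} [DecidableEq ι] (S : ι → Subalgebra A T)
    (hS : ∀ i j, IsLocStep (S i) (S i ⊔ S j)) :
    ∃ (Y : Scheme.{u}) (g : ∀ i, Spec (.of (S i)) ⟶ Y) (f : Y ⟶ Spec (.of A)),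
      (∀ i, IsOpenImmersion (g i)) ∧ (∀ z : Y, ∃ i, z ∈ Set.range (g i)) ∧
      (∀ i, g i ≫ f = Spec.map (CommRingCat.ofHom (algebraMap A (S i)))) ∧
      (∀ i j, IsPullback (specIncl (le_sup_left : S i ≤ S i ⊔ S j))
        (specIncl (le_sup_right : S j ≤ S i ⊔ S j)) (g i) (g j)) ∧ IsSeparated f := by
  let F := glueDiagram S
  have hF : ∀ {s t : {s : Finset ι // s.Nonempty}ᵒᵈ} (h : s ⟶ t), IsOpenImmersion (F.map h) := by
    intro s t h
    obtain ⟨hle, f, hf, g, hg, hfg, hs⟩ := IsLocStep.finset_sup hS (OrderDual.ofDual t).2 (leOfHom h)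
    exact (specIncl_isLocStep hle hf hg hfg hs).1
  -- Two points over `L` and `L'` with the same image over `K` map into the basic opens of `f` and
  -- of `f'`, hence into that of `f * f'`. This is exactly the image of the spectrum attached to `L
  -- ∪ L'`, which supplies a common preimage.
  have hdir : (F ⋙ Scheme.forget).IsLocallyDirected := by
    refine ⟨?_⟩
    intro s t r a b x y hxy
    let K : Finset ι := (OrderDual.ofDual r).1
    let L : Finset ι := (OrderDual.ofDual s).1
    let L' : Finset ι := (OrderDual.ofDual t).1
    have hK : K.Nonempty := (OrderDual.ofDual r).2
    have ha : K ⊆ L := leOfHom a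
    have hb : K ⊆ L' := leOfHom b
    let q : {s : Finset ι // s.Nonempty}ᵒᵈ := OrderDual.toDual ⟨L ∪ L', hK.mono
      (ha.trans Finset.subset_union_left)⟩
    let u : q ⟶ s := homOfLE (show L ⊆ L ∪ L' from Finset.subset_union_left)
    let v : q ⟶ t := homOfLE (show L' ⊆ L ∪ L' from Finset.subset_union_right)
    replace hxy : F.map a x = F.map b y := hxy
    obtain ⟨hle, f, hf, g, hg, hfg, hs⟩ := IsLocStep.finset_sup hS hK ha
    obtain ⟨hle', f', hf', g', hg', hfg', hs'⟩ := IsLocStep.finset_sup hS hK hb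
    have hr1 := (specIncl_isLocStep hle hf hg hfg hs).2
    have hr2 := (specIncl_isLocStep hle' hf' hg' hfg' hs').2
    have hle'' : K.sup S ≤ (L ∪ L').sup S := Finset.sup_mono (ha.trans Finset.subset_union_left)
    have hff : f * f' ∈ K.sup S := mul_mem hf hf'
    have hr3 : Set.range (specIncl hle'') = (PrimeSpectrum.basicOpen (⟨f * f', hff⟩ : ↥(K.sup S)) :
        Set (PrimeSpectrum ↥(K.sup S))) := by
      have hl : L.sup S ≤ (L ∪ L').sup S := Finset.sup_mono Finset.subset_union_left
      have hl' : L'.sup S ≤ (L ∪ L').sup S := Finset.sup_mono Finset.subset_union_right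
      refine (specIncl_isLocStep hle'' hff (mul_mem (hl hg) (hl' hg'))
        (by rw [mul_mul_mul_comm, hfg, hfg', one_mul]) ?_).2
      have : (L ∪ L').sup S ≤ saturation (K.sup S) (f * f') hff := by
        rw [Finset.sup_union]
        refine sup_le (fun c hc => ?_) fun c hc => ?_
        · obtain ⟨n, hn⟩ := hs c hc
          refine ⟨n, ?_⟩
          rw [mul_pow, mul_comm (f ^ n), mul_assoc]
          exact mul_mem (pow_mem hf' n) hn
        · obtain ⟨n, hn⟩ := hs' c hc
          refine ⟨n, ?_⟩
          rw [mul_pow, mul_assoc]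
          exact mul_mem (pow_mem hf n) hn
      exact fun c hc => this hc
    have hz : F.map a x ∈ Set.range (specIncl hle'') := by
      rw [hr3]
      have h1 : F.map a x ∈ Set.range (specIncl hle) := ⟨x, rfl⟩
      have h2 : F.map a x ∈ Set.range (specIncl hle') := ⟨y, hxy.symm⟩
      rw [hr1] at h1
      rw [hr2] at h2
      have h3 : (⟨f * f', hff⟩ : ↥(K.sup S)) = ⟨f, hf⟩ * ⟨f', hf'⟩ := rfl
      rw [h3, PrimeSpectrum.basicOpen_mul]
      exact ⟨h1, h2⟩
    obtain ⟨z, hz⟩ := hz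
    refine ⟨q, u, v, z, ?_, ?_⟩
    · apply (F.map a).isOpenEmbedding.injective
      change (F.map u ≫ F.map a) z = F.map a x
      rw [← F.map_comp]
      exact hz
    · apply (F.map b).isOpenEmbedding.injective
      change (F.map v ≫ F.map b) z = F.map b y
      rw [← F.map_comp, ← hxy]
      exact hz
  let o : ι → {s : Finset ι // s.Nonempty}ᵒᵈ := fun i =>
    OrderDual.toDual ⟨{i}, Finset.singleton_nonempty i⟩
  have ho : ∀ i, (OrderDual.ofDual (o i)).1.sup S = S i := fun i => Finset.sup_singleton
  let e : ∀ i, Spec (.of (S i)) ⟶ F.obj (o i) := fun i => specIncl (ho i).le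
  have he : ∀ i, IsIso (e i) := fun i => isIso_specIncl (ho i).le (ho i).ge
  let d : Cocone F :=
    { pt := Spec (.of A)
      ι :=
        { app := fun s => Spec.map (CommRingCat.ofHom (algebraMap A _))
          naturality := fun s t h => by
            change specIncl _ ≫ _ = _ ≫ 𝟙 _
            rw [Category.comp_id, ← Spec.map_comp]
            rfl } }
  let g : ∀ i, Spec (.of (S i)) ⟶ colimit F := fun i => e i ≫ colimit.ι F (o i)
  have hgo : ∀ i, IsOpenImmersion (g i) := fun i => inferInstance
  have hgc : ∀ z : ↥(colimit F), ∃ i, z ∈ Set.range (g i) := by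
    intro z
    obtain ⟨s, x, rfl⟩ := Scheme.IsLocallyDirected.ι_jointly_surjective F z
    obtain ⟨i, hi⟩ := (OrderDual.ofDual s).2
    let u : s ⟶ o i := homOfLE (show {i} ⊆ (OrderDual.ofDual s).1 from
      Finset.singleton_subset_iff.mpr hi)
    obtain ⟨y, hy⟩ := (e i).surjective (F.map u x)
    refine ⟨i, y, ?_⟩
    change (colimit.ι F (o i)) (e i y) = _
    rw [hy]
    change (F.map u ≫ colimit.ι F (o i)) x = _
    rw [colimit.w]
  have hgf : ∀ i, g i ≫ colimit.desc F d = Spec.map (CommRingCat.ofHom (algebraMap A (S i))) := by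
    intro i
    rw [Category.assoc, colimit.ι_desc]
    change specIncl _ ≫ Spec.map _ = _
    rw [← Spec.map_comp]
    rfl
  have hgp : ∀ i j, IsPullback (specIncl (le_sup_left : S i ≤ S i ⊔ S j))
        (specIncl (le_sup_right : S j ≤ S i ⊔ S j)) (g i) (g j) := by
    intro i j
    let q : {s : Finset ι // s.Nonempty}ᵒᵈ := OrderDual.toDual ⟨{i, j}, Finset.insert_nonempty _ _⟩
    have hq : (OrderDual.ofDual q).1.sup S = S i ⊔ S j := by
      change ({i, j} : Finset ι).sup S = _
      rw [Finset.sup_insert, Finset.sup_singleton]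
    let u : q ⟶ o i := homOfLE (show ({i} : Finset ι) ⊆ {i, j} by simp)
    let v : q ⟶ o j := homOfLE (show ({j} : Finset ι) ⊆ {i, j} by simp)
    let r : Spec (.of ↥(S i ⊔ S j)) ⟶ F.obj q := specIncl hq.le
    have hr : IsIso r := isIso_specIncl hq.le hq.ge
    have h1 : specIncl (le_sup_left : S i ≤ S i ⊔ S j) ≫ g i = r ≫ colimit.ι F q := by
      rw [← colimit.w F u, ← Category.assoc, ← Category.assoc]
      congr 1
      change specIncl _ ≫ specIncl _ = specIncl _ ≫ specIncl _
      rw [specIncl_comp, specIncl_comp]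
    have h2 : specIncl (le_sup_right : S j ≤ S i ⊔ S j) ≫ g j = r ≫ colimit.ι F q := by
      rw [← colimit.w F v, ← Category.assoc, ← Category.assoc]
      congr 1
      change specIncl _ ≫ specIncl _ = specIncl _ ≫ specIncl _
      rw [specIncl_comp, specIncl_comp]
    obtain ⟨hle, f, hf, f', hf', hff, hs⟩ := hS i j
    have := (specIncl_isLocStep hle hf hf' hff hs).1
    refine isPullback_of_isOpenImmersion (h1.trans h2.symm) ?_
    rintro _ ⟨⟨x, rfl⟩, y, hxy⟩
    replace hxy : colimit.ι F (o j) (e j y) = colimit.ι F (o i) (e i x) := hxy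
    -- A coincidence in the colimit is already witnessed at an index containing both `i` and `j`,
    -- hence comes from the spectrum of `S i ⊔ S j`.
    obtain ⟨s, b, a, z, hz1, hz2⟩ := (Scheme.IsLocallyDirected.ι_eq_ι_iff F).mp hxy
    let m : s ⟶ q := homOfLE (show ({i, j} : Finset ι) ⊆ (OrderDual.ofDual s).1 by
      have ha : {i} ⊆ (OrderDual.ofDual s).1 := leOfHom a
      have hb : {j} ⊆ (OrderDual.ofDual s).1 := leOfHom b
      rw [Finset.insert_eq]
      exact Finset.union_subset ha hb)
    obtain ⟨w, hw⟩ := r.surjective (F.map m z)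
    refine ⟨w, ?_⟩
    rw [h1]
    change colimit.ι F q (r w) = colimit.ι F (o i) (e i x)
    rw [hw, ← hz2]
    change (F.map m ≫ colimit.ι F q) z = (F.map a ≫ colimit.ι F (o i)) z
    rw [colimit.w, colimit.w]
  refine ⟨colimit F, g, colimit.desc F d, hgo, hgc, hgf, hgp,
    isSeparated_of_cover g hgo hgc hgp _ hgf fun i j w => ?_⟩
  refine isClosedImmersion_lift_of_surjective _ _ ?_ w
  intro c
  -- The range of the multiplication map is a subalgebra that contains both `S i` and `S j`, which
  -- gives surjectivity onto their supremum.
  have h1 : S i ⊔ S j ≤ (Algebra.TensorProduct.lift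
      (Subalgebra.inclusion (le_sup_left : S i ≤ S i ⊔ S j))
      (Subalgebra.inclusion (le_sup_right : S j ≤ S i ⊔ S j)) fun _ _ => Commute.all _ _).range.map
      (S i ⊔ S j).val := by
    refine sup_le (fun x hx => ?_) fun x hx => ?_
    · exact ⟨_, ⟨(⟨x, hx⟩ : S i) ⊗ₜ 1, rfl⟩, by simp⟩
    · exact ⟨_, ⟨1 ⊗ₜ (⟨x, hx⟩ : S j), rfl⟩, by simp⟩
  have h2 := h1 c.2
  obtain ⟨d, ⟨t, ht⟩, hd⟩ := h2
  exact ⟨t, ht.trans (Subtype.ext hd)⟩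

end LocStep

/-! ### Subalgebras of the Laurent polynomial ring spanned by monomials -/

section Toric

variable {k : Type u} [Field k]

theorem mono_mul (m n : ℤ × ℤ) : mono k m * mono k n = mono k (m + n) := by
  simp [mono, AddMonoidAlgebra.single_mul_single]

theorem mono_zero : mono k 0 = 1 := rfl

theorem mono_pow (m : ℤ × ℤ) (n : ℕ) : mono k m ^ n = mono k (n • m) := by
  simp [mono, AddMonoidAlgebra.single_pow]

theorem coeff_mono (m n : ℤ × ℤ) : (mono k m).coeff n = if m = n then 1 else 0 := by
  classical
  simp [mono, Finsupp.single_apply]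

instance : IsDomain (Laurent k) := NoZeroDivisors.to_isDomain _

theorem laurent_eq_sum (f : Laurent k) :
    f = ∑ m ∈ f.coeff.support, f.coeff m • mono k m := by
  conv_lhs => rw [← AddMonoidAlgebra.sum_coeff_single f]
  refine Finset.sum_congr rfl fun m _ => ?_
  simp [mono, AddMonoidAlgebra.smul_single]

/-- The subalgebra spanned by the monomials with exponents in `M`. -/
def monoAlg (k : Type u) [Field k] (M : AddSubmonoid (ℤ × ℤ)) : Subalgebra k (Laurent k) where
  carrier := {f | ∀ m, f.coeff m ≠ 0 → m ∈ M}
  mul_mem' := by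
    classical
    intro f g hf hg m hm
    have := AddMonoidAlgebra.support_coeff_mul_subset f g (Finsupp.mem_support_iff.mpr hm)
    obtain ⟨a, ha, b, hb, rfl⟩ := Finset.mem_add.mp this
    exact M.add_mem (hf a (Finsupp.mem_support_iff.mp ha)) (hg b (Finsupp.mem_support_iff.mp hb))
  add_mem' := by
    intro f g hf hg m hm
    by_cases h : f.coeff m = 0
    · refine hg m fun h' => hm ?_
      simp [h, h']
    · exact hf m h
  algebraMap_mem' r m hm := by
    classical
    have h : algebraMap k (Laurent k) r = AddMonoidAlgebra.single 0 r := by simp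
    rw [h, AddMonoidAlgebra.coeff_single, Finsupp.single_apply] at hm
    by_cases h' : (0 : ℤ × ℤ) = m
    · exact h' ▸ M.zero_mem
    · simp [h'] at hm

theorem mem_monoAlg {M : AddSubmonoid (ℤ × ℤ)} {f : Laurent k} :
    f ∈ monoAlg k M ↔ ∀ m, f.coeff m ≠ 0 → m ∈ M := Iff.rfl

theorem mono_mem_monoAlg {M : AddSubmonoid (ℤ × ℤ)} {m : ℤ × ℤ} :
    mono k m ∈ monoAlg k M ↔ m ∈ M := by
  refine ⟨fun h => h m ?_, fun h n hn => ?_⟩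
  · rw [coeff_mono, if_pos rfl]
    exact one_ne_zero
  · rw [coeff_mono] at hn
    by_cases h' : m = n
    · exact h' ▸ h
    · simp [h'] at hn

theorem monoAlg_le_iff {M : AddSubmonoid (ℤ × ℤ)} {B : Subalgebra k (Laurent k)} :
    monoAlg k M ≤ B ↔ ∀ m ∈ M, mono k m ∈ B := by
  refine ⟨fun h m hm => h (mono_mem_monoAlg.mpr hm), fun h f hf => ?_⟩
  rw [laurent_eq_sum f]
  exact B.sum_mem fun m hm => B.smul_mem (h m (hf m (Finsupp.mem_support_iff.mp hm))) _

theorem monoAlg_mono {M N : AddSubmonoid (ℤ × ℤ)} (h : M ≤ N) : monoAlg k M ≤ monoAlg k N :=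
  fun _ hf m hm => h (hf m hm)

theorem adjoin_mono_eq (s : Set (ℤ × ℤ)) :
    Algebra.adjoin k (mono k '' s) = monoAlg k (AddSubmonoid.closure s) := by
  refine le_antisymm (Algebra.adjoin_le ?_) (monoAlg_le_iff.mpr fun m hm => ?_)
  · rintro _ ⟨m, hm, rfl⟩
    exact mono_mem_monoAlg.mpr (AddSubmonoid.subset_closure hm)
  · induction hm using AddSubmonoid.closure_induction with
    | mem m hm => exact Algebra.subset_adjoin ⟨m, hm, rfl⟩
    | zero => exact Subalgebra.one_mem _
    | add a b _ _ ha hb => rw [← mono_mul]; exact Subalgebra.mul_mem _ ha hb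

theorem monoAlg_sup (M N : AddSubmonoid (ℤ × ℤ)) :
    monoAlg k M ⊔ monoAlg k N = monoAlg k (M ⊔ N) := by
  refine le_antisymm (sup_le (monoAlg_mono le_sup_left) (monoAlg_mono le_sup_right))
    (monoAlg_le_iff.mpr fun m hm => ?_)
  obtain ⟨a, ha, b, hb, rfl⟩ := AddSubmonoid.mem_sup.mp hm
  rw [← mono_mul]
  exact Subalgebra.mul_mem _ ((le_sup_left : monoAlg k M ≤ _) (mono_mem_monoAlg.mpr ha))
    ((le_sup_right : monoAlg k N ≤ _) (mono_mem_monoAlg.mpr hb))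

theorem monoAlg_top : monoAlg k ⊤ = ⊤ := by
  ext f
  simp [mem_monoAlg]

/-- The lattice points on which two linear forms are nonnegative. -/
def dualCone (u v : ℤ × ℤ) : AddSubmonoid (ℤ × ℤ) where
  carrier := {m | 0 ≤ u.1 * m.1 + u.2 * m.2 ∧ 0 ≤ v.1 * m.1 + v.2 * m.2}
  zero_mem' := by simp
  add_mem' := by
    rintro a b ⟨h1, h2⟩ ⟨h3, h4⟩
    constructor
    · simp only [Prod.fst_add, Prod.snd_add]; linarith
    · simp only [Prod.fst_add, Prod.snd_add]; linarith

theorem mem_dualCone {u v m : ℤ × ℤ} :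
    m ∈ dualCone u v ↔ 0 ≤ u.1 * m.1 + u.2 * m.2 ∧ 0 ≤ v.1 * m.1 + v.2 * m.2 := Iff.rfl

theorem natCombo_mem {M : AddSubmonoid (ℤ × ℤ)} {u : ℤ × ℤ} (hu : u ∈ M) {c : ℤ} (hc : 0 ≤ c) :
    (c * u.1, c * u.2) ∈ M := by
  have h := M.nsmul_mem hu c.toNat
  have h2 : c.toNat • u = (c * u.1, c * u.2) := by
    ext <;> simp [Int.toNat_of_nonneg hc]
  rwa [h2] at h

/-- If `u, v` is a basis of the lattice, the cone spanned by `u` and `v` is cut out by the dual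
basis. -/
theorem closure_pair_eq {u v : ℤ × ℤ} (h : u.1 * v.2 - u.2 * v.1 = 1) :
    AddSubmonoid.closure {u, v} = dualCone (v.2, -v.1) (-u.2, u.1) := by
  refine le_antisymm ?_ ?_
  · rw [AddSubmonoid.closure_le]
    rintro m (rfl | rfl)
    · exact ⟨by simp only; linarith, by simp only; linarith⟩
    · exact ⟨by simp only; linarith, by simp only; linarith⟩
  · rintro ⟨a, b⟩ ⟨h1, h2⟩
    simp only at h1 h2
    have hu : u ∈ AddSubmonoid.closure {u, v} := AddSubmonoid.subset_closure (by simp)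
    have hv : v ∈ AddSubmonoid.closure {u, v} := AddSubmonoid.subset_closure (by simp)
    have := add_mem (natCombo_mem hu h1) (natCombo_mem hv h2)
    convert this using 1
    ext
    · simp only [Prod.fst_add]; linear_combination (-a) * h
    · simp only [Prod.snd_add]; linear_combination (-b) * h

/-- The monomial algebra of a smooth cone is a polynomial ring. -/
theorem exists_mvPolynomial_equiv {u v : ℤ × ℤ} (h : u.1 * v.2 - u.2 * v.1 = 1) :
    Nonempty (MvPolynomial (Fin 2) k ≃ₐ[k] monoAlg k (AddSubmonoid.closure {u, v})) := by
  let g : (Fin 2 →₀ ℕ) →+ ℤ × ℤ :=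
    { toFun := fun n => n 0 • u + n 1 • v
      map_zero' := by simp
      map_add' := fun a b => by simp only [Finsupp.coe_add, Pi.add_apply, add_smul]; abel }
  have hg : Function.Injective g := by
    intro a b hab
    have h1 : (a 0 : ℤ) * u.1 + a 1 * v.1 = b 0 * u.1 + b 1 * v.1 := by
      simpa [g] using congrArg Prod.fst hab
    have h2 : (a 0 : ℤ) * u.2 + a 1 * v.2 = b 0 * u.2 + b 1 * v.2 := by
      simpa [g] using congrArg Prod.snd hab
    have h3 : (a 0 : ℤ) = b 0 := by
      linear_combination v.2 * h1 - v.1 * h2 - (a 0 - b 0 : ℤ) * h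
    have h4 : (a 1 : ℤ) = b 1 := by
      linear_combination u.1 * h2 - u.2 * h1 - (a 1 - b 1 : ℤ) * h
    ext i
    fin_cases i
    · exact_mod_cast h3
    · exact_mod_cast h4
  -- The polynomial ring is the monoid algebra of ℕ², so an injective map on exponents induces an
  -- injection of algebras.
  let φ : MvPolynomial (Fin 2) k →ₐ[k] Laurent k := AddMonoidAlgebra.mapDomainAlgHom k k g
  have hφ : Function.Injective φ := AddMonoidAlgebra.mapDomain_injective hg
  have hX : φ = MvPolynomial.aeval ![mono k u, mono k v] := by
    apply MvPolynomial.algHom_ext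
    intro i
    have : φ (MvPolynomial.X i) = mono k (g (Finsupp.single i 1)) := AddMonoidAlgebra.mapDomain_single
    rw [this, MvPolynomial.aeval_X]
    fin_cases i <;> simp [g]
  have hr : φ.range = monoAlg k (AddSubmonoid.closure {u, v}) := by
    rw [hX, ← Algebra.adjoin_range_eq_range_aeval, ← adjoin_mono_eq, Set.image_pair]
    congr 1
    ext x
    simp [or_comm]
  exact ⟨(AlgEquiv.ofInjective φ hφ).trans (Subalgebra.equivOfEq _ _ hr)⟩

end Toric

/-! ### The charts of the surface -/

section ChartCones

variable (k : Type u) [Field k] (p : ℕ)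

/-- The cones of exponents of the chart rings. -/
def cone : Fin 5 → AddSubmonoid (ℤ × ℤ) :=
  ![dualCone (0, 1) (p, 1), dualCone (0, 1) (-1, p), dualCone (0, -1) (-1, p),
    dualCone (1, 0) (0, -1), dualCone (1, 0) (p, 1)]

theorem expo_sub_mem_cone (i : Fin 5) (j : Fin 10) : expo p j - expo p (idx i) ∈ cone p i := by
  have hp : (0 : ℤ) ≤ p := Int.natCast_nonneg p
  fin_cases i <;> fin_cases j <;>
    simp [expo, cone, mem_dualCone, idx, Fin.castLE, Matrix.cons_val] <;> (try constructor) <;>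
    nlinarith [mul_nonneg hp hp]

/-- The vector (0,1) splits this cone into two halves: for a ≥ 0 it is spanned by (1,0) and (0,1),
for a < 0 by (-1,p) and (0,1). -/
theorem cone_zero_le {M : AddSubmonoid (ℤ × ℤ)} (h1 : ((1 : ℤ), (0 : ℤ)) ∈ M)
    (h2 : ((0 : ℤ), (1 : ℤ)) ∈ M) (h3 : ((-1 : ℤ), (p : ℤ)) ∈ M) : cone p 0 ≤ M := by
  rintro ⟨a, b⟩ ⟨h4, h5⟩
  simp only at h4 h5
  rcases le_or_gt 0 a with ha | ha
  · have := add_mem (natCombo_mem h1 ha) (natCombo_mem h2 (c := b) (by linarith))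
    simpa using this
  · have := add_mem (natCombo_mem h3 (c := -a) (by linarith)) (natCombo_mem h2 h5)
    convert this using 1
    ext
    · simp
    · simp only [Prod.snd_add]
      ring

theorem cone_one_eq : cone p 1 = AddSubmonoid.closure {((p : ℤ), (1 : ℤ)), (-1, 0)} := by
  rw [closure_pair_eq (by simp)]
  simp [cone]

theorem dualCone_comm (u v : ℤ × ℤ) : dualCone u v = dualCone v u := by
  ext m
  exact and_comm

theorem cone_two_eq : cone p 2 = AddSubmonoid.closure {((-1 : ℤ), (0 : ℤ)), (-(p : ℤ), -1)} := by
  rw [closure_pair_eq (by simp), dualCone_comm]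
  simp [cone]

theorem cone_three_eq : cone p 3 = AddSubmonoid.closure {((0 : ℤ), (-1 : ℤ)), (1, 0)} := by
  rw [closure_pair_eq (by simp), dualCone_comm]
  simp [cone]

theorem cone_four_eq : cone p 4 = AddSubmonoid.closure {((1 : ℤ), -(p : ℤ)), (0, 1)} := by
  rw [closure_pair_eq (by simp)]
  simp [cone]

theorem exists_cone_eq_closure {i : Fin 5} (hi : i ≠ 0) :
    ∃ u v : ℤ × ℤ, u.1 * v.2 - u.2 * v.1 = 1 ∧ cone p i = AddSubmonoid.closure {u, v} := by
  fin_cases i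
  · exact absurd rfl hi
  · exact ⟨_, _, by simp, cone_one_eq p⟩
  · exact ⟨_, _, by simp, cone_two_eq p⟩
  · exact ⟨_, _, by simp, cone_three_eq p⟩
  · exact ⟨_, _, by simp, cone_four_eq p⟩

/-- In each chart the generators of the cone occur among the exponents of the quotients of
coordinates. The number given to `key` is the index of the coordinate that provides the generator.
-/
theorem cone_le_closure (i : Fin 5) :
    cone p i ≤ AddSubmonoid.closure (Set.range fun j => expo p j - expo p (idx i)) := by
  have key : ∀ (j : Fin 10) (m : ℤ × ℤ), expo p j - expo p (idx i) = m →
      m ∈ AddSubmonoid.closure (Set.range fun j => expo p j - expo p (idx i)) := by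
    rintro j m rfl
    exact AddSubmonoid.subset_closure ⟨j, rfl⟩
  fin_cases i
  · exact cone_zero_le p (key 1 _ (by simp [expo, idx])) (key 5 _ (by simp [expo, idx]))
      (key 4 _ (by simp [expo, idx]))
  · change cone p 1 ≤ _
    rw [cone_one_eq, AddSubmonoid.closure_le]
    rintro m (rfl | rfl)
    · exact key 6 _ (by simp [expo, idx])
    · exact key 0 _ (by simp [expo, idx])
  · change cone p 2 ≤ _
    rw [cone_two_eq, AddSubmonoid.closure_le]
    rintro m (rfl | rfl)
    · exact key 8 _ (by simp [expo, idx])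
    · exact key 7 _ (by simp [expo, idx]; ring)
  · change cone p 3 ≤ _
    rw [cone_three_eq, AddSubmonoid.closure_le]
    rintro m (rfl | rfl)
    · exact key 4 _ (by simp [expo, idx])
    · exact key 9 _ (by simp [expo, idx])
  · change cone p 4 ≤ _
    rw [cone_four_eq, AddSubmonoid.closure_le]
    rintro m (rfl | rfl)
    · exact key 0 _ (by simp [expo, idx])
    · exact key 3 _ (by simp [expo, idx])

/-- This makes the charts combinatorial: membership in `R_i` becomes a pair of linear inequalities
on exponents, and the overlap `R_ij` belongs to the sum of the two cones. -/
theorem chartRing_eq (i : Fin 5) : chartRing k p i = monoAlg k (cone p i) := by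
  have h : Set.range (coordMono k p i) = mono k '' Set.range fun j => expo p j - expo p (idx i) := by
    rw [← Set.range_comp]
    rfl
  rw [chartRing, h, adjoin_mono_eq]
  congr 1
  refine le_antisymm ?_ (cone_le_closure p i)
  rw [AddSubmonoid.closure_le]
  rintro _ ⟨j, rfl⟩
  exact expo_sub_mem_cone p i j

/-- The polynomial ring charts. -/
theorem exists_chartRing_equiv {i : Fin 5} (hi : i ≠ 0) :
    Nonempty (MvPolynomial (Fin 2) k ≃ₐ[k] chartRing k p i) := by
  obtain ⟨u, v, h, hc⟩ := exists_cone_eq_closure p hi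
  rw [chartRing_eq, hc]
  exact exists_mvPolynomial_equiv h

theorem coordMono_mem (i : Fin 5) (j : Fin 10) : coordMono k p i j ∈ chartRing k p i :=
  Algebra.subset_adjoin ⟨j, rfl⟩

theorem coordMono_mul_coordMono (i j : Fin 5) (l : Fin 10) :
    coordMono k p i (idx j) * coordMono k p j l = coordMono k p i l := by
  rw [coordMono, coordMono, mono_mul, coordMono]
  congr 1
  abel

theorem coordMono_self (i : Fin 5) : coordMono k p i (idx i) = 1 := by
  rw [coordMono, sub_self, mono_zero]

/-- Each generator `T_l / T_j` of `R_j` becomes `T_l / T_i` after multiplication by `T_j / T_i`.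
Thus `R_ij` is `R_i` with `T_j / T_i` inverted. -/
theorem coordMono_pow_mul_mem (i j : Fin 5) (c : Laurent k)
    (hc : c ∈ chartRing k p i ⊔ chartRing k p j) :
    ∃ n : ℕ, coordMono k p i (idx j) ^ n * c ∈ chartRing k p i := by
  have : chartRing k p i ⊔ chartRing k p j ≤
      saturation (chartRing k p i) (coordMono k p i (idx j)) (coordMono_mem k p i _) := by
    refine sup_le (le_saturation _ _ _) (Algebra.adjoin_le ?_)
    rintro _ ⟨l, rfl⟩
    refine ⟨1, ?_⟩
    rw [pow_one, coordMono_mul_coordMono]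
    exact coordMono_mem k p i l
  exact this hc

theorem isLocStep_chartRing (i j : Fin 5) :
    IsLocStep (chartRing k p i) (chartRing k p i ⊔ chartRing k p j) := by
  refine ⟨le_sup_left, coordMono k p i (idx j), coordMono_mem k p i _, coordMono k p j (idx i),
    (le_sup_right : chartRing k p j ≤ _) (coordMono_mem k p j _), ?_,
    coordMono_pow_mul_mem k p i j⟩
  rw [coordMono_mul_coordMono, coordMono_self]

theorem overlapRing_eq (i j : Fin 5) : overlapRing k p i j = monoAlg k (cone p i ⊔ cone p j) := by
  rw [overlapRing, chartRing_eq, chartRing_eq, monoAlg_sup]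

/-- By Cramer's rule every lattice vector is an integral combination of `u` and `v`. Any multiple of
`u` is available, and the inequality says that the coefficient of `v` is nonnegative. -/
theorem halfPlane_le {M : AddSubmonoid (ℤ × ℤ)} {u v : ℤ × ℤ} (h : u.1 * v.2 - u.2 * v.1 = 1)
    (hu : u ∈ M) (hu' : -u ∈ M) (hv : v ∈ M) : dualCone (-u.2, u.1) (-u.2, u.1) ≤ M := by
  rintro ⟨a, b⟩ ⟨h1, -⟩
  simp only at h1
  have hs : ∀ c : ℤ, (c * u.1, c * u.2) ∈ M := by
    intro c
    rcases le_or_gt 0 c with hc | hc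
    · exact natCombo_mem hu hc
    · have := natCombo_mem hu' (c := -c) (by linarith)
      simpa using this
  have := add_mem (hs (v.2 * a - v.1 * b)) (natCombo_mem hv h1)
  convert this using 1
  ext
  · simp only [Prod.fst_add]; linear_combination (-a) * h
  · simp only [Prod.snd_add]; linear_combination (-b) * h

theorem eq_top_of_mem {M : AddSubmonoid (ℤ × ℤ)} {u v : ℤ × ℤ} (h : u.1 * v.2 - u.2 * v.1 = 1)
    (hu : u ∈ M) (hu' : -u ∈ M) (hv : v ∈ M) (hv' : -v ∈ M) : M = ⊤ := by
  rw [eq_top_iff]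
  rintro m -
  rcases le_total 0 (-u.2 * m.1 + u.1 * m.2) with h1 | h1
  · exact halfPlane_le h hu hu' hv ⟨h1, h1⟩
  · refine halfPlane_le (u := -u) (v := -v) ?_ hu' (by simpa using hu) hv' ?_
    · simpa using h
    · rw [mem_dualCone]
      simp only [Prod.fst_neg, Prod.snd_neg]
      constructor <;> linarith

theorem dualCone_le_right (u v : ℤ × ℤ) : dualCone u v ≤ dualCone v v := fun _ h => ⟨h.2, h.2⟩

theorem dualCone_le_left (u v : ℤ × ℤ) : dualCone u v ≤ dualCone u u := fun _ h => ⟨h.1, h.1⟩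

/-- Charts whose fan cones share a ray overlap in the half plane dual to that ray. The three such
overlaps with a nontrivial transition map are 01, 04 and 34, with rays (0,1), (p,1) and (1,0). -/
theorem cone_sup_zero_one : cone p 0 ⊔ cone p 1 = dualCone (0, 1) (0, 1) := by
  refine le_antisymm (sup_le (dualCone_le_left _ _) (dualCone_le_left _ _)) ?_
  refine halfPlane_le (u := (1, 0)) (v := (0, 1)) (by simp) ?_ ?_ ?_
  · exact AddSubmonoid.mem_sup_left (by simp [cone, mem_dualCone])
  · exact AddSubmonoid.mem_sup_right (by simp [cone, mem_dualCone])
  · exact AddSubmonoid.mem_sup_left (by simp [cone, mem_dualCone])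

theorem cone_sup_zero_four : cone p 0 ⊔ cone p 4 = dualCone (p, 1) (p, 1) := by
  refine le_antisymm (sup_le (dualCone_le_right _ _) (dualCone_le_right _ _)) ?_
  have h := halfPlane_le (M := cone p 0 ⊔ cone p 4) (u := (1, -p)) (v := (0, 1)) (by simp) ?_ ?_ ?_
  · simpa using h
  · exact AddSubmonoid.mem_sup_right (by simp [cone, mem_dualCone])
  · exact AddSubmonoid.mem_sup_left (by simp [cone, mem_dualCone])
  · exact AddSubmonoid.mem_sup_left (by simp [cone, mem_dualCone])

theorem cone_sup_three_four : cone p 3 ⊔ cone p 4 = dualCone (1, 0) (1, 0) := by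
  refine le_antisymm (sup_le (dualCone_le_left _ _) (dualCone_le_left _ _)) ?_
  have h := halfPlane_le (M := cone p 3 ⊔ cone p 4) (u := (0, -1)) (v := (1, 0)) (by simp) ?_ ?_ ?_
  · simpa using h
  · exact AddSubmonoid.mem_sup_left (by simp [cone, mem_dualCone])
  · exact AddSubmonoid.mem_sup_right (by simp [cone, mem_dualCone])
  · exact AddSubmonoid.mem_sup_left (by simp [cone, mem_dualCone])

/-- Fan cones without a common ray meet only in the origin, so the charts intersect in the full
torus. There every substitution by units is defined, and invariance of the overlap is automatic. -/
theorem cone_sup_zero_two : cone p 0 ⊔ cone p 2 = ⊤ := by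
  have h1 : ((-1 : ℤ), (0 : ℤ)) ∈ cone p 0 ⊔ cone p 2 :=
    AddSubmonoid.mem_sup_right (by simp [cone, mem_dualCone])
  have h2 : ((1 : ℤ), (0 : ℤ)) ∈ cone p 0 ⊔ cone p 2 :=
    AddSubmonoid.mem_sup_left (by simp [cone, mem_dualCone])
  have h3 : (-(p : ℤ), (-1 : ℤ)) ∈ cone p 0 ⊔ cone p 2 :=
    AddSubmonoid.mem_sup_right (by simp [cone, mem_dualCone])
  refine eq_top_of_mem (u := (1, 0)) (v := (0, 1)) (by simp) h2 (by simpa using h1) ?_ ?_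
  · exact AddSubmonoid.mem_sup_left (by simp [cone, mem_dualCone])
  · have := add_mem h3 (natCombo_mem h2 (Int.natCast_nonneg p))
    simpa using this

theorem cone_sup_zero_three : cone p 0 ⊔ cone p 3 = ⊤ := by
  have h1 : ((-1 : ℤ), (p : ℤ)) ∈ cone p 0 ⊔ cone p 3 :=
    AddSubmonoid.mem_sup_left (by simp [cone, mem_dualCone])
  have h2 : ((0 : ℤ), (-1 : ℤ)) ∈ cone p 0 ⊔ cone p 3 :=
    AddSubmonoid.mem_sup_right (by simp [cone, mem_dualCone])
  refine eq_top_of_mem (u := (1, 0)) (v := (0, 1)) (by simp) ?_ ?_ ?_ (by simpa using h2)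
  · exact AddSubmonoid.mem_sup_left (by simp [cone, mem_dualCone])
  · have := add_mem h1 (natCombo_mem h2 (Int.natCast_nonneg p))
    simpa using this
  · exact AddSubmonoid.mem_sup_left (by simp [cone, mem_dualCone])

theorem cone_sup_one_four [NeZero p] : cone p 1 ⊔ cone p 4 = ⊤ := by
  have h1 : ((-1 : ℤ), (0 : ℤ)) ∈ cone p 1 ⊔ cone p 4 :=
    AddSubmonoid.mem_sup_left (by simp [cone, mem_dualCone])
  have h2 : ((0 : ℤ), (1 : ℤ)) ∈ cone p 1 ⊔ cone p 4 :=
    AddSubmonoid.mem_sup_right (by simp [cone, mem_dualCone])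
  have h3 : ((1 : ℤ), -(p : ℤ)) ∈ cone p 1 ⊔ cone p 4 :=
    AddSubmonoid.mem_sup_right (by simp [cone, mem_dualCone])
  have h4 : ((1 : ℤ), (0 : ℤ)) ∈ cone p 1 ⊔ cone p 4 := by
    have := add_mem h3 (natCombo_mem h2 (Int.natCast_nonneg p))
    simpa using this
  refine eq_top_of_mem (u := (1, -(p : ℤ))) (v := (0, 1)) (by simp) h3 ?_ h2 ?_
  · exact AddSubmonoid.mem_sup_left (by simp [cone, mem_dualCone]; nlinarith)
  · have hp : (0 : ℤ) ≤ p - 1 := by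
      have := NeZero.pos p
      omega
    have := add_mem (add_mem h3 h1) (natCombo_mem h2 hp)
    convert this using 1
    ext
    · simp
    · simp only [Prod.snd_add, Prod.snd_neg]
      ring

theorem cone_sup_two_four : cone p 2 ⊔ cone p 4 = ⊤ := by
  have h1 : ((-1 : ℤ), (0 : ℤ)) ∈ cone p 2 ⊔ cone p 4 :=
    AddSubmonoid.mem_sup_left (by simp [cone, mem_dualCone])
  have h2 : ((0 : ℤ), (1 : ℤ)) ∈ cone p 2 ⊔ cone p 4 :=
    AddSubmonoid.mem_sup_right (by simp [cone, mem_dualCone])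
  have h3 : ((1 : ℤ), -(p : ℤ)) ∈ cone p 2 ⊔ cone p 4 :=
    AddSubmonoid.mem_sup_right (by simp [cone, mem_dualCone])
  have h4 : ((1 : ℤ), (0 : ℤ)) ∈ cone p 2 ⊔ cone p 4 := by
    have := add_mem h3 (natCombo_mem h2 (Int.natCast_nonneg p))
    simpa using this
  have h5 : (-(p : ℤ), (-1 : ℤ)) ∈ cone p 2 ⊔ cone p 4 :=
    AddSubmonoid.mem_sup_left (by simp [cone, mem_dualCone])
  refine eq_top_of_mem (u := (1, 0)) (v := (0, 1)) (by simp) h4 (by simpa using h1) h2 ?_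
  have := add_mem h5 (natCombo_mem h4 (Int.natCast_nonneg p))
  simpa using this

/-- The homomorphism from `R₀` to the Laurent polynomial ring. -/
def R0.toLaurent : R0 k p →ₐ[k] Laurent k :=
  Ideal.Quotient.liftₐ _ (MvPolynomial.aeval ![mono k (1, 0), mono k (0, 1), mono k (-1, p)]) (by
    intro a ha
    have h : Ideal.span {(MvPolynomial.X 0 * MvPolynomial.X 2 - MvPolynomial.X 1 ^ p :
        MvPolynomial (Fin 3) k)} ≤ RingHom.ker (MvPolynomial.aeval (R := k)
          ![mono k (1, 0), mono k (0, 1), mono k (-1, (p : ℤ))]) := by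
      rw [Ideal.span_singleton_le_iff_mem, RingHom.mem_ker]
      simp [mono_mul, mono_pow]
    exact h ha)

theorem R0.toLaurent_var (i : Fin 3) :
    R0.toLaurent k p (R0.var k p i) = ![mono k (1, 0), mono k (0, 1), mono k (-1, (p : ℤ))] i := by
  exact MvPolynomial.aeval_X _ _

theorem R0.toLaurent_comp_mk : (R0.toLaurent k p).comp (Ideal.Quotient.mkₐ k _) =
    MvPolynomial.aeval ![mono k (1, 0), mono k (0, 1), mono k (-1, (p : ℤ))] := by
  apply MvPolynomial.algHom_ext
  intro i
  rw [MvPolynomial.aeval_X]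
  exact R0.toLaurent_var k p i

theorem R0.range_toLaurent : (R0.toLaurent k p).range = chartRing k p 0 := by
  rw [chartRing_eq]
  have h1 : (R0.toLaurent k p).range = ((R0.toLaurent k p).comp (Ideal.Quotient.mkₐ k _)).range := by
    rw [AlgHom.range_comp, (AlgHom.range_eq_top _).mpr (Ideal.Quotient.mkₐ_surjective k _),
      Algebra.map_top]
  rw [h1, R0.toLaurent_comp_mk, ← Algebra.adjoin_range_eq_range_aeval]
  have h2 : Set.range ![mono k (1, 0), mono k (0, 1), mono k (-1, (p : ℤ))] =
      mono k '' {((1 : ℤ), (0 : ℤ)), (0, 1), (-1, (p : ℤ))} := by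
    rw [Set.image_insert_eq, Set.image_pair, Matrix.range_cons, Matrix.range_cons,
      Matrix.range_cons, Matrix.range_empty, Set.union_empty]
    rfl
  rw [h2, adjoin_mono_eq]
  congr 1
  refine le_antisymm ?_ (cone_zero_le p (AddSubmonoid.subset_closure (by simp))
    (AddSubmonoid.subset_closure (by simp)) (AddSubmonoid.subset_closure (by simp)))
  rw [AddSubmonoid.closure_le]
  rintro m (rfl | rfl | rfl) <;> simp [cone, mem_dualCone]

/-- The element `xz = y^p` holds in `R₀`. -/
theorem R0.var_mul : R0.var k p 0 * R0.var k p 2 = R0.var k p 1 ^ p := by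
  rw [← sub_eq_zero]
  exact Ideal.Quotient.eq_zero_iff_mem.mpr (Ideal.subset_span rfl)

/-- A linear retraction of `R0.toLaurent`. -/
def R0.ofLaurent : Laurent k →+ R0 k p :=
  (Finsupp.liftAddHom fun m : ℤ × ℤ => (AddMonoidHom.mulRight
    (if 0 ≤ m.1 then R0.var k p 0 ^ m.1.toNat * R0.var k p 1 ^ m.2.toNat else
      R0.var k p 2 ^ (-m.1).toNat * R0.var k p 1 ^ (p * m.1 + m.2).toNat)).comp
        (algebraMap k (R0 k p) : k →+ R0 k p)).comp
    { toFun := fun f => f.coeff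
      map_zero' := rfl
      map_add' := fun _ _ => rfl }

/-- The relation xz = y^p brings every monomial to a normal form x^a y^b or z^c y^d. The Laurent
exponent determines this form, and reading it back inverts the map to the Laurent ring; this is how
its injectivity is obtained. -/
theorem R0.ofLaurent_toLaurent (r : R0 k p) : R0.ofLaurent k p (R0.toLaurent k p r) = r := by
  obtain ⟨f, rfl⟩ := Ideal.Quotient.mk_surjective r
  have h0 : R0.toLaurent k p (Ideal.Quotient.mk _ f) = MvPolynomial.aeval
      ![mono k (1, 0), mono k (0, 1), mono k (-1, (p : ℤ))] f :=
    DFunLike.congr_fun (R0.toLaurent_comp_mk k p) f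
  rw [h0]
  induction f using MvPolynomial.induction_on' with
  | add f g hf hg =>
    rw [map_add, map_add, map_add, hf, hg]
    · exact DFunLike.congr_fun (R0.toLaurent_comp_mk k p) g
    · exact DFunLike.congr_fun (R0.toLaurent_comp_mk k p) f
  | monomial e c =>
    have h1 : MvPolynomial.aeval ![mono k (1, 0), mono k (0, 1), mono k (-1, (p : ℤ))]
        (MvPolynomial.monomial e c) = AddMonoidAlgebra.single
          ((e 0 : ℤ) - e 2, (e 1 + p * e 2 : ℤ)) c := by
      rw [MvPolynomial.aeval_monomial, Finsupp.prod_fintype _ _ (by simp)]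
      simp only [Fin.prod_univ_three, Matrix.cons_val, mono_pow, mono_mul]
      simp [mono, AddMonoidAlgebra.single_mul_single, sub_eq_add_neg, mul_comm]
    have h2 : (Ideal.Quotient.mk _ (MvPolynomial.monomial e c) : R0 k p) =
        algebraMap k (R0 k p) c *
          (R0.var k p 0 ^ e 0 * R0.var k p 1 ^ e 1 * R0.var k p 2 ^ e 2) := by
      rw [MvPolynomial.monomial_eq, Finsupp.prod_fintype _ _ (by simp), map_mul]
      simp only [Fin.prod_univ_three, map_mul, map_pow]
      rfl
    rw [h1, h2]
    have h3 : R0.ofLaurent k p (AddMonoidAlgebra.single ((e 0 : ℤ) - e 2, (e 1 + p * e 2 : ℤ)) c) =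
        algebraMap k (R0 k p) c * (if 0 ≤ (e 0 : ℤ) - e 2 then
          R0.var k p 0 ^ ((e 0 : ℤ) - e 2).toNat * R0.var k p 1 ^ (e 1 + p * e 2 : ℤ).toNat else
          R0.var k p 2 ^ (-((e 0 : ℤ) - e 2)).toNat *
            R0.var k p 1 ^ (p * ((e 0 : ℤ) - e 2) + (e 1 + p * e 2 : ℤ)).toNat) :=
      Finsupp.sum_single_index (by simp)
    rw [h3]
    congr 1
    split_ifs with h
    · have ha : ((e 0 : ℤ) - e 2).toNat = e 0 - e 2 := by omega
      have hb : (e 1 + p * e 2 : ℤ).toNat = e 1 + p * e 2 := by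
        rw [← Int.toNat_natCast (e 1 + p * e 2)]
        push_cast
        rfl
      obtain ⟨d, hd⟩ : ∃ d, e 0 = e 2 + d := ⟨e 0 - e 2, by omega⟩
      rw [ha, hb, hd, pow_add, pow_mul, ← R0.var_mul, Nat.add_sub_cancel_left]
      ring
    · obtain ⟨d, hd⟩ : ∃ d, e 2 = e 0 + d := ⟨e 2 - e 0, by omega⟩
      have ha : (-((e 0 : ℤ) - e 2)).toNat = d := by omega
      have hb : (p * ((e 0 : ℤ) - e 2) + (e 1 + p * e 2 : ℤ)).toNat = p * e 0 + e 1 := by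
        rw [← Int.toNat_natCast (p * e 0 + e 1)]
        push_cast
        congr 1
        ring
      rw [ha, hb, hd, pow_add, pow_mul, ← R0.var_mul]
      ring

theorem R0.toLaurent_injective : Function.Injective (R0.toLaurent k p) :=
  Function.LeftInverse.injective (R0.ofLaurent_toLaurent k p)

/-- `R₀` is the zeroth chart ring. -/
def R0.equivChartRing : R0 k p ≃ₐ[k] chartRing k p 0 :=
  (AlgEquiv.ofInjective _ (R0.toLaurent_injective k p)).trans
    (Subalgebra.equivOfEq _ _ (R0.range_toLaurent k p))

theorem R0.coe_equivChartRing (r : R0 k p) :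
    (R0.equivChartRing k p r : Laurent k) = R0.toLaurent k p r := rfl

theorem R0.toLaurent_coords (j : Fin 10) : R0.toLaurent k p (coords k p j) = coordMono k p 0 j := by
  fin_cases j <;>
    simp [coords, R0.toLaurent_var, coordMono, mono_mul, mono_pow, expo, mono_zero, idx,
      ← Prod.zero_eq_mk, add_comm]

instance : IsDomain (R0 k p) := (R0.toLaurent_injective k p).isDomain (R0.toLaurent k p).toRingHom

end ChartCones

/-! ### Morphisms from affine schemes to projective space -/

section
variable {A : Type u} [CommRing A] {σ : Type*} [SetLike σ A] [AddSubgroupClass σ A] (𝒜 : ℕ → σ)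
  [GradedRing 𝒜]

/-- Since `f r` is invertible, its basic open set is all of `X`, so the piece of the glued morphism
over that open set is the whole morphism. -/
theorem fromOfGlobalSections_eq_specMap_awayι {X : Scheme.{u}}
    (f : A →+* Γ(X, ⊤)) (hf : (HomogeneousIdeal.irrelevant 𝒜).toIdeal.map f = ⊤)
    {r : A} {n : ℕ} (hn : 0 < n) (hr : r ∈ 𝒜 n)
    (ψ : Localization.Away (f r) →+* Γ(X, ⊤))
    (hψ : ψ.comp (algebraMap _ (Localization.Away (f r))) = RingHom.id _) (hu : IsUnit (f r))
    (hm : Submonoid.powers r ≤ (Submonoid.powers (f r)).comap f) :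
    Proj.fromOfGlobalSections 𝒜 f hf = X.toSpecΓ ≫ Spec.map (CommRingCat.ofHom
      (ψ.comp ((IsLocalization.map (M := .powers r) (T := .powers (f r))
       (Localization.Away (f r)) f hm).comp (algebraMap _ (Localization.Away r))))) ≫
        Proj.awayι 𝒜 r hr hn := by
  have hU : X.basicOpen (f r) = ⊤ := Scheme.basicOpen_of_isUnit _ hu
  have : IsIso (X.basicOpen (f r)).ι := by
    have : (X.basicOpen (f r)).ι = (X.isoOfEq hU).hom ≫ X.topIso.hom := by
      rw [Scheme.topIso_hom, Scheme.isoOfEq_hom_ι]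
    rw [this]
    infer_instance
  rw [← cancel_epi (X.basicOpen (f r)).ι]
  have h1 : (X.basicOpen (f r)).ι ≫ Proj.fromOfGlobalSections 𝒜 f hf =
      Proj.toBasicOpenOfGlobalSections 𝒜 f rfl hn hr ≫ (Proj.basicOpen 𝒜 r).ι := by
    rw [← Proj.fromOfGlobalSections_resLE 𝒜 f hf hn hr]
    exact (Scheme.Hom.resLE_comp_ι _ _).symm
  rw [h1]
  have h2 : (X.basicOpen (f r)).ι ≫ X.toSpecΓ ≫ Spec.map (CommRingCat.ofHom ψ) =
      (Scheme.isoOfEq _ (X.toSpecΓ_preimage_basicOpen (f r))).inv ≫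
        X.toSpecΓ ∣_ _ ≫ (basicOpenIsoSpecAway _).hom := by
    rw [← cancel_mono (Spec.map (CommRingCat.ofHom (algebraMap Γ(X, ⊤) (Localization.Away (f r)))))]
    simp only [Category.assoc, ← Spec.map_comp, ← CommRingCat.ofHom_comp, hψ]
    rw [basicOpenIsoSpecAway_hom_SpecMap, CommRingCat.ofHom_id]
    erw [Spec.map_id, Category.comp_id]
    refine Eq.trans ?_ (congrArg (fun t => (Scheme.isoOfEq _
      (X.toSpecΓ_preimage_basicOpen (f r))).inv ≫ t) (morphismRestrict_ι X.toSpecΓ _).symm)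
    exact (Scheme.isoOfEq_inv_ι_assoc _ _ _).symm
  rw [CommRingCat.ofHom_comp, Spec.map_comp, Category.assoc, reassoc_of% h2,
    Proj.toBasicOpenOfGlobalSections, ← Proj.basicOpenIsoSpec_inv_ι]
  simp only [Category.assoc]

end
attribute [local instance] MvPolynomial.gradedAlgebra

theorem X_mem_homogeneousSubmodule (k : Type u) [Field k] {n : ℕ} (i : Fin (n + 1)) :
    (MvPolynomial.X i : MvPolynomial (Fin (n + 1)) k) ∈
      MvPolynomial.homogeneousSubmodule (Fin (n + 1)) k 1 := MvPolynomial.isHomogeneous_X k i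

/-- Any unit coordinate may serve as denominator, not only the one normalized to 1. The last formula
says that the ring map sends a/X_i^m to a(v)/v_i^m; by `away_hom_ext` it determines the map, and the
comparisons of projective points are deduced from it. -/
theorem exists_projPoint_eq {k : Type u} [Field k] {n : ℕ} {B : Type u} [CommRing B] [Algebra k B]
    (v : Fin (n + 1) → B) (j : Fin (n + 1)) (hv : v j = 1) (i : Fin (n + 1)) (hu : IsUnit (v i)) :
    ∃ φ : HomogeneousLocalization.Away (MvPolynomial.homogeneousSubmodule (Fin (n + 1)) k)
        (MvPolynomial.X i) →+* B,
      projPoint v j hv = Spec.map (CommRingCat.ofHom φ) ≫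
        Proj.awayι _ (MvPolynomial.X i) (X_mem_homogeneousSubmodule k i) one_pos ∧
      ∀ m a ha, φ (.mk _ (X_mem_homogeneousSubmodule k i) m a ha) * v i ^ m =
        MvPolynomial.aeval v a := by
  set F : MvPolynomial (Fin (n + 1)) k →+* Γ(Spec (.of B), ⊤) :=
    ((Scheme.ΓSpecIso (.of B)).inv.hom.comp (MvPolynomial.aeval v).toRingHom) with hF
  have hFX : F (MvPolynomial.X i) = (Scheme.ΓSpecIso (.of B)).inv.hom (v i) := by simp [hF]
  have hinv : ∀ b, (Scheme.ΓSpecIso (.of B)).hom.hom ((Scheme.ΓSpecIso (.of B)).inv.hom b) = b := fun b =>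
    DFunLike.congr_fun (congrArg CommRingCat.Hom.hom (Scheme.ΓSpecIso (.of B)).inv_hom_id) b
  have hu' : IsUnit (F (MvPolynomial.X i)) := by
    rw [hFX]; exact hu.map _
  have hu2 : ∀ y : Submonoid.powers (F (MvPolynomial.X i)), IsUnit (RingHom.id Γ(Spec (.of B), ⊤) y) := by
    rintro ⟨_, m, rfl⟩
    exact (hu'.pow m).map _
  let ψ : Localization.Away (F (MvPolynomial.X i)) →+* Γ(Spec (.of B), ⊤) :=
    IsLocalization.lift (M := .powers (F (MvPolynomial.X i))) (g := RingHom.id _) hu2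
  have hm : Submonoid.powers (MvPolynomial.X i : MvPolynomial (Fin (n + 1)) k) ≤
      (Submonoid.powers (F (MvPolynomial.X i))).comap F := by
    rw [← Submonoid.map_le_iff_le_comap, Submonoid.map_powers]
  have key := fun hf => fromOfGlobalSections_eq_specMap_awayι
    (MvPolynomial.homogeneousSubmodule (Fin (n + 1)) k) F hf one_pos
    (X_mem_homogeneousSubmodule k i) ψ (IsLocalization.lift_comp _) hu' hm
  refine ⟨(Scheme.ΓSpecIso (.of B)).hom.hom.comp (ψ.comp ((IsLocalization.map
    (Localization.Away (F (MvPolynomial.X i))) F hm).comp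
      (algebraMap (HomogeneousLocalization.Away (MvPolynomial.homogeneousSubmodule (Fin (n + 1)) k)
        (MvPolynomial.X i))
        (Localization.Away (MvPolynomial.X i : MvPolynomial (Fin (n + 1)) k))))), ?_, ?_⟩
  · refine (key _).trans ?_
    rw [CommRingCat.ofHom_comp (g := (Scheme.ΓSpecIso (.of B)).hom.hom), Spec.map_comp, Category.assoc]
    congr 1
    exact (SpecMap_ΓSpecIso_hom _).symm
  · intro m a ha
    have h1 : IsLocalization.map (Localization.Away (F (MvPolynomial.X i))) F hm
        (algebraMap (HomogeneousLocalization.Away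
            (MvPolynomial.homogeneousSubmodule (Fin (n + 1)) k) (MvPolynomial.X i))
          (Localization.Away (MvPolynomial.X i : MvPolynomial (Fin (n + 1)) k))
          (HomogeneousLocalization.Away.mk (MvPolynomial.homogeneousSubmodule (Fin (n + 1)) k)
            (X_mem_homogeneousSubmodule k i) m a ha)) *
            algebraMap Γ(Spec (.of B), ⊤) (Localization.Away (F (MvPolynomial.X i)))
              (F (MvPolynomial.X i)) ^ m =
          algebraMap Γ(Spec (.of B), ⊤) (Localization.Away (F (MvPolynomial.X i))) (F a) := by
      rw [HomogeneousLocalization.algebraMap_apply, HomogeneousLocalization.Away.val_mk,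
        Localization.mk_eq_mk', IsLocalization.map_mk', ← map_pow, ← map_pow]
      exact IsLocalization.mk'_spec _ _ _
    have h2 := congrArg ψ h1
    have hψ : ∀ b, ψ (algebraMap _ _ b) = b := fun b => IsLocalization.lift_eq hu2 b
    rw [map_mul, map_pow, hψ, hψ] at h2
    have h3 := congrArg (Scheme.ΓSpecIso (.of B)).hom.hom h2
    have h4 : (Scheme.ΓSpecIso (.of B)).hom.hom (F (MvPolynomial.X i)) = v i := by rw [hFX, hinv]
    rw [map_mul, map_pow, h4] at h3
    exact h3.trans (hinv _)

section ProjPoint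

variable {k : Type u} [Field k] {n : ℕ} {B C : Type u} [CommRing B] [Algebra k B] [CommRing C]
  [Algebra k C]

theorem away_hom_ext {i : Fin (n + 1)} {v : Fin (n + 1) → B} (hu : IsUnit (v i))
    {φ φ' : HomogeneousLocalization.Away (MvPolynomial.homogeneousSubmodule (Fin (n + 1)) k)
        (MvPolynomial.X i) →+* B}
    (h : ∀ m a ha, φ (.mk _ (X_mem_homogeneousSubmodule k i) m a ha) * v i ^ m =
      MvPolynomial.aeval v a)
    (h' : ∀ m a ha, φ' (.mk _ (X_mem_homogeneousSubmodule k i) m a ha) * v i ^ m =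
      MvPolynomial.aeval v a) : φ = φ' := by
  ext x
  obtain ⟨m, a, ha, rfl⟩ := HomogeneousLocalization.Away.mk_surjective _
    (X_mem_homogeneousSubmodule k i) x
  exact (hu.pow m).mul_right_cancel ((h m a ha).trans (h' m a ha).symm)

theorem aeval_mul_of_isHomogeneous {v : Fin (n + 1) → B} {c : B} {a : MvPolynomial (Fin (n + 1)) k}
    {m : ℕ} (ha : a.IsHomogeneous m) :
    MvPolynomial.aeval (fun l => c * v l) a = c ^ m * MvPolynomial.aeval v a := by
  rw [MvPolynomial.aeval_def, MvPolynomial.aeval_def, MvPolynomial.eval₂_eq', MvPolynomial.eval₂_eq',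
    Finset.mul_sum]
  refine Finset.sum_congr rfl fun d hd => ?_
  have h := ha (MvPolynomial.mem_support_iff.mp hd)
  simp only [mul_pow, Finset.prod_mul_distrib, Finset.prod_pow_eq_pow_sum]
  have h2 : ∑ i, d i = m := by
    rw [← h, Finsupp.weight_apply, Finsupp.sum_fintype _ _ (by simp)]
    simp
  rw [h2]
  ring

/-- A form of degree m is multiplied by c^m, which cancels in a/X_i^m. The factor is automatically a
unit, because `w j = 1`. -/
theorem projPoint_smul {v w : Fin (n + 1) → B} {i j : Fin (n + 1)} (hv : v i = 1) (hw : w j = 1)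
    {c : B} (h : ∀ l, w l = c * v l) : projPoint (k := k) v i hv = projPoint w j hw := by
  have hc : w i = c := by rw [h, hv, mul_one]
  have hu : IsUnit (w i) := by
    rw [hc]
    exact IsUnit.of_mul_eq_one (v j) (by rw [← h, hw])
  obtain ⟨φ, h1, h2⟩ := exists_projPoint_eq (k := k) v i hv i (by rw [hv]; exact isUnit_one)
  obtain ⟨φ', h3, h4⟩ := exists_projPoint_eq (k := k) w j hw i hu
  have : φ = φ' := by
    refine away_hom_ext hu (fun m a ha => ?_) h4
    have h5 := h2 m a ha
    rw [hv, one_pow, mul_one] at h5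
    have hww : w = fun l => c * v l := funext h
    have ha' : a.IsHomogeneous m := by simpa using ha
    rw [h5, hc, hww, aeval_mul_of_isHomogeneous ha', mul_comm]
  rw [h1, h3, this]

theorem specAlg_projPoint (g : B →ₐ[k] C) (v : Fin (n + 1) → B) (i : Fin (n + 1)) (hv : v i = 1) :
    specAlg k g ≫ projPoint (k := k) v i hv =
      projPoint (k := k) (fun l => g (v l)) i (by rw [hv, map_one]) := by
  obtain ⟨φ, h1, h2⟩ := exists_projPoint_eq (k := k) v i hv i (by rw [hv]; exact isUnit_one)
  have hg : g (v i) = 1 := by rw [hv, map_one]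
  obtain ⟨φ', h3, h4⟩ := exists_projPoint_eq (k := k) (fun l => g (v l)) i hg i
    (by rw [hg]; exact isUnit_one)
  have : g.toRingHom.comp φ = φ' := by
    refine away_hom_ext (v := fun l => g (v l)) (by rw [hg]; exact isUnit_one)
      (fun m a ha => ?_) h4
    have h5 := congrArg g (h2 m a ha)
    rw [map_mul, map_pow] at h5
    refine h5.trans ?_
    rw [← AlgHom.comp_apply, MvPolynomial.comp_aeval]
  rw [h1, h3, ← this, CommRingCat.ofHom_comp, Spec.map_comp, Category.assoc]

theorem projPoint_toSpecK (v : Fin (n + 1) → B) (i : Fin (n + 1)) (hv : v i = 1) :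
    projPoint (k := k) v i hv ≫ ProjSpace.toSpecK k n =
      Spec.map (CommRingCat.ofHom (algebraMap k B)) := by
  obtain ⟨φ, h1, h2⟩ := exists_projPoint_eq (k := k) v i hv i (by rw [hv]; exact isUnit_one)
  rw [h1, ProjSpace.toSpecK, Category.assoc, Proj.awayι_toSpecZero_assoc, ← Spec.map_comp,
    ← Spec.map_comp]
  congr 1
  ext c
  have h3 := h2 0 (MvPolynomial.C c) (by simp)
  rw [pow_zero, mul_one, MvPolynomial.aeval_C] at h3
  refine Eq.trans ?_ h3
  change φ _ = φ _
  congr 1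

theorem projPoint_preimage (v : Fin (n + 1) → B) (i : Fin (n + 1)) (hv : v i = 1)
    {f : MvPolynomial (Fin (n + 1)) k} {m : ℕ} (hm : 0 < m) (hf : f.IsHomogeneous m) :
    projPoint (k := k) v i hv ⁻¹ᵁ Proj.basicOpen _ f =
      PrimeSpectrum.basicOpen (MvPolynomial.aeval v f) := by
  refine (Proj.fromOfGlobalSections_preimage_basicOpen _ _ _ hm hf).trans ?_
  exact (basicOpen_eq_of_affine (R := .of B) _).trans rfl

/-- The ring map hits every coordinate, so it is surjective when the coordinates generate. A chart
is thereby a closed subscheme of a standard affine open set. -/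
theorem exists_projPoint_eq_of_adjoin_eq_top (v : Fin (n + 1) → B) (i : Fin (n + 1)) (hv : v i = 1)
    (hB : Algebra.adjoin k (Set.range v) = ⊤) :
    ∃ φ : HomogeneousLocalization.Away (MvPolynomial.homogeneousSubmodule (Fin (n + 1)) k)
        (MvPolynomial.X i) →+* B, Function.Surjective φ ∧
      projPoint v i hv = Spec.map (CommRingCat.ofHom φ) ≫
        Proj.awayι _ (MvPolynomial.X i) (X_mem_homogeneousSubmodule k i) one_pos := by
  obtain ⟨φ, h1, h2⟩ := exists_projPoint_eq (k := k) v i hv i (by rw [hv]; exact isUnit_one)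
  simp only [hv, one_pow, mul_one] at h2
  refine ⟨φ, fun b => ?_, h1⟩
  have hb : b ∈ Algebra.adjoin k (Set.range v) := by rw [hB]; trivial
  induction hb using Algebra.adjoin_induction with
  | mem x hx =>
    obtain ⟨l, rfl⟩ := hx
    exact ⟨_, (h2 1 (MvPolynomial.X l) (by simpa using MvPolynomial.isHomogeneous_X k l)).trans
      (MvPolynomial.aeval_X _ _)⟩
  | algebraMap c =>
    exact ⟨_, (h2 0 (MvPolynomial.C c) (by simp)).trans
      (MvPolynomial.aeval_C _ _)⟩
  | add x y _ _ hx hy =>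
    obtain ⟨⟨a, rfl⟩, ⟨b, rfl⟩⟩ := And.intro hx hy
    exact ⟨a + b, map_add _ _ _⟩
  | mul x y _ _ hx hy =>
    obtain ⟨⟨a, rfl⟩, ⟨b, rfl⟩⟩ := And.intro hx hy
    exact ⟨a * b, map_mul _ _ _⟩

end ProjPoint

/-! ### Kernels and images -/

theorem ker_eq_vanishingIdeal {X Y : Scheme.{u}} [IsReduced X] (f : X ⟶ Y) :
    f.ker = Scheme.IdealSheafData.vanishingIdeal (.closure (Set.range f)) := by
  have h := Scheme.IdealSheafData.map_vanishingIdeal f ⊤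
  rw [Scheme.IdealSheafData.vanishingIdeal_top, Scheme.nilradical_eq_bot,
    Scheme.IdealSheafData.map_bot] at h
  rw [h]
  congr 2
  exact Set.image_univ

theorem range_eq_preimage_of_isPullback {W U V Y : Scheme.{u}} {a : W ⟶ U} {b : W ⟶ V} {g : U ⟶ Y}
    {h : V ⟶ Y} (H : IsPullback a b g h) : Set.range a = g ⁻¹' Set.range h := by
  ext x
  constructor
  · rintro ⟨w, rfl⟩
    refine ⟨b w, ?_⟩
    rw [← Scheme.Hom.comp_apply, ← Scheme.Hom.comp_apply, H.w]
  · rintro ⟨v, hv⟩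
    obtain ⟨w, hw, -⟩ := Scheme.exists_preimage_of_isPullback H x v hv.symm
    exact ⟨w, hw⟩

theorem isPullback_comp_mono {X V Y : Scheme.{u}} (f : X ⟶ V) (j : V ⟶ Y) [Mono j] :
    IsPullback f (𝟙 X) j (f ≫ j) := by
  refine ⟨⟨by simp⟩, ⟨PullbackCone.IsLimit.mk _ (fun s => s.snd) (fun s => ?_) (fun s => ?_)
    (fun s m _ h => ?_)⟩⟩
  · rw [← cancel_mono j, Category.assoc, s.condition]
  · simp
  · rw [← h, Category.comp_id]

theorem comap_ker_comp {X V Y : Scheme.{u}} (f : X ⟶ V) (j : V ⟶ Y) [IsOpenImmersion j]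
    [QuasiCompact (f ≫ j)] : (f ≫ j).ker.comap j = f.ker := by
  ext1
  funext W
  rw [Scheme.IdealSheafData.ideal_comap_of_isOpenImmersion,
    Scheme.ker_ideal_of_isPullback_of_isOpenImmersion _ _ _ _ (isPullback_comp_mono f j) W]

/-! ### The charts of `X₀` -/

section X0Charts

variable (k : Type u) [Field k] (p : ℕ)

instance (i : Fin 5) : IsDomain (chartRing k p i) := inferInstance

theorem adjoin_chart_eq_top (i : Fin 5) : Algebra.adjoin k (Set.range fun j =>
    (⟨coordMono k p i j, coordMono_mem k p i j⟩ : chartRing k p i)) = ⊤ := by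
  apply Subalgebra.map_injective (f := (chartRing k p i).val) Subtype.val_injective
  rw [AlgHom.map_adjoin, ← Set.range_comp, Algebra.map_top, Subalgebra.range_val]
  rfl

theorem exists_chart_eq (i : Fin 5) :
    ∃ φ : HomogeneousLocalization.Away (MvPolynomial.homogeneousSubmodule (Fin 10) k)
        (MvPolynomial.X (idx i)) →+* chartRing k p i, Function.Surjective φ ∧
      chart k p i = Spec.map (CommRingCat.ofHom φ) ≫
        Proj.awayι _ (MvPolynomial.X (idx i)) (X_mem_homogeneousSubmodule k (idx i)) one_pos :=
  exists_projPoint_eq_of_adjoin_eq_top _ _ _ (adjoin_chart_eq_top k p i)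

/-- Inside the Laurent ring the two coordinate vectors are proportional with factor `T_i / T_j`, so
`projPoint_smul` applies. -/
theorem specAlg_chart_eq {B : Type u} [CommRing B] [Algebra k B] {i j : Fin 5}
    (g : chartRing k p i →ₐ[k] B) (h : chartRing k p j →ₐ[k] B) (f : B →ₐ[k] Laurent k)
    (hf : Function.Injective f) (hg : f.comp g = (chartRing k p i).val)
    (hh : f.comp h = (chartRing k p j).val) :
    specAlg k g ≫ chart k p i = specAlg k h ≫ chart k p j := by
  rw [chart, chart, specAlg_projPoint, specAlg_projPoint]
  refine projPoint_smul _ _ (c := h ⟨coordMono k p j (idx i), coordMono_mem k p j _⟩) fun l => ?_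
  apply hf
  have hg' := fun a => DFunLike.congr_fun hg a
  have hh' := fun a => DFunLike.congr_fun hh a
  simp only [AlgHom.comp_apply] at hg' hh'
  rw [map_mul, hg', hh', hh']
  exact (coordMono_mul_coordMono k p j i l).symm

theorem specIncl_chart (i j : Fin 5) :
    specIncl (le_sup_left : chartRing k p i ≤ chartRing k p i ⊔ chartRing k p j) ≫ chart k p i =
      specIncl (le_sup_right : chartRing k p j ≤ chartRing k p i ⊔ chartRing k p j) ≫
        chart k p j :=
  specAlg_chart_eq k p (Subalgebra.inclusion le_sup_left) (Subalgebra.inclusion le_sup_right)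
    (Subalgebra.val _) Subtype.val_injective rfl rfl

theorem chart_toSpecK (i : Fin 5) : chart k p i ≫ ProjSpace.toSpecK k 9 =
    Spec.map (CommRingCat.ofHom (algebraMap k (chartRing k p i))) := projPoint_toSpecK _ _ _

/-- The torus is dense in every chart because `R_i` embeds in the Laurent ring. All five charts
therefore have the closure of the same torus as closure in projective space. -/
theorem closure_range_chart (i : Fin 5) : closure (Set.range (chart k p i)) =
    closure (Set.range (specAlg k (chartRing k p i).val ≫ chart k p i)) := by
  have hd : DenseRange (specAlg k (chartRing k p i).val) := by
    refine (PrimeSpectrum.denseRange_comap_iff_ker_le_nilRadical _).mpr ?_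
    have : RingHom.ker (chartRing k p i).val.toRingHom = ⊥ :=
      (RingHom.injective_iff_ker_eq_bot _).mp Subtype.val_injective
    exact this.trans_le bot_le
  refine subset_antisymm (closure_minimal ?_ isClosed_closure) (closure_mono ?_)
  · rw [← Set.image_univ, ← hd.closure_range]
    refine (image_closure_subset_closure_image (chart k p i).continuous).trans ?_
    rw [← Set.range_comp]
    rfl
  · rintro _ ⟨x, rfl⟩
    exact ⟨specAlg k (chartRing k p i).val x, rfl⟩

theorem closure_range_chart_eq (i j : Fin 5) :
    closure (Set.range (chart k p i)) = closure (Set.range (chart k p j)) := by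
  rw [closure_range_chart, closure_range_chart k p j,
    specAlg_chart_eq k p (chartRing k p i).val (chartRing k p j).val (AlgHom.id k _)
      Function.injective_id rfl rfl]

theorem range_embU0 : Set.range (embU0 k p) = Set.range (chart k p 0) := by
  have h : chart k p 0 = specAlg k (R0.equivChartRing k p).toAlgHom ≫ embU0 k p := by
    refine Eq.trans ?_ (specAlg_projPoint (R0.equivChartRing k p).toAlgHom (coords k p) 0 rfl).symm
    rw [chart]
    congr 1
    funext j
    exact Subtype.ext (R0.toLaurent_coords k p j).symm
  have : IsIso (specAlg k (R0.equivChartRing k p).toAlgHom) := by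
    have : IsIso (CommRingCat.ofHom (R0.equivChartRing k p).toAlgHom.toRingHom) :=
      (ConcreteCategory.isIso_iff_bijective _).mpr (R0.equivChartRing k p).bijective
    infer_instance
  have hs : Function.Surjective (specAlg k (R0.equivChartRing k p).toAlgHom) :=
    (specAlg k (R0.equivChartRing k p).toAlgHom).surjective
  rw [h]
  exact (hs.range_comp _).symm

/-- The surface is defined through the zeroth chart alone; this equality is what lets all the other
charts factor through it. -/
theorem idealX0_eq_ker (i : Fin 5) : idealX0 k p = (chart k p i).ker := by
  rw [ker_eq_vanishingIdeal, idealX0]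
  congr 1
  ext1
  change closure _ = closure _
  rw [range_embU0, closure_range_chart_eq k p 0 i]

theorem ker_X0ι : (X0.ι k p).ker = idealX0 k p := Scheme.IdealSheafData.ker_subschemeι _

/-- The affine charts of `X₀`. -/
def X0.chart (i : Fin 5) : Spec (.of (chartRing k p i)) ⟶ X0 k p :=
  IsClosedImmersion.lift (X0.ι k p) (LocTrivDef.chart k p i)
    (by rw [ker_X0ι, idealX0_eq_ker k p i])

theorem X0.chart_ι (i : Fin 5) : X0.chart k p i ≫ X0.ι k p = LocTrivDef.chart k p i :=
  IsClosedImmersion.lift_fac _ _ _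

theorem X0.chart_toSpecK (i : Fin 5) : X0.chart k p i ≫ X0.toSpecK k p =
    Spec.map (CommRingCat.ofHom (algebraMap k (chartRing k p i))) := by
  rw [X0.toSpecK, ← Category.assoc, X0.chart_ι, LocTrivDef.chart_toSpecK]

/-- Over the standard affine open set, the chart and the surface are closed subschemes with the same
ideal sheaf. As the base change of an open immersion, the chart is then itself an open immersion
with the expected image. -/
theorem X0.exists_isPullback_chart (i : Fin 5) :
    ∃ f : Spec (.of (chartRing k p i)) ⟶ _,
      IsPullback f (X0.chart k p i) (Proj.awayι _ (MvPolynomial.X (idx i))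
        (X_mem_homogeneousSubmodule k (idx i)) one_pos) (X0.ι k p) := by
  obtain ⟨φ, hφ, h⟩ := exists_chart_eq k p i
  have : IsClosedImmersion (Spec.map (CommRingCat.ofHom φ)) :=
    IsClosedImmersion.spec_of_surjective _ hφ
  have hq : QuasiCompact (Spec.map (CommRingCat.ofHom φ) ≫ Proj.awayι _ (MvPolynomial.X (idx i))
      (X_mem_homogeneousSubmodule k (idx i)) one_pos) := by
    rw [← h]
    have : QuasiCompact (LocTrivDef.chart k p i ≫ ProjSpace.toSpecK k 9) := by
      rw [LocTrivDef.chart_toSpecK]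
      infer_instance
    exact QuasiCompact.of_comp _ (ProjSpace.toSpecK k 9)
  refine ⟨Spec.map (CommRingCat.ofHom φ), isPullback_of_isClosedImmersion _ _ _ _ ?_ ?_⟩
  · rw [X0.chart_ι, h]
  · rw [ker_X0ι, idealX0_eq_ker k p i, h, comap_ker_comp]

instance (i : Fin 5) : IsOpenImmersion (X0.chart k p i) := by
  obtain ⟨f, hf⟩ := X0.exists_isPullback_chart k p i
  exact MorphismProperty.of_isPullback hf inferInstance

theorem X0.range_chart (i : Fin 5) : Set.range (X0.chart k p i) = X0.ι k p ⁻¹'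
    (Proj.basicOpen (MvPolynomial.homogeneousSubmodule (Fin 10) k) (MvPolynomial.X (idx i)) :
      Set (ProjSpace k 9)) := by
  obtain ⟨f, hf⟩ := X0.exists_isPullback_chart k p i
  rw [← Proj.opensRange_awayι _ (MvPolynomial.X (idx i)) (X_mem_homogeneousSubmodule k (idx i)) one_pos]
  exact range_eq_preimage_of_isPullback hf.flip

/-- A form that vanishes on the zeroth chart has empty nonvanishing locus there, and the surface is
the closure of that chart. -/
theorem X0.mem_ideal (x : X0 k p) {f : MvPolynomial (Fin 10) k} {m : ℕ} (hm : 0 < m)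
    (hf : f.IsHomogeneous m) (h : MvPolynomial.aeval (coordMono k p 0) f = 0) :
    X0.ι k p x ∉ Proj.basicOpen (MvPolynomial.homogeneousSubmodule (Fin 10) k) f := by
  intro hx
  have h1 : X0.ι k p x ∈ closure (Set.range (LocTrivDef.chart k p 0)) := by
    have : X0.ι k p x ∈ Set.range (idealX0 k p).subschemeι := ⟨x, rfl⟩
    rw [Scheme.IdealSheafData.range_subschemeι, idealX0,
      Scheme.IdealSheafData.coe_support_vanishingIdeal] at this
    rwa [← range_embU0]
  obtain ⟨_, h2, ⟨y, rfl⟩⟩ := mem_closure_iff.mp h1 _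
    (Proj.basicOpen (MvPolynomial.homogeneousSubmodule (Fin 10) k) f).isOpen hx
  have h3 : y ∈ LocTrivDef.chart k p 0 ⁻¹ᵁ
    Proj.basicOpen (MvPolynomial.homogeneousSubmodule (Fin 10) k) f := h2
  rw [LocTrivDef.chart, projPoint_preimage _ _ _ hm hf] at h3
  apply h3
  have h4 : MvPolynomial.aeval (fun j => (⟨coordMono k p 0 j, coordMono_mem k p 0 j⟩ :
      chartRing k p 0)) f = 0 := by
    apply Subtype.val_injective
    refine Eq.trans ?_ h
    change (chartRing k p 0).val _ = _
    rw [← AlgHom.comp_apply, MvPolynomial.comp_aeval]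
    rfl
  rw [h4]
  exact zero_mem _

/-- Each of `T_5` to `T_9` has a power which on the surface equals a monomial divisible by one of
`T_1`, `T_2`, `T_3`. If `T_0` to `T_4` all vanished at a point, every coordinate would vanish there.
-/
theorem X0.exists_mem_basicOpen [Fact p.Prime] (x : X0 k p) :
    ∃ i : Fin 5, X0.ι k p x ∈
      Proj.basicOpen (MvPolynomial.homogeneousSubmodule (Fin 10) k) (MvPolynomial.X (idx i)) := by
  by_contra! hcon
  set I := (X0.ι k p x).asHomogeneousIdeal.toIdeal with hI
  have hprime : I.IsPrime := (X0.ι k p x).isPrime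
  have hmem : ∀ f : MvPolynomial (Fin 10) k,
      X0.ι k p x ∉ Proj.basicOpen (MvPolynomial.homogeneousSubmodule (Fin 10) k) f ↔ f ∈ I :=
    fun f => not_not
  simp only [hmem] at hcon
  have key : ∀ (l : Fin 10) (N : ℕ) (m : MvPolynomial (Fin 10) k), 0 < N → m.IsHomogeneous N →
      MvPolynomial.aeval (coordMono k p 0) m = coordMono k p 0 l ^ N → m ∈ I →
      MvPolynomial.X l ∈ I := by
    intro l N m hN hm h hmI
    have h1 : MvPolynomial.X l ^ N - m ∈ I := by
      rw [← hmem]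
      refine X0.mem_ideal k p x hN (MvPolynomial.IsHomogeneous.sub ?_ hm) ?_
      · simpa using (MvPolynomial.isHomogeneous_X k l).pow N
      · rw [map_sub, map_pow, MvPolynomial.aeval_X, h, sub_self]
    have h2 := I.add_mem h1 hmI
    rw [sub_add_cancel] at h2
    exact hprime.mem_of_pow_mem _ h2
  have hX := fun l : Fin 10 => MvPolynomial.isHomogeneous_X k l
  have hp2 : 2 ≤ p := (Fact.out : p.Prime).two_le
  -- The relation for `T_5` homogenizes y^p = xz by `T_0` to the power p - 2; writing p = q + 2
  -- keeps that exponent free of truncated subtraction.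
  obtain ⟨q, rfl⟩ : ∃ q, p = q + 2 := ⟨p - 2, by omega⟩
  have hall : ∀ l : Fin 10, MvPolynomial.X l ∈ I := by
    intro l
    fin_cases l
    · exact hcon 0
    · exact hcon 1
    · exact hcon 2
    · exact hcon 3
    · exact hcon 4
    · refine key 5 (q + 2) (MvPolynomial.X 1 * (MvPolynomial.X 4 * MvPolynomial.X 0 ^ q))
        (by omega) ?_ ?_ (I.mul_mem_right _ (hcon 1))
      · have := (hX 1).mul ((hX 4).mul ((hX 0).pow q))
        convert this using 1
        ring
      · simp [coordMono, mono_mul, mono_pow, expo, idx]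
    · refine key 6 (q + 3) (MvPolynomial.X 2 * MvPolynomial.X 1 ^ (q + 2))
        (by omega) ?_ ?_ (I.mul_mem_right _ (hcon 2))
      · have := (hX 2).mul ((hX 1).pow (q + 2))
        convert this using 1
        ring
      · simp [coordMono, mono_mul, mono_pow, expo, idx]
        congr 2
        ring
    · refine key 7 (q + 3) (MvPolynomial.X 1 * MvPolynomial.X 2 ^ (q + 2))
        (by omega) ?_ ?_ (I.mul_mem_right _ (hcon 1))
      · have := (hX 1).mul ((hX 2).pow (q + 2))
        convert this using 1
        ring
      · simp [coordMono, mono_mul, mono_pow, expo, idx]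
        congr 2 <;> ring
    -- With N = p² + p + 2, N times the exponent of `T_8` is the exponent of `T_3` plus N - 1 times
    -- that of `T_2`. Exchanging the roles of `T_2` and `T_3` gives the relation for `T_9`.
    · refine key 8 ((q + 2) ^ 2 + (q + 2) + 2)
        (MvPolynomial.X 3 * MvPolynomial.X 2 ^ ((q + 2) ^ 2 + (q + 2) + 1))
        (by omega) ?_ ?_ (I.mul_mem_right _ (hcon 3))
      · have := (hX 3).mul ((hX 2).pow ((q + 2) ^ 2 + (q + 2) + 1))
        convert this using 1
        ring
      · simp [coordMono, mono_mul, mono_pow, expo, idx]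
        congr 2 <;> ring
    · refine key 9 ((q + 2) ^ 2 + (q + 2) + 2)
        (MvPolynomial.X 2 * MvPolynomial.X 3 ^ ((q + 2) ^ 2 + (q + 2) + 1))
        (by omega) ?_ ?_ (I.mul_mem_right _ (hcon 2))
      · have := (hX 2).mul ((hX 3).pow ((q + 2) ^ 2 + (q + 2) + 1))
        convert this using 1
        ring
      · simp [coordMono, mono_mul, mono_pow, expo, idx]
        congr 2 <;> ring
  have hcov := Proj.iSup_basicOpen_eq_top' (MvPolynomial.homogeneousSubmodule (Fin 10) k)
    (fun l : Fin 10 => MvPolynomial.X l) (fun l => ⟨1, X_mem_homogeneousSubmodule k l⟩) (by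
      rw [eq_top_iff]
      intro f _
      have hf : f ∈ Algebra.adjoin k (Set.range (MvPolynomial.X : Fin 10 → MvPolynomial (Fin 10) k)) := by
        rw [MvPolynomial.adjoin_range_X]
        trivial
      induction hf using Algebra.adjoin_induction with
      | mem a ha => exact Algebra.subset_adjoin ha
      | algebraMap c =>
        exact Subalgebra.algebraMap_mem _ (algebraMap k
          (MvPolynomial.homogeneousSubmodule (Fin 10) k 0) c)
      | add a b _ _ ha hb => exact Subalgebra.add_mem _ (ha trivial) (hb trivial)
      | mul a b _ _ ha hb => exact Subalgebra.mul_mem _ (ha trivial) (hb trivial))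
  have hx : X0.ι k (q + 2) x ∈ (⨆ l : Fin 10, Proj.basicOpen
      (MvPolynomial.homogeneousSubmodule (Fin 10) k) (MvPolynomial.X l)) := by
    rw [hcov]
    trivial
  obtain ⟨l, hl⟩ := Opens.mem_iSup.mp hx
  exact (hmem _).mpr (hall l) hl

theorem X0.isCharts [Fact p.Prime] : IsCharts k p (X0.chart k p) where
  comp_ι := X0.chart_ι k p
  isOpenImmersion := inferInstance
  range_eq := X0.range_chart k p
  covers x := by
    obtain ⟨i, hi⟩ := X0.exists_mem_basicOpen k p x
    refine ⟨i, ?_⟩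
    rw [X0.range_chart]
    exact hi

/-- Within the i-th chart, the j-th chart is the locus where `T_j / T_i` does not vanish, and this
is the spectrum of `R_ij`. -/
theorem X0.isPullback_chart (i j : Fin 5) : IsPullback
    (specIncl (le_sup_left : chartRing k p i ≤ chartRing k p i ⊔ chartRing k p j))
    (specIncl (le_sup_right : chartRing k p j ≤ chartRing k p i ⊔ chartRing k p j))
    (X0.chart k p i) (X0.chart k p j) := by
  have hw : specIncl (le_sup_left : chartRing k p i ≤ chartRing k p i ⊔ chartRing k p j) ≫
      X0.chart k p i = specIncl (le_sup_right : chartRing k p j ≤ _) ≫ X0.chart k p j := by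
    rw [← cancel_mono (X0.ι k p), Category.assoc, Category.assoc, X0.chart_ι, X0.chart_ι,
      specIncl_chart]
  obtain ⟨hle, f, hf, g, hg, hfg, hs⟩ := isLocStep_chartRing k p i j
  obtain ⟨h1, -⟩ := specIncl_isLocStep hle hf hg hfg hs
  refine isPullback_of_isOpenImmersion hw ?_
  rintro _ ⟨⟨x, rfl⟩, hx⟩
  rw [X0.range_chart] at hx
  have h2 : x ∈ LocTrivDef.chart k p i ⁻¹ᵁ Proj.basicOpen
      (MvPolynomial.homogeneousSubmodule (Fin 10) k) (MvPolynomial.X (idx j)) := by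
    rw [← X0.chart_ι]
    exact hx
  rw [LocTrivDef.chart, projPoint_preimage _ _ _ one_pos (MvPolynomial.isHomogeneous_X _ _),
    MvPolynomial.aeval_X] at h2
  have h3 : x ∈ Set.range (specIncl (le_sup_left : chartRing k p i ≤
      chartRing k p i ⊔ chartRing k p j)) := by
    rw [(specIncl_isLocStep le_sup_left (coordMono_mem k p i (idx j))
      ((le_sup_right : chartRing k p j ≤ _) (coordMono_mem k p j (idx i))) (by
        rw [coordMono_mul_coordMono, coordMono_self]) (coordMono_pow_mul_mem k p i j)).2]
    exact h2
  obtain ⟨y, rfl⟩ := h3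
  exact ⟨y, rfl⟩

end X0Charts

attribute [local instance] MvPolynomial.gradedAlgebra

/-! ### Local rings of a scheme in a chart -/

/-- The local ring of a scheme in an affine chart. -/
def stalkEquiv {X : Scheme.{u}} {R : Type u} [CommRing R] (f : Spec (.of R) ⟶ X) [IsOpenImmersion f]
    (x : PrimeSpectrum R) : X.presheaf.stalk (f x) ≃+* Localization.AtPrime x.asIdeal :=
  letI y : Spec (.of R) := x
  (asIso (f.stalkMap y) ≪≫ Spec.stalkIso (.of R) y).commRingCatIsoToRingEquiv

theorem isDomain_stalk {X : Scheme.{u}} {R : Type u} [CommRing R] [IsDomain R]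
    (f : Spec (.of R) ⟶ X) [IsOpenImmersion f] (x : PrimeSpectrum R) :
    IsDomain (X.presheaf.stalk (f x)) := by
  have h1 : IsDomain (Localization.AtPrime x.asIdeal) :=
    IsLocalization.isDomain_localization x.asIdeal.primeCompl_le_nonZeroDivisors
  exact (stalkEquiv f x).toMulEquiv.isDomain

theorem isIntegrallyClosed_stalk {X : Scheme.{u}} {R : Type u} [CommRing R] [IsDomain R]
    [IsIntegrallyClosed R] (f : Spec (.of R) ⟶ X) [IsOpenImmersion f] (x : PrimeSpectrum R) :
    IsIntegrallyClosed (X.presheaf.stalk (f x)) := by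
  have h1 : IsDomain (Localization.AtPrime x.asIdeal) :=
    IsLocalization.isDomain_localization x.asIdeal.primeCompl_le_nonZeroDivisors
  have h2 : IsIntegrallyClosed (Localization.AtPrime x.asIdeal) :=
    isIntegrallyClosed_of_isLocalization _ _ x.asIdeal.primeCompl_le_nonZeroDivisors
  exact IsIntegrallyClosed.of_equiv (stalkEquiv f x).symm

theorem isRegularLocalRing_stalk {X : Scheme.{u}} {R : Type u} [CommRing R] [IsRegularRing R]
    (f : Spec (.of R) ⟶ X) [IsOpenImmersion f] (x : PrimeSpectrum R) :
    IsRegularLocalRing (X.presheaf.stalk (f x)) :=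
  IsRegularLocalRing.of_ringEquiv (stalkEquiv f x).symm

theorem isNoetherianRing_stalk {X : Scheme.{u}} {R : Type u} [CommRing R] [IsNoetherianRing R]
    (f : Spec (.of R) ⟶ X) [IsOpenImmersion f] (x : PrimeSpectrum R) :
    IsNoetherianRing (X.presheaf.stalk (f x)) :=
  isNoetherianRing_of_ringEquiv _ (stalkEquiv f x).symm

theorem ringKrullDim_stalk_eq_height {X : Scheme.{u}} {R : Type u} [CommRing R]
    (f : Spec (.of R) ⟶ X) [IsOpenImmersion f] (x : PrimeSpectrum R) :
    ringKrullDim (X.presheaf.stalk (f x)) = x.asIdeal.height :=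
  (ringKrullDim_eq_of_ringEquiv (stalkEquiv f x)).trans
    (IsLocalization.AtPrime.ringKrullDim_eq_height x.asIdeal _)

theorem topologicalKrullDim_eq_iSup_stalk (X : Scheme.{u}) [Nonempty X] :
    topologicalKrullDim X = ⨆ x : X, ringKrullDim (X.presheaf.stalk x) := by
  rw [topologicalKrullDim, Order.krullDim_eq_of_orderIso (irreducibleSetEquivPoints (α := X)),
    Order.krullDim_eq_iSup_coheight]
  exact iSup_congr fun x => (ringKrullDim_stalk_eq_coheight x).symm

/-! ### The chart rings -/

theorem isIso_specAlg (k : Type u) [Field k] {S T : Type u} [CommRing S] [CommRing T] [Algebra k S] [Algebra k T]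
    (e : S ≃ₐ[k] T) : IsIso (specAlg k e.toAlgHom) := by
  have : IsIso (CommRingCat.ofHom e.toAlgHom.toRingHom) :=
    (ConcreteCategory.isIso_iff_bijective _).mpr e.bijective
  infer_instance

section ChartRings

variable (k : Type u) [Field k] (p : ℕ)

theorem isRegularRing_chartRing {i : Fin 5} (hi : i ≠ 0) : IsRegularRing (chartRing k p i) := by
  obtain ⟨e⟩ := exists_chartRing_equiv k p hi
  exact IsRegularRing.of_ringEquiv e.toRingEquiv

theorem isIntegrallyClosed_chartRing_of_ne {i : Fin 5} (hi : i ≠ 0) :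
    IsIntegrallyClosed (chartRing k p i) := by
  obtain ⟨e⟩ := exists_chartRing_equiv k p hi
  exact IsIntegrallyClosed.of_equiv e.toRingEquiv

theorem height_le_of_chartRing {i : Fin 5} (hi : i ≠ 0) (q : Ideal (chartRing k p i)) [q.IsPrime] :
    (q.height : WithBot ℕ∞) ≤ 2 := by
  obtain ⟨e⟩ := exists_chartRing_equiv k p hi
  refine Ideal.height_le_ringKrullDim_of_isPrime.trans ?_
  rw [← ringKrullDim_eq_of_ringEquiv e.toRingEquiv, MvPolynomial.ringKrullDim_of_isNoetherianRing,
    ringKrullDim_eq_zero_of_field]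
  simp

/-- All rings with the torus as a localization share the fraction field of the Laurent ring, so
integrality over several of them can be compared in one field. -/
theorem isFractionRing_of_isLocStep_top {A T : Type u} [CommRing A] [CommRing T] [IsDomain T]
    [Algebra A T] {B : Subalgebra A T} (h : IsLocStep B ⊤) : IsFractionRing B (FractionRing T) := by
  obtain ⟨-, f, hf, g, -, hfg, hs⟩ := h
  have : FaithfulSMul B (FractionRing T) :=
    (faithfulSMul_iff_algebraMap_injective _ _).mpr
      ((IsFractionRing.injective T (FractionRing T)).comp Subtype.val_injective)
  refine IsFractionRing.of_field B _ fun z => ?_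
  obtain ⟨a, b, hb, rfl⟩ := IsFractionRing.div_surjective (A := T) z
  obtain ⟨m, hm⟩ := hs a trivial
  obtain ⟨n, hn⟩ := hs b trivial
  have hf0 : f ≠ 0 := by
    rintro rfl
    simp at hfg
  have hfK : algebraMap T (FractionRing T) f ≠ 0 := by
    rwa [Ne, FaithfulSMul.algebraMap_eq_zero_iff]
  have hbK : algebraMap T (FractionRing T) b ≠ 0 := by
    rw [Ne, FaithfulSMul.algebraMap_eq_zero_iff]
    exact nonZeroDivisors.ne_zero hb
  refine ⟨⟨f ^ n, B.pow_mem hf n⟩ * ⟨f ^ m * a, hm⟩, ⟨f ^ m, B.pow_mem hf m⟩ * ⟨f ^ n * b, hn⟩, ?_⟩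
  change _ = algebraMap T (FractionRing T) (f ^ n * (f ^ m * a)) /
    algebraMap T (FractionRing T) (f ^ m * (f ^ n * b))
  simp only [map_mul, map_pow]
  field_simp

theorem mem_of_isIntegral {A T : Type u} [CommRing A] [CommRing T] [IsDomain T]
    [Algebra A T] {B : Subalgebra A T} (h : IsLocStep B ⊤) [IsIntegrallyClosed B]
    {C : Subalgebra A T} (hC : C ≤ B) (z : FractionRing T) (hz : IsIntegral C z) :
    ∃ b ∈ B, algebraMap T (FractionRing T) b = z := by
  have := isFractionRing_of_isLocStep_top h
  let _ := (Subalgebra.inclusion hC).toRingHom.toAlgebra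
  have : IsScalarTower C B (FractionRing T) := IsScalarTower.of_algebraMap_eq fun _ => rfl
  obtain ⟨b, hb⟩ := IsIntegrallyClosed.isIntegral_iff.mp (hz.tower_top (A := B))
  exact ⟨b, b.2, hb⟩

theorem isIntegrallyClosed_of_isLocStep {A T : Type u} [CommRing A] [CommRing T] [IsDomain T]
    [Algebra A T] {B C : Subalgebra A T} (h : IsLocStep B C) [IsIntegrallyClosed B] :
    IsIntegrallyClosed C := by
  obtain ⟨hle, f, hf, g, hg, hfg, hs⟩ := h
  let _ := (Subalgebra.inclusion hle).toRingHom.toAlgebra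
  have := isLocalization_of_isLocStep hle hf hg hfg hs
  have hf0 : (⟨f, hf⟩ : B) ≠ 0 := by
    intro h
    have : f = 0 := congrArg Subtype.val h
    simp [this] at hfg
  exact isIntegrallyClosed_of_isLocalization (R := B) C (Submonoid.powers ⟨f, hf⟩)
    (powers_le_nonZeroDivisors_of_noZeroDivisors hf0)

theorem chartRing_sup_eq_top {i j : Fin 5} (h : cone p i ⊔ cone p j = ⊤) :
    chartRing k p i ⊔ chartRing k p j = ⊤ := by
  rw [chartRing_eq, chartRing_eq, monoAlg_sup, h, monoAlg_top]

/-- The zeroth cone is the intersection of the half planes belonging to the overlaps with charts 1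
and 4. Hence `R_0` is the intersection of `R_01` and `R_04`, which are localizations of polynomial
rings and so integrally closed. -/
instance [NeZero p] : IsIntegrallyClosed (chartRing k p 0) := by
  have h02 : chartRing k p 0 ⊔ chartRing k p 2 = ⊤ := chartRing_sup_eq_top k p (cone_sup_zero_two p)
  have h14 : chartRing k p 1 ⊔ chartRing k p 4 = ⊤ := chartRing_sup_eq_top k p (cone_sup_one_four p)
  have h0 : IsLocStep (chartRing k p 0) ⊤ := h02 ▸ isLocStep_chartRing k p 0 2
  have h1 : IsLocStep (chartRing k p 1 ⊔ chartRing k p 0) ⊤ := by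
    have := (isLocStep_chartRing k p 1 4).sup_right (chartRing k p 0)
    rwa [h14, top_sup_eq] at this
  have h4 : IsLocStep (chartRing k p 4 ⊔ chartRing k p 0) ⊤ := by
    have := (isLocStep_chartRing k p 4 1).sup_right (chartRing k p 0)
    rwa [sup_comm (chartRing k p 4) (chartRing k p 1), h14, top_sup_eq] at this
  have := isFractionRing_of_isLocStep_top h0
  have := isIntegrallyClosed_chartRing_of_ne k p (i := 1) (by decide)
  have := isIntegrallyClosed_chartRing_of_ne k p (i := 4) (by decide)
  have := isIntegrallyClosed_of_isLocStep (isLocStep_chartRing k p 1 0)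
  have := isIntegrallyClosed_of_isLocStep (isLocStep_chartRing k p 4 0)
  rw [isIntegrallyClosed_iff (FractionRing (Laurent k))]
  intro z hz
  obtain ⟨b, hb, rfl⟩ := mem_of_isIntegral h1 le_sup_right z hz
  obtain ⟨b', hb', h⟩ := mem_of_isIntegral h4 le_sup_right _ hz
  obtain rfl : b' = b := IsFractionRing.injective _ _ h
  refine ⟨⟨b', ?_⟩, rfl⟩
  rw [sup_comm, chartRing_eq, chartRing_eq, monoAlg_sup] at hb hb'
  rw [cone_sup_zero_one] at hb
  rw [cone_sup_zero_four] at hb'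
  rw [chartRing_eq]
  exact fun m hm => ⟨(hb m hm).1, (hb' m hm).1⟩

theorem isIntegrallyClosed_chartRing [NeZero p] (i : Fin 5) :
    IsIntegrallyClosed (chartRing k p i) := by
  by_cases hi : i = 0
  · subst hi
    infer_instance
  · exact isIntegrallyClosed_chartRing_of_ne k p hi

end ChartRings

/-! ### The singular point -/

section Origin

variable (k : Type u) [Field k] (p : ℕ)

/-- The homomorphism out of `R₀` given by values of `x`, `y`, `z`. -/
def R0.lift {B : Type u} [CommRing B] [Algebra k B] (v : Fin 3 → B) (hv : v 0 * v 2 = v 1 ^ p) :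
    R0 k p →ₐ[k] B :=
  Ideal.Quotient.liftₐ _ (MvPolynomial.aeval v) (by
    intro a ha
    have h : Ideal.span {(MvPolynomial.X 0 * MvPolynomial.X 2 - MvPolynomial.X 1 ^ p :
        MvPolynomial (Fin 3) k)} ≤ RingHom.ker (MvPolynomial.aeval (R := k) v) := by
      rw [Ideal.span_singleton_le_iff_mem, RingHom.mem_ker]
      simp [hv]
    exact h ha)

variable {k p} in
theorem R0.lift_var {B : Type u} [CommRing B] [Algebra k B] (v : Fin 3 → B)
    (hv : v 0 * v 2 = v 1 ^ p) (i : Fin 3) : R0.lift k p v hv (R0.var k p i) = v i :=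
  MvPolynomial.aeval_X _ _

variable {k p} in
theorem R0.algHom_ext {B : Type u} [CommRing B] [Algebra k B] {f g : R0 k p →ₐ[k] B}
    (h : ∀ i, f (R0.var k p i) = g (R0.var k p i)) : f = g := by
  apply Ideal.Quotient.algHom_ext
  exact MvPolynomial.algHom_ext h

variable [NeZero p]

/-- The origin of `Spec R₀` as a `k`-rational point. -/
def R0.originHom : R0 k p →ₐ[k] k := R0.lift k p 0 (by simp [NeZero.ne p])

/-- The maximal ideal of the origin of `Spec R₀`. -/
def R0.originIdeal : Ideal (R0 k p) := RingHom.ker (R0.originHom k p)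

instance : (R0.originIdeal k p).IsMaximal :=
  RingHom.ker_isMaximal_of_surjective _ fun c => ⟨algebraMap k _ c, (R0.originHom k p).commutes c⟩

theorem R0.var_mem_originIdeal (i : Fin 3) : R0.var k p i ∈ R0.originIdeal k p := by
  rw [R0.originIdeal, RingHom.mem_ker]
  exact R0.lift_var _ _ i

theorem R0.originIdeal_eq_span : R0.originIdeal k p = Ideal.span (Set.range (R0.var k p)) := by
  refine le_antisymm (fun r hr => ?_) (Ideal.span_le.mpr ?_)
  · have h : (Ideal.Quotient.mkₐ k (Ideal.span (Set.range (R0.var k p))) : R0 k p →ₐ[k] _) =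
        (Algebra.ofId k (R0 k p ⧸ Ideal.span (Set.range (R0.var k p)))).comp (R0.originHom k p) := by
      refine R0.algHom_ext (B := R0 k p ⧸ Ideal.span (Set.range (R0.var k p))) fun i => ?_
      have h1 : R0.originHom k p (R0.var k p i) = 0 := R0.var_mem_originIdeal k p i
      rw [AlgHom.comp_apply, h1, map_zero]
      exact Ideal.Quotient.eq_zero_iff_mem.mpr (Ideal.subset_span ⟨i, rfl⟩)
    have h2 := DFunLike.congr_fun h r
    have h3 : R0.originHom k p r = 0 := hr
    rw [AlgHom.comp_apply, h3, map_zero] at h2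
    exact Ideal.Quotient.eq_zero_iff_mem.mp h2
  · rintro _ ⟨i, rfl⟩
    exact R0.var_mem_originIdeal k p i

theorem R0.originIdeal_le {q : Ideal (R0 k p)} [q.IsPrime] (h0 : R0.var k p 0 ∈ q)
    (h2 : R0.var k p 2 ∈ q) : R0.originIdeal k p ≤ q := by
  rw [R0.originIdeal_eq_span, Ideal.span_le]
  rintro _ ⟨i, rfl⟩
  fin_cases i
  · exact h0
  · have : R0.var k p 1 ^ p ∈ q := by
      rw [← R0.var_mul]
      exact q.mul_mem_right _ h0
    exact Ideal.IsPrime.mem_of_pow_mem inferInstance _ this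
  · exact h2

theorem R0.var_ne_zero (i : Fin 3) : R0.var k p i ≠ 0 := by
  intro h
  have := congrArg (R0.toLaurent k p) h
  rw [R0.toLaurent_var, map_zero] at this
  have h2 : ∀ m, mono k m ≠ 0 := fun m h => one_ne_zero (α := k) (by
    have := coeff_mono (k := k) m m
    rw [h] at this
    simpa using this.symm)
  fin_cases i <;> exact h2 _ this

/-- The upper bound is Krull's height theorem: the ideal is minimal over the one generated by x and
z, since y^p = xz. For the lower bound, the kernel of x, y ↦ 0, z ↦ T into k[T] lies strictly
between 0 and the origin ideal. -/
theorem R0.height_originIdeal : (R0.originIdeal k p).height = 2 := by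
  apply le_antisymm
  · have hmin : R0.originIdeal k p ∈ (Ideal.span {R0.var k p 0, R0.var k p 2}).minimalPrimes := by
      refine ⟨⟨inferInstance, Ideal.span_le.mpr ?_⟩, fun q hq _ => ?_⟩
      · rintro _ (rfl | rfl) <;> exact R0.var_mem_originIdeal k p _
      · have := hq.1
        exact R0.originIdeal_le k p (hq.2 (Ideal.subset_span (by simp)))
          (hq.2 (Ideal.subset_span (by simp)))
    refine (Ideal.height_le_card_of_mem_minimalPrimes_span (Set.toFinite _) hmin).trans ?_
    have h : ({R0.var k p 0, R0.var k p 2} : Set (R0 k p)).ncard ≤ 1 + 1 :=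
      (Set.ncard_insert_le _ _).trans (by rw [Set.ncard_singleton])
    exact_mod_cast h
  · let g : R0 k p →ₐ[k] Polynomial k := R0.lift k p ![0, 0, Polynomial.X] (by simp [NeZero.ne p])
    have hq : (RingHom.ker g).IsPrime := RingHom.ker_isPrime g
    have hg : ∀ i, g (R0.var k p i) = ![0, 0, Polynomial.X] i := fun i => R0.lift_var _ _ i
    have h1 : (⊥ : Ideal (R0 k p)) < RingHom.ker g := by
      refine bot_lt_iff_ne_bot.mpr fun h => R0.var_ne_zero k p 0 ?_
      have : R0.var k p 0 ∈ RingHom.ker g := hg 0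
      rwa [h] at this
    have h2 : RingHom.ker g < R0.originIdeal k p := by
      refine lt_of_le_of_ne (fun r hr => ?_) fun h => ?_
      · have h3 : (Polynomial.aeval (0 : k)).comp g = R0.originHom k p := by
          refine R0.algHom_ext fun i => ?_
          rw [AlgHom.comp_apply, hg, R0.originHom, R0.lift_var]
          fin_cases i <;> simp
        rw [R0.originIdeal, RingHom.mem_ker, ← h3, AlgHom.comp_apply]
        rw [RingHom.mem_ker] at hr
        rw [hr, map_zero]
      · have h3 := R0.var_mem_originIdeal k p 2
        rw [← h, RingHom.mem_ker, hg] at h3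
        exact Polynomial.X_ne_zero h3
    have h3 := Ideal.height_add_one_le_of_lt_of_isPrime h1
    have h4 := Ideal.height_add_one_le_of_lt_of_isPrime h2
    rw [Ideal.height_bot, zero_add] at h3
    calc (2 : ℕ∞) = 1 + 1 := by norm_num
      _ ≤ (RingHom.ker g).height + 1 := by gcongr
      _ ≤ _ := h4

/-- The chart `Spec R₀ → X₀`. -/
def X0.chartR0 : Spec (.of (R0 k p)) ⟶ X0 k p :=
  specAlg k (R0.equivChartRing k p).symm.toAlgHom ≫ X0.chart k p 0

instance : IsOpenImmersion (X0.chartR0 k p) := by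
  have := isIso_specAlg k (R0.equivChartRing k p).symm
  unfold X0.chartR0
  infer_instance

theorem X0.range_chartR0 : Set.range (X0.chartR0 k p) = Set.range (X0.chart k p 0) := by
  have := isIso_specAlg k (R0.equivChartRing k p).symm
  exact (specAlg k (R0.equivChartRing k p).symm.toAlgHom).surjective.range_comp
    (X0.chart k p 0)

theorem X0.chartR0_ι : X0.chartR0 k p ≫ X0.ι k p = embU0 k p := by
  rw [X0.chartR0, Category.assoc, X0.chart_ι]
  refine (specAlg_projPoint _ _ _ _).trans ?_
  rw [embU0]
  congr 1
  funext j
  apply (R0.equivChartRing k p).injective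
  refine (AlgEquiv.apply_symm_apply _ _).trans ?_
  exact Subtype.ext (R0.toLaurent_coords k p j).symm

theorem X0.chartR0_mem_range_iff (q : PrimeSpectrum (R0 k p)) (i : Fin 5) :
    X0.chartR0 k p q ∈ Set.range (X0.chart k p i) ↔ coords k p (idx i) ∉ q.asIdeal := by
  rw [X0.range_chart]
  have h2 : embU0 k p ⁻¹ᵁ Proj.basicOpen
      (MvPolynomial.homogeneousSubmodule (Fin 10) k) (MvPolynomial.X (idx i)) =
        PrimeSpectrum.basicOpen (coords k p (idx i)) := by
    refine (projPoint_preimage (coords k p) 0 rfl one_pos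
      (MvPolynomial.isHomogeneous_X _ _)).trans ?_
    rw [MvPolynomial.aeval_X]
  rw [← X0.chartR0_ι] at h2
  exact iff_of_eq (congrArg (fun U : (Spec (.of (R0 k p))).Opens => q ∈ U) h2)

/-- The singular point of `X₀`. -/
def X0.sing : X0 k p := X0.chartR0 k p ⟨R0.originIdeal k p, inferInstance⟩

theorem X0.sing_notMem_range {i : Fin 5} (hi : i ≠ 0) :
    X0.sing k p ∉ Set.range (X0.chart k p i) := by
  rw [X0.sing, X0.chartR0_mem_range_iff, not_not]
  have h := R0.var_mem_originIdeal k p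
  fin_cases i
  · exact absurd rfl hi
  · exact h 0
  · exact Ideal.mul_mem_left _ _ (Ideal.pow_mem_of_mem _ (h 1) _ (Nat.succ_pos _))
  · exact Ideal.mul_mem_left _ _ (h 2)
  · exact h 2

/-- On the zeroth chart a point outside charts 1 and 4 has x = z = 0, hence y = 0: it is the origin.
-/
theorem X0.exists_mem_range_of_ne [Fact p.Prime] {x : X0 k p} (hx : x ≠ X0.sing k p) :
    ∃ i : Fin 5, i ≠ 0 ∧ x ∈ Set.range (X0.chart k p i) := by
  obtain ⟨i, hi⟩ := (X0.isCharts k p).covers x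
  by_cases hi0 : i = 0
  · subst hi0
    rw [← X0.range_chartR0] at hi
    obtain ⟨q, rfl⟩ := hi
    by_contra! hcon
    have h0 := not_not.mp (mt (X0.chartR0_mem_range_iff k p q 1).mpr (hcon 1 (by decide)))
    have h2 := not_not.mp (mt (X0.chartR0_mem_range_iff k p q 4).mpr (hcon 4 (by decide)))
    have h4 : (PrimeSpectrum.asIdeal (R := R0 k p) q).IsPrime := PrimeSpectrum.isPrime _
    have h3 : R0.originIdeal k p = PrimeSpectrum.asIdeal (R := R0 k p) q :=
      Ideal.IsMaximal.eq_of_le inferInstance h4.ne_top (R0.originIdeal_le k p h0 h2)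
    exact hx (congrArg (X0.chartR0 k p) (PrimeSpectrum.ext h3.symm))
  · exact ⟨i, hi0, hi⟩

end Origin

/-! ### Global geometry of `X₀` -/

section Geometry

variable (k : Type u) [Field k] (p : ℕ)

theorem X0.denseRange_chart (i : Fin 5) : DenseRange (X0.chart k p i) := by
  intro x
  have hind := (X0.ι k p).isClosedEmbedding.isInducing
  rw [hind.closure_eq_preimage_closure_image, ← Set.range_comp]
  have h1 : X0.ι k p x ∈ Set.range (idealX0 k p).subschemeι := ⟨x, rfl⟩
  rw [Scheme.IdealSheafData.range_subschemeι, idealX0,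
    Scheme.IdealSheafData.coe_support_vanishingIdeal] at h1
  have h2 : (X0.ι k p ∘ X0.chart k p i) = LocTrivDef.chart k p i := by
    rw [← X0.chart_ι]
    rfl
  rw [h2, closure_range_chart_eq k p i 0, ← range_embU0]
  exact h1

variable [Fact p.Prime]

instance : IsReduced (X0 k p) := by
  have : ∀ x : X0 k p, _root_.IsReduced ((X0 k p).presheaf.stalk x) := by
    intro x
    obtain ⟨i, y, rfl⟩ := (X0.isCharts k p).covers x
    have := isDomain_stalk (X0.chart k p i) y
    infer_instance
  exact isReduced_of_isReduced_stalk _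

instance : IrreducibleSpace (X0 k p) where
  toNonempty := X0_nonempty k p
  isPreirreducible_univ := by
    have h1 : IsPreirreducible (Set.range (X0.chart k p 0)) := by
      rw [← Set.image_univ]
      exact (PreirreducibleSpace.isPreirreducible_univ).image _ (X0.chart k p 0).continuous.continuousOn
    have h2 := h1.closure
    rwa [(X0.denseRange_chart k p 0).closure_range] at h2

instance X0.isIntegral : IsIntegral (X0 k p) := isIntegral_of_irreducibleSpace_of_isReduced _

theorem X0.isNormalScheme : IsNormalScheme (X0 k p) := by
  intro x
  obtain ⟨i, y, rfl⟩ := (X0.isCharts k p).covers x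
  have := isIntegrallyClosed_chartRing k p i
  exact ⟨isDomain_stalk _ y, isIntegrallyClosed_stalk _ y⟩

theorem X0.isRegularLocalRing_stalk {x : X0 k p} (hx : x ≠ X0.sing k p) :
    IsRegularLocalRing ((X0 k p).presheaf.stalk x) := by
  obtain ⟨i, hi, y, rfl⟩ := X0.exists_mem_range_of_ne k p hx
  have := isRegularRing_chartRing k p hi
  exact LocTrivDef.isRegularLocalRing_stalk _ y

theorem X0.ringKrullDim_stalk_sing : ringKrullDim ((X0 k p).presheaf.stalk (X0.sing k p)) = 2 := by
  rw [X0.sing, ringKrullDim_stalk_eq_height, R0.height_originIdeal]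
  rfl

theorem X0.topologicalKrullDim_eq : topologicalKrullDim (X0 k p) = 2 := by
  rw [topologicalKrullDim_eq_iSup_stalk]
  refine le_antisymm (iSup_le fun x => ?_) ?_
  · by_cases hx : x = X0.sing k p
    · rw [hx, X0.ringKrullDim_stalk_sing]
    · obtain ⟨i, hi, y, rfl⟩ := X0.exists_mem_range_of_ne k p hx
      have : (PrimeSpectrum.asIdeal (R := chartRing k p i) y).IsPrime := PrimeSpectrum.isPrime _
      exact (ringKrullDim_stalk_eq_height _ y).trans_le (height_le_of_chartRing k p hi _)
  · rw [← X0.ringKrullDim_stalk_sing k p]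
    exact le_iSup (fun x => ringKrullDim ((X0 k p).presheaf.stalk x)) (X0.sing k p)

/-- The regular locus of `X₀`. -/
def X0.regularLocus : (X0 k p).Opens := ⨆ i : {i : Fin 5 // i ≠ 0}, (X0.chart k p i).opensRange

theorem X0.coe_regularLocus : (X0.regularLocus k p : Set (X0 k p)) = {X0.sing k p}ᶜ := by
  ext x
  rw [X0.regularLocus, SetLike.mem_coe, Opens.mem_iSup]
  constructor
  · rintro ⟨i, hi⟩ rfl
    exact X0.sing_notMem_range k p i.2 hi
  · intro hx
    obtain ⟨i, hi, h⟩ := X0.exists_mem_range_of_ne k p hx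
    exact ⟨⟨i, hi⟩, h⟩

theorem smooth_chart {i : Fin 5} (hi : i ≠ 0) :
    Smooth (X0.chart k p i ≫ X0.toSpecK k p) := by
  obtain ⟨e⟩ := exists_chartRing_equiv k p hi
  rw [X0.chart_toSpecK, HasRingHomProperty.Spec_iff (P := @Smooth)]
  have : Algebra.Smooth k (MvPolynomial (Fin 2) k) := ⟨inferInstance, inferInstance⟩
  have : Algebra.Smooth k (chartRing k p i) := Algebra.Smooth.of_equiv e
  exact RingHom.smooth_algebraMap.mpr this

theorem X0.smooth_regularLocus : Smooth ((X0.regularLocus k p).ι ≫ X0.toSpecK k p) := by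
  let g : ∀ i : {i : Fin 5 // i ≠ 0}, Spec (.of (chartRing k p i)) ⟶ (X0.regularLocus k p).toScheme :=
    fun i => IsOpenImmersion.lift (X0.regularLocus k p).ι (X0.chart k p i) (by
      rw [Scheme.Opens.range_ι]
      exact SetLike.coe_subset_coe.mpr (le_iSup (fun i : {i : Fin 5 // i ≠ 0} =>
        (X0.chart k p i).opensRange) i))
  have hg : ∀ i, g i ≫ (X0.regularLocus k p).ι = X0.chart k p i :=
    fun i => IsOpenImmersion.lift_fac _ _ _
  have ho : ∀ i, IsOpenImmersion (g i) := fun i => by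
    have : IsOpenImmersion (g i ≫ (X0.regularLocus k p).ι) := by rw [hg]; infer_instance
    exact IsOpenImmersion.of_comp _ (X0.regularLocus k p).ι
  have hc : ∀ z, ∃ i, z ∈ Set.range (g i) := by
    intro z
    obtain ⟨i, y, hy⟩ := Opens.mem_iSup.mp z.2
    refine ⟨i, y, ?_⟩
    apply (X0.regularLocus k p).ι.isOpenEmbedding.injective
    rw [← Scheme.Hom.comp_apply, hg]
    exact hy
  have : IsZariskiLocalAtSource (@Smooth.{u}) := HasRingHomProperty.instIsZariskiLocalAtSource
  refine (IsZariskiLocalAtSource.iff_of_openCover (P := @Smooth.{u}) (coverOf g ho hc)).mpr ?_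
  change ∀ i : {i : Fin 5 // i ≠ 0}, Smooth (g i ≫ (X0.regularLocus k p).ι ≫ X0.toSpecK k p)
  intro i
  rw [← Category.assoc, hg]
  exact smooth_chart k p i.2

theorem X0.isProjectiveOver : IsProjectiveOver (X0.toSpecK k p) :=
  ⟨9, X0.ι k p, inferInstance, rfl⟩

/-- Chart 3 is an affine plane and is dense in the surface. -/
theorem X0.birationalOver : Scheme.BirationalOver (X0.toSpecK k p)
    (𝔸(ULift.{u} (Fin 2); Spec (.of k)) ↘ Spec (.of k)) := by
  obtain ⟨e⟩ := exists_chartRing_equiv k p (i := 3) (by decide)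
  let e' := (MvPolynomial.renameEquiv k (Equiv.ulift.{u} (α := Fin 2))).trans e
  have := isIso_specAlg k e'
  let α : (X0.chart k p 3).opensRange.toScheme ≅ 𝔸(ULift.{u} (Fin 2); Spec (.of k)) :=
    (X0.chart k p 3).isoOpensRange.symm ≪≫ asIso (specAlg k e'.toAlgHom) ≪≫
      (AffineSpace.SpecIso (ULift.{u} (Fin 2)) (.of k)).symm
  refine ⟨⟨(X0.chart k p 3).opensRange, X0.denseRange_chart k p 3, ⊤, dense_univ,
    α ≪≫ (Scheme.topIso _).symm⟩, ?_⟩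
  change (α ≪≫ (Scheme.topIso _).symm).hom ≫ (⊤ : Scheme.Opens _).ι ≫ _ = _
  have h1 : (Scheme.topIso 𝔸(ULift.{u} (Fin 2); Spec (.of k))).inv ≫ (⊤ : Scheme.Opens _).ι = 𝟙 _ :=
    (Scheme.topIso _).inv_hom_id
  rw [Iso.trans_hom, Category.assoc, Iso.symm_hom, reassoc_of% h1]
  simp only [α, Iso.trans_hom, Iso.symm_hom, Category.assoc, asIso_hom]
  rw [AffineSpace.SpecIso_inv_over, Iso.inv_comp_eq, ← Category.assoc,
    Scheme.Hom.isoOpensRange_hom_ι, X0.chart_toSpecK, ← Spec.map_comp]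
  congr 1
  refine CommRingCat.hom_ext (RingHom.ext fun c => ?_)
  exact e'.toAlgHom.commutes c

end Geometry

/-! ### The multiplicity of the singular point -/

theorem length_quotient_maximalIdeal_pow_of_ringEquiv {A B : Type*} [CommRing A] [CommRing B]
    [IsLocalRing A] [IsLocalRing B] (e : A ≃+* B) (n : ℕ) :
    Module.length A (A ⧸ IsLocalRing.maximalIdeal A ^ n) =
      Module.length B (B ⧸ IsLocalRing.maximalIdeal B ^ n) := by
  rw [Module.length_quotient, Module.length_quotient,
    ← Order.coheight_orderIso e.symm.idealComapOrderIso]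
  congr 1
  change Ideal.comap e.symm (IsLocalRing.maximalIdeal A ^ n) = _
  rw [Ideal.comap_symm, Ideal.map_pow]
  congr 1
  have := IsLocalRing.eq_maximalIdeal (Ideal.map_isMaximal_of_equiv e (p := IsLocalRing.maximalIdeal A))
  exact this

/-- Restricting scalars to `K` multiplies lengths by the degree of the residue field extension,
which is one here. -/
theorem length_eq_length_of_surjective_residue {K L M : Type*} [Field K] [CommRing L] [IsLocalRing L]
    [Algebra K L] [AddCommGroup M] [Module K M] [Module L M] [IsScalarTower K L M]
    (h : Function.Surjective (algebraMap K (IsLocalRing.ResidueField L))) :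
    Module.length L M = Module.length K M := by
  rw [IsLocalRing.length_restrictScalars K L M]
  have h1 : Function.Surjective (algebraMap (IsLocalRing.ResidueField K)
      (IsLocalRing.ResidueField L)) := fun x => by
    obtain ⟨y, rfl⟩ := h x
    exact ⟨IsLocalRing.residue K y, rfl⟩
  have h2 : Module.length (IsLocalRing.ResidueField K) (IsLocalRing.ResidueField L) = 1 :=
    (Module.length_eq_of_surjective h1).trans (Module.length_eq_one _ _)
  rw [h2, mul_one]

theorem length_localization_quotient_pow {K R : Type*} [Field K] [CommRing R] [Algebra K R]
    (M : Ideal R) [M.IsMaximal] (h : Function.Surjective (algebraMap K (R ⧸ M))) (n : ℕ) :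
    Module.length (Localization.AtPrime M)
      (Localization.AtPrime M ⧸ IsLocalRing.maximalIdeal (Localization.AtPrime M) ^ n) =
      Module.length K (R ⧸ M ^ n) := by
  have h' : Function.Surjective
      (algebraMap K (IsLocalRing.ResidueField (Localization.AtPrime M))) := by
    intro x
    obtain ⟨y, rfl⟩ := (IsLocalization.AtPrime.equivQuotMaximalIdeal M _).surjective x
    obtain ⟨c, rfl⟩ := h y
    exact ⟨c, (IsLocalization.AtPrime.equivQuotMaximalIdeal_apply_mk M _ _).symm⟩
  rw [length_eq_length_of_surjective_residue h']
  exact (((IsLocalization.AtPrime.equivQuotMaximalIdealPow M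
    (Localization.AtPrime M) n).restrictScalars K).toLinearEquiv.length_eq).symm

theorem ideal_pow_succ {R : Type*} [CommRing R] (I : Ideal R) (n : ℕ) : I ^ (n + 1) = I ^ n * I :=
  pow_succ I n

theorem pow_mul_pow_mem_pow {R : Type*} [CommRing R] {I : Ideal R} {r s : R} (hr : r ∈ I)
    (hs : s ∈ I) {a b n : ℕ} (h : n ≤ a + b) : r ^ a * s ^ b ∈ I ^ n := by
  refine Ideal.pow_le_pow_right h ?_
  rw [pow_add]
  exact Ideal.mul_mem_mul (Ideal.pow_mem_pow hr _) (Ideal.pow_mem_pow hs _)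

section Multiplicity

variable (k : Type u) [Field k] (p : ℕ)

/-- The functions on `Spec R₀` vanishing to order at least `n` at the origin. -/
def R0.orderIdeal (hp : 2 ≤ p) (n : ℕ) : Ideal (R0 k p) where
  -- A monomial with a ≥ 0 is x^a y^b of order a + b. One with a < 0 is z^(-a) y^(pa+b) of order (p
  -- - 1)a + b. As p ≥ 2, the order is the smaller of the two numbers in either case.
  carrier := {r | ∀ m, (R0.toLaurent k p r).coeff m ≠ 0 →
    (n : ℤ) ≤ m.1 + m.2 ∧ (n : ℤ) ≤ (p - 1) * m.1 + m.2}
  zero_mem' m hm := by simp at hm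
  add_mem' {r s} hr hs m hm := by
    by_cases h : (R0.toLaurent k p r).coeff m = 0
    · refine hs m fun h' => hm ?_
      simp [h, h']
    · exact hr m h
  smul_mem' := by
    classical
    intro r s hs m hm
    rw [smul_eq_mul, map_mul] at hm
    have := AddMonoidAlgebra.support_coeff_mul_subset _ _ (Finsupp.mem_support_iff.mpr hm)
    obtain ⟨a, ha, b, hb, rfl⟩ := Finset.mem_add.mp this
    have h1 := hs b (Finsupp.mem_support_iff.mp hb)
    have h2 : R0.toLaurent k p r ∈ monoAlg k (cone p 0) := by
      rw [← chartRing_eq, ← R0.range_toLaurent]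
      exact ⟨r, rfl⟩
    obtain ⟨h3, h4⟩ := mem_dualCone.mp (h2 a (Finsupp.mem_support_iff.mp ha))
    simp only [Prod.fst_add, Prod.snd_add, zero_mul, one_mul, zero_add] at h3 h4 ⊢
    have hp' : (2 : ℤ) ≤ p := by exact_mod_cast hp
    have h5 : 0 ≤ a.1 + a.2 := by
      by_contra h
      nlinarith
    have h6 : 0 ≤ (p - 1) * a.1 + a.2 := by
      by_contra h
      nlinarith
    constructor <;> linarith

variable (hp : 2 ≤ p)

theorem R0.orderIdeal_mul_le (m n : ℕ) :
    R0.orderIdeal k p hp m * R0.orderIdeal k p hp n ≤ R0.orderIdeal k p hp (m + n) := by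
  classical
  rw [Ideal.mul_le]
  intro r hr s hs l hl
  rw [map_mul] at hl
  have := AddMonoidAlgebra.support_coeff_mul_subset _ _ (Finsupp.mem_support_iff.mpr hl)
  obtain ⟨a, ha, b, hb, rfl⟩ := Finset.mem_add.mp this
  obtain ⟨h1, h2⟩ := hr a (Finsupp.mem_support_iff.mp ha)
  obtain ⟨h3, h4⟩ := hs b (Finsupp.mem_support_iff.mp hb)
  push_cast
  simp only [Prod.fst_add, Prod.snd_add]
  constructor <;> linarith

variable [NeZero p]

/-- This is where p ≥ 2 matters: the second form takes the value p - 1 on the exponent of x, and the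
first takes it on the exponent of z. -/
theorem R0.originIdeal_le_orderIdeal : R0.originIdeal k p ≤ R0.orderIdeal k p hp 1 := by
  rw [R0.originIdeal_eq_span, Ideal.span_le]
  rintro _ ⟨i, rfl⟩ m hm
  have hp' : (2 : ℤ) ≤ p := by exact_mod_cast hp
  rw [R0.toLaurent_var] at hm
  fin_cases i <;> simp [coeff_mono] at hm <;> subst hm <;> constructor <;> push_cast <;> linarith

theorem R0.originIdeal_pow_le_orderIdeal {n : ℕ} (hn : n ≠ 0) :
    R0.originIdeal k p ^ n ≤ R0.orderIdeal k p hp n := by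
  induction n, Nat.one_le_iff_ne_zero.mpr hn using Nat.le_induction with
  | base => simpa using R0.originIdeal_le_orderIdeal k p hp
  | succ n hn' ih =>
    rw [ideal_pow_succ]
    exact (Ideal.mul_mono (ih (by omega)) (R0.originIdeal_le_orderIdeal k p hp)).trans
      (R0.orderIdeal_mul_le k p hp n 1)

/-- Written in normal form, a monomial of order at least n is visibly a product of at least n of the
generators x, y, z. -/
theorem R0.orderIdeal_le_originIdeal_pow (n : ℕ) :
    R0.orderIdeal k p hp n ≤ R0.originIdeal k p ^ n := by
  intro r hr
  rw [← R0.ofLaurent_toLaurent k p r]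
  have h : ∀ f : Laurent k, R0.ofLaurent k p f = f.coeff.sum fun m c => algebraMap k (R0 k p) c *
      (if 0 ≤ m.1 then R0.var k p 0 ^ m.1.toNat * R0.var k p 1 ^ m.2.toNat else
        R0.var k p 2 ^ (-m.1).toNat * R0.var k p 1 ^ (p * m.1 + m.2).toNat) := fun f => rfl
  rw [h]
  refine Ideal.sum_mem _ fun m hm => Ideal.mul_mem_left _ _ ?_
  obtain ⟨h1, h2⟩ := hr m (Finsupp.mem_support_iff.mp hm)
  have key : ∀ (i j : Fin 3) (a b : ℕ), n ≤ a + b →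
      R0.var k p i ^ a * R0.var k p j ^ b ∈ R0.originIdeal k p ^ n := fun i j a b hab =>
    pow_mul_pow_mem_pow (R0.var_mem_originIdeal k p i) (R0.var_mem_originIdeal k p j) hab
  split_ifs with h0
  · refine key _ _ _ _ ?_
    omega
  · refine key _ _ _ _ ?_
    have h3 : (n : ℤ) ≤ -m.1 + (p * m.1 + m.2) := by linarith
    generalize (p : ℤ) * m.1 + m.2 = q at *
    omega

/-- The exponents of the monomials of order less than `n`. -/
def lowExpo (n : ℕ) (i : Fin n × Fin n) : ℤ × ℤ :=
  -- The square of side n consists of two triangles. Pairs with i + j < n give x^i y^j. For the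
  -- others put c = n - i ≥ 1 and d = i + j - n; they give z^c y^d, of order c + d = j < n.
  if (i.1 + i.2 : ℕ) < n then (i.1, i.2) else
    ((i.1 : ℤ) - n, p * ((n : ℤ) - i.1) + ((i.1 : ℤ) + i.2 - n))

theorem lowExpo_injective (n : ℕ) : Function.Injective (lowExpo p n) := by
  rintro ⟨⟨a, ha⟩, ⟨b, hb⟩⟩ ⟨⟨a', ha'⟩, ⟨b', hb'⟩⟩ h
  simp only [lowExpo] at h
  split_ifs at h with h1 h2 h2 <;> rw [Prod.mk.injEq] at h <;> obtain ⟨h3, h4⟩ := h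
  · simp only [Prod.mk.injEq, Fin.mk.injEq]
    omega
  · omega
  · omega
  · have h5 : a = a' := by omega
    subst h5
    simp only [Prod.mk.injEq, Fin.mk.injEq, true_and]
    linarith

theorem lowExpo_mem (n : ℕ) (i : Fin n × Fin n) : lowExpo p n i ∈ cone p 0 := by
  have h1 := i.1.2
  have h2 : (0 : ℤ) ≤ p := by positivity
  rw [lowExpo]
  refine mem_dualCone.mpr ?_
  split_ifs with h
  · constructor <;> simp <;> positivity
  · simp only [zero_mul, one_mul, zero_add]
    have h3 : (n : ℤ) ≤ i.1 + i.2 := by exact_mod_cast not_lt.mp h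
    have h4 : (i.1 : ℤ) ≤ n := by exact_mod_cast h1.le
    constructor <;> nlinarith

theorem lowExpo_order_lt (n : ℕ) (i : Fin n × Fin n) : (lowExpo p n i).1 + (lowExpo p n i).2 < n ∨
    (p - 1) * (lowExpo p n i).1 + (lowExpo p n i).2 < n := by
  rw [lowExpo]
  have h2 : (i.2 : ℤ) < n := by exact_mod_cast i.2.2
  split_ifs with h
  · left
    change (i.1 : ℤ) + i.2 < n
    exact_mod_cast h
  · right
    linarith

theorem exists_lowExpo_eq (hp : 2 ≤ p) {n : ℕ} {m : ℤ × ℤ} (hm : m ∈ cone p 0)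
    (h : m.1 + m.2 < n ∨ (p - 1) * m.1 + m.2 < n) : ∃ i, lowExpo p n i = m := by
  obtain ⟨a, b⟩ := m
  obtain ⟨h1, h2⟩ := mem_dualCone.mp hm
  simp only [zero_mul, one_mul, zero_add] at h1 h2 h
  have hp' : (2 : ℤ) ≤ p := by exact_mod_cast hp
  by_cases ha : 0 ≤ a
  · have h3 : a + b < n := h.elim id fun h => by nlinarith
    lift a to ℕ using ha
    lift b to ℕ using h1
    refine ⟨⟨⟨a, by omega⟩, ⟨b, by omega⟩⟩, ?_⟩
    rw [lowExpo, if_pos (by simp only; omega)]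
  · have h3 : (p - 1) * a + b < n := h.elim (fun h => by nlinarith) id
    obtain ⟨d, hd⟩ := Int.eq_ofNat_of_zero_le h2
    obtain ⟨c, hc⟩ := Int.eq_ofNat_of_zero_le (show 0 ≤ -a by omega)
    have h4 : c + d < n := by
      zify
      rw [← hc, ← hd]
      linarith
    refine ⟨⟨⟨n - c, by omega⟩, ⟨c + d, h4⟩⟩, ?_⟩
    rw [lowExpo, if_neg (by simp only; omega)]
    have h5 : ((n - c : ℕ) : ℤ) = n - c := by omega
    simp only [Nat.cast_add, h5, ← hc, ← hd, Prod.mk.injEq]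
    constructor <;> ring

/-- The coefficients of the monomials of order less than `n`. -/
def R0.lowCoeff (n : ℕ) : R0 k p →ₗ[k] (Fin n × Fin n → k) where
  toFun r i := (R0.toLaurent k p r).coeff (lowExpo p n i)
  map_add' r s := by
    ext i
    simp
  map_smul' c r := by
    ext i
    rw [map_smul]
    rfl

theorem R0.lowCoeff_surjective (n : ℕ) : Function.Surjective (R0.lowCoeff k p n) := by
  classical
  intro v
  have h : ∀ i, ∃ r, R0.toLaurent k p r = mono k (lowExpo p n i) := fun i => by
    have : mono k (lowExpo p n i) ∈ (R0.toLaurent k p).range := by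
      rw [R0.range_toLaurent, chartRing_eq]
      exact mono_mem_monoAlg.mpr (lowExpo_mem p n i)
    exact this
  choose r hr using h
  refine ⟨∑ i, v i • r i, ?_⟩
  have h1 : ∀ i, R0.lowCoeff k p n (r i) = Pi.single i 1 := fun i => by
    ext j
    change (R0.toLaurent k p (r i)).coeff (lowExpo p n j) = _
    rw [hr, coeff_mono, Pi.single_apply]
    simp only [(lowExpo_injective p n).eq_iff, eq_comm]
  rw [map_sum]
  ext j
  simp [h1, Pi.single_apply]

theorem R0.ker_lowCoeff (hp : 2 ≤ p) {n : ℕ} (hn : n ≠ 0) : LinearMap.ker (R0.lowCoeff k p n) =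
    (R0.originIdeal k p ^ n).restrictScalars k := by
  ext r
  rw [LinearMap.mem_ker, Submodule.restrictScalars_mem]
  constructor
  · intro h
    refine R0.orderIdeal_le_originIdeal_pow k p hp n fun m hm => ?_
    by_contra h'
    rw [not_and_or, not_le, not_le] at h'
    have h2 : R0.toLaurent k p r ∈ monoAlg k (cone p 0) := by
      rw [← chartRing_eq, ← R0.range_toLaurent]
      exact ⟨r, rfl⟩
    obtain ⟨i, rfl⟩ := exists_lowExpo_eq p hp (h2 m hm) h'
    exact hm (congrFun h i)
  · intro h
    ext i
    by_contra h'
    obtain ⟨h1, h2⟩ := R0.originIdeal_pow_le_orderIdeal k p hp hn h _ h'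
    rcases lowExpo_order_lt p n i with h3 | h3
    · exact h3.not_ge h1
    · exact h3.not_ge h2

theorem R0.length_quotient_originIdeal_pow (hp : 2 ≤ p) {n : ℕ} (hn : n ≠ 0) :
    Module.length k (R0 k p ⧸ R0.originIdeal k p ^ n) = (n ^ 2 : ℕ) := by
  have e : (R0 k p ⧸ R0.originIdeal k p ^ n) ≃ₗ[k] (Fin n × Fin n → k) :=
    ((Submodule.Quotient.restrictScalarsEquiv k (R0.originIdeal k p ^ n)).symm.trans
      (Submodule.quotEquivOfEq _ _ (R0.ker_lowCoeff k p hp hn).symm)).trans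
      ((R0.lowCoeff k p n).quotKerEquivOfSurjective (R0.lowCoeff_surjective k p n))
  rw [e.length_eq, Module.length_eq_finrank]
  simp [sq]

theorem X0.length_stalk_sing (hp : 2 ≤ p) {n : ℕ} (hn : n ≠ 0) :
    Module.length ((X0 k p).presheaf.stalk (X0.sing k p))
      ((X0 k p).presheaf.stalk (X0.sing k p) ⧸
        IsLocalRing.maximalIdeal ((X0 k p).presheaf.stalk (X0.sing k p)) ^ n) = (n ^ 2 : ℕ) := by
  refine (length_quotient_maximalIdeal_pow_of_ringEquiv
    (stalkEquiv (X0.chartR0 k p) ⟨R0.originIdeal k p, inferInstance⟩) n).trans ?_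
  rw [← R0.length_quotient_originIdeal_pow k p hp hn]
  refine length_localization_quotient_pow (R0.originIdeal k p) (fun y => ?_) n
  obtain ⟨r, rfl⟩ := Ideal.Quotient.mk_surjective y
  refine ⟨R0.originHom k p r, ?_⟩
  refine (Ideal.Quotient.eq (I := R0.originIdeal k p)
    (x := algebraMap k _ (R0.originHom k p r)) (y := r)).mpr ?_
  change R0.originHom k p _ = 0
  rw [map_sub, AlgHom.commutes]
  exact sub_self _

/-- The length is n² for every n ≥ 1, not only asymptotically, so the sequence is eventually
constant. -/
theorem X0.multiplicity_sing (hp : 2 ≤ p) : Filter.Tendsto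
    (fun n : ℕ => 2 * ((Module.length ((X0 k p).presheaf.stalk (X0.sing k p))
      ((X0 k p).presheaf.stalk (X0.sing k p) ⧸
        IsLocalRing.maximalIdeal ((X0 k p).presheaf.stalk (X0.sing k p)) ^ n)).toNat : ℝ) /
          (n : ℝ) ^ 2)
    Filter.atTop (nhds 2) := by
  refine tendsto_const_nhds.congr' ?_
  filter_upwards [Filter.eventually_ne_atTop 0] with n hn
  rw [X0.length_stalk_sing k p hp hn, ENat.toNat_natCast]
  push_cast
  have : (n : ℝ) ≠ 0 := by exact_mod_cast hn
  field_simp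

end Multiplicity

/-! ### Algebras over `k[λ]` -/

section Trunc

variable {k : Type u} [Field k] {n : ℕ} [NeZero n]

/-- The class of `t` in `S ⊗ k[t]/(t^n)`. -/
abbrev lamT (k : Type u) [Field k] (n : ℕ) [NeZero n] (S : Type u) [CommRing S] [Algebra k S] :
    S ⊗[k] (ArtAlg.trunc k n).carrier :=
  1 ⊗ₜ ArtAlg.t k n

theorem lamT_pow (S : Type u) [CommRing S] [Algebra k S] : lamT k n S ^ n = 0 := by
  rw [lamT, Algebra.TensorProduct.tmul_pow, ArtAlg.t_pow, TensorProduct.tmul_zero]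

/-- The reduction `S ⊗ k[t]/(t^n) → S`, `t ↦ 0`. -/
def redTrunc (k : Type u) [Field k] (n : ℕ) [NeZero n] (S : Type u) [CommRing S] [Algebra k S] :
    S ⊗[k] (ArtAlg.trunc k n).carrier →ₐ[k] S :=
  Algebra.TensorProduct.lift (AlgHom.id k S) ((Algebra.ofId k S).comp (ArtAlg.trunc k n).aug)
    (fun _ _ => Commute.all _ _)

theorem exists_trunc_eq (a : (ArtAlg.trunc k n).carrier) :
    ∃ b, a = algebraMap k _ ((ArtAlg.trunc k n).aug a) + ArtAlg.t k n * b := by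
  let q : Polynomial k →+* (ArtAlg.trunc k n).carrier := AdjoinRoot.mk ((Polynomial.X : Polynomial k) ^ n)
  obtain ⟨f, rfl⟩ : ∃ f, q f = a := AdjoinRoot.mk_surjective a
  obtain ⟨g, hg⟩ := Polynomial.X_dvd_sub_C (p := f)
  have hf : q f = algebraMap k _ (f.coeff 0) + ArtAlg.t k n * q g := by
    rw [sub_eq_iff_eq_add'] at hg
    exact (congrArg q hg).trans ((map_add q _ _).trans (congrArg _ (map_mul q _ _)))
  have ht : (ArtAlg.trunc k n).aug (ArtAlg.t k n) = 0 := by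
    have : (ArtAlg.trunc k n).aug (ArtAlg.t k n) ^ n = 0 := by rw [← map_pow, ArtAlg.t_pow, map_zero]
    exact (pow_eq_zero_iff (NeZero.ne n)).mp this
  refine ⟨q g, ?_⟩
  have h1 := congrArg (ArtAlg.trunc k n).aug hf
  rw [map_add, map_mul, ht, zero_mul, add_zero, AlgHom.commutes] at h1
  rw [h1]
  exact hf

variable {S : Type u} [CommRing S] [Algebra k S]

theorem redTrunc_tmul (s : S) (a : (ArtAlg.trunc k n).carrier) :
    redTrunc k n S (s ⊗ₜ a) = s * algebraMap k S ((ArtAlg.trunc k n).aug a) := by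
  simp [redTrunc, Algebra.ofId_apply]

theorem exists_eq_redTrunc_add (x : S ⊗[k] (ArtAlg.trunc k n).carrier) :
    ∃ y, x = redTrunc k n S x ⊗ₜ 1 + lamT k n S * y := by
  induction x using TensorProduct.induction_on with
  | zero => exact ⟨0, by simp⟩
  | tmul s a =>
    obtain ⟨b, hb⟩ := exists_trunc_eq a
    refine ⟨s ⊗ₜ b, ?_⟩
    rw [redTrunc_tmul, Algebra.TensorProduct.tmul_mul_tmul, one_mul]
    conv_lhs => rw [hb]
    rw [TensorProduct.tmul_add, Algebra.algebraMap_eq_smul_one, TensorProduct.tmul_smul,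
      TensorProduct.smul_tmul', mul_comm s, ← Algebra.smul_def]
  | add x y hx hy =>
    obtain ⟨x', hx'⟩ := hx
    obtain ⟨y', hy'⟩ := hy
    refine ⟨x' + y', ?_⟩
    conv_lhs => rw [hx', hy']
    rw [map_add, TensorProduct.add_tmul]
    ring

theorem redTrunc_surjective : Function.Surjective (redTrunc k n S) := fun s =>
  ⟨s ⊗ₜ 1, by simp [redTrunc_tmul]⟩

/-- The kernel of the reduction is nil, so every point lies in the closed fibre. Questions about
underlying sets can therefore be settled there. -/
theorem surjective_specAlg_redTrunc : Function.Surjective (specAlg k (redTrunc k n S)) := by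
  have h : Set.range (PrimeSpectrum.comap (redTrunc k n S).toRingHom) = Set.univ := by
    rw [_root_.range_comap_of_surjective _ _ redTrunc_surjective,
      PrimeSpectrum.zeroLocus_eq_univ_iff]
    intro x hx
    obtain ⟨y, hy⟩ := exists_eq_redTrunc_add x
    have hx' : redTrunc k n S x = 0 := hx
    rw [hx', TensorProduct.zero_tmul, zero_add] at hy
    refine ⟨n, ?_⟩
    rw [hy, mul_pow, lamT_pow, zero_mul]
    exact Submodule.zero_mem _
  exact Set.range_eq_univ.mp h

/-- An endomorphism of the `k[λ]`-algebra `S[λ]` which is the identity modulo `λ` is bijective. -/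
theorem bijective_of_redTrunc_comp_eq (φ : S ⊗[k] (ArtAlg.trunc k n).carrier →ₐ[k] S ⊗[k] (ArtAlg.trunc k n).carrier)
    (h1 : ∀ a, φ (1 ⊗ₜ a) = 1 ⊗ₜ a) (h2 : (redTrunc k n S).comp φ = redTrunc k n S) :
    Function.Bijective φ := by
  -- The difference 1 - φ commutes with multiplication by `t` and has image in the multiples of `t`.
  -- It is therefore nilpotent, and φ is invertible.
  let N : Module.End k (S ⊗[k] (ArtAlg.trunc k n).carrier) := 1 - φ.toLinearMap
  have hN : ∀ x, N x = x - φ x := fun x => rfl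
  have hl : ∀ m x, N (lamT k n S ^ m * x) = lamT k n S ^ m * N x := fun m x => by
    rw [hN, hN, map_mul, map_pow, h1, mul_sub]
  have hm : ∀ x, ∃ y, N x = lamT k n S * y := fun x => by
    obtain ⟨y, hy⟩ := exists_eq_redTrunc_add (N x)
    have h3 : redTrunc k n S (N x) = 0 := by
      rw [hN, map_sub, ← AlgHom.comp_apply, h2, sub_self]
    rw [h3, TensorProduct.zero_tmul, zero_add] at hy
    exact ⟨y, hy⟩
  have hpow : ∀ m x, ∃ y, (N ^ m) x = lamT k n S ^ m * y := fun m => by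
    induction m with
    | zero => exact fun x => ⟨x, by simp⟩
    | succ m ih =>
      intro x
      obtain ⟨y, hy⟩ := ih x
      obtain ⟨z, hz⟩ := hm y
      refine ⟨z, ?_⟩
      rw [pow_succ', Module.End.mul_apply, hy, hl, hz]
      ring
  have hnil : IsNilpotent N := ⟨n, LinearMap.ext fun x => by
    obtain ⟨y, hy⟩ := hpow n x
    rw [hy, lamT_pow, zero_mul]
    rfl⟩
  have hu := hnil.isUnit_one_sub
  have he : 1 - N = φ.toLinearMap := sub_sub_cancel _ _
  rw [he] at hu
  exact (Module.End.isUnit_iff _).mp hu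

variable {T : Type u} [CommRing T] [Algebra k T]

theorem tensor_map_injective {f : S →ₐ[k] T} (hf : Function.Injective f) :
    Function.Injective (Algebra.TensorProduct.map f (AlgHom.id k (ArtAlg.trunc k n).carrier)) :=
  Module.Flat.rTensor_preserves_injective_linearMap (M := (ArtAlg.trunc k n).carrier) f.toLinearMap hf

theorem redTrunc_map (f : S →ₐ[k] T) : (redTrunc k n T).comp
    (Algebra.TensorProduct.map f (AlgHom.id k (ArtAlg.trunc k n).carrier)) = f.comp (redTrunc k n S) := by
  refine Algebra.TensorProduct.ext' fun s a => ?_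
  rw [AlgHom.comp_apply, AlgHom.comp_apply, Algebra.TensorProduct.map_tmul, redTrunc_tmul,
    redTrunc_tmul, map_mul, AlgHom.commutes]
  rfl

end Trunc

section AdjLam

variable {k : Type u} [Field k] {p : ℕ} {S : Type u} [CommRing S] [Algebra k S]

/-- The element `λ` of `S[λ]`. -/
abbrev lamOf (k : Type u) [Field k] (p : ℕ) (S : Type u) [CommRing S] [Algebra k S] : Adj k p S :=
  1 ⊗ₜ ArtAlg.t k (p + 1)

theorem lamOf_pow (S : Type u) [CommRing S] [Algebra k S] : lamOf k p S ^ (p + 1) = 0 := lamT_pow S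

theorem redLam_tmul (s : S) (a : (kl k p).carrier) :
    redLam k p S (s ⊗ₜ a) = s * algebraMap k S ((kl k p).aug a) := redTrunc_tmul s a

theorem exists_eq_redLam_add (x : Adj k p S) :
    ∃ y, x = redLam k p S x ⊗ₜ 1 + lamOf k p S * y := exists_eq_redTrunc_add x

theorem redLam_surjective : Function.Surjective (redLam k p S) := redTrunc_surjective

theorem surjective_specAlg_redLam : Function.Surjective (specAlg k (redLam k p S)) :=
  surjective_specAlg_redTrunc

/-- An endomorphism of the `k[λ]`-algebra `S[λ]` which is the identity modulo `λ` is bijective. -/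
theorem bijective_of_redLam_comp_eq (φ : Adj k p S →ₐ[k] Adj k p S)
    (h1 : ∀ a, φ (1 ⊗ₜ a) = 1 ⊗ₜ a) (h2 : (redLam k p S).comp φ = redLam k p S) :
    Function.Bijective φ := bijective_of_redTrunc_comp_eq φ h1 h2

theorem redLam_map {T : Type u} [CommRing T] [Algebra k T] (f : S →ₐ[k] T) : (redLam k p T).comp
    (Algebra.TensorProduct.map f (AlgHom.id k (kl k p).carrier)) = f.comp (redLam k p S) :=
  redTrunc_map f

end AdjLam

/-! ### The transition automorphisms on the torus -/

section LaurentLam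

variable {k : Type u} [Field k] {p : ℕ}

theorem valLam_injective (S : Subalgebra k (Laurent k)) : Function.Injective (valLam k p S) :=
  tensor_map_injective (Subtype.val_injective)

theorem valLam_tmul (S : Subalgebra k (Laurent k)) (s : S) (a : (kl k p).carrier) :
    valLam k p S (s ⊗ₜ a) = (s : Laurent k) ⊗ₜ a := rfl

theorem valLam_inclLam {S S' : Subalgebra k (Laurent k)} (h : S ≤ S') (x : Adj k p S) :
    valLam k p S' (inclLam k p h x) = valLam k p S x := by
  have : (valLam k p S').comp (inclLam k p h) = valLam k p S :=
    Algebra.TensorProduct.ext' fun s a => rfl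
  exact DFunLike.congr_fun this x

theorem redLam_valLam (S : Subalgebra k (Laurent k)) (x : Adj k p S) :
    redLam k p (Laurent k) (valLam k p S x) = redLam k p S x :=
  DFunLike.congr_fun (redLam_map S.val) x

theorem redLam_inclLam {S S' : Subalgebra k (Laurent k)} (h : S ≤ S') :
    (redLam k p S').comp (inclLam k p h) = (Subalgebra.inclusion h).comp (redLam k p S) :=
  redLam_map _

theorem valLam_surjective {S : Subalgebra k (Laurent k)} (h : S = ⊤) :
    Function.Surjective (valLam k p S) := by
  subst h
  intro x
  induction x using TensorProduct.induction_on with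
  | zero => exact ⟨0, map_zero _⟩
  | tmul s a => exact ⟨(⟨s, trivial⟩ : (⊤ : Subalgebra k (Laurent k))) ⊗ₜ a, rfl⟩
  | add x y hx hy =>
    obtain ⟨x', rfl⟩ := hx
    obtain ⟨y', rfl⟩ := hy
    exact ⟨x' + y', map_add _ _ _⟩

theorem tmul_mem_range_valLam {S : Subalgebra k (Laurent k)} {f : Laurent k} (hf : f ∈ S)
    (a : (kl k p).carrier) : f ⊗ₜ a ∈ (valLam k p S).range := ⟨(⟨f, hf⟩ : S) ⊗ₜ a, rfl⟩

theorem range_valLam_le_iff {S : Subalgebra k (Laurent k)} {B : Subalgebra k (Adj k p (Laurent k))}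
    (hB : ∀ a, 1 ⊗ₜ a ∈ B) : (valLam k p S).range ≤ B ↔ ∀ f ∈ S, f ⊗ₜ 1 ∈ B := by
  refine ⟨fun h f hf => h (tmul_mem_range_valLam hf 1), ?_⟩
  rintro h _ ⟨x, rfl⟩
  induction x using TensorProduct.induction_on with
  | zero => simp
  | tmul s a =>
    have := B.mul_mem (h s s.2) (hB a)
    rw [Algebra.TensorProduct.tmul_mul_tmul, one_mul, mul_one] at this
    exact this
  | add x y hx hy =>
    have := B.add_mem hx hy
    exact (map_add (valLam k p S) x y).symm ▸ this

theorem range_valLam_monoAlg_le_iff {M : AddSubmonoid (ℤ × ℤ)}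
    {B : Subalgebra k (Adj k p (Laurent k))} (hB : ∀ a, 1 ⊗ₜ a ∈ B) :
    (valLam k p (monoAlg k M)).range ≤ B ↔ ∀ m ∈ M, mono k m ⊗ₜ 1 ∈ B := by
  rw [range_valLam_le_iff hB]
  constructor
  · exact fun h m hm => h _ (mono_mem_monoAlg.mpr hm)
  · intro h f hf
    have := monoAlg_le_iff (k := k) (M := M) (B := B.comap Algebra.TensorProduct.includeLeft)
    exact this.mpr h hf

theorem monoUnit_val (m : ℤ × ℤ) : (monoUnit k p m : Adj k p (Laurent k)) = mono k m ⊗ₜ 1 := rfl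

theorem monoUnit_mul (m n : ℤ × ℤ) : monoUnit k p m * monoUnit k p n = monoUnit k p (m + n) := by
  refine Units.ext ?_
  rw [Units.val_mul, monoUnit_val, monoUnit_val, monoUnit_val, Algebra.TensorProduct.tmul_mul_tmul,
    mono_mul, one_mul]

theorem monoUnit_zpow (m : ℤ × ℤ) (n : ℤ) : monoUnit k p m ^ n = monoUnit k p (n • m) := by
  let f : Multiplicative (ℤ × ℤ) →* (Adj k p (Laurent k))ˣ :=
    MonoidHom.mk' (fun m => monoUnit k p m.toAdd) fun a b => (monoUnit_mul _ _).symm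
  exact (map_zpow f (Multiplicative.ofAdd m) n).symm

theorem monoUnit_eq (m : ℤ × ℤ) : monoUnit k p m = ux k p ^ m.1 * uy k p ^ m.2 := by
  rw [monoUnit_zpow, monoUnit_zpow, monoUnit_mul]
  simp

theorem adj_algHom_ext {B : Type*} [CommRing B] [Algebra k B]
    {f g : Adj k p (Laurent k) →ₐ[k] B} (h : ∀ a, f (1 ⊗ₜ a) = g (1 ⊗ₜ a))
    (hx : f (ux k p) = g (ux k p)) (hy : f (uy k p) = g (uy k p)) : f = g := by
  have h1 : (AlgHom.equalizer f g) = ⊤ := by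
    rw [eq_top_iff]
    intro x _
    have h2 : (valLam k p (monoAlg k ⊤)).range ≤ AlgHom.equalizer f g := by
      rw [range_valLam_monoAlg_le_iff h]
      intro m _
      have hx' : Units.map (f : _ →* B) (ux k p) = Units.map (g : _ →* B) (ux k p) := Units.ext hx
      have hy' : Units.map (f : _ →* B) (uy k p) = Units.map (g : _ →* B) (uy k p) := Units.ext hy
      have : Units.map (f : _ →* B) (monoUnit k p m) = Units.map (g : _ →* B) (monoUnit k p m) := by
        rw [monoUnit_eq, map_mul, map_mul, map_zpow, map_zpow, map_zpow, map_zpow, hx', hy']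
      exact congrArg Units.val this
    exact h2 (valLam_surjective monoAlg_top x)
  exact AlgHom.ext fun x => (h1 ▸ Algebra.mem_top : x ∈ AlgHom.equalizer f g)

variable (u v : (Adj k p (Laurent k))ˣ)

theorem subst_tmul (a : (kl k p).carrier) : subst k p u v (1 ⊗ₜ a) = 1 ⊗ₜ a := by
  simp [subst]

theorem subst_monoUnit (m : ℤ × ℤ) : subst k p u v (monoUnit k p m) = ↑(u ^ m.1 * v ^ m.2) := by
  rw [monoUnit_val]
  simp [subst, mono, ← Algebra.TensorProduct.one_def]

theorem subst_ux : subst k p u v (ux k p) = u := by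
  rw [subst_monoUnit]
  simp

theorem subst_uy : subst k p u v (uy k p) = v := by
  rw [subst_monoUnit]
  simp

theorem psiExt_tmul (i j : Fin 5) (a : (kl k p).carrier) : psiExt k p i j (1 ⊗ₜ a) = 1 ⊗ₜ a := by
  fin_cases i <;> fin_cases j <;> first | rfl | exact subst_tmul _ _ a

theorem redLam_lam : redLam k p (Laurent k) (lam k p) = 0 := by
  have h : (redLam k p (Laurent k) (lam k p)) ^ (p + 1) = 0 := by
    rw [← map_pow]
    exact (congrArg _ (lamOf_pow (Laurent k))).trans (map_zero _)
  exact pow_eq_zero_iff (Nat.succ_ne_zero p) |>.mp h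

theorem redLam_monoUnit (m : ℤ × ℤ) : redLam k p (Laurent k) (monoUnit k p m) = mono k m := by
  rw [monoUnit_val, redLam_tmul, map_one, map_one, mul_one]

theorem redLam_uyAdd : redLam k p (Laurent k) (uyAdd k p) = mono k (0, 1) := by
  rw [uyAdd_val, map_add, redLam_lam, add_zero, redLam_monoUnit]

theorem redLam_uOneAdd : redLam k p (Laurent k) (uOneAdd k p) = 1 := by
  have : (redLam k p (Laurent k)) (uOneAdd k p * uy k p) = redLam k p (Laurent k) (uy k p) := by
    rw [← Units.val_mul, uOneAdd, inv_mul_cancel_right, redLam_uyAdd, redLam_monoUnit]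
  rw [map_mul] at this
  have h2 : redLam k p (Laurent k) (uy k p) ≠ 0 := ((uy k p).isUnit.map _).ne_zero
  exact mul_right_cancel₀ h2 (this.trans (one_mul _).symm)

theorem uOneAdd_val : (uOneAdd k p : Adj k p (Laurent k)) = 1 + lam k p * ↑(uy k p)⁻¹ := by
  rw [uOneAdd, Units.val_mul, uyAdd_val, add_mul, Units.mul_inv]

theorem uOneSub_val : (uOneSub k p : Adj k p (Laurent k)) = 1 - lam k p * ↑(uy k p)⁻¹ := rfl

variable [Fact p.Prime] [CharP k p]

/-- With t = λ/y, the product (1 - t)^p (1 + t)^p is 1 - t^(2p) in characteristic p, and λ^(2p) = 0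
since 2p ≥ p + 1. So ψ_34 is given by the same formula as ψ_14 and ψ_24. -/
theorem inv_uOneSub_pow : (uOneSub k p ^ p)⁻¹ = uOneAdd k p ^ p := by
  rw [inv_eq_iff_mul_eq_one]
  have hc : CharP (Adj k p (Laurent k)) p := by
    have : Nontrivial (Adj k p (Laurent k)) := (redLam k p (Laurent k)).toRingHom.domain_nontrivial
    exact charP_of_injective_algebraMap (algebraMap k (Adj k p (Laurent k))).injective p
  refine Units.ext ?_
  rw [Units.val_mul, Units.val_pow_eq_pow_val, Units.val_pow_eq_pow_val, ← mul_pow, uOneAdd_val,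
    uOneSub_val]
  have h : (1 - lam k p * ↑(uy k p)⁻¹) * (1 + lam k p * ↑(uy k p)⁻¹) =
      1 - (lam k p * (↑(uy k p)⁻¹ : Adj k p (Laurent k))) ^ 2 := by ring
  rw [h, sub_pow_char, one_pow, ← pow_mul, mul_pow,
    show 2 * p = (p + 1) + (p - 1) by have := (Fact.out : p.Prime).two_le; omega, pow_add (lam k p)]
  have h2 : lam k p ^ (p + 1) = 0 := lamOf_pow _
  rw [h2, zero_mul, zero_mul, sub_zero, Units.val_one]

/-- The transition maps form a coboundary. -/
theorem psiExt_comp {i j : Fin 5} (hij : i < j) :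
    (psiExt k p j 4).comp (psiExt k p i j) = psiExt k p i 4 := by
  have h3 : psiExt k p 3 4 = subst k p (ux k p * uOneAdd k p ^ p) (uy k p) := by
    rw [← inv_uOneSub_pow]
    rfl
  have h0 : (subst k p (ux k p * uOneAdd k p ^ p) (uy k p)).comp (subst k p (ux k p) (uyAdd k p)) =
      subst k p (ux k p * uOneAdd k p ^ p) (uyAdd k p) := by
    refine adj_algHom_ext (fun a => ?_) ?_ ?_
    · rw [AlgHom.comp_apply, subst_tmul, subst_tmul, subst_tmul]
    · rw [AlgHom.comp_apply, subst_ux, subst_ux, subst_ux]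
    · rw [AlgHom.comp_apply, subst_uy, subst_uy, uyAdd_val, map_add, subst_uy]
      congr 1
      exact subst_tmul _ _ _
  have h03 : (psiExt k p 3 4).comp (subst k p (ux k p) (uyAdd k p)) =
      subst k p (ux k p * uOneAdd k p ^ p) (uyAdd k p) := by rw [h3, h0]
  have h13 : (psiExt k p 3 4).comp (AlgHom.id k _) =
      subst k p (ux k p * uOneAdd k p ^ p) (uy k p) := by rw [h3, AlgHom.comp_id]
  fin_cases i <;> fin_cases j <;> first
    | exact absurd hij (by decide)
    | exact h0
    | exact h03
    | exact h13
    | exact AlgHom.id_comp _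
    | exact AlgHom.comp_id _

theorem redLam_psiExt (i j : Fin 5) :
    (redLam k p (Laurent k)).comp (psiExt k p i j) = redLam k p (Laurent k) := by
  have key : ∀ (u v : (Adj k p (Laurent k))ˣ), redLam k p (Laurent k) u = mono k (1, 0) →
      redLam k p (Laurent k) v = mono k (0, 1) →
      (redLam k p (Laurent k)).comp (subst k p u v) = redLam k p (Laurent k) := fun u v hu hv => by
    refine adj_algHom_ext (fun a => ?_) ?_ ?_
    · rw [AlgHom.comp_apply, subst_tmul]
    · rw [AlgHom.comp_apply, subst_ux, hu, redLam_monoUnit]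
    · rw [AlgHom.comp_apply, subst_uy, hv, redLam_monoUnit]
  have h1 : redLam k p (Laurent k) ↑(ux k p * uOneAdd k p ^ p) = mono k (1, 0) := by
    rw [Units.val_mul, Units.val_pow_eq_pow_val, map_mul, map_pow, redLam_uOneAdd, one_pow, mul_one,
      redLam_monoUnit]
  have h2 : redLam k p (Laurent k) ↑(ux k p * (uOneSub k p ^ p)⁻¹) = mono k (1, 0) := by
    rw [inv_uOneSub_pow, h1]
  have hx := redLam_monoUnit (k := k) (p := p) (1, 0)
  have hy := redLam_monoUnit (k := k) (p := p) (0, 1)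
  have hy' := redLam_uyAdd (k := k) (p := p)
  fin_cases i <;> fin_cases j <;> first
    | rfl
    | exact key _ _ hx hy'
    | exact key _ _ h1 hy'
    | exact key _ _ h1 hy
    | exact key _ _ h2 hy

theorem psiExt_bijective (i j : Fin 5) : Function.Bijective (psiExt k p i j) :=
  bijective_of_redLam_comp_eq _ (psiExt_tmul i j) (redLam_psiExt i j)

/-- Nothing is to be shown when the overlap is the torus or the map is the identity. In the half
planes 01 and 04, the exponent of the factor y + λ in the image of a monomial is b, respectively pa
+ b, so only nonnegative powers occur. In 34 the variable y is invertible, while x has nonnegative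
exponent. -/
theorem psiExt_mem_range {i j : Fin 5} (hij : i < j) {x : Adj k p (Laurent k)}
    (hx : x ∈ (valLam k p (overlapRing k p i j)).range) :
    psiExt k p i j x ∈ (valLam k p (overlapRing k p i j)).range := by
  suffices h : (valLam k p (overlapRing k p i j)).range ≤
      (valLam k p (overlapRing k p i j)).range.comap (psiExt k p i j) from h hx
  have htop : cone p i ⊔ cone p j = ⊤ → (valLam k p (overlapRing k p i j)).range ≤
      (valLam k p (overlapRing k p i j)).range.comap (psiExt k p i j) := fun h y _ => by
    refine valLam_surjective ?_ _
    rw [overlapRing_eq, h, monoAlg_top]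
  have hid : psiExt k p i j = AlgHom.id k _ → (valLam k p (overlapRing k p i j)).range ≤
      (valLam k p (overlapRing k p i j)).range.comap (psiExt k p i j) := fun h y hy => by
    rw [Subalgebra.mem_comap, h]
    exact hy
  have hgen : ∀ M, cone p i ⊔ cone p j = M →
      (∀ m ∈ M, psiExt k p i j (monoUnit k p m) ∈ (valLam k p (monoAlg k M)).range) →
      (valLam k p (overlapRing k p i j)).range ≤
      (valLam k p (overlapRing k p i j)).range.comap (psiExt k p i j) := by
    intro M h h'
    rw [overlapRing_eq, h]
    refine (range_valLam_monoAlg_le_iff fun a => ?_).mpr h'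
    rw [Subalgebra.mem_comap, psiExt_tmul]
    exact tmul_mem_range_valLam (one_mem _) a
  have hmono : ∀ {M : AddSubmonoid (ℤ × ℤ)} {m}, m ∈ M →
      (monoUnit k p m : Adj k p (Laurent k)) ∈ (valLam k p (monoAlg k M)).range := fun hm =>
    tmul_mem_range_valLam (mono_mem_monoAlg.mpr hm) 1
  have hlam : ∀ {M : AddSubmonoid (ℤ × ℤ)}, lam k p ∈ (valLam k p (monoAlg k M)).range :=
    tmul_mem_range_valLam (one_mem _) _
  have hadd : ∀ {M : AddSubmonoid (ℤ × ℤ)}, (0, 1) ∈ M →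
      (uyAdd k p : Adj k p (Laurent k)) ∈ (valLam k p (monoAlg k M)).range := fun h => by
    rw [uyAdd_val]
    exact add_mem (hmono h) hlam
  have h01 : (i, j) = (0, 1) → (valLam k p (overlapRing k p i j)).range ≤
      (valLam k p (overlapRing k p i j)).range.comap (psiExt k p i j) := fun h => by
    obtain ⟨rfl, rfl⟩ := Prod.mk.inj h
    refine hgen _ (cone_sup_zero_one p) fun m hm => ?_
    have h1 : 0 ≤ m.2 := by simpa using (mem_dualCone.mp hm).1
    have : psiExt k p 0 1 = subst k p (ux k p) (uyAdd k p) := rfl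
    rw [this, subst_monoUnit, monoUnit_zpow]
    obtain ⟨n, hn⟩ := Int.eq_ofNat_of_zero_le h1
    rw [hn, zpow_natCast, Units.val_mul, Units.val_pow_eq_pow_val]
    refine mul_mem (hmono (mem_dualCone.mpr ?_)) (pow_mem (hadd (mem_dualCone.mpr ?_)) _) <;> simp
  have h04 : (i, j) = (0, 4) → (valLam k p (overlapRing k p i j)).range ≤
      (valLam k p (overlapRing k p i j)).range.comap (psiExt k p i j) := fun h => by
    obtain ⟨rfl, rfl⟩ := Prod.mk.inj h
    refine hgen _ (cone_sup_zero_four p) fun m hm => ?_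
    have h1 : 0 ≤ p * m.1 + m.2 := by simpa using (mem_dualCone.mp hm).1
    have : psiExt k p 0 4 = subst k p (ux k p * uOneAdd k p ^ p) (uyAdd k p) := rfl
    rw [this, subst_monoUnit]
    obtain ⟨n, hn⟩ := Int.eq_ofNat_of_zero_le h1
    -- In the coordinates x y^(-p) and y of this overlap, x^a y^b is (x y^(-p))^a y^(pa+b). The
    -- first factor is fixed, and y goes to y + λ.
    have h2 : (ux k p * uOneAdd k p ^ p) ^ m.1 * uyAdd k p ^ m.2 =
        monoUnit k p (m.1, -(p * m.1)) * uyAdd k p ^ n := by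
      rw [monoUnit_eq, ← zpow_natCast (uyAdd k p) n]
      have hn' : (n : ℤ) = p * m.1 + m.2 := hn.symm
      rw [hn', uOneAdd, zpow_add, mul_pow, mul_zpow, mul_zpow,
        ← zpow_natCast, ← zpow_natCast, ← zpow_mul, ← zpow_mul, inv_zpow, ← zpow_neg]
      simp only [mul_assoc]
      congr 1
      rw [mul_left_comm]
    rw [h2, Units.val_mul, Units.val_pow_eq_pow_val]
    refine mul_mem (hmono (mem_dualCone.mpr ?_)) (pow_mem (hadd (mem_dualCone.mpr ?_)) _) <;> simp
  have h34 : (i, j) = (3, 4) → (valLam k p (overlapRing k p i j)).range ≤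
      (valLam k p (overlapRing k p i j)).range.comap (psiExt k p i j) := fun h => by
    obtain ⟨rfl, rfl⟩ := Prod.mk.inj h
    refine hgen _ (cone_sup_three_four p) fun m hm => ?_
    have h1 : 0 ≤ m.1 := by simpa using (mem_dualCone.mp hm).1
    have : psiExt k p 3 4 = subst k p (ux k p * (uOneSub k p ^ p)⁻¹) (uy k p) := rfl
    rw [this, inv_uOneSub_pow, subst_monoUnit, monoUnit_zpow]
    obtain ⟨n, hn⟩ := Int.eq_ofNat_of_zero_le h1
    rw [hn, zpow_natCast, Units.val_mul, Units.val_pow_eq_pow_val, Units.val_mul,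
      Units.val_pow_eq_pow_val, uOneAdd_val]
    refine mul_mem (pow_mem (mul_mem (hmono (mem_dualCone.mpr ?_)) (pow_mem (add_mem (one_mem _)
      (mul_mem hlam (hmono (m := -(0, 1)) (mem_dualCone.mpr ?_)))) _)) _)
      (hmono (mem_dualCone.mpr ?_)) <;> simp
  have : NeZero p := ⟨(Fact.out : p.Prime).ne_zero⟩
  fin_cases i <;> fin_cases j <;> first
    | exact absurd hij (by decide)
    | exact hid rfl
    | exact h01 rfl
    | exact h04 rfl
    | exact h34 rfl
    | exact htop (cone_sup_zero_two p)
    | exact htop (cone_sup_zero_three p)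
    | exact htop (cone_sup_one_four p)
    | exact htop (cone_sup_two_four p)

/-- Preservation of `R_ij[λ]` is enough: the restricted endomorphism is the identity modulo the
nilpotent λ, hence bijective. -/
theorem exists_isPsi {i j : Fin 5} (hij : i < j) : ∃ ψ, IsPsi k p i j ψ := by
  let S := overlapRing k p i j
  let e := AlgEquiv.ofInjective (valLam k p S) (valLam_injective S)
  let φ : Adj k p S →ₐ[k] Adj k p S := (e.symm : _ →ₐ[k] Adj k p S).comp
    (((psiExt k p i j).comp (valLam k p S)).codRestrict _ fun x => psiExt_mem_range hij ⟨x, rfl⟩)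
  have hφ : ∀ x, valLam k p S (φ x) = psiExt k p i j (valLam k p S x) := fun x =>
    congrArg Subtype.val (e.apply_symm_apply _)
  have hb : Function.Bijective φ := by
    refine bijective_of_redLam_comp_eq φ (fun a => valLam_injective S ?_) (AlgHom.ext fun x => ?_)
    · rw [hφ, valLam_tmul, OneMemClass.coe_one, psiExt_tmul]
    · refine Subtype.ext ?_
      rw [AlgHom.comp_apply, ← redLam_valLam, ← redLam_valLam, hφ, ← AlgHom.comp_apply,
        redLam_psiExt]
  exact ⟨AlgEquiv.ofBijective φ hb, hφ⟩

end LaurentLam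

/-! ### Spectra of algebras over `k` and their thickenings -/

section SpecAlg

variable {k : Type u} [Field k] {R S T : Type u} [CommRing R] [CommRing S] [CommRing T]
  [Algebra k R] [Algebra k S] [Algebra k T]

theorem specAlg_comp (f : R →ₐ[k] S) (g : S →ₐ[k] T) :
    specAlg k g ≫ specAlg k f = specAlg k (g.comp f) :=
  (Spec.map_comp _ _).symm

theorem specAlg_id : specAlg k (AlgHom.id k S) = 𝟙 _ := Spec.map_id _

/-- The isomorphism of spectra attached to an isomorphism of algebras. -/
def specEquiv (e : S ≃ₐ[k] T) : Spec (.of T) ≅ Spec (.of S) where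
  hom := specAlg k e.toAlgHom
  inv := specAlg k e.symm.toAlgHom
  hom_inv_id := (specAlg_comp _ _).trans
    ((congrArg (specAlg k) (AlgHom.ext e.apply_symm_apply)).trans specAlg_id)
  inv_hom_id := (specAlg_comp _ _).trans
    ((congrArg (specAlg k) (AlgHom.ext e.symm_apply_apply)).trans specAlg_id)

theorem specAlg_toSpecK (f : S →ₐ[k] T) : specAlg k f ≫
    Spec.map (CommRingCat.ofHom (algebraMap k S)) = Spec.map (CommRingCat.ofHom (algebraMap k T)) := by
  rw [← Spec.map_comp]
  congr 1
  exact CommRingCat.hom_ext (RingHom.ext f.commutes)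

/-- The spectrum of `S ⊗_k A` is the product. -/
theorem isPullback_specAlg_include (S : Type u) [CommRing S] [Algebra k S] (A : ArtAlg k) :
    IsPullback (specAlg k (Algebra.TensorProduct.includeLeft : S →ₐ[k] S ⊗[k] A.carrier))
      (specAlg k (Algebra.TensorProduct.includeRight : A.carrier →ₐ[k] S ⊗[k] A.carrier))
      (Spec.map (CommRingCat.ofHom (algebraMap k S))) A.toSpecK :=
  isPullback_SpecMap_of_isPushout _ _ _ _ (CommRingCat.isPushout_tensorProduct k S A.carrier)

/-- The spectrum of `S` is the closed fibre of the spectrum of `S[λ]`. -/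
theorem isPullback_specAlg_redLam (p : ℕ) (S : Type u) [CommRing S] [Algebra k S] :
    IsPullback (specAlg k (redLam k p S)) (Spec.map (CommRingCat.ofHom (algebraMap k S)))
      (specAlg k Algebra.TensorProduct.includeRight) (kl k p).pt := by
  refine IsPullback.of_right (h₁₂ := specAlg k (Algebra.TensorProduct.includeLeft : S →ₐ[k] Adj k p S))
    (v₁₃ := Spec.map (CommRingCat.ofHom (algebraMap k S))) (h₂₂ := (kl k p).toSpecK) ?_ ?_
    (isPullback_specAlg_include S (kl k p))
  · have h1 : specAlg k (redLam k p S) ≫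
        specAlg k (Algebra.TensorProduct.includeLeft : S →ₐ[k] Adj k p S) = 𝟙 _ := by
      rw [specAlg_comp, ← specAlg_id (k := k)]
      refine congrArg (specAlg k) (AlgHom.ext fun s => ?_)
      change redLam k p S (s ⊗ₜ 1) = s
      rw [redLam_tmul, map_one, map_one, mul_one]
    rw [h1, ArtAlg.pt_toSpecK]
    exact IsPullback.of_horiz_isIso ⟨by simp⟩
  · rw [specAlg_comp]
    refine Eq.trans (congrArg Spec.map (CommRingCat.hom_ext (RingHom.ext fun a => ?_)))
      (Spec.map_comp _ _)
    change redLam k p S (1 ⊗ₜ a) = _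
    rw [redLam_tmul, one_mul]
    rfl

end SpecAlg

/-! ### Twisted charts -/

section Twist

variable (k : Type u) [Field k] (p : ℕ)

/-- The homomorphism `S[λ] → k[x, x⁻¹, y, y⁻¹][λ]` given by `ψ_i4`. -/
def twistHom (i : Fin 5) (S : Subalgebra k (Laurent k)) : Adj k p S →ₐ[k] Adj k p (Laurent k) :=
  (psiExt k p i 4).comp (valLam k p S)

/-- The image of `S[λ]` under `ψ_i4`. -/
def twist (i : Fin 5) (S : Subalgebra k (Laurent k)) : Subalgebra k (Adj k p (Laurent k)) :=
  (twistHom k p i S).range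

theorem twist_mono (i : Fin 5) {S S' : Subalgebra k (Laurent k)} (h : S ≤ S') :
    twist k p i S ≤ twist k p i S' := by
  rintro _ ⟨x, rfl⟩
  exact ⟨inclLam k p h x, congrArg (psiExt k p i 4) (valLam_inclLam h x)⟩

theorem tmul_mem_twist (i : Fin 5) (S : Subalgebra k (Laurent k)) (a : (kl k p).carrier) :
    1 ⊗ₜ a ∈ twist k p i S := ⟨1 ⊗ₜ a, psiExt_tmul i 4 a⟩

variable [Fact p.Prime] [CharP k p]

theorem twistHom_injective (i : Fin 5) (S : Subalgebra k (Laurent k)) :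
    Function.Injective (twistHom k p i S) :=
  (psiExt_bijective i 4).injective.comp (valLam_injective S)

variable {k p}

/-- This is the coboundary relation. After embedding by ψ_i4 and ψ_j4, the automorphism ψ_ij becomes
an equality of elements of the Laurent ring over `k[λ]`. -/
theorem twistHom_isPsi {i j : Fin 5} (hij : i < j)
    {ψ : Adj k p (overlapRing k p i j) ≃ₐ[k] Adj k p (overlapRing k p i j)} (hψ : IsPsi k p i j ψ)
    (x : Adj k p (overlapRing k p i j)) :
    twistHom k p j (overlapRing k p i j) (ψ x) = twistHom k p i (overlapRing k p i j) x := by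
  rw [twistHom, AlgHom.comp_apply, hψ x, ← AlgHom.comp_apply, psiExt_comp hij]
  rfl

theorem isPsi_tmul {i j : Fin 5}
    {ψ : Adj k p (overlapRing k p i j) ≃ₐ[k] Adj k p (overlapRing k p i j)} (hψ : IsPsi k p i j ψ)
    (a : (kl k p).carrier) : ψ (1 ⊗ₜ a) = 1 ⊗ₜ a :=
  valLam_injective _ ((hψ _).trans (psiExt_tmul i j a))

theorem redLam_isPsi {i j : Fin 5}
    {ψ : Adj k p (overlapRing k p i j) ≃ₐ[k] Adj k p (overlapRing k p i j)} (hψ : IsPsi k p i j ψ)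
    (x : Adj k p (overlapRing k p i j)) : redLam k p _ (ψ x) = redLam k p _ x := by
  refine Subtype.ext ?_
  rw [← redLam_valLam, ← redLam_valLam, hψ, ← AlgHom.comp_apply, redLam_psiExt]

theorem twist_overlap_eq {i j : Fin 5} (hij : i < j) :
    twist k p i (overlapRing k p i j) = twist k p j (overlapRing k p i j) := by
  obtain ⟨ψ, hψ⟩ := exists_isPsi (k := k) (p := p) hij
  apply le_antisymm
  · rintro _ ⟨x, rfl⟩
    exact ⟨ψ x, twistHom_isPsi hij hψ x⟩
  · rintro _ ⟨x, rfl⟩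
    refine ⟨ψ.symm x, ?_⟩
    have := twistHom_isPsi hij hψ (ψ.symm x)
    rw [ψ.apply_symm_apply] at this
    exact this.symm

/-- A Nakayama argument with a nilpotent ideal. The two twisted charts generate the twisted overlap
modulo λ, because `R_i` and `R_j` generate `R_ij`. Hence `D = C + λD`, and iterating gives `D = C`.
-/
theorem twist_sup_of_lt {i j : Fin 5} (hij : i < j) :
    twist k p i (chartRing k p i) ⊔ twist k p j (chartRing k p j) =
      twist k p i (overlapRing k p i j) := by
  set C := twist k p i (chartRing k p i) ⊔ twist k p j (chartRing k p j) with hC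
  set D := twist k p i (overlapRing k p i j) with hD
  have hCD : C ≤ D := by
    refine sup_le (twist_mono k p i le_sup_left) ?_
    rw [hD, twist_overlap_eq hij]
    exact twist_mono k p j le_sup_right
  refine le_antisymm hCD ?_
  let l := lamOf k p (Laurent k)
  have hlC : l ∈ C := (le_sup_left : _ ≤ C) (tmul_mem_twist k p i _ _)
  -- Those functions whose twist lies in `C + λD` form a subalgebra. It contains `R_i`, and it
  -- contains `R_j` because ψ_ij is the identity modulo λ, so it contains all of `R_ij`.
  let B : Subalgebra k (Laurent k) :=
    { carrier := {f | ∃ c ∈ C, ∃ d ∈ D, psiExt k p i 4 (f ⊗ₜ 1) = c + l * d}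
      mul_mem' := by
        rintro f f' ⟨c, hc, d, hd, h⟩ ⟨c', hc', d', hd', h'⟩
        refine ⟨c * c', mul_mem hc hc', c * d' + d * c' + l * d * d', ?_, ?_⟩
        · exact add_mem (add_mem (mul_mem (hCD hc) hd') (mul_mem hd (hCD hc')))
            (mul_mem (mul_mem (hCD hlC) hd) hd')
        · have : (f * f') ⊗ₜ[k] (1 : (kl k p).carrier) = (f ⊗ₜ 1) * (f' ⊗ₜ 1) := by
            rw [Algebra.TensorProduct.tmul_mul_tmul, one_mul]
          rw [this, map_mul, h, h']
          ring
      add_mem' := by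
        rintro f f' ⟨c, hc, d, hd, h⟩ ⟨c', hc', d', hd', h'⟩
        refine ⟨c + c', add_mem hc hc', d + d', add_mem hd hd', ?_⟩
        rw [TensorProduct.add_tmul, map_add, h, h']
        ring
      algebraMap_mem' := fun r => ⟨algebraMap k _ r, C.algebraMap_mem r, 0, zero_mem _, by
        rw [mul_zero, add_zero]
        exact (psiExt k p i 4).commutes r⟩ }
  have hB : overlapRing k p i j ≤ B := by
    refine sup_le (fun f hf => ?_) (fun f hf => ?_)
    · exact ⟨_, (le_sup_left : _ ≤ C) ⟨(⟨f, hf⟩ : chartRing k p i) ⊗ₜ 1, rfl⟩, 0, zero_mem _,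
        by rw [mul_zero, add_zero]; rfl⟩
    · obtain ⟨ψ, hψ⟩ := exists_isPsi (k := k) (p := p) hij
      let f' : overlapRing k p i j := ⟨f, (le_sup_right : chartRing k p j ≤ overlapRing k p i j) hf⟩
      obtain ⟨z, hz⟩ := exists_eq_redLam_add (ψ (f' ⊗ₜ 1))
      rw [redLam_isPsi hψ, redLam_tmul, map_one, map_one, mul_one] at hz
      refine ⟨_, (le_sup_right : _ ≤ C) ⟨(⟨f, hf⟩ : chartRing k p j) ⊗ₜ 1, rfl⟩,
        twistHom k p j (overlapRing k p i j) z, ?_, ?_⟩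
      · rw [hD, twist_overlap_eq hij]
        exact ⟨z, rfl⟩
      · have h1 := twistHom_isPsi hij hψ (f' ⊗ₜ 1)
        rw [hz, map_add, map_mul] at h1
        have h2 : twistHom k p j (overlapRing k p i j) (lamOf k p _) = l := psiExt_tmul j 4 _
        rw [h2] at h1
        exact h1.symm
  have hstep : ∀ d ∈ D, ∃ c ∈ C, ∃ d' ∈ D, d = c + l * d' := by
    rintro _ ⟨x, rfl⟩
    obtain ⟨z, hz⟩ := exists_eq_redLam_add x
    obtain ⟨c, hc, d, hd, h⟩ := hB (redLam k p _ x).2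
    refine ⟨c, hc, d + twistHom k p i (overlapRing k p i j) z, add_mem hd ⟨z, rfl⟩, ?_⟩
    have h2 : twistHom k p i (overlapRing k p i j) (lamOf k p _) = l := psiExt_tmul i 4 _
    have h3 : twistHom k p i (overlapRing k p i j) (redLam k p _ x ⊗ₜ 1) = c + l * d := h
    change twistHom k p i (overlapRing k p i j) x = _
    conv_lhs => rw [hz]
    rw [map_add, map_mul, h2, h3]
    ring
  have hpow : ∀ n, ∀ d ∈ D, ∃ c ∈ C, ∃ d' ∈ D, d = c + l ^ n * d' := fun n => by
    induction n with
    | zero => exact fun d hd => ⟨0, zero_mem _, d, hd, by simp⟩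
    | succ n ih =>
      intro d hd
      obtain ⟨c, hc, d', hd', rfl⟩ := ih d hd
      obtain ⟨c', hc', d'', hd'', rfl⟩ := hstep d' hd'
      exact ⟨c + l ^ n * c', add_mem hc (mul_mem (pow_mem hlC n) hc'), d'', hd'', by ring⟩
  intro d hd
  -- At the exponent p + 1 the error term vanishes.
  obtain ⟨c, hc, d', _, rfl⟩ := hpow (p + 1) d hd
  have : l ^ (p + 1) = 0 := lamOf_pow _
  rwa [this, zero_mul, add_zero]

theorem twist_sup {i j : Fin 5} (hij : i ≠ j) :
    twist k p i (chartRing k p i) ⊔ twist k p j (chartRing k p j) =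
      twist k p i (chartRing k p i ⊔ chartRing k p j) := by
  rcases lt_or_gt_of_ne hij with h | h
  · exact twist_sup_of_lt h
  · rw [sup_comm, twist_sup_of_lt h, twist_overlap_eq h, overlapRing, sup_comm]

/-- The twisted algebras are isomorphic images of `R_i[λ]` and `R_ij[λ]`, so the localization
property of the untwisted charts carries over. -/
theorem isLocStep_twist (i j : Fin 5) : IsLocStep (twist k p i (chartRing k p i))
    (twist k p i (chartRing k p i) ⊔ twist k p j (chartRing k p j)) := by
  by_cases hij : i = j
  · subst hij
    rw [sup_idem]
    exact IsLocStep.refl _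
  rw [twist_sup hij]
  obtain ⟨hle, f, hf, g, hg, hfg, hs⟩ := isLocStep_chartRing k p i j
  refine ⟨twist_mono k p i hle, psiExt k p i 4 (f ⊗ₜ 1), ⟨(⟨f, hf⟩ : chartRing k p i) ⊗ₜ 1, rfl⟩,
    psiExt k p i 4 (g ⊗ₜ 1), ⟨(⟨g, hg⟩ : ↥(chartRing k p i ⊔ chartRing k p j)) ⊗ₜ 1, rfl⟩, ?_, ?_⟩
  · rw [← map_mul, Algebra.TensorProduct.tmul_mul_tmul, hfg, one_mul, ← Algebra.TensorProduct.one_def,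
      map_one]
  · rintro _ ⟨x, rfl⟩
    change ∃ n : ℕ, _ * psiExt k p i 4 (valLam k p (chartRing k p i ⊔ chartRing k p j) x) ∈ _
    have key : ∃ n : ℕ, (f ⊗ₜ 1) ^ n * valLam k p (chartRing k p i ⊔ chartRing k p j) x ∈ (valLam k p (chartRing k p i)).range := by
      induction x using TensorProduct.induction_on with
      | zero => exact ⟨0, by simp⟩
      | tmul s a =>
        obtain ⟨n, hn⟩ := hs s s.2
        refine ⟨n, ?_⟩
        rw [valLam_tmul, Algebra.TensorProduct.tmul_pow, Algebra.TensorProduct.tmul_mul_tmul, one_pow,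
          one_mul]
        exact tmul_mem_range_valLam hn a
      | add x y hx hy =>
        obtain ⟨m, hm⟩ := hx
        obtain ⟨n, hn⟩ := hy
        have hF : ∀ l : ℕ, (f ⊗ₜ[k] (1 : (kl k p).carrier)) ^ l ∈ (valLam k p (chartRing k p i)).range :=
          fun l => pow_mem (tmul_mem_range_valLam hf 1) l
        refine ⟨m + n, ?_⟩
        have := add_mem (mul_mem (hF n) hm) (mul_mem (hF m) hn)
        convert this using 1
        rw [map_add]
        ring
    obtain ⟨n, y, hy⟩ := key
    refine ⟨n, y, ?_⟩
    change psiExt k p i 4 (valLam k p (chartRing k p i) y) = _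
    rw [← map_pow, ← map_mul, ← hy]
    rfl

end Twist

/-! ### Existence of the glued deformation -/

theorem left_le_overlapRing (k : Type u) [Field k] (p : ℕ) (i j : Fin 5) :
    chartRing k p i ≤ overlapRing k p i j := le_sup_left

theorem right_le_overlapRing (k : Type u) [Field k] (p : ℕ) (i j : Fin 5) :
    chartRing k p j ≤ overlapRing k p i j := le_sup_right

theorem X0.isPullback_overlap (k : Type u) [Field k] (p : ℕ) [Fact p.Prime] (i j : Fin 5) :
    IsPullback (specAlg k (Subalgebra.inclusion (left_le_overlapRing k p i j)))
      (specAlg k (Subalgebra.inclusion (right_le_overlapRing k p i j)))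
      (X0.chart k p i) (X0.chart k p j) :=
  X0.isPullback_chart k p i j

section Existence

variable {k : Type u} [Field k] {p : ℕ} [Fact p.Prime] [CharP k p]

/-- The twisted charts are subalgebras of one ring and are glued along inclusions, so no separate
cocycle verification on triple overlaps is needed. Transporting back along the isomorphisms ψ_i4
restores the prescribed transition maps. -/
theorem exists_glued_scheme : ∃ (Y : Scheme.{u})
    (g : (i : Fin 5) → (Spec (.of (Adj k p (chartRing k p i))) ⟶ Y)) (f : Y ⟶ Spec (.of k)),
    (∀ i, IsOpenImmersion (g i)) ∧ (∀ z : Y, ∃ i, z ∈ Set.range (g i)) ∧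
    (∀ i, g i ≫ f = Spec.map (CommRingCat.ofHom (algebraMap k _))) ∧ IsSeparated f ∧
    ∀ i j, i < j → ∃ ψ, IsPsi k p i j ψ ∧
      IsPullback (specAlg k (inclLam k p (right_le_overlapRing k p i j)))
        (specAlg k ψ.toAlgHom ≫
          specAlg k (inclLam k p (left_le_overlapRing k p i j)))
        (g j) (g i) := by
  obtain ⟨Y, g, f, ho, hc, hf, hp, hsep⟩ :=
    exists_glue (fun i : Fin 5 => twist k p i (chartRing k p i)) isLocStep_twist
  let e : ∀ i (S : Subalgebra k (Laurent k)), Adj k p S ≃ₐ[k] twist k p i S := fun i S =>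
    AlgEquiv.ofInjective (twistHom k p i S) (twistHom_injective k p i S)
  refine ⟨Y, fun i => (specEquiv (e i (chartRing k p i))).inv ≫ g i, f, fun i => inferInstance,
    fun z => ?_, fun i => ?_, hsep, fun i j hij => ?_⟩
  · obtain ⟨i, y, rfl⟩ := hc z
    refine ⟨i, (specEquiv (e i (chartRing k p i))).hom y, ?_⟩
    rw [← Scheme.Hom.comp_apply, Iso.hom_inv_id_assoc]
  · rw [Category.assoc, hf]
    exact specAlg_toSpecK _
  · obtain ⟨ψ, hψ⟩ := exists_isPsi (k := k) (p := p) hij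
    refine ⟨ψ, hψ, ?_⟩
    have hsup : twist k p j (overlapRing k p i j) =
        twist k p i (chartRing k p i) ⊔ twist k p j (chartRing k p j) := by
      rw [twist_sup_of_lt hij, twist_overlap_eq hij]
    refine (hp i j).flip.of_iso
      (specEquiv ((e j (overlapRing k p i j)).trans (Subalgebra.equivOfEq _ _ hsup)))
      (specEquiv (e j (chartRing k p j))) (specEquiv (e i (chartRing k p i))) (Iso.refl _) ?_ ?_ ?_ ?_
    · refine (specAlg_comp _ _).trans (Eq.trans ?_ (specAlg_comp _ _).symm)
      congr 1
      refine AlgHom.ext fun x => Subtype.ext ?_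
      exact congrArg (psiExt k p j 4) (valLam_inclLam (right_le_overlapRing k p i j) x).symm
    · rw [specAlg_comp]
      refine (specAlg_comp _ _).trans (Eq.trans ?_ (specAlg_comp _ _).symm)
      congr 1
      refine AlgHom.ext fun x => Subtype.ext ?_
      refine Eq.trans ?_ (twistHom_isPsi hij hψ _).symm
      exact congrArg (psiExt k p i 4) (valLam_inclLam (left_le_overlapRing k p i j) x).symm
    · rw [Iso.hom_inv_id_assoc]
      exact Category.comp_id _
    · rw [Iso.hom_inv_id_assoc]
      exact Category.comp_id _

/-- The gluing data of the deformation. -/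
def IsGluing {Y : Scheme.{u}} (g : (i : Fin 5) → (Spec (.of (Adj k p (chartRing k p i))) ⟶ Y)) : Prop :=
  ∀ i j, i < j → ∃ ψ, IsPsi k p i j ψ ∧
    IsPullback (specAlg k (inclLam k p (right_le_overlapRing k p i j)))
      (specAlg k ψ.toAlgHom ≫ specAlg k (inclLam k p (left_le_overlapRing k p i j))) (g j) (g i)

theorem specAlg_redLam_inclLam {S S' : Subalgebra k (Laurent k)} (h : S ≤ S') :
    specAlg k (Subalgebra.inclusion h) ≫ specAlg k (redLam k p S) =
      specAlg k (redLam k p S') ≫ specAlg k (inclLam k p h) := by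
  rw [specAlg_comp, specAlg_comp]
  exact congrArg (specAlg k) (redLam_inclLam h).symm

theorem specAlg_redLam_isPsi {i j : Fin 5}
    {ψ : Adj k p (overlapRing k p i j) ≃ₐ[k] Adj k p (overlapRing k p i j)} (hψ : IsPsi k p i j ψ) :
    specAlg k (redLam k p _) ≫ specAlg k ψ.toAlgHom = specAlg k (redLam k p (overlapRing k p i j)) := by
  rw [specAlg_comp]
  exact congrArg (specAlg k) (AlgHom.ext fun x => redLam_isPsi hψ x)

theorem specAlg_redLam_isPsi_inclLam {i j : Fin 5}
    {ψ : Adj k p (overlapRing k p i j) ≃ₐ[k] Adj k p (overlapRing k p i j)} (hψ : IsPsi k p i j ψ) :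
    specAlg k (Subalgebra.inclusion (left_le_overlapRing k p i j)) ≫
        specAlg k (redLam k p (chartRing k p i)) =
      specAlg k (redLam k p _) ≫ specAlg k ψ.toAlgHom ≫
        specAlg k (inclLam k p (left_le_overlapRing k p i j)) := by
  rw [specAlg_redLam_inclLam, ← Category.assoc, specAlg_redLam_isPsi hψ]

theorem comp_eq_comp_of_factor {C : Type*} [Category C] {W V V' U U' O Y : C} {a : W ⟶ V} {b : W ⟶ V'}
    {r : V ⟶ U} {r' : V' ⟶ U'} {ρ : W ⟶ O} {l : O ⟶ U} {l' : O ⟶ U'} {g : U ⟶ Y} {g' : U' ⟶ Y}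
    (h1 : a ≫ r = ρ ≫ l) (h2 : b ≫ r' = ρ ≫ l') (h3 : l' ≫ g' = l ≫ g) :
    a ≫ r ≫ g = b ≫ r' ≫ g' := by
  rw [← Category.assoc, h1, Category.assoc, ← h3, ← Category.assoc, ← h2, Category.assoc]

section Gluing

variable {Y : Scheme.{u}} {g : (i : Fin 5) → (Spec (.of (Adj k p (chartRing k p i))) ⟶ Y)}
  (ho : ∀ i, IsOpenImmersion (g i)) (hc : ∀ z : Y, ∃ i, z ∈ Set.range (g i)) (hg : IsGluing g)

theorem IsGluing.exists_toBase (ho : ∀ i, IsOpenImmersion (g i))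
    (hc : ∀ z : Y, ∃ i, z ∈ Set.range (g i)) (hg : IsGluing g) : ∃ t : Y ⟶ (kl k p).spec,
      ∀ i, g i ≫ t = specAlg k Algebra.TensorProduct.includeRight := by
  choose! ψ hψ hp using hg
  refine exists_desc_of_cover g ho hc (fun i j hij => (hp i j hij).flip)
    (fun i => specAlg k (Algebra.TensorProduct.includeRight :
      (kl k p).carrier →ₐ[k] Adj k p (chartRing k p i))) (fun i j hij => ?_)
  rw [Category.assoc, specAlg_comp, specAlg_comp, specAlg_comp]
  exact congrArg (specAlg k) (AlgHom.ext fun a => isPsi_tmul (hψ i j hij) a)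

theorem IsGluing.exists_incl (hg : IsGluing g) : ∃ ι : X0 k p ⟶ Y,
    ∀ i, X0.chart k p i ≫ ι = specAlg k (redLam k p (chartRing k p i)) ≫ g i := by
  choose! ψ hψ hp using hg
  exact exists_desc_of_cover (X0.chart k p) inferInstance (X0.isCharts k p).covers
    (fun i j _ => X0.isPullback_overlap k p i j)
    (fun i => specAlg k (redLam k p (chartRing k p i)) ≫ g i)
    (fun i j hij => comp_eq_comp_of_factor (specAlg_redLam_isPsi_inclLam (hψ i j hij))
      (specAlg_redLam_inclLam (right_le_overlapRing k p i j)) (hp i j hij).w)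

theorem specAlg_redLam_injective (S : Type u) [CommRing S] [Algebra k S] :
    Function.Injective (specAlg k (redLam k p S)) :=
  PrimeSpectrum.comap_injective_of_surjective (redLam k p S).toRingHom redLam_surjective

/-- A common point of two thickened charts lies in the thickened overlap, and reduction modulo λ is
bijective on points. So the points of the closed fibre are identified exactly as in the original
surface. -/
theorem IsGluing.chart_eq_chart (hg : IsGluing g) {i j : Fin 5} (hij : i < j)
    (v : Spec (.of (chartRing k p i))) (w : Spec (.of (chartRing k p j)))
    (h : g i (specAlg k (redLam k p _) v) = g j (specAlg k (redLam k p _) w)) :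
    X0.chart k p i v = X0.chart k p j w := by
  obtain ⟨ψ, hψ, hp⟩ := hg i j hij
  obtain ⟨q, hq1, hq2⟩ := Scheme.exists_preimage_of_isPullback hp _ _ h.symm
  obtain ⟨q', rfl⟩ := surjective_specAlg_redLam q
  have h1 : specAlg k (Subalgebra.inclusion (left_le_overlapRing k p i j)) q' = v := by
    apply specAlg_redLam_injective (k := k) (p := p)
    rw [← hq2]
    exact congrArg (fun f => f q') (specAlg_redLam_isPsi_inclLam hψ)
  have h2 : specAlg k (Subalgebra.inclusion (right_le_overlapRing k p i j)) q' = w := by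
    apply specAlg_redLam_injective (k := k) (p := p)
    rw [← hq1]
    exact congrArg (fun f => f q') (specAlg_redLam_inclLam (p := p) (right_le_overlapRing k p i j))
  rw [← h1, ← h2]
  exact congrArg (fun f => f q') (X0.isPullback_overlap k p i j).w

theorem IsGluing.isPullback_incl (ho : ∀ i, IsOpenImmersion (g i)) (hg : IsGluing g) {ι : X0 k p ⟶ Y}
    (hι : ∀ i, X0.chart k p i ≫ ι = specAlg k (redLam k p (chartRing k p i)) ≫ g i) (i : Fin 5) :
    IsPullback (X0.chart k p i) (specAlg k (redLam k p (chartRing k p i))) ι (g i) := by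
  have hι' : ∀ i v, ι (X0.chart k p i v) = g i (specAlg k (redLam k p _) v) := fun i v =>
    congrArg (fun f => f v) (hι i)
  refine (IsOpenImmersion.isPullback _ _ _ _ (hι i) ?_).flip
  ext x
  change ι x ∈ Set.range (g i) ↔ x ∈ Set.range (X0.chart k p i)
  constructor
  · rintro ⟨q, hq⟩
    obtain ⟨v, rfl⟩ := surjective_specAlg_redLam q
    refine ⟨v, ?_⟩
    obtain ⟨j, w, rfl⟩ := (X0.isCharts k p).covers x
    rw [hι'] at hq
    rcases lt_trichotomy i j with hij | rfl | hij
    · exact hg.chart_eq_chart hij _ _ hq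
    · congr 1
      exact specAlg_redLam_injective _ ((g i).isOpenEmbedding.injective hq)
    · exact (hg.chart_eq_chart hij _ _ hq.symm).symm
  · rintro ⟨v, rfl⟩
    exact ⟨_, (hι' i v).symm⟩

theorem flat_specAlg_includeRight (S : Type u) [CommRing S] [Algebra k S] :
    Flat (specAlg k (Algebra.TensorProduct.includeRight : (kl k p).carrier →ₐ[k] Adj k p S)) :=
  MorphismProperty.of_isPullback (P := @Flat) (isPullback_specAlg_include S (kl k p)) inferInstance

theorem locallyOfFiniteType_specAlg_includeRight (S : Type u) [CommRing S] [Algebra k S]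
    (h : LocallyOfFiniteType (Spec.map (CommRingCat.ofHom (algebraMap k S)))) :
    LocallyOfFiniteType (specAlg k (Algebra.TensorProduct.includeRight :
      (kl k p).carrier →ₐ[k] Adj k p S)) :=
  MorphismProperty.of_isPullback (P := @LocallyOfFiniteType)
    (isPullback_specAlg_include S (kl k p)) h

instance surjective_pt (A : ArtAlg k) : Surjective A.pt := by
  have : Subsingleton (PrimeSpectrum A.carrier) := inferInstance
  have h : Nontrivial k := inferInstance
  exact ⟨fun y => ⟨(⟨⊥, Ideal.isPrime_bot⟩ : PrimeSpectrum k),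
    Subsingleton.elim (α := PrimeSpectrum A.carrier) _ _⟩⟩

end Gluing

theorem exists_isGluedDeformation : ∃ D, IsGluedDeformation k p (X0.chart k p) D := by
  obtain ⟨Y, g, f, ho, hc, hf, hsep, hg⟩ := exists_glued_scheme (k := k) (p := p)
  replace hg : IsGluing g := hg
  obtain ⟨t, ht⟩ := hg.exists_toBase ho hc
  obtain ⟨ι, hι⟩ := hg.exists_incl
  have htf : t ≫ (kl k p).toSpecK = f := by
    refine hom_ext_of_cover g ho hc fun i => ?_
    rw [← Category.assoc, ht, hf]
    exact specAlg_toSpecK _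
  have hsq : ∀ i, IsPullback (specAlg k (redLam k p (chartRing k p i)))
      (X0.chart k p i ≫ X0.toSpecK k p) (g i ≫ t) (kl k p).pt := fun i => by
    rw [ht, X0.chart_toSpecK]
    exact isPullback_specAlg_redLam p _
  have hw : ι ≫ t = X0.toSpecK k p ≫ (kl k p).pt := by
    refine hom_ext_of_cover (X0.chart k p) inferInstance (X0.isCharts k p).covers fun i => ?_
    rw [← Category.assoc, hι, Category.assoc, (hsq i).w, Category.assoc]
  have h0 : NeZero p := ⟨(Fact.out : p.Prime).ne_zero⟩
  -- The base has a single point, so the nonempty closed fibre already gives surjectivity.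
  have hsurj : Surjective (ι ≫ t) := by
    rw [hw]
    infer_instance
  have hflat : ∀ i, Flat (g i ≫ t) := fun i => by
    rw [ht]
    exact flat_specAlg_includeRight _
  have hft : ∀ i, LocallyOfFiniteType (g i ≫ t) := fun i => by
    rw [ht]
    refine locallyOfFiniteType_specAlg_includeRight (chartRing k p i) ?_
    rw [← X0.chart_toSpecK]
    infer_instance
  have hc1 : IsZariskiLocalAtSource (@Flat.{u}) := HasRingHomProperty.instIsZariskiLocalAtSource
  have hc2 : IsZariskiLocalAtSource (@LocallyOfFiniteType.{u}) :=
    HasRingHomProperty.instIsZariskiLocalAtSource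
  have hqc : QuasiCompact t := by
    have : Finite (coverOf g ho hc).I₀ := inferInstanceAs (Finite (Fin 5))
    have : ∀ i, CompactSpace ((coverOf g ho hc).X i) := fun i =>
      inferInstanceAs (CompactSpace (PrimeSpectrum _))
    have hcomp : CompactSpace Y := Scheme.OpenCover.compactSpace (coverOf g ho hc)
    infer_instance
  -- The gluing was shown to be separated over `k`; separatedness over `k[λ]` follows by
  -- cancellation.
  have hsep' : IsSeparated (t ≫ (kl k p).toSpecK) := by rwa [htf]
  let D : Deformation (X0.toSpecK k p) (kl k p) :=
    { total := Y
      toBase := t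
      incl := ι
      flat := (IsZariskiLocalAtSource.iff_of_openCover (P := @Flat.{u}) (coverOf g ho hc)).mpr hflat
      surjective := .of_comp ι t
      separated := IsSeparated.of_comp t (kl k p).toSpecK
      locallyOfFiniteType := (IsZariskiLocalAtSource.iff_of_openCover (P := @LocallyOfFiniteType.{u})
        (coverOf g ho hc)).mpr hft
      quasiCompact := hqc
      isPullback := isPullback_of_cover g ho hc hw (X0.chart k p)
        (fun i => specAlg k (redLam k p (chartRing k p i))) (hg.isPullback_incl ho hι) hsq }
  exact ⟨D, g, ho, hc, ht, hι, hg⟩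

end Existence

/-! ### Charts of trivial deformations -/

/-- The inclusion `S → S ⊗ A`. -/
abbrev inclTensor {k : Type u} [Field k] (S : Type u) [CommRing S] [Algebra k S] (A : ArtAlg k) :
    S →ₐ[k] S ⊗[k] A.carrier := Algebra.TensorProduct.includeLeft

section TrivialCharts

variable {k : Type u} [Field k] {X : Scheme.{u}} {s : X ⟶ Spec (.of k)} {A : ArtAlg k}

theorem Deformation.isTrivial_trivial (s : X ⟶ Spec (.of k)) [Surjective s] [IsSeparated s]
    [LocallyOfFiniteType s] [QuasiCompact s] (A : ArtAlg k) : (Deformation.trivial s A).IsTrivial :=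
  ⟨pullback.fst s A.toSpecK, pullback.lift_fst _ _ _, IsPullback.of_hasPullback s A.toSpecK⟩

theorem Deformation.IsTrivial.baseChange {D : Deformation s A} {B : ArtAlg k} (h : D.IsTrivial)
    (f : A ⟶ B) : (D.baseChange f).IsTrivial := by
  obtain ⟨r, h1, h2⟩ := h
  refine ⟨D.proj f ≫ r, ?_, ?_⟩
  · rw [← Category.assoc, D.baseChange_incl_proj, h1]
  · rw [← ArtAlg.specMap_toSpecK f]
    exact (D.baseChange_isPullback f).paste_horiz h2

theorem Deformation.IsTrivial.isLocallyTrivial {D : Deformation s A} (h : D.IsTrivial) :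
    D.IsLocallyTrivial := by
  obtain ⟨r, h1, h2⟩ := h
  intro x
  refine ⟨⊤, ⊤, rfl, _root_.trivial, (⊤ : D.total.Opens).ι ≫ r ≫ (Scheme.topIso X).inv, ?_, ?_⟩
  · rw [← cancel_mono (Scheme.topIso X).hom]
    simp only [Category.assoc, Iso.inv_hom_id, Category.comp_id, Category.id_comp]
    rw [← Category.assoc, Scheme.Hom.resLE_comp_ι, Category.assoc, h1, Category.comp_id]
    rfl
  · refine h2.of_iso (Scheme.topIso D.total).symm (Scheme.topIso X).symm (Iso.refl _) (Iso.refl _)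
      ?_ ?_ ?_ ?_
    · simp only [Iso.symm_hom]
      rw [← Category.assoc]
      change _ = ((Scheme.topIso D.total).inv ≫ (Scheme.topIso D.total).hom) ≫ _
      rw [Iso.inv_hom_id, Category.id_comp]
    · change _ = (Scheme.topIso D.total).inv ≫ (Scheme.topIso D.total).hom ≫ _
      rw [Iso.inv_hom_id_assoc]
      exact Category.comp_id _
    · change _ = (Scheme.topIso X).inv ≫ (Scheme.topIso X).hom ≫ _
      rw [Iso.inv_hom_id_assoc]
      exact Category.comp_id _
    · simp

variable {E : Deformation s A} {r : E.total ⟶ X} (hr : IsPullback r E.toBase s A.toSpecK)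
  {S : Type u} [CommRing S] [Algebra k S] {c : Spec (.of S) ⟶ X}
  (hc : c ≫ s = Spec.map (CommRingCat.ofHom (algebraMap k S)))

/-- The chart of a trivial deformation over a chart of the closed fibre. -/
def trivChart : Spec (.of (S ⊗[k] A.carrier)) ⟶ E.total :=
  hr.lift (specAlg k (Algebra.TensorProduct.includeLeft : S →ₐ[k] S ⊗[k] A.carrier) ≫ c)
    (specAlg k (Algebra.TensorProduct.includeRight : A.carrier →ₐ[k] S ⊗[k] A.carrier)) (by
      rw [Category.assoc, hc]
      exact (isPullback_specAlg_include S A).w)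

theorem trivChart_fst : trivChart hr hc ≫ r =
    specAlg k (Algebra.TensorProduct.includeLeft : S →ₐ[k] S ⊗[k] A.carrier) ≫ c :=
  hr.lift_fst _ _ _

theorem trivChart_snd : trivChart hr hc ≫ E.toBase =
    specAlg k (Algebra.TensorProduct.includeRight : A.carrier →ₐ[k] S ⊗[k] A.carrier) :=
  hr.lift_snd _ _ _

theorem isPullback_trivChart : IsPullback (trivChart hr hc)
    (specAlg k (Algebra.TensorProduct.includeLeft : S →ₐ[k] S ⊗[k] A.carrier)) r c := by
  refine IsPullback.of_right (h₁₂ := E.toBase) (v₁₃ := A.toSpecK) (h₂₂ := s) ?_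
    (trivChart_fst hr hc) hr.flip
  rw [trivChart_snd, hc]
  exact (isPullback_specAlg_include S A).flip

theorem isOpenImmersion_trivChart [IsOpenImmersion c] : IsOpenImmersion (trivChart hr hc) :=
  MorphismProperty.of_isPullback (P := @IsOpenImmersion) (isPullback_trivChart hr hc).flip
    inferInstance

theorem mem_range_trivChart {z : E.total} :
    z ∈ Set.range (trivChart hr hc) ↔ r z ∈ Set.range c := by
  constructor
  · rintro ⟨w, rfl⟩
    exact ⟨_, (congrArg (fun f => f w) (trivChart_fst hr hc)).symm⟩
  · rintro ⟨w, hw⟩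
    obtain ⟨q, hq, -⟩ := Scheme.exists_preimage_of_isPullback (isPullback_trivChart hr hc) z w hw.symm
    exact ⟨q, hq⟩

theorem map_comp_trivChart {S' : Type u} [CommRing S'] [Algebra k S'] {c' : Spec (.of S') ⟶ X}
    (hc' : c' ≫ s = Spec.map (CommRingCat.ofHom (algebraMap k S'))) (f : S →ₐ[k] S')
    (hf : specAlg k f ≫ c = c') :
    specAlg k (Algebra.TensorProduct.map f (AlgHom.id k A.carrier)) ≫ trivChart hr hc =
      trivChart hr hc' := by
  refine hr.hom_ext ?_ ?_
  · rw [Category.assoc, trivChart_fst, trivChart_fst, ← hf, ← Category.assoc, ← Category.assoc,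
      specAlg_comp, specAlg_comp]
    rfl
  · rw [Category.assoc, trivChart_snd, trivChart_snd, specAlg_comp]
    exact congrArg (specAlg k) (AlgHom.ext fun x =>
      (Algebra.TensorProduct.map_tmul _ _ _ _).trans (by rw [map_one]; rfl))

theorem chart_incl_eq_trivChart {n : ℕ} [NeZero n] {E : Deformation s (ArtAlg.trunc k n)}
    {r : E.total ⟶ X} (hr : IsPullback r E.toBase s (ArtAlg.trunc k n).toSpecK)
    (hi : E.incl ≫ r = 𝟙 X) : c ≫ E.incl = specAlg k (redTrunc k n S) ≫ trivChart hr hc := by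
  refine hr.hom_ext ?_ ?_
  · rw [Category.assoc, hi, Category.assoc, trivChart_fst, ← Category.assoc, specAlg_comp]
    have h : (redTrunc k n S).comp Algebra.TensorProduct.includeLeft = AlgHom.id k S := by
      refine AlgHom.ext fun x => ?_
      change redTrunc k n S (x ⊗ₜ 1) = x
      rw [redTrunc_tmul, map_one, map_one, mul_one]
    rw [h, specAlg_id, Category.id_comp, Category.comp_id]
  · rw [Category.assoc, Category.assoc, trivChart_snd, E.isPullback.w, ← Category.assoc, hc,
      specAlg_comp]
    refine (Spec.map_comp _ _).symm.trans
      (congrArg Spec.map (CommRingCat.hom_ext (RingHom.ext fun a => ?_)))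
    change _ = redTrunc k n S (1 ⊗ₜ a)
    rw [redTrunc_tmul, one_mul]
    rfl

theorem isPullback_map_trivChart {S₁ S₂ S₃ : Type u} [CommRing S₁] [Algebra k S₁] [CommRing S₂]
    [Algebra k S₂] [CommRing S₃] [Algebra k S₃] {c₁ : Spec (.of S₁) ⟶ X} {c₂ : Spec (.of S₂) ⟶ X}
    [IsOpenImmersion c₁] [IsOpenImmersion c₂]
    (h₁ : c₁ ≫ s = Spec.map (CommRingCat.ofHom (algebraMap k S₁)))
    (h₂ : c₂ ≫ s = Spec.map (CommRingCat.ofHom (algebraMap k S₂)))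
    {f₁ : S₁ →ₐ[k] S₃} {f₂ : S₂ →ₐ[k] S₃}
    (hp : IsPullback (specAlg k f₁) (specAlg k f₂) c₁ c₂) :
    IsPullback (specAlg k (Algebra.TensorProduct.map f₁ (AlgHom.id k A.carrier)))
      (specAlg k (Algebra.TensorProduct.map f₂ (AlgHom.id k A.carrier)))
      (trivChart hr h₁) (trivChart hr h₂) := by
  have h₃ : (specAlg k f₁ ≫ c₁) ≫ s = Spec.map (CommRingCat.ofHom (algebraMap k S₃)) := by
    rw [Category.assoc, h₁]
    exact specAlg_toSpecK f₁
  have e₁ := map_comp_trivChart hr h₁ h₃ f₁ rfl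
  have e₂ := map_comp_trivChart hr h₂ h₃ f₂ hp.w.symm
  have : IsOpenImmersion (specAlg k f₁) :=
    MorphismProperty.of_isPullback (P := @IsOpenImmersion) hp.flip inferInstance
  have o₁ := isOpenImmersion_trivChart hr h₁
  have o₂ := isOpenImmersion_trivChart hr h₂
  have o₃ := isOpenImmersion_trivChart hr h₃
  rw [← e₁] at o₃
  have : IsOpenImmersion (specAlg k (Algebra.TensorProduct.map f₁ (AlgHom.id k A.carrier))) :=
    IsOpenImmersion.of_comp _ (trivChart hr h₁)
  refine isPullback_of_isOpenImmersion (e₁.trans e₂.symm) ?_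
  rw [e₁]
  rintro z ⟨hz₁, hz₂⟩
  rw [mem_range_trivChart] at hz₁ hz₂ ⊢
  obtain ⟨w₁, hw₁⟩ := hz₁
  obtain ⟨w₂, hw₂⟩ := hz₂
  obtain ⟨q, hq, -⟩ := Scheme.exists_preimage_of_isPullback hp w₁ w₂ (hw₁.trans hw₂.symm)
  exact ⟨q, by rw [Scheme.Hom.comp_apply, hq, hw₁]⟩

end TrivialCharts

/-! ### Local triviality of the glued deformation -/

section LocallyTrivial

variable {k : Type u} [Field k] {p : ℕ} [Fact p.Prime] [CharP k p]

/-- Each chart `R_i[λ]` is a product with the base, and the inclusion of `R_i` provides the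
retraction. The twist is only in the gluing. -/
theorem IsGluedDeformation.isLocallyTrivial {D : Deformation (X0.toSpecK k p) (kl k p)}
    (hD : IsGluedDeformation k p (X0.chart k p) D) : D.IsLocallyTrivial := by
  obtain ⟨g, ho, hc, ht, hι, hg⟩ := hD
  replace hg : IsGluing g := hg
  intro x
  obtain ⟨i, v, rfl⟩ := (X0.isCharts k p).covers x
  have hp := hg.isPullback_incl ho hι i
  have hU : (X0.chart k p i).opensRange = D.incl ⁻¹ᵁ (g i).opensRange := by
    ext y
    constructor
    · rintro ⟨w, rfl⟩
      exact ⟨_, (congrArg (fun f => f w) (hι i)).symm⟩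
    · rintro ⟨w, hw⟩
      obtain ⟨q, hq, -⟩ := Scheme.exists_preimage_of_isPullback hp y w hw.symm
      exact ⟨q, hq⟩
  let a := (X0.chart k p i).isoOpensRange
  let b := (g i).isoOpensRange
  have ha : a.hom ≫ (X0.chart k p i).opensRange.ι = X0.chart k p i := Scheme.Hom.isoOpensRange_hom_ι _
  have hb : b.hom ≫ (g i).opensRange.ι = g i := Scheme.Hom.isoOpensRange_hom_ι _
  let l := specAlg k (inclTensor (chartRing k p i) (kl k p))
  have hl : specAlg k (redLam k p (chartRing k p i)) ≫ l = 𝟙 _ := by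
    rw [specAlg_comp, ← specAlg_id (k := k)]
    refine congrArg (specAlg k) (AlgHom.ext fun s => ?_)
    change redLam k p _ (s ⊗ₜ 1) = s
    rw [redLam_tmul, map_one, map_one, mul_one]
  refine ⟨_, _, hU, ⟨v, rfl⟩, b.inv ≫ l ≫ a.hom, ?_, ?_⟩
  · rw [← cancel_epi a.hom, Category.comp_id, ← Category.assoc, ← Category.assoc]
    have h1 : a.hom ≫ D.incl.resLE (g i).opensRange (X0.chart k p i).opensRange hU.le =
        specAlg k (redLam k p (chartRing k p i)) ≫ b.hom := by
      rw [← cancel_mono (g i).opensRange.ι, Category.assoc, Category.assoc, Scheme.Hom.resLE_comp_ι,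
        hb, ← Category.assoc, ha, hι]
    rw [h1, Category.assoc (specAlg _ _), b.hom_inv_id, Category.comp_id, ← Category.assoc, hl,
      Category.id_comp]
  · refine (isPullback_specAlg_include (chartRing k p i) (kl k p)).of_iso b a (Iso.refl _) (Iso.refl _)
      ?_ ?_ ?_ ?_
    · rw [Iso.hom_inv_id_assoc]
    · rw [← Category.assoc, hb, ht]
      exact Category.comp_id _
    · rw [← Category.assoc, ha, X0.chart_toSpecK]
      exact Category.comp_id _
    · simp

end LocallyTrivial

/-! ### Reduction modulo `λ^p` -/

section Epsilon

variable (k : Type u) [Field k] (p : ℕ)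

/-- `S[ε] = S ⊗_k k[ε]`, where `ε^p = 0`. -/
abbrev Eps [NeZero p] (S : Type u) [CommRing S] [Algebra k S] : Type u :=
  S ⊗[k] (ArtAlg.trunc k p).carrier

/-- The truncation `S[λ] → S[ε]`. -/
def truncLam [NeZero p] (S : Type u) [CommRing S] [Algebra k S] :
    Adj k p S →ₐ[k] Eps k p S :=
  Algebra.TensorProduct.map (AlgHom.id k S) (ArtAlg.Hom.toAlgHom (ArtAlg.truncMap k p))

/-- The inclusion `S[ε] → k[x, x⁻¹, y, y⁻¹][ε]`. -/
def valEps [NeZero p] (S : Subalgebra k (Laurent k)) :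
    Eps k p S →ₐ[k] Eps k p (Laurent k) :=
  Algebra.TensorProduct.map S.val (AlgHom.id k _)

/-- The inclusion `S[ε] → S'[ε]` of subalgebras `S ≤ S'`. -/
def inclEps [NeZero p] {S S' : Subalgebra k (Laurent k)} (h : S ≤ S') :
    Eps k p S →ₐ[k] Eps k p S' :=
  Algebra.TensorProduct.map (Subalgebra.inclusion h) (AlgHom.id k _)

theorem toAlgHom_truncMap_t [NeZero p] :
    ArtAlg.Hom.toAlgHom (ArtAlg.truncMap k p) (ArtAlg.t k (p + 1)) = ArtAlg.t k p := by
  exact AdjoinRoot.liftAlgHom_root (Polynomial.X ^ (p + 1)) (Algebra.ofId k (ArtAlg.Trunc k p))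
    (AdjoinRoot.root (Polynomial.X ^ p)) _

variable {k p}

section

variable [NeZero p]

theorem truncLam_tmul (S : Type u) [CommRing S] [Algebra k S] (s : S) (a : (kl k p).carrier) :
    truncLam k p S (s ⊗ₜ a) = s ⊗ₜ ArtAlg.Hom.toAlgHom (ArtAlg.truncMap k p) a := rfl

theorem valEps_injective (S : Subalgebra k (Laurent k)) : Function.Injective (valEps k p S) :=
  tensor_map_injective Subtype.val_injective

theorem valEps_tmul (S : Subalgebra k (Laurent k)) (s : S) (a : (ArtAlg.trunc k p).carrier) :
    valEps k p S (s ⊗ₜ a) = (s : Laurent k) ⊗ₜ a := rfl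

theorem valEps_truncLam (S : Subalgebra k (Laurent k)) (x : Adj k p S) :
    valEps k p S (truncLam k p S x) = truncLam k p (Laurent k) (valLam k p S x) := by
  have : (valEps k p S).comp (truncLam k p S) = (truncLam k p (Laurent k)).comp (valLam k p S) :=
    Algebra.TensorProduct.ext' fun s a => rfl
  exact DFunLike.congr_fun this x

theorem valEps_inclEps {S S' : Subalgebra k (Laurent k)} (h : S ≤ S')
    (x : Eps k p S) :
    valEps k p S' (inclEps k p h x) = valEps k p S x := by
  have : (valEps k p S').comp (inclEps k p h) = valEps k p S :=
    Algebra.TensorProduct.ext' fun s a => rfl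
  exact DFunLike.congr_fun this x

theorem redTrunc_valEps (S : Subalgebra k (Laurent k)) (x : Eps k p S) :
    redTrunc k p (Laurent k) (valEps k p S x) = redTrunc k p S x :=
  DFunLike.congr_fun (redTrunc_map S.val) x

theorem redTrunc_truncLam (S : Type u) [CommRing S] [Algebra k S] :
    (redTrunc k p S).comp (truncLam k p S) = redLam k p S := by
  refine Algebra.TensorProduct.ext' fun s a => ?_
  rw [AlgHom.comp_apply, truncLam_tmul, redTrunc_tmul, redLam_tmul, ← ArtAlg.aug_comp (ArtAlg.truncMap k p)]
  rfl

/-- A homomorphism `S[λ] → S[ε]` over `k[λ] → k[ε]` which induces the identity modulo `λ` exhibits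
`Spec S[ε]` as the restriction of `Spec S[λ]`. -/
theorem isPullback_specAlg_of_redTrunc_comp_eq {S : Type u} [CommRing S] [Algebra k S]
    {ρ : Adj k p S →ₐ[k] Eps k p S}
    (h1 : ∀ a, ρ (1 ⊗ₜ a) = 1 ⊗ₜ ArtAlg.Hom.toAlgHom (ArtAlg.truncMap k p) a)
    (h2 : (redTrunc k p S).comp ρ = redLam k p S) :
    IsPullback (specAlg k ρ)
      (specAlg k (Algebra.TensorProduct.includeRight :
        (ArtAlg.trunc k p).carrier →ₐ[k] Eps k p S))
      (specAlg k (Algebra.TensorProduct.includeRight : (kl k p).carrier →ₐ[k] Adj k p S))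
      (ArtAlg.specMap (ArtAlg.truncMap k p)) := by
  have hτ : IsPullback (specAlg k (truncLam k p S))
      (specAlg k (Algebra.TensorProduct.includeRight :
        (ArtAlg.trunc k p).carrier →ₐ[k] Eps k p S))
      (specAlg k (Algebra.TensorProduct.includeRight : (kl k p).carrier →ₐ[k] Adj k p S))
      (ArtAlg.specMap (ArtAlg.truncMap k p)) := by
    refine IsPullback.of_right (h₁₂ := specAlg k (inclTensor S (kl k p)))
      (v₁₃ := Spec.map (CommRingCat.ofHom (algebraMap k S))) (h₂₂ := (kl k p).toSpecK) ?_ ?_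
      (isPullback_specAlg_include S (kl k p))
    · have h : (truncLam k p S).comp (inclTensor S (kl k p)) = inclTensor S (ArtAlg.trunc k p) :=
        AlgHom.ext fun s => (truncLam_tmul S s 1).trans (congrArg (s ⊗ₜ ·) (map_one _))
      rw [ArtAlg.specMap_toSpecK, specAlg_comp, h]
      exact isPullback_specAlg_include S (ArtAlg.trunc k p)
    · rw [specAlg_comp]
      refine Eq.trans (congrArg (specAlg k) (AlgHom.ext fun a => ?_)) (specAlg_comp _ _).symm
      rfl
  -- Extending ρ on `S` linearly over `k[ε]` factors it as the plain truncation followed by θ. As θ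
  -- is the identity modulo ε, it is an automorphism and preserves the cartesian square.
  let θ : Eps k p S →ₐ[k] Eps k p S :=
    Algebra.TensorProduct.lift (ρ.comp (inclTensor S (kl k p))) Algebra.TensorProduct.includeRight
      (fun _ _ => Commute.all _ _)
  have hθ : ∀ s a, θ (s ⊗ₜ a) = ρ (s ⊗ₜ 1) * (1 ⊗ₜ a) := fun s a => Algebra.TensorProduct.lift_tmul _ _ _ _ _
  have hb : Function.Bijective θ := by
    refine bijective_of_redTrunc_comp_eq θ (fun a => ?_) (Algebra.TensorProduct.ext' fun s a => ?_)
    · rw [hθ, ← Algebra.TensorProduct.one_def, map_one, one_mul]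
    · rw [AlgHom.comp_apply, hθ, map_mul, ← AlgHom.comp_apply, h2, redLam_tmul, redTrunc_tmul,
        redTrunc_tmul, map_one, map_one, mul_one, one_mul]
  have hρ : θ.comp (truncLam k p S) = ρ := by
    refine Algebra.TensorProduct.ext' fun s a => ?_
    rw [AlgHom.comp_apply, truncLam_tmul, hθ, ← h1, ← map_mul, Algebra.TensorProduct.tmul_mul_tmul,
      mul_one, one_mul]
  have hiso : IsIso (specAlg k θ) := isIso_specAlg k (AlgEquiv.ofBijective θ hb)
  have hθ' : IsPullback (specAlg k θ)
      (specAlg k (Algebra.TensorProduct.includeRight :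
        (ArtAlg.trunc k p).carrier →ₐ[k] Eps k p S))
      (specAlg k (Algebra.TensorProduct.includeRight :
        (ArtAlg.trunc k p).carrier →ₐ[k] Eps k p S)) (𝟙 _) := by
    refine IsPullback.of_horiz_isIso ⟨?_⟩
    rw [Category.comp_id, specAlg_comp]
    refine congrArg (specAlg k) (AlgHom.ext fun a => ?_)
    change θ (1 ⊗ₜ a) = 1 ⊗ₜ a
    rw [hθ, ← Algebra.TensorProduct.one_def, map_one, one_mul]
  have := hθ'.paste_horiz hτ
  rw [specAlg_comp, hρ, Category.id_comp] at this
  exact this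

end

variable (k p) [Fact p.Prime] [CharP k p]

/-- Compatible homomorphisms `R_i[λ] → R_i[ε]`, that is, a morphism from the trivial deformation
over `k[ε]` to the glued deformation. -/
structure IsTransition
    (ρ : (i : Fin 5) → Adj k p (chartRing k p i) →ₐ[k] Eps k p (chartRing k p i)) :
    Prop where
  tmul : ∀ i a, ρ i (1 ⊗ₜ a) = 1 ⊗ₜ ArtAlg.Hom.toAlgHom (ArtAlg.truncMap k p) a
  red : ∀ i, (redTrunc k p (chartRing k p i)).comp (ρ i) = redLam k p (chartRing k p i)
  overlap : ∀ i j, i < j → ∀ ψ, IsPsi k p i j ψ → ∃ ρ' : Adj k p (overlapRing k p i j) →ₐ[k]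
      Eps k p (overlapRing k p i j),
    ρ'.comp (inclLam k p (right_le_overlapRing k p i j)) =
      (inclEps k p (right_le_overlapRing k p i j)).comp (ρ j) ∧
    ρ'.comp (ψ.toAlgHom.comp (inclLam k p (left_le_overlapRing k p i j))) =
      (inclEps k p (left_le_overlapRing k p i j)).comp (ρ i)

variable {k p}

theorem truncLam_lam : truncLam k p (Laurent k) (lam k p) ^ p = 0 := by
  have : truncLam k p (Laurent k) (lam k p) = lamT k p (Laurent k) := by
    rw [lam, truncLam_tmul, toAlgHom_truncMap_t]
  rw [this, lamT_pow]

instance charP_adj : CharP (Adj k p (Laurent k)) p := by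
  have : Nontrivial (Adj k p (Laurent k)) := (redLam k p (Laurent k)).toRingHom.domain_nontrivial
  exact charP_of_injective_algebraMap (algebraMap k (Adj k p (Laurent k))).injective p

theorem truncLam_uOneAdd_pow :
    truncLam k p (Laurent k) ↑(uOneAdd k p ^ p) = 1 := by
  rw [Units.val_pow_eq_pow_val, uOneAdd_val, add_pow_char, one_pow, mul_pow, map_add, map_mul,
    map_one, map_pow, truncLam_lam, zero_mul, add_zero]

theorem truncLam_comp_subst (v : (Adj k p (Laurent k))ˣ) :
    (truncLam k p (Laurent k)).comp (subst k p (ux k p * uOneAdd k p ^ p) v) =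
      (truncLam k p (Laurent k)).comp (subst k p (ux k p) v) := by
  refine adj_algHom_ext (fun a => ?_) ?_ ?_
  · rw [AlgHom.comp_apply, AlgHom.comp_apply, subst_tmul, subst_tmul]
  · rw [AlgHom.comp_apply, AlgHom.comp_apply, subst_ux, subst_ux, Units.val_mul, map_mul,
      truncLam_uOneAdd_pow, mul_one]
  · rw [AlgHom.comp_apply, AlgHom.comp_apply, subst_uy, subst_uy]

theorem subst_ux_uy : subst k p (ux k p) (uy k p) = AlgHom.id k _ :=
  adj_algHom_ext (fun a => subst_tmul _ _ a) (subst_ux _ _) (subst_uy _ _)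

/-- The factor (1 + λ/y)^p = 1 + λ^p/y^p is 1 modulo λ^p. Only the translation of y survives, and it
occurs exactly in the transition maps out of the zeroth chart. -/
theorem truncLam_comp_psiExt {i j : Fin 5} (hij : i < j) :
    (truncLam k p (Laurent k)).comp (psiExt k p i j) =
      (truncLam k p (Laurent k)).comp (if i = 0 then psiExt k p 0 1 else AlgHom.id k _) := by
  have h1 := truncLam_comp_subst (k := k) (p := p) (uyAdd k p)
  have h2 := truncLam_comp_subst (k := k) (p := p) (uy k p)
  rw [subst_ux_uy] at h2
  have h3 : (truncLam k p (Laurent k)).comp (psiExt k p 3 4) =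
      (truncLam k p (Laurent k)).comp (AlgHom.id k _) := by
    rw [← h2, ← inv_uOneSub_pow]
    rfl
  fin_cases i <;> fin_cases j <;> first
    | exact absurd hij (by decide)
    | rfl
    | exact h1
    | exact h2
    | exact h3

/-- The point is that the translation of y extends over the singular chart once ε^p = 0: z = x^(-1)
y^p is fixed, because (y + ε)^p = y^p. -/
theorem exists_valEps_eq (i : Fin 5) : ∃ ρ : Adj k p (chartRing k p i) →ₐ[k]
    Eps k p (chartRing k p i),
    ∀ x, valEps k p (chartRing k p i) (ρ x) = truncLam k p (Laurent k)
      ((if i = 0 then psiExt k p 0 1 else AlgHom.id k _) (valLam k p (chartRing k p i) x)) := by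
  by_cases hi : i = 0
  · subst hi
    rw [if_pos rfl]
    let σ := (truncLam k p (Laurent k)).comp (psiExt k p 0 1)
    let B := (valEps k p (chartRing k p 0)).range
    have hmem : ∀ {m : ℤ × ℤ}, m ∈ cone p 0 → truncLam k p (Laurent k) (monoUnit k p m) ∈ B := fun {m} hm => by
      have h : mono k m ∈ chartRing k p 0 := by
        rw [chartRing_eq]
        exact mono_mem_monoAlg.mpr hm
      exact ⟨(⟨_, h⟩ : chartRing k p 0) ⊗ₜ ArtAlg.Hom.toAlgHom (ArtAlg.truncMap k p) 1, rfl⟩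
    have hle : (valLam k p (chartRing k p 0)).range ≤ B.comap σ := by
      rw [chartRing_eq]
      refine (range_valLam_monoAlg_le_iff fun a => ?_).mpr fun m hm => ?_
      · rw [Subalgebra.mem_comap, AlgHom.comp_apply, psiExt_tmul, truncLam_tmul]
        exact ⟨1 ⊗ₜ _, rfl⟩
      -- The exponents of monomials with image in `B` form a submonoid, so it is enough to treat the
      -- three generators x, y, z.
      · let M : AddSubmonoid (ℤ × ℤ) :=
          { carrier := {m | σ (monoUnit k p m) ∈ B}
            zero_mem' := by
              have : (monoUnit k p 0 : Adj k p (Laurent k)) = 1 := rfl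
              rw [Set.mem_ofPred_eq, this, map_one]
              exact one_mem _
            add_mem' := fun {a b} ha hb => by
              rw [Set.mem_ofPred_eq, ← monoUnit_mul, Units.val_mul, map_mul]
              exact mul_mem ha hb }
        have hy : truncLam k p (Laurent k) (uyAdd k p) ∈ B := by
          rw [uyAdd_val, map_add]
          refine add_mem (hmem (m := (0, 1)) (mem_dualCone.mpr (by simp))) ?_
          rw [lam, truncLam_tmul]
          exact ⟨1 ⊗ₜ _, rfl⟩
        have hσ : ∀ m, σ (monoUnit k p m) = truncLam k p (Laurent k) ↑(ux k p ^ m.1 * uyAdd k p ^ m.2) :=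
          fun m => congrArg _ (subst_monoUnit _ _ m)
        refine cone_zero_le p (M := M) ?_ ?_ ?_ hm
        · change σ (monoUnit k p _) ∈ B
          rw [hσ, zpow_one, zpow_zero, mul_one]
          exact hmem (m := (1, 0)) (mem_dualCone.mpr (by simp))
        · change σ (monoUnit k p _) ∈ B
          rw [hσ, zpow_one, zpow_zero, one_mul]
          exact hy
        · change σ (monoUnit k p _) ∈ B
          have h : truncLam k p (Laurent k) ↑(uyAdd k p ^ p) = truncLam k p (Laurent k) ↑(uy k p ^ p) := by
            rw [Units.val_pow_eq_pow_val, uyAdd_val, add_pow_char, map_add, map_pow _ (lam k p),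
              truncLam_lam, add_zero, Units.val_pow_eq_pow_val]
          rw [hσ, zpow_natCast, Units.val_mul, map_mul, h, ← map_mul, ← Units.val_mul, monoUnit_zpow,
            ← zpow_natCast, monoUnit_zpow, monoUnit_mul]
          refine hmem (mem_dualCone.mpr ?_)
          constructor <;> simp
    let e := AlgEquiv.ofInjective (valEps k p (chartRing k p 0)) (valEps_injective _)
    exact ⟨(e.symm : _ →ₐ[k] Eps k p (chartRing k p 0)).comp
      ((σ.comp (valLam k p (chartRing k p 0))).codRestrict B fun x => hle ⟨x, rfl⟩),
      fun x => congrArg Subtype.val (e.apply_symm_apply ⟨σ (valLam k p (chartRing k p 0) x), hle ⟨x, rfl⟩⟩)⟩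
  · rw [if_neg hi]
    exact ⟨truncLam k p _, valEps_truncLam _⟩

/-- Translation on the zeroth chart and plain truncation on the others are compatible, since the
zeroth chart absorbs the whole truncated cocycle. -/
theorem exists_isTransition : ∃ ρ, IsTransition k p ρ := by
  choose ρ hρ using exists_valEps_eq (k := k) (p := p)
  refine ⟨ρ, fun i a => ?_, fun i => ?_, fun i j hij ψ hψ => ?_⟩
  · apply valEps_injective
    rw [hρ, valLam_tmul, valEps_tmul]
    split_ifs
    · rw [OneMemClass.coe_one, psiExt_tmul]
      rfl
    · rfl
  · refine AlgHom.ext fun x => Subtype.ext ?_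
    rw [AlgHom.comp_apply, ← redTrunc_valEps, hρ, ← AlgHom.comp_apply, redTrunc_truncLam, ← redLam_valLam]
    split_ifs
    · rw [← AlgHom.comp_apply, redLam_psiExt]
    · rfl
  · refine ⟨truncLam k p _, AlgHom.ext fun x => valEps_injective _ ?_,
      AlgHom.ext fun x => valEps_injective _ ?_⟩
    · have hj : j ≠ 0 := fun h => absurd hij (by rw [h]; exact Fin.not_lt_zero i)
      rw [AlgHom.comp_apply, AlgHom.comp_apply, valEps_truncLam, valEps_inclEps, hρ, if_neg hj,
        valLam_inclLam]
      rfl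
    · rw [AlgHom.comp_apply, AlgHom.comp_apply, AlgHom.comp_apply, valEps_truncLam, valEps_inclEps, hρ]
      have := hψ (inclLam k p (left_le_overlapRing k p i j) x)
      refine (congrArg (truncLam k p (Laurent k)) this).trans ?_
      rw [valLam_inclLam, ← AlgHom.comp_apply, truncLam_comp_psiExt hij]
      rfl

end Epsilon

/-! ### The restriction of the glued deformation is trivial -/

section BaseChange

variable {k : Type u} [Field k] {p : ℕ} [Fact p.Prime] [CharP k p]

theorem specAlg_comp_eq_of_isTransition
    {ρ : (i : Fin 5) → Adj k p (chartRing k p i) →ₐ[k] Eps k p (chartRing k p i)}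
    (hρ : IsTransition k p ρ) {Y : Scheme.{u}}
    {g : (i : Fin 5) → (Spec (.of (Adj k p (chartRing k p i))) ⟶ Y)} (hg : IsGluing g)
    {i j : Fin 5} (hij : i < j) :
    specAlg k (inclEps k p (left_le_overlapRing k p i j)) ≫ specAlg k (ρ i) ≫ g i =
      specAlg k (inclEps k p (right_le_overlapRing k p i j)) ≫ specAlg k (ρ j) ≫ g j := by
  obtain ⟨ψ, hψ, hp⟩ := hg i j hij
  obtain ⟨ρ', h1, h2⟩ := hρ.overlap i j hij ψ hψ
  refine comp_eq_comp_of_factor (ρ := specAlg k ρ') ?_ ?_ hp.w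
  · rw [specAlg_comp, specAlg_comp, specAlg_comp, ← h2]
  · rw [specAlg_comp, specAlg_comp, ← h1]

/-- The compatible ring maps glue to a morphism from the trivial deformation over `k[ε]` to `D`. It
is cartesian over the base because it is so on every chart, and hence identifies its source with the
pullback of `D`. -/
theorem IsGluedDeformation.baseChange_isomorphic {D : Deformation (X0.toSpecK k p) (kl k p)}
    (hD : IsGluedDeformation k p (X0.chart k p) D)
    {E : Deformation (X0.toSpecK k p) (ArtAlg.trunc k p)} (hE : E.IsTrivial) :
    (D.baseChange (ArtAlg.truncMap k p)).Isomorphic E := by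
  obtain ⟨g, ho, hc, ht, hι, hg⟩ := hD
  replace hg : IsGluing g := hg
  obtain ⟨r, hi, hr⟩ := hE
  obtain ⟨ρ, hρ⟩ := exists_isTransition (k := k) (p := p)
  have hs := X0.chart_toSpecK k p
  let γ := fun i => trivChart hr (hs i)
  have hγo : ∀ i, IsOpenImmersion (γ i) := fun i => isOpenImmersion_trivChart hr (hs i)
  have hγc : ∀ z : E.total, ∃ i, z ∈ Set.range (γ i) := fun z => by
    obtain ⟨i, hi⟩ := (X0.isCharts k p).covers (r z)
    exact ⟨i, (mem_range_trivChart hr (hs i)).mpr hi⟩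
  obtain ⟨q, hq⟩ := exists_desc_of_cover γ hγo hγc
    (fun i j _ => isPullback_map_trivChart hr (hs i) (hs j) (X0.isPullback_overlap k p i j))
    (fun i => specAlg k (ρ i) ≫ g i) (fun i j hij => specAlg_comp_eq_of_isTransition hρ hg hij)
  have hiq : E.incl ≫ q = D.incl := by
    refine hom_ext_of_cover (X0.chart k p) inferInstance (X0.isCharts k p).covers fun i => ?_
    rw [← Category.assoc, chart_incl_eq_trivChart (hs i) hr hi, Category.assoc]
    refine (congrArg _ (hq i)).trans ?_
    rw [← Category.assoc, specAlg_comp, hρ.red, hι]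
  have hsq : ∀ i, IsPullback (specAlg k (ρ i)) (γ i ≫ E.toBase) (g i ≫ D.toBase)
      (ArtAlg.specMap (ArtAlg.truncMap k p)) := fun i => by
    rw [ht, trivChart_snd]
    exact isPullback_specAlg_of_redTrunc_comp_eq (hρ.tmul i) (hρ.red i)
  -- All points of the thickening come from the closed fibre, where the morphism is known to be the
  -- inclusion of the surface in `D`.
  have hsurj : Function.Surjective E.incl := fun z => by
    obtain ⟨i, w, rfl⟩ := hγc z
    obtain ⟨v, rfl⟩ := surjective_specAlg_redTrunc w
    exact ⟨X0.chart k p i v, congrArg (fun f => f v) (chart_incl_eq_trivChart (hs i) hr hi)⟩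
  have hpb : ∀ i, IsPullback (γ i) (specAlg k (ρ i)) q (g i) := fun i => by
    refine (IsOpenImmersion.isPullback _ _ _ _ (hq i) ?_).flip
    ext z
    change q z ∈ Set.range (g i) ↔ z ∈ Set.range (γ i)
    constructor
    · rintro ⟨w, hw⟩
      obtain ⟨x, rfl⟩ := hsurj z
      have h1 : g i w = D.incl x := hw.trans (congrArg (fun f => f x) hiq)
      obtain ⟨v, rfl, -⟩ := Scheme.exists_preimage_of_isPullback (hg.isPullback_incl ho hι i) x w h1.symm
      exact ⟨_, (congrArg (fun f => f v) (chart_incl_eq_trivChart (hs i) hr hi)).symm⟩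
    · rintro ⟨w, rfl⟩
      exact ⟨_, (congrArg (fun f => f w) (hq i)).symm⟩
  have hw : q ≫ D.toBase = E.toBase ≫ ArtAlg.specMap (ArtAlg.truncMap k p) := by
    refine hom_ext_of_cover γ hγo hγc fun i => ?_
    rw [← Category.assoc, hq, Category.assoc, (hsq i).w, Category.assoc]
  exact Deformation.Isomorphic.of_isPullback (D.baseChange_isPullback _)
    (isPullback_of_cover g ho hc hw γ (fun i => specAlg k (ρ i)) hpb hsq)
    (D.baseChange_incl_proj _) hiq

end BaseChange

/-! ### An infinitesimal section which does not lift -/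

section Obstruction

variable {k : Type u} [Field k] {p : ℕ}

theorem coeff_mono_mul (m n : ℤ × ℤ) (f : Laurent k) : (mono k m * f).coeff (m + n) = f.coeff n := by
  refine (AddMonoidAlgebra.coeff_single_mul_eq_mul_coeff n fun a _ => ?_).trans (one_mul _)
  exact add_right_inj m

/-- The coefficient of a monomial in `k[x, x⁻¹, y, y⁻¹][ε]`. -/
def epsCoeff (k : Type u) [Field k] (p : ℕ) [NeZero p] (m : ℤ × ℤ) :
    Eps k p (Laurent k) →ₗ[k] (ArtAlg.trunc k p).carrier :=
  (TensorProduct.lid k _).toLinearMap ∘ₗ LinearMap.rTensor _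
    (Finsupp.lapply m ∘ₗ (AddMonoidAlgebra.coeffLinearEquiv k).toLinearMap)

theorem epsCoeff_tmul [NeZero p] (m : ℤ × ℤ) (f : Laurent k) (a : (ArtAlg.trunc k p).carrier) :
    epsCoeff k p m (f ⊗ₜ a) = f.coeff m • a := rfl

theorem epsCoeff_mono_mul [NeZero p] (m n : ℤ × ℤ) (w : Eps k p (Laurent k)) :
    epsCoeff k p (m + n) ((mono k m ⊗ₜ 1) * w) = epsCoeff k p n w := by
  induction w using TensorProduct.induction_on with
  | zero => rw [mul_zero, map_zero, map_zero]
  | tmul f a => rw [Algebra.TensorProduct.tmul_mul_tmul, epsCoeff_tmul, epsCoeff_tmul, coeff_mono_mul,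
      one_mul]
  | add x y hx hy => rw [mul_add, map_add, map_add, hx, hy]

theorem epsCoeff_valEps_eq_zero [NeZero p] {i : Fin 5} {m : ℤ × ℤ} (hm : m ∉ cone p i)
    (w : Eps k p (chartRing k p i)) : epsCoeff k p m (valEps k p (chartRing k p i) w) = 0 := by
  induction w using TensorProduct.induction_on with
  | zero => rw [map_zero, map_zero]
  | tmul f a =>
    have h : (f : Laurent k) ∈ monoAlg k (cone p i) := by
      rw [← chartRing_eq]
      exact f.2
    have h0 : (f : Laurent k).coeff m = 0 := by
      by_contra h1
      exact hm (h m h1)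
    rw [valEps_tmul, epsCoeff_tmul, h0, zero_smul]
  | add x y hx hy => rw [map_add, map_add, hx, hy, add_zero]

/-- The value of functions on the affine chart `U₀` at the singular point. -/
def evOrigin (k : Type u) [Field k] (p : ℕ) [NeZero p] : chartRing k p 0 →ₐ[k] k :=
  (R0.originHom k p).comp (R0.equivChartRing k p).symm.toAlgHom

theorem evOrigin_eq_coeff [NeZero p] (hp : 2 ≤ p) (f : chartRing k p 0) :
    evOrigin k p f = (f : Laurent k).coeff 0 := by
  obtain ⟨r, rfl⟩ := (R0.equivChartRing k p).surjective f
  have h1 : evOrigin k p (R0.equivChartRing k p r) = R0.originHom k p r :=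
    congrArg _ ((R0.equivChartRing k p).symm_apply_apply r)
  have h2 : r - algebraMap k _ (R0.originHom k p r) ∈ R0.originIdeal k p := by
    rw [R0.originIdeal, RingHom.mem_ker, map_sub, AlgHom.commutes]
    exact sub_self _
  have h3 := R0.originIdeal_le_orderIdeal k p hp h2
  have h4 : (R0.toLaurent k p (r - algebraMap k _ (R0.originHom k p r))).coeff 0 = 0 := by
    by_contra h
    simpa using (h3 0 h).1
  rw [map_sub, AlgHom.commutes] at h4
  rw [h1, R0.coe_equivChartRing]
  have h5 : (algebraMap k (Laurent k) (R0.originHom k p r)).coeff 0 = R0.originHom k p r := by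
    rw [Algebra.algebraMap_eq_smul_one, ← mono_zero, AddMonoidAlgebra.coeff_smul, Finsupp.smul_apply,
      coeff_mono, if_pos rfl, smul_eq_mul, mul_one]
  rw [AddMonoidAlgebra.coeff_sub, Finsupp.sub_apply, h5, sub_eq_zero] at h4
  exact h4.symm

/-- The section of the trivial family `U₀[ε]` at the singular point. -/
def evEps (k : Type u) [Field k] (p : ℕ) [NeZero p] :
    Eps k p (chartRing k p 0) →ₐ[k] (ArtAlg.trunc k p).carrier :=
  Algebra.TensorProduct.lift ((Algebra.ofId k _).comp (evOrigin k p)) (AlgHom.id k _)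
    (fun _ _ => Commute.all _ _)

theorem evEps_tmul [NeZero p] (f : chartRing k p 0) (a : (ArtAlg.trunc k p).carrier) :
    evEps k p (f ⊗ₜ a) = algebraMap k _ (evOrigin k p f) * a :=
  Algebra.TensorProduct.lift_tmul _ _ _ _ _

/-- Evaluation at the singular point becomes extraction of the constant coefficient, which makes
sense in the Laurent ring and so can be computed from another chart. -/
theorem evEps_eq_epsCoeff [NeZero p] (hp : 2 ≤ p) (w : Eps k p (chartRing k p 0)) :
    evEps k p w = epsCoeff k p 0 (valEps k p (chartRing k p 0) w) := by
  induction w using TensorProduct.induction_on with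
  | zero => rw [map_zero, map_zero, map_zero]
  | tmul f a => rw [evEps_tmul, valEps_tmul, epsCoeff_tmul, evOrigin_eq_coeff hp, Algebra.smul_def]
  | add x y hx hy => rw [map_add, map_add, map_add, hx, hy]

theorem aug_evEps [NeZero p] (w : Eps k p (chartRing k p 0)) :
    (ArtAlg.trunc k p).aug (evEps k p w) = evOrigin k p (redTrunc k p _ w) := by
  induction w using TensorProduct.induction_on with
  | zero => rw [map_zero, map_zero, map_zero, map_zero]
  | tmul f a =>
    rw [evEps_tmul, redTrunc_tmul, map_mul, map_mul, AlgHom.commutes, AlgHom.commutes]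
    rfl
  | add x y hx hy => rw [map_add, map_add, map_add, map_add, hx, hy]

theorem exists_eq_mul_of_truncMap_eq_zero [NeZero p] {a : (kl k p).carrier}
    (h : ArtAlg.Hom.toAlgHom (ArtAlg.truncMap k p) a = 0) : ∃ b, a = ArtAlg.t k (p + 1) ^ p * b := by
  let q : Polynomial k →+* (kl k p).carrier := AdjoinRoot.mk ((Polynomial.X : Polynomial k) ^ (p + 1))
  obtain ⟨f, rfl⟩ : ∃ f, q f = a := AdjoinRoot.mk_surjective a
  have h0 : Polynomial.eval₂ (algebraMap k (ArtAlg.Trunc k p)) (AdjoinRoot.root _) f = 0 := h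
  have h1 : AdjoinRoot.mk ((Polynomial.X : Polynomial k) ^ p) f = 0 :=
    (AdjoinRoot.aeval_eq f).symm.trans h0
  rw [AdjoinRoot.mk_eq_zero] at h1
  obtain ⟨g, rfl⟩ := h1
  refine ⟨q g, (map_mul q _ _).trans ?_⟩
  rw [map_pow]
  rfl

theorem t_pow_ne_zero [NeZero p] : ArtAlg.t k (p + 1) ^ p ≠ 0 := fun h => by
  have h1 : AdjoinRoot.mk ((Polynomial.X : Polynomial k) ^ (p + 1)) (Polynomial.X ^ p) = 0 := by
    rw [map_pow]
    exact h
  rw [AdjoinRoot.mk_eq_zero, Polynomial.X_pow_dvd_iff] at h1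
  simpa using h1 p (Nat.lt_succ_self p)

variable [Fact p.Prime] [CharP k p]

/-- Frobenius annihilates the multiples of ε, so a p-th power depends only on the reduction. This is
what makes the following computations independent of the chosen transition. -/
theorem pow_eq_of_redTrunc_eq {S : Type u} [CommRing S] [Algebra k S] [Nontrivial S] (w : Eps k p S) :
    w ^ p = (redTrunc k p S w ^ p) ⊗ₜ 1 := by
  have : Nontrivial (Eps k p S) := (redTrunc k p S).toRingHom.domain_nontrivial
  have : CharP (Eps k p S) p := charP_of_injective_algebraMap (algebraMap k (Eps k p S)).injective p
  obtain ⟨y, hy⟩ := exists_eq_redTrunc_add w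
  conv_lhs => rw [hy]
  rw [add_pow_char, mul_pow, lamT_pow, zero_mul, add_zero, Algebra.TensorProduct.tmul_pow, one_pow]

/-- The class of a monomial in a chart ring. -/
def chartMono (k : Type u) [Field k] (p : ℕ) (i : Fin 5) (m : ℤ × ℤ) (hm : m ∈ cone p i) : chartRing k p i :=
  ⟨mono k m, by rw [chartRing_eq]; exact mono_mem_monoAlg.mpr hm⟩

theorem chartMono_mul {i : Fin 5} {m n : ℤ × ℤ} (hm : m ∈ cone p i) (hn : n ∈ cone p i) :
    chartMono k p i m hm * chartMono k p i n hn = chartMono k p i (m + n) (add_mem hm hn) :=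
  Subtype.ext (mono_mul m n)

theorem chartMono_pow {i : Fin 5} {m : ℤ × ℤ} (hm : m ∈ cone p i) (n : ℕ) :
    chartMono k p i m hm ^ n = chartMono k p i (n • m) (nsmul_mem hm n) :=
  Subtype.ext (mono_pow m n)

section

variable {ρ : (i : Fin 5) → Adj k p (chartRing k p i) →ₐ[k] Eps k p (chartRing k p i)}

/-- Functions identified by the gluing on an overlap have the same image in the Laurent ring over
`k[ε]`, whichever chart is used to compute it. -/
theorem IsTransition.valEps_eq (hρ : IsTransition k p ρ) {i j : Fin 5} (hij : i < j)
    {x : Adj k p (chartRing k p i)} {x' : Adj k p (chartRing k p j)}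
    (h : psiExt k p i j (valLam k p (chartRing k p i) x) = valLam k p (chartRing k p j) x') :
    valEps k p (chartRing k p i) (ρ i x) = valEps k p (chartRing k p j) (ρ j x') := by
  obtain ⟨ψ, hψ⟩ := exists_isPsi (k := k) (p := p) hij
  obtain ⟨ρ', e1, e2⟩ := hρ.overlap i j hij ψ hψ
  have h1 : ψ (inclLam k p (left_le_overlapRing k p i j) x) =
      inclLam k p (right_le_overlapRing k p i j) x' := by
    apply valLam_injective
    rw [hψ, valLam_inclLam, valLam_inclLam, h]
  have h2 := DFunLike.congr_fun e1 x'
  have h3 := DFunLike.congr_fun e2 x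
  have h4 : inclEps k p (left_le_overlapRing k p i j) (ρ i x) =
      inclEps k p (right_le_overlapRing k p i j) (ρ j x') :=
    h3.symm.trans ((congrArg ρ' h1).trans h2)
  rw [← valEps_inclEps (left_le_overlapRing k p i j), h4, valEps_inclEps]

/-- The image of the p-th power is exactly the monomial with exponent `p • Q`. The constant
coefficient sought is therefore the coefficient at `-(p • Q)` of an element of the chart ring, which
is zero because that exponent lies outside the cone. -/
theorem IsTransition.epsCoeff_pow_mul_eq_zero (hρ : IsTransition k p ρ) {j : Fin 5} {P Q : ℤ × ℤ} (hP : P ∈ cone p j) (hQ : Q ∈ cone p j)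
    (hn : -(p • Q) ∉ cone p j) :
    epsCoeff k p 0 (valEps k p (chartRing k p j)
      (ρ j (chartMono k p j (p • Q + P) (add_mem (nsmul_mem hQ p) hP) ⊗ₜ 1))) = 0 := by
  have h : chartMono k p j (p • Q + P) (add_mem (nsmul_mem hQ p) hP) ⊗ₜ[k] (1 : (kl k p).carrier) =
      (chartMono k p j Q hQ ⊗ₜ 1) ^ p * (chartMono k p j P hP ⊗ₜ 1) := by
    rw [Algebra.TensorProduct.tmul_pow, Algebra.TensorProduct.tmul_mul_tmul, one_pow, one_mul,
      chartMono_pow, chartMono_mul]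
  have h4 : valEps k p (chartRing k p j) (ρ j (chartMono k p j Q hQ ⊗ₜ 1)) ^ p =
      mono k (p • Q) ⊗ₜ 1 := by
    rw [pow_eq_of_redTrunc_eq, redTrunc_valEps, ← AlgHom.comp_apply (redTrunc k p _), hρ.red, redLam_tmul,
      map_one, map_one, mul_one, ← mono_pow]
    rfl
  have h5 := epsCoeff_mono_mul (p := p) (p • Q) (-(p • Q))
    (valEps k p (chartRing k p j) (ρ j (chartMono k p j P hP ⊗ₜ 1)))
  rw [add_neg_cancel] at h5
  rw [h, map_mul, map_mul, map_pow, map_pow, h4, h5, epsCoeff_valEps_eq_zero hn]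

/-- In chart 1 the function y is glued to y + λ, and y = (x^(-1))^p · x^p y there. The first summand
contributes nothing since x^p is not in `R_1`; the second contributes ε. -/
theorem IsTransition.evEps_y (hρ : IsTransition k p ρ) :
    evEps k p (ρ 0 (chartMono k p 0 (0, 1) (mem_dualCone.mpr (by simp)) ⊗ₜ 1)) =
    ArtAlg.t k p := by
  have hP : ((p : ℤ), (1 : ℤ)) ∈ cone p 1 := mem_dualCone.mpr (by simp)
  have hQ : ((-1 : ℤ), (0 : ℤ)) ∈ cone p 1 := mem_dualCone.mpr (by simp)
  have hp : 2 ≤ p := (Fact.out : p.Prime).two_le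
  have hn : -(p • ((-1 : ℤ), (0 : ℤ))) ∉ cone p 1 := fun h => by
    have := (mem_dualCone.mp h).2
    simp at this
    omega
  have e := hρ.valEps_eq (i := 0) (j := 1) (by decide) (x := chartMono k p 0 (0, 1) (mem_dualCone.mpr (by simp)) ⊗ₜ 1)
    (x' := chartMono k p 1 _ (add_mem (nsmul_mem hQ p) hP) ⊗ₜ 1 + 1 ⊗ₜ ArtAlg.t k (p + 1)) (by
    refine (subst_uy _ _).trans ?_
    rw [uyAdd_val, map_add, valLam_tmul, valLam_tmul]
    refine congrArg (· + _) (congrArg (fun m => mono k m ⊗ₜ[k] (1 : (kl k p).carrier)) ?_)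
    simp)
  have h0 : ((1 : chartRing k p 1) : Laurent k).coeff 0 = 1 := (coeff_mono 0 0).trans (if_pos rfl)
  rw [evEps_eq_epsCoeff hp, e, map_add, map_add, map_add, hρ.epsCoeff_pow_mul_eq_zero hP hQ hn, hρ.tmul,
    toAlgHom_truncMap_t, valEps_tmul, epsCoeff_tmul, h0, one_smul, zero_add]

/-- In chart 4 the function x is glued to x + x y^(-p) λ^p. The last term dies with ε^p, and x = y^p
· x y^(-p) contributes nothing since y^(-p) is not in `R_4`. -/
theorem IsTransition.evEps_x (hρ : IsTransition k p ρ) :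
    evEps k p (ρ 0 (chartMono k p 0 (1, 0) (mem_dualCone.mpr (by simp)) ⊗ₜ 1)) = 0 := by
  have hP : ((1 : ℤ), -(p : ℤ)) ∈ cone p 4 := mem_dualCone.mpr (by simp)
  have hQ : ((0 : ℤ), (1 : ℤ)) ∈ cone p 4 := mem_dualCone.mpr (by simp)
  have hp : 2 ≤ p := (Fact.out : p.Prime).two_le
  have hn : -(p • ((0 : ℤ), (1 : ℤ))) ∉ cone p 4 := fun h => by
    have := (mem_dualCone.mp h).2
    simp at this
    omega
  have e := hρ.valEps_eq (i := 0) (j := 4) (by decide) (x := chartMono k p 0 (1, 0) (mem_dualCone.mpr (by simp)) ⊗ₜ 1)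
    (x' := chartMono k p 4 _ (add_mem (nsmul_mem hQ p) hP) ⊗ₜ 1 +
      chartMono k p 4 _ hP ⊗ₜ 1 * (1 ⊗ₜ ArtAlg.t k (p + 1)) ^ p) (by
    refine (subst_ux _ _).trans ?_
    rw [Units.val_mul, Units.val_pow_eq_pow_val, uOneAdd_val, add_pow_char, one_pow, mul_pow, mul_add,
      mul_one, mul_left_comm, mul_comm (lam k p ^ p), map_add, map_mul, map_pow,
      valLam_tmul, valLam_tmul, valLam_tmul, ← Units.val_pow_eq_pow_val, ← Units.val_mul]
    refine congrArg₂ (· + ·) ?_ (congrArg (· * _) ?_)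
    · refine congrArg (fun m => mono k m ⊗ₜ[k] (1 : (kl k p).carrier)) ?_
      simp
    · rw [← zpow_neg_one, ← zpow_natCast, monoUnit_zpow, monoUnit_zpow, monoUnit_mul]
      refine congrArg (fun m => mono k m ⊗ₜ[k] (1 : (kl k p).carrier)) ?_
      simp)
  have h0 : ρ 4 (1 ⊗ₜ ArtAlg.t k (p + 1)) ^ p = 0 := by
    rw [hρ.tmul, toAlgHom_truncMap_t]
    exact lamT_pow _
  rw [evEps_eq_epsCoeff hp, e, map_add, map_mul, map_pow, h0, mul_zero, add_zero,
    hρ.epsCoeff_pow_mul_eq_zero hP hQ hn]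

/-- The infinitesimal section of `U₀[ε]` at the singular point does not lift. -/
theorem IsTransition.false_of_section (hρ : IsTransition k p ρ)
    {v : Adj k p (chartRing k p 0) →ₐ[k] (kl k p).carrier}
    (hv : ∀ x, ArtAlg.Hom.toAlgHom (ArtAlg.truncMap k p) (v x) = evEps k p (ρ 0 x)) : False := by
  have hp : 2 ≤ p := (Fact.out : p.Prime).two_le
  let x0 := chartMono k p 0 (1, 0) (mem_dualCone.mpr (by simp))
  let y0 := chartMono k p 0 (0, 1) (mem_dualCone.mpr (by simp))
  let z0 := chartMono k p 0 (-1, p) (mem_dualCone.mpr (by simp))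
  have hx := hρ.evEps_x
  have hy := hρ.evEps_y
  -- Lifting from `k[ε]` to `k[λ]` leaves only multiples of λ^p free, so x ↦ λ^p b and y ↦ λ + λ^p
  -- b'. For z it is enough that its value is a multiple of λ.
  obtain ⟨b, hb⟩ := exists_eq_mul_of_truncMap_eq_zero ((hv _).trans hx)
  obtain ⟨b', hb'⟩ := exists_eq_mul_of_truncMap_eq_zero (a := v (y0 ⊗ₜ 1) - ArtAlg.t k (p + 1))
    (by rw [map_sub, hv, hy, toAlgHom_truncMap_t, sub_self])
  have hz : (kl k p).aug (v (z0 ⊗ₜ 1)) = 0 := by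
    rw [← ArtAlg.aug_comp (ArtAlg.truncMap k p), AlgHom.comp_apply, hv, aug_evEps, ← AlgHom.comp_apply
      (redTrunc k p _), hρ.red, redLam_tmul, map_one, map_one, mul_one, evOrigin_eq_coeff hp]
    exact (coeff_mono _ _).trans (if_neg (by simp))
  obtain ⟨c, hc⟩ := exists_trunc_eq (v (z0 ⊗ₜ 1))
  rw [hz, map_zero, zero_add] at hc
  have hxyz : v (x0 ⊗ₜ 1) * v (z0 ⊗ₜ 1) = v (y0 ⊗ₜ 1) ^ p := by
    rw [← map_mul, ← map_pow, Algebra.TensorProduct.tmul_mul_tmul, Algebra.TensorProduct.tmul_pow,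
      one_pow, one_mul]
    refine congrArg v (congrArg (· ⊗ₜ _) (Subtype.ext ?_))
    change mono k (1, 0) * mono k (-1, p) = mono k (0, 1) ^ p
    rw [mono_mul, mono_pow]
    simp
  have : CharP (kl k p).carrier p := charP_of_injective_algebraMap (algebraMap k (kl k p).carrier).injective p
  have ht : ArtAlg.t k (p + 1) ^ (p + 1) = 0 := ArtAlg.t_pow _
  rw [sub_eq_iff_eq_add] at hb'
  -- Substitution in xz = y^p: the p-th power of λ^p b' vanishes because p² ≥ p + 1, so the right
  -- side is λ^p, whereas the left side is divisible by λ^(p+1) = 0.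
  rw [hb, hb', hc, add_pow_char, mul_pow, ← pow_mul,
    pow_eq_zero_of_le (by nlinarith : p + 1 ≤ p * p) ht, zero_mul, zero_add] at hxyz
  refine t_pow_ne_zero (k := k) (p := p) (hxyz.symm.trans ?_)
  rw [mul_mul_mul_comm, ← pow_succ, ht, zero_mul]

end

end Obstruction

/-! ### Lifting sections along locally trivial deformations -/

section Lifting

variable {k : Type u} [Field k] {X : Scheme.{u}} {s : X ⟶ Spec (.of k)} {A B : ArtAlg k}

theorem Deformation.Isomorphic.exists_isPullback {C : ArtAlg k} {D : Deformation s C} {f : C ⟶ A}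
    {E : Deformation s A} (h : (D.baseChange f).Isomorphic E) :
    ∃ j : E.total ⟶ D.total, IsPullback j E.toBase D.toBase (ArtAlg.specMap f) ∧ E.incl ≫ j = D.incl := by
  obtain ⟨e, h1, h2⟩ := h.symm
  refine ⟨e.hom ≫ D.proj f, ?_, ?_⟩
  · have h3 : IsPullback e.hom E.toBase (D.baseChange f).toBase (𝟙 _) := IsPullback.of_horiz_isIso ⟨by simp [h2]⟩
    have := h3.paste_horiz (D.baseChange_isPullback f)
    rwa [Category.id_comp] at this
  · rw [← Category.assoc, h1, D.baseChange_incl_proj]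

/-- A section of one of two deformations which both extend to a locally trivial deformation over
the fibre product can be transported to the other one. -/
theorem Deformation.IsLocallyTrivial.exists_section [Module.Finite k A.carrier] {f : A ⟶ B}
    {D : Deformation s (ArtAlg.fibreProd f f)} (hD : D.IsLocallyTrivial) {D₁ D₂ : Deformation s A}
    (h₁ : (D.baseChange (ArtAlg.fibreProdFst f f)).Isomorphic D₁)
    (h₂ : (D.baseChange (ArtAlg.fibreProdSnd f f)).Isomorphic D₂)
    {E : Deformation s B} {q : E.total ⟶ D₂.total}
    (hq : IsPullback q E.toBase D₂.toBase (ArtAlg.specMap f)) (hqi : E.incl ≫ q = D₂.incl)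
    {σ : A.spec ⟶ D₂.total} (hσ : σ ≫ D₂.toBase = 𝟙 _) :
    ∃ (h : E.total ⟶ D₁.total) (σ' : A.spec ⟶ D₁.total),
      h ≫ D₁.toBase = E.toBase ≫ ArtAlg.specMap f ∧ E.incl ≫ h = D₁.incl ∧ σ' ≫ D₁.toBase = 𝟙 _ ∧
      ArtAlg.specMap f ≫ σ' = hq.lift (ArtAlg.specMap f ≫ σ) (𝟙 _)
        (by rw [Category.assoc, hσ, Category.comp_id, Category.id_comp]) ≫ h := by
  obtain ⟨j₁, hj₁, hi₁⟩ := h₁.exists_isPullback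
  obtain ⟨j₂, hj₂, hi₂⟩ := h₂.exists_isPullback
  have hff : ArtAlg.specMap f ≫ ArtAlg.specMap (ArtAlg.fibreProdSnd f f) =
      ArtAlg.specMap f ≫ ArtAlg.specMap (ArtAlg.fibreProdFst f f) := by
    rw [← ArtAlg.specMap_comp, ← ArtAlg.specMap_comp, (ArtAlg.fibreProd_isPullback f f).w]
  -- Restricted to `B`, both deformations are pullbacks of `D` along the same map out of the fibre
  -- product; this identification gives the morphism `h`.
  let h : E.total ⟶ D₁.total := hj₁.lift (q ≫ j₂) (E.toBase ≫ ArtAlg.specMap f) (by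
    rw [Category.assoc, hj₂.w, ← Category.assoc, hq.w, Category.assoc, hff, Category.assoc])
  obtain ⟨x, hx⟩ : ∃ x : Spec (.of k) ⟶ X, x ≫ D₂.incl = A.pt ≫ σ :=
    ⟨D₂.isPullback.lift (A.pt ≫ σ) (𝟙 _) (by rw [Category.assoc, hσ]; simp),
      D₂.isPullback.lift_fst _ _ _⟩
  let o : Spec (.of k) := (⊥ : PrimeSpectrum k)
  -- Take a product neighbourhood of the closed point of the section. Since the spectrum of `A` has
  -- only one point, the whole section stays inside it.
  obtain ⟨U, W, hUW, hxU, r, hr, hp⟩ := hD (x o)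
  have hrange : Set.range (σ ≫ j₂) ⊆ Set.range W.ι := by
    rintro _ ⟨z, rfl⟩
    obtain ⟨z', rfl⟩ := (surjective_pt A).surj z
    have ho : z' = o := Subsingleton.elim (α := PrimeSpectrum k) _ _
    have h1 : (A.pt ≫ σ ≫ j₂) z' = D.incl (x z') := by
      rw [← Category.assoc, ← hx, Category.assoc, hi₂]
      rfl
    rw [Scheme.Opens.range_ι]
    rw [hUW, ← ho] at hxU
    change (A.pt ≫ σ ≫ j₂) z' ∈ W
    rw [h1]
    exact hxU
  let l : A.spec ⟶ W := IsOpenImmersion.lift W.ι (σ ≫ j₂) hrange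
  have hl : l ≫ W.ι = σ ≫ j₂ := IsOpenImmersion.lift_fac _ _ _
  have hlb : l ≫ W.ι ≫ D.toBase = ArtAlg.specMap (ArtAlg.fibreProdSnd f f) := by
    rw [← Category.assoc, hl, Category.assoc, hj₂.w, ← Category.assoc, hσ, Category.id_comp]
  -- Keep the projection to `U` and replace the second projection of the fibre product by the first.
  -- The two projections agree after restriction to `B`, so the old and the new section agree there.
  let m : A.spec ⟶ W := hp.lift (l ≫ r) (ArtAlg.specMap (ArtAlg.fibreProdFst f f)) (by
    rw [Category.assoc, hp.w, ArtAlg.specMap_toSpecK, ← Category.assoc, hlb, ArtAlg.specMap_toSpecK])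
  have hm : ArtAlg.specMap f ≫ m = ArtAlg.specMap f ≫ l := by
    refine hp.hom_ext ?_ ?_
    · rw [Category.assoc, hp.lift_fst, Category.assoc]
    · rw [Category.assoc, hp.lift_snd, Category.assoc, hlb, hff]
  let σ' : A.spec ⟶ D₁.total := hj₁.lift (m ≫ W.ι) (𝟙 _) (by
    rw [Category.assoc, hp.lift_snd, Category.id_comp])
  refine ⟨h, σ', hj₁.lift_snd _ _ _, ?_, hj₁.lift_snd _ _ _, ?_⟩
  · refine hj₁.hom_ext ?_ ?_
    · rw [Category.assoc, hj₁.lift_fst, ← Category.assoc, hqi, hi₂, hi₁]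
    · rw [Category.assoc, hj₁.lift_snd, ← Category.assoc, E.isPullback.w, Category.assoc,
        ArtAlg.pt_specMap, D₁.isPullback.w]
  · refine hj₁.hom_ext ?_ ?_
    · rw [Category.assoc, hj₁.lift_fst, Category.assoc, hj₁.lift_fst, ← Category.assoc, hm,
        Category.assoc, hl, ← Category.assoc (hq.lift _ _ _), hq.lift_fst, Category.assoc]
    · rw [Category.assoc, hj₁.lift_snd, Category.assoc, hj₁.lift_snd, ← Category.assoc (hq.lift _ _ _),
        hq.lift_snd, Category.id_comp, Category.comp_id]

end Lifting

/-! ### Morphisms of affine schemes over `k` as algebra homomorphisms -/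

section SpecAlg

variable {k : Type u} [Field k] {S T : Type u} [CommRing S] [CommRing T] [Algebra k S] [Algebra k T]

theorem exists_specAlg_eq (q : Spec (.of T) ⟶ Spec (.of S))
    (hq : q ≫ Spec.map (CommRingCat.ofHom (algebraMap k S)) = Spec.map (CommRingCat.ofHom (algebraMap k T))) :
    ∃ φ : S →ₐ[k] T, specAlg k φ = q := by
  obtain ⟨ψ, rfl⟩ := Spec.map_surjective q
  rw [← Spec.map_comp] at hq
  have h := Spec.map_injective hq
  exact ⟨{ ψ.hom with commutes' := fun c => congrArg (fun g => g.hom c) h }, rfl⟩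

theorem specAlg_injective {φ ψ : S →ₐ[k] T} (h : specAlg k φ = specAlg k ψ) : φ = ψ := by
  have := congrArg CommRingCat.Hom.hom (Spec.map_injective h)
  exact AlgHom.ext fun x => congrArg (fun g : S →+* T => g x) this

theorem exists_specAlg_eq_of_comp {R : Type u} [CommRing R] [Algebra k R] {f : R →ₐ[k] S} {f' : R →ₐ[k] T}
    {q : Spec (.of T) ⟶ Spec (.of S)} (hq : q ≫ specAlg k f = specAlg k f') :
    ∃ φ : S →ₐ[k] T, specAlg k φ = q ∧ φ.comp f = f' := by
  obtain ⟨φ, rfl⟩ := exists_specAlg_eq q (by rw [← specAlg_toSpecK f, reassoc_of% hq, specAlg_toSpecK])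
  exact ⟨φ, rfl, specAlg_injective ((specAlg_comp _ _).symm.trans hq)⟩

theorem exists_comp_eq_of_isPullback {R₁ R₂ : Type u} [CommRing R₁] [Algebra k R₁] [CommRing R₂]
    [Algebra k R₂] {Y : Scheme.{u}} {g₁ : Spec (.of R₁) ⟶ Y} {g₂ : Spec (.of R₂) ⟶ Y} {f₁ : R₁ →ₐ[k] S}
    {f₂ : R₂ →ₐ[k] S} {ψ : S →ₐ[k] S} (hp : IsPullback (specAlg k f₁) (specAlg k ψ ≫ specAlg k f₂) g₁ g₂)
    {c₁ : R₁ →ₐ[k] T} {c₂ : R₂ →ₐ[k] T} (h : specAlg k c₁ ≫ g₁ = specAlg k c₂ ≫ g₂) :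
    ∃ φ : S →ₐ[k] T, φ.comp f₁ = c₁ ∧ φ.comp (ψ.comp f₂) = c₂ := by
  obtain ⟨φ, hφ, h1⟩ := exists_specAlg_eq_of_comp (hp.lift_fst _ _ h)
  refine ⟨φ, h1, specAlg_injective ?_⟩
  rw [← specAlg_comp, ← specAlg_comp, hφ, hp.lift_snd]

end SpecAlg

/-! ### The glued deformation and the trivial one do not come from a common deformation -/

section Nonexistence

variable {k : Type u} [Field k] {p : ℕ} [Fact p.Prime] [CharP k p]

theorem isPsi_unique {i j : Fin 5} {ψ ψ' : Adj k p (overlapRing k p i j) ≃ₐ[k] Adj k p (overlapRing k p i j)}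
    (h : IsPsi k p i j ψ) (h' : IsPsi k p i j ψ') : ψ = ψ' :=
  AlgEquiv.ext fun a => valLam_injective _ ((h a).trans (h' a).symm)

theorem apply_one_tmul_of_specAlg_comp_eq {S : Type u} [CommRing S] [Algebra k S]
    {ρ : Adj k p S →ₐ[k] Eps k p S}
    (h : specAlg k ρ ≫ specAlg k (Algebra.TensorProduct.includeRight : (kl k p).carrier →ₐ[k] Adj k p S) =
      specAlg k (Algebra.TensorProduct.includeRight : (ArtAlg.trunc k p).carrier →ₐ[k] Eps k p S) ≫
        ArtAlg.specMap (ArtAlg.truncMap k p)) (a : (kl k p).carrier) :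
    ρ (1 ⊗ₜ a) = 1 ⊗ₜ ArtAlg.Hom.toAlgHom (ArtAlg.truncMap k p) a := by
  rw [specAlg_comp] at h
  have h2 : ρ.comp Algebra.TensorProduct.includeRight = Algebra.TensorProduct.includeRight.comp
      (ArtAlg.Hom.toAlgHom (ArtAlg.truncMap k p)) :=
    specAlg_injective (h.trans (specAlg_comp (ArtAlg.Hom.toAlgHom (ArtAlg.truncMap k p)) _))
  exact DFunLike.congr_fun h2 a

/-- A morphism from a trivial deformation over `k[ε]` to the glued deformation is given by compatible
homomorphisms of rings. -/
theorem exists_isTransition_of_hom {D : Deformation (X0.toSpecK k p) (kl k p)}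
    {g : (i : Fin 5) → (Spec (.of (Adj k p (chartRing k p i))) ⟶ D.total)}
    (ho : ∀ i, IsOpenImmersion (g i)) (ht : ∀ i, g i ≫ D.toBase = specAlg k Algebra.TensorProduct.includeRight)
    (hι : ∀ i, X0.chart k p i ≫ D.incl = specAlg k (redLam k p (chartRing k p i)) ≫ g i)
    (hg : IsGluing g) {E : Deformation (X0.toSpecK k p) (ArtAlg.trunc k p)} {r : E.total ⟶ X0 k p}
    (hi : E.incl ≫ r = 𝟙 _) (hr : IsPullback r E.toBase (X0.toSpecK k p) (ArtAlg.trunc k p).toSpecK)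
    {h : E.total ⟶ D.total} (hb : h ≫ D.toBase = E.toBase ≫ ArtAlg.specMap (ArtAlg.truncMap k p))
    (hh : E.incl ≫ h = D.incl) :
    ∃ ρ, IsTransition k p ρ ∧
      ∀ i, specAlg k (ρ i) ≫ g i = trivChart hr (X0.chart_toSpecK k p i) ≫ h := by
  have hs := X0.chart_toSpecK k p
  let γ := fun i => trivChart hr (hs i)
  -- On points the morphism is determined by the closed fibre, where it is the inclusion; so it
  -- carries each chart into the corresponding chart.
  have hrange : ∀ i, Set.range (γ i ≫ h) ⊆ Set.range (g i) := fun i => by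
    rintro _ ⟨w, rfl⟩
    obtain ⟨v, rfl⟩ := surjective_specAlg_redTrunc w
    have h1 : specAlg k (redTrunc k p (chartRing k p i)) ≫ γ i ≫ h =
        specAlg k (redLam k p (chartRing k p i)) ≫ g i := by
      rw [← hι, ← hh, ← Category.assoc, ← chart_incl_eq_trivChart (hs i) hr hi, Category.assoc]
    exact ⟨_, (congrArg (fun f => f v) h1).symm⟩
  let l := fun i => IsOpenImmersion.lift (g i) (γ i ≫ h) (hrange i)
  have hl : ∀ i, l i ≫ g i = γ i ≫ h := fun i => IsOpenImmersion.lift_fac _ _ _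
  have hlb : ∀ i, l i ≫ specAlg k (Algebra.TensorProduct.includeRight : (kl k p).carrier →ₐ[k]
      Adj k p (chartRing k p i)) = specAlg k (Algebra.TensorProduct.includeRight :
        (ArtAlg.trunc k p).carrier →ₐ[k] Eps k p (chartRing k p i)) ≫
          ArtAlg.specMap (ArtAlg.truncMap k p) := fun i => by
    rw [← ht, ← Category.assoc, hl, Category.assoc, hb, ← Category.assoc, trivChart_snd]
  have hex : ∀ i, ∃ ρ : Adj k p (chartRing k p i) →ₐ[k] Eps k p (chartRing k p i),
      specAlg k ρ = l i := fun i => by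
    refine exists_specAlg_eq (l i) ?_
    rw [← specAlg_toSpecK (Algebra.TensorProduct.includeRight : (kl k p).carrier →ₐ[k]
      Adj k p (chartRing k p i)), ← Category.assoc, hlb, Category.assoc]
    refine (congrArg _ (ArtAlg.specMap_toSpecK (ArtAlg.truncMap k p))).trans ?_
    exact specAlg_toSpecK _
  choose ρ hρ using hex
  have htm : ∀ i a, ρ i (1 ⊗ₜ a) = 1 ⊗ₜ ArtAlg.Hom.toAlgHom (ArtAlg.truncMap k p) a := fun i =>
    apply_one_tmul_of_specAlg_comp_eq ((congrArg (· ≫ _) (hρ i)).trans (hlb i))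
  refine ⟨ρ, ⟨htm, fun i => ?_, fun i₀ j₀ hij ψ hψ => ?_⟩, fun i => by rw [hρ]; exact hl i⟩
  · apply specAlg_injective
    have := ho i
    rw [← specAlg_comp, hρ, ← cancel_mono (g i), Category.assoc, hl, ← hι, ← hh, ← Category.assoc,
      ← chart_incl_eq_trivChart (hs i) hr hi, Category.assoc]
  · obtain ⟨ψ', hψ', hp⟩ := hg i₀ j₀ hij
    obtain rfl := isPsi_unique hψ hψ'
    have hw := (isPullback_map_trivChart hr (hs i₀) (hs j₀) (X0.isPullback_overlap k p i₀ j₀)).w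
    have hc : ∀ (i : Fin 5) (hi : chartRing k p i ≤ overlapRing k p i₀ j₀),
        specAlg k ((inclEps k p hi).comp (ρ i)) ≫ g i = specAlg k (inclEps k p hi) ≫ γ i ≫ h := fun i hi => by
      rw [← specAlg_comp, Category.assoc, hρ, hl]
    refine exists_comp_eq_of_isPullback hp ?_
    rw [hc, hc, ← Category.assoc, ← Category.assoc]
    exact congrArg (· ≫ h) hw.symm

/-- The constant section at the singular point would be transported to a section of the glued
deformation over `k[λ]`. In the zeroth chart this contradicts `IsTransition.false_of_section`. -/
theorem IsGluedDeformation.not_exists {D D₂ : Deformation (X0.toSpecK k p) (kl k p)}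
    (hD : IsGluedDeformation k p (X0.chart k p) D) (hD₂ : D₂.IsTrivial) :
    ¬ ∃ Xb : Deformation (X0.toSpecK k p)
        (ArtAlg.fibreProd (ArtAlg.truncMap k p) (ArtAlg.truncMap k p)), Xb.IsLocallyTrivial ∧
      (Xb.baseChange (ArtAlg.fibreProdFst (ArtAlg.truncMap k p) (ArtAlg.truncMap k p))).Isomorphic D ∧
      (Xb.baseChange (ArtAlg.fibreProdSnd (ArtAlg.truncMap k p) (ArtAlg.truncMap k p))).Isomorphic D₂ := by
  rintro ⟨Xb, hXb, h₁, h₂⟩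
  obtain ⟨g, ho, hc, ht, hι, hg⟩ := hD
  replace hg : IsGluing g := hg
  obtain ⟨r₂, hi₂, hr₂⟩ := hD₂
  let f := ArtAlg.truncMap k p
  let x : Spec (.of k) ⟶ X0 k p := specAlg k (evOrigin k p) ≫ X0.chart k p 0
  have hx : x ≫ X0.toSpecK k p = 𝟙 _ := by
    rw [Category.assoc, X0.chart_toSpecK, specAlg_toSpecK]
    exact Spec.map_id _
  -- The constant section of the trivial deformation at the singular point.
  let σ : (kl k p).spec ⟶ D₂.total := hr₂.lift ((kl k p).toSpecK ≫ x) (𝟙 _) (by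
    rw [Category.assoc, hx, Category.comp_id, Category.id_comp])
  have hσ : σ ≫ D₂.toBase = 𝟙 _ := hr₂.lift_snd _ _ _
  let E := D₂.baseChange f
  have hq : IsPullback (D₂.proj f) E.toBase D₂.toBase (ArtAlg.specMap f) := D₂.baseChange_isPullback f
  have hr : IsPullback (D₂.proj f ≫ r₂) E.toBase (X0.toSpecK k p) (ArtAlg.trunc k p).toSpecK := by
    rw [← ArtAlg.specMap_toSpecK f]
    exact hq.paste_horiz hr₂
  have hi : E.incl ≫ D₂.proj f ≫ r₂ = 𝟙 _ := by
    rw [← Category.assoc, D₂.baseChange_incl_proj, hi₂]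
  obtain ⟨h, σ', hb, hh, hσ', hf⟩ :=
    hXb.exists_section h₁ h₂ hq (D₂.baseChange_incl_proj f) hσ
  obtain ⟨ρ, hρ, hρh⟩ := exists_isTransition_of_hom ho ht hι hg hi hr hb hh
  -- In the zeroth chart over `k[ε]` this section is evaluation at the origin.
  have hσE : hq.lift (ArtAlg.specMap f ≫ σ) (𝟙 _)
      (by rw [Category.assoc, hσ, Category.comp_id, Category.id_comp]) =
      specAlg k (evEps k p) ≫ trivChart hr (X0.chart_toSpecK k p 0) := by
    refine hr.hom_ext ?_ ?_
    · rw [← Category.assoc, hq.lift_fst, Category.assoc, hr₂.lift_fst, ← Category.assoc,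
        ArtAlg.specMap_toSpecK, Category.assoc, trivChart_fst, ← Category.assoc, ← Category.assoc]
      refine congrArg (· ≫ X0.chart k p 0) ?_
      refine Eq.trans ?_ (specAlg_comp (inclTensor (chartRing k p 0) (ArtAlg.trunc k p)) (evEps k p)).symm
      refine (specAlg_comp (evOrigin k p) (Algebra.ofId k (ArtAlg.trunc k p).carrier)).trans ?_
      refine congrArg (specAlg k) (AlgHom.ext fun s => ?_)
      exact ((evEps_tmul s 1).trans (mul_one _)).symm
    · rw [hq.lift_snd, Category.assoc, trivChart_snd, specAlg_comp]
      have h4 : (evEps k p).comp Algebra.TensorProduct.includeRight = AlgHom.id k _ :=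
        AlgHom.ext fun a => (evEps_tmul 1 a).trans (by rw [map_one, map_one, one_mul]; rfl)
      rw [h4]
      exact (Spec.map_id _).symm
  have hfac : ArtAlg.specMap f ≫ σ' = specAlg k (evEps k p) ≫ specAlg k (ρ 0) ≫ g 0 := by
    rw [hf, hσE, Category.assoc, hρh]
  have := ho 0
  -- The base has one point and the restriction to `k[ε]` already factors through the zeroth chart,
  -- so the section does too and becomes a ring homomorphism.
  have hrange : Set.range σ' ⊆ Set.range (g 0) := by
    rintro _ ⟨z, rfl⟩
    obtain ⟨z', rfl⟩ := (surjective_pt (kl k p)).surj z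
    rw [← ArtAlg.pt_specMap f]
    exact ⟨_, (congrArg (fun q => q ((ArtAlg.trunc k p).pt z')) hfac).symm⟩
  let l := IsOpenImmersion.lift (g 0) σ' hrange
  have hl : l ≫ g 0 = σ' := IsOpenImmersion.lift_fac _ _ _
  obtain ⟨v, hv⟩ := exists_specAlg_eq (k := k) l (by
    rw [← specAlg_toSpecK (Algebra.TensorProduct.includeRight : (kl k p).carrier →ₐ[k]
      Adj k p (chartRing k p 0)), ← ht, ← Category.assoc, ← Category.assoc, hl, hσ', Category.id_comp])
  refine hρ.false_of_section (v := v) fun a => ?_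
  have h3 : specAlg k ((ArtAlg.Hom.toAlgHom f).comp v) = specAlg k ((evEps k p).comp (ρ 0)) := by
    rw [← specAlg_comp, ← specAlg_comp, ← cancel_mono (g 0), Category.assoc, Category.assoc, ← hfac, hv, hl]
    rfl
  exact DFunLike.congr_fun (specAlg_injective h3) a

end Nonexistence

/-! ### The toric resolution of `xz = y^p` -/

section Fan

variable (k : Type u) [Field k] {p : ℕ}

theorem monoAlg_sup_le_saturation {M N : AddSubmonoid (ℤ × ℤ)} {u : ℤ × ℤ} (hu : u ∈ M)
    (h : ∀ m ∈ N, ∃ n : ℕ, n • u + m ∈ M) :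
    monoAlg k M ⊔ monoAlg k N ≤ saturation (monoAlg k M) (mono k u) (mono_mem_monoAlg.mpr hu) := by
  refine sup_le (le_saturation _ _ _) (monoAlg_le_iff.mpr fun m hm => ?_)
  obtain ⟨n, hn⟩ := h m hm
  refine ⟨n, ?_⟩
  rw [mono_pow, mono_mul]
  exact mono_mem_monoAlg.mpr hn

theorem isLocStep_monoAlg {M N : AddSubmonoid (ℤ × ℤ)} {u : ℤ × ℤ} (hu : u ∈ M) (hu' : -u ∈ M ⊔ N)
    (h : ∀ m ∈ N, ∃ n : ℕ, n • u + m ∈ M) : IsLocStep (monoAlg k M) (monoAlg k M ⊔ monoAlg k N) := by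
  refine ⟨le_sup_left, mono k u, mono_mem_monoAlg.mpr hu, mono k (-u), ?_,
    by rw [mono_mul, add_neg_cancel, mono_zero], fun c hc => monoAlg_sup_le_saturation k hu h hc⟩
  rw [monoAlg_sup]
  exact mono_mem_monoAlg.mpr hu'

/-- The duals of the two-dimensional cones of the fan of the minimal resolution. -/
def fan (i : ℕ) : AddSubmonoid (ℤ × ℤ) := dualCone (i, 1) (i + 1, 1)

theorem mem_fan {i : ℕ} {m : ℤ × ℤ} : m ∈ fan i ↔ 0 ≤ i * m.1 + m.2 ∧ 0 ≤ (i + 1) * m.1 + m.2 := by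
  rw [fan, mem_dualCone, one_mul]

theorem fan_eq_closure (i : ℕ) : fan i = AddSubmonoid.closure {((1 : ℤ), -(i : ℤ)), (-1, (i : ℤ) + 1)} := by
  rw [closure_pair_eq (by simp), dualCone_comm]
  simp [fan]

/-- The rays (i,1) with 0 ≤ i ≤ p lie between (0,1) and (p,1), so linear forms nonnegative on the
two outer rays are nonnegative on them. -/
theorem cone_zero_le_fan {i : ℕ} (hi : i < p) : cone p 0 ≤ fan i := by
  rintro ⟨a, b⟩ h
  obtain ⟨h1, h2⟩ := mem_dualCone.mp h
  have hi' : (i : ℤ) + 1 ≤ p := by exact_mod_cast hi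
  simp only [zero_mul, one_mul, zero_add] at h1 h2
  rw [mem_fan]
  constructor <;> rcases le_or_gt 0 a with ha | ha <;> nlinarith

/-- The coordinate rings of the charts of the resolution. -/
abbrev fanAlg (i : ℕ) : Subalgebra k (Laurent k) := monoAlg k (fan i)

theorem chartRing_zero_le_fanAlg {i : ℕ} (hi : i < p) : chartRing k p 0 ≤ fanAlg k i := by
  rw [chartRing_eq]
  exact monoAlg_mono (cone_zero_le_fan hi)

instance (i : ℕ) : IsRegularRing (fanAlg k i) := by
  obtain ⟨e⟩ := exists_mvPolynomial_equiv (k := k) (u := (1, -(i : ℤ))) (v := (-1, (i : ℤ) + 1)) (by simp)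
  rw [← fan_eq_closure] at e
  exact IsRegularRing.of_ringEquiv e.toRingEquiv

/-- Use (0,-1) = (-1,i+1) + (1,-i-2). The second summand lies in the j-th cone because j ≥ i + 2.
Thus y becomes invertible on the overlap of two non-adjacent charts. -/
theorem neg_mem_fan_sup {i j : ℕ} (h : i + 1 < j) : -((0 : ℤ), (1 : ℤ)) ∈ fan i ⊔ fan j := by
  have h1 : ((-1 : ℤ), (i : ℤ) + 1) ∈ fan i := mem_fan.mpr (by simp)
  have h2 : ((1 : ℤ), -(i : ℤ) - 2) ∈ fan j := by
    rw [mem_fan]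
    constructor <;> push_cast <;> omega
  have h3 := add_mem (AddSubmonoid.mem_sup_left (T := fan j) h1) (AddSubmonoid.mem_sup_right (S := fan i) h2)
  convert h3 using 1
  ext
  · simp
  · simp only [Prod.snd_neg, Prod.snd_add]
    ring

theorem isLocStep_fanAlg_of_lt {i j : ℕ} (h : i + 1 < j ∨ j + 1 < i) :
    IsLocStep (fanAlg k i) (fanAlg k i ⊔ fanAlg k j) := by
  refine isLocStep_monoAlg k (u := (0, 1)) (mem_fan.mpr (by simp)) ?_ fun m _ => ?_
  · rcases h with h | h
    · exact neg_mem_fan_sup h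
    · rw [sup_comm]
      exact neg_mem_fan_sup h
  · refine ⟨((i : ℤ) * m.1 + m.2).natAbs + (((i : ℤ) + 1) * m.1 + m.2).natAbs, mem_fan.mpr ?_⟩
    simp only [Prod.smul_mk, smul_zero, nsmul_eq_mul, mul_one, Prod.fst_add, Prod.snd_add, zero_add]
    push_cast
    have h1 := neg_abs_le ((i : ℤ) * m.1 + m.2)
    have h2 := neg_abs_le (((i : ℤ) + 1) * m.1 + m.2)
    have h3 := abs_nonneg ((i : ℤ) * m.1 + m.2)
    have h4 := abs_nonneg (((i : ℤ) + 1) * m.1 + m.2)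
    constructor <;> linarith

theorem exists_nsmul_add_mem_fan {i : ℕ} {m : ℤ × ℤ} (hm : m ∈ fan (i + 1)) :
    ∃ n : ℕ, n • ((-1 : ℤ), (i + 1 : ℤ)) + m ∈ fan i := by
  obtain ⟨h1, h2⟩ := mem_fan.mp hm
  push_cast at h1 h2
  refine ⟨((i : ℤ) * m.1 + m.2).natAbs, mem_fan.mpr ?_⟩
  simp only [Prod.smul_mk, nsmul_eq_mul, Prod.fst_add, Prod.snd_add]
  push_cast
  constructor
  · have : 0 ≤ |(i : ℤ) * m.1 + m.2| + ((i : ℤ) * m.1 + m.2) := by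
      linarith [neg_abs_le ((i : ℤ) * m.1 + m.2)]
    linarith
  · linarith

theorem exists_nsmul_add_mem_fan_succ {i : ℕ} {m : ℤ × ℤ} (hm : m ∈ fan i) :
    ∃ n : ℕ, n • ((1 : ℤ), -(i + 1 : ℤ)) + m ∈ fan (i + 1) := by
  obtain ⟨h1, h2⟩ := mem_fan.mp hm
  refine ⟨((i + 2 : ℤ) * m.1 + m.2).natAbs, mem_fan.mpr ?_⟩
  simp only [Prod.smul_mk, nsmul_eq_mul, Prod.fst_add, Prod.snd_add]
  push_cast
  constructor
  · linarith
  · have : 0 ≤ |((i : ℤ) + 2) * m.1 + m.2| + (((i : ℤ) + 2) * m.1 + m.2) := by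
      linarith [neg_abs_le (((i : ℤ) + 2) * m.1 + m.2)]
    linarith

/-- Adjacent charts overlap where the coordinate belonging to their common ray is inverted; for
non-adjacent charts one inverts y and obtains the torus. -/
theorem isLocStep_fanAlg (i j : ℕ) : IsLocStep (fanAlg k i) (fanAlg k i ⊔ fanAlg k j) := by
  rcases lt_trichotomy i j with h | rfl | h
  · rcases eq_or_lt_of_le (Nat.succ_le_of_lt h) with rfl | h
    · exact isLocStep_monoAlg k (u := (-1, i + 1)) (mem_fan.mpr (by simp))
        (AddSubmonoid.mem_sup_right (mem_fan.mpr (by simp))) fun m hm => exists_nsmul_add_mem_fan hm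
    · exact isLocStep_fanAlg_of_lt k (Or.inl h)
  · rw [sup_idem]
    exact IsLocStep.refl _
  · rcases eq_or_lt_of_le (Nat.succ_le_of_lt h) with rfl | h
    · exact isLocStep_monoAlg k (u := (1, -(j + 1))) (mem_fan.mpr (by simp))
        (AddSubmonoid.mem_sup_right (mem_fan.mpr (by simp))) fun m hm => exists_nsmul_add_mem_fan_succ hm
    · exact isLocStep_fanAlg_of_lt k (Or.inr h)

end Fan

/-- The gluing of the affine toric surfaces of the fan, with its morphism to `Spec k[x, y, z]/(xz - y^p)`. -/
structure FanSurface (k : Type u) [Field k] (p : ℕ) where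
  Z : Scheme.{u}
  g (i : Fin p) : Spec (.of (fanAlg k i)) ⟶ Z
  q : Z ⟶ Spec (.of (chartRing k p 0))
  [isOpenImmersion (i : Fin p) : IsOpenImmersion (g i)]
  covers (z : Z) : ∃ i, z ∈ Set.range (g i)
  g_q (i : Fin p) : g i ≫ q = specIncl (chartRing_zero_le_fanAlg k i.2)
  isPullback (i j : Fin p) : IsPullback (specIncl (le_sup_left : fanAlg k i ≤ fanAlg k i ⊔ fanAlg k j))
    (specIncl (le_sup_right : fanAlg k j ≤ fanAlg k i ⊔ fanAlg k j)) (g i) (g j)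
  [isSeparated : IsSeparated q]

attribute [instance] FanSurface.isOpenImmersion FanSurface.isSeparated

namespace FanSurface

variable (k : Type u) [Field k] (p : ℕ)

theorem nonempty : Nonempty (FanSurface k p) := by
  obtain ⟨Z, g, f, ho, hc, hf, hp, hs⟩ :=
    exists_glue (fun i : Fin p => fanAlg k i) fun i j => isLocStep_fanAlg k i j
  obtain ⟨q, hq⟩ := exists_desc_of_cover g ho hc (fun i j _ => hp i j)
    (fun i => specIncl (chartRing_zero_le_fanAlg k i.2)) fun i j _ => by
      rw [specIncl_comp, specIncl_comp]
  have hqf : q ≫ Spec.map (CommRingCat.ofHom (algebraMap k (chartRing k p 0))) = f := by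
    refine hom_ext_of_cover g ho hc fun i => ?_
    rw [← Category.assoc, hq, hf]
    exact specAlg_toSpecK _
  have : IsSeparated (q ≫ Spec.map (CommRingCat.ofHom (algebraMap k (chartRing k p 0)))) := by
    rwa [hqf]
  have : IsSeparated q := IsSeparated.of_comp q
    (Spec.map (CommRingCat.ofHom (algebraMap k (chartRing k p 0))))
  exact ⟨⟨Z, g, q, hc, hq, hp⟩⟩

variable {k p} (F : FanSurface k p)

theorem isRegularScheme : IsRegularScheme F.Z := by
  intro z
  obtain ⟨i, y, rfl⟩ := F.covers z
  exact LocTrivDef.isRegularLocalRing_stalk (F.g i) y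

instance : QuasiCompact F.q := by
  have : Finite (coverOf F.g F.isOpenImmersion F.covers).I₀ := inferInstanceAs (Finite (Fin p))
  have : ∀ i, CompactSpace ((coverOf F.g F.isOpenImmersion F.covers).X i) := fun i =>
    inferInstanceAs (CompactSpace (PrimeSpectrum _))
  have hcomp : CompactSpace F.Z := Scheme.OpenCover.compactSpace (coverOf F.g F.isOpenImmersion F.covers)
  exact (quasiCompact_iff_compactSpace F.q).mpr hcomp

instance : LocallyOfFiniteType F.q := by
  have hc : IsZariskiLocalAtSource (@LocallyOfFiniteType.{u}) :=
    HasRingHomProperty.instIsZariskiLocalAtSource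
  refine (IsZariskiLocalAtSource.iff_of_openCover (P := @LocallyOfFiniteType.{u})
    (coverOf F.g F.isOpenImmersion F.covers)).mpr fun (i : Fin p) => ?_
  change LocallyOfFiniteType (F.g i ≫ F.q)
  rw [F.g_q]
  have h : LocallyOfFiniteType (specIncl (chartRing_zero_le_fanAlg k i.2) ≫
      Spec.map (CommRingCat.ofHom (algebraMap k (chartRing k p 0)))) := by
    rw [specAlg_toSpecK (k := k)]
    obtain ⟨e⟩ := exists_mvPolynomial_equiv (k := k) (u := (1, -(i : ℤ))) (v := (-1, (i : ℤ) + 1)) (by simp)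
    rw [← fan_eq_closure] at e
    have : Algebra.FiniteType k (fanAlg k i) := Algebra.FiniteType.equiv inferInstance e
    exact (HasRingHomProperty.Spec_iff (P := @LocallyOfFiniteType)).mpr
      (RingHom.finiteType_algebraMap.mpr this)
  exact locallyOfFiniteType_of_comp _ (Spec.map (CommRingCat.ofHom (algebraMap k (chartRing k p 0))))

end FanSurface

/-! ### The resolution is proper -/

theorem exists_extend_of_isLocStep {A T : Type u} [CommRing A] [CommRing T] [Algebra A T]
    {B C : Subalgebra A T} (hle : B ≤ C) {f g : T} (hf : f ∈ B) (hg : g ∈ C) (hfg : f * g = 1)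
    (hs : ∀ c ∈ C, ∃ n : ℕ, f ^ n * c ∈ B) {K : Type u} [Field K] (φ : B →+* K) (h : φ ⟨f, hf⟩ ≠ 0) :
    ∃ φ' : C →+* K, φ'.comp (Subalgebra.inclusion hle).toRingHom = φ := by
  let _ := (Subalgebra.inclusion hle).toRingHom.toAlgebra
  have := isLocalization_of_isLocStep hle hf hg hfg hs
  exact ⟨IsLocalization.Away.lift (⟨f, hf⟩ : B) (IsUnit.mk0 _ h), IsLocalization.Away.lift_comp _ _⟩

section Coordinates

variable (k : Type u) [Field k]

/-- The first coordinate of the `i`-th chart of the resolution. -/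
def coordU (i : ℕ) : fanAlg k i := ⟨mono k (1, -i), mono_mem_monoAlg.mpr (mem_fan.mpr (by simp))⟩

/-- The second coordinate of the `i`-th chart of the resolution. -/
def coordV (i : ℕ) : fanAlg k i := ⟨mono k (-1, i + 1), mono_mem_monoAlg.mpr (mem_fan.mpr (by simp))⟩

variable {k}

theorem isInteger_of_coord {R K : Type u} [CommRing R] [Field K] [Algebra R K] {i : ℕ} {φ : fanAlg k i →+* K}
    (h : ∀ c : k, IsLocalization.IsInteger R (φ (algebraMap k _ c)))
    (hU : IsLocalization.IsInteger R (φ (coordU k i))) (hV : IsLocalization.IsInteger R (φ (coordV k i)))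
    (x : fanAlg k i) : IsLocalization.IsInteger R (φ x) := by
  let B : Subalgebra k (fanAlg k i) :=
    { (algebraMap R K).rangeS.comap φ with
      algebraMap_mem' := h }
  have hle : fanAlg k i ≤ B.map (fanAlg k i).val := by
    have h1 : fanAlg k i = Algebra.adjoin k (mono k '' {((1 : ℤ), -(i : ℤ)), (-1, (i : ℤ) + 1)}) := by
      rw [adjoin_mono_eq, ← fan_eq_closure]
    refine h1.le.trans (Algebra.adjoin_le ?_)
    rintro _ ⟨m, rfl | rfl, rfl⟩
    · exact ⟨coordU k i, hU, rfl⟩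
    · exact ⟨coordV k i, hV, rfl⟩
  obtain ⟨y, hy, hyx⟩ := hle x.2
  obtain rfl : y = x := Subtype.ext hyx
  exact hy

end Coordinates

namespace FanSurface

variable {k : Type u} [Field k] {p : ℕ} (F : FanSurface k p) {K : Type u} [Field K]

/-- Two points with values in a ring, in two charts, which agree on the resolution. -/
def Agree {K : Type u} [CommRing K] {i j : Fin p} (φ : fanAlg k i →+* K) (φ' : fanAlg k j →+* K) : Prop :=
  Spec.map (CommRingCat.ofHom φ) ≫ F.g i = Spec.map (CommRingCat.ofHom φ') ≫ F.g j

variable {F}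

theorem Agree.comp_eq {i j : Fin p} {φ : fanAlg k i →+* K} {φ' : fanAlg k j →+* K} (h : F.Agree φ φ')
    (x : chartRing k p 0) : φ (Subalgebra.inclusion (chartRing_zero_le_fanAlg k i.2) x) =
      φ' (Subalgebra.inclusion (chartRing_zero_le_fanAlg k j.2) x) := by
  have h1 := congrArg (· ≫ F.q) h
  simp only [Category.assoc, F.g_q] at h1
  rw [← Spec.map_comp, ← Spec.map_comp] at h1
  exact congrArg (fun f => f.hom x) (Spec.map_injective h1)

theorem agree_of_comp {i j : Fin p} (φ : (fanAlg k i ⊔ fanAlg k j : Subalgebra k (Laurent k)) →+* K) :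
    F.Agree (φ.comp (Subalgebra.inclusion le_sup_left).toRingHom)
      (φ.comp (Subalgebra.inclusion le_sup_right).toRingHom) := by
  have h1 := congrArg (Spec.map (CommRingCat.ofHom φ) ≫ ·) (F.isPullback i j).w
  rw [← Category.assoc, ← Category.assoc, ← Spec.map_comp, ← Spec.map_comp] at h1
  exact h1

/-- A field-valued point of one chart at which the monomial defining the overlap is nonzero also
lies in the other chart, where the inverse monomial takes the inverse value. -/
theorem exists_agree {i j : Fin p} {u : ℤ × ℤ} (hu : u ∈ fan i) (hu' : -u ∈ fan j)
    (h : ∀ m ∈ fan j, ∃ n : ℕ, n • u + m ∈ fan i) {φ : fanAlg k i →+* K}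
    (hφ : φ ⟨mono k u, mono_mem_monoAlg.mpr hu⟩ ≠ 0) :
    ∃ φ' : fanAlg k j →+* K, F.Agree φ φ' ∧
      φ' ⟨mono k (-u), mono_mem_monoAlg.mpr hu'⟩ = (φ ⟨mono k u, mono_mem_monoAlg.mpr hu⟩)⁻¹ := by
  have hu1 : mono k (-u) ∈ fanAlg k i ⊔ fanAlg k j :=
    (le_sup_right : fanAlg k j ≤ _) (mono_mem_monoAlg.mpr hu')
  have hm : mono k u * mono k (-u) = 1 := by rw [mono_mul, add_neg_cancel, mono_zero]
  obtain ⟨θ, rfl⟩ := exists_extend_of_isLocStep le_sup_left _ hu1 hm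
    (fun c hc => monoAlg_sup_le_saturation k hu h hc) φ hφ
  refine ⟨_, agree_of_comp θ, eq_inv_of_mul_eq_one_right ?_⟩
  refine (map_mul θ _ _).symm.trans ((congrArg θ (Subtype.ext ?_)).trans (map_one θ))
  exact hm

variable {R : Type u} [CommRing R] [IsDomain R] [ValuationRing R] [Algebra R K] [IsFractionRing R K]

/-- If the first coordinate is not integral, pass to the preceding chart, whose second coordinate is
its inverse and hence integral. The descent ends at chart 0, where the first coordinate is x,
integral by hypothesis. -/
theorem exists_agree_integer_of_coordV {i : ℕ} (hi : i < p) {φ : fanAlg k (⟨i, hi⟩ : Fin p) →+* K}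
    (h : ∀ x, IsLocalization.IsInteger R (φ (Subalgebra.inclusion (chartRing_zero_le_fanAlg k hi) x)))
    (hV : IsLocalization.IsInteger R (φ (coordV k i))) :
    ∃ (j : Fin p) (φ' : fanAlg k j →+* K), F.Agree φ φ' ∧ ∀ x, IsLocalization.IsInteger R (φ' x) := by
  induction i with
  | zero =>
    refine ⟨_, φ, rfl, isInteger_of_coord (fun c => h (algebraMap k _ c)) ?_ hV⟩
    have hx : mono k (1, 0) ∈ chartRing k p 0 := by
      rw [chartRing_eq]
      exact mono_mem_monoAlg.mpr (mem_dualCone.mpr (by simp))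
    have e : coordU k 0 = Subalgebra.inclusion (chartRing_zero_le_fanAlg k hi) ⟨_, hx⟩ :=
      Subtype.ext (by simp [coordU])
    rw [e]
    exact h _
  | succ i ih =>
    rcases ValuationRing.isInteger_or_isInteger R (φ (coordU k (i + 1))) with hU | hU
    · exact ⟨_, φ, rfl, isInteger_of_coord (fun c => h (algebraMap k _ c)) hU hV⟩
    · by_cases h0 : φ (coordU k (i + 1)) = 0
      · refine ⟨_, φ, rfl, isInteger_of_coord (fun c => h (algebraMap k _ c)) ?_ hV⟩
        rw [h0]
        exact IsLocalization.isInteger_zero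
      · obtain ⟨φ', h1, h2⟩ := exists_agree (F := F) (i := ⟨i + 1, hi⟩) (j := ⟨i, by omega⟩)
          (u := (1, -((i + 1 : ℕ) : ℤ))) (mem_fan.mpr (by simp)) (mem_fan.mpr (by simp))
          (fun m hm => by simpa using exists_nsmul_add_mem_fan_succ hm) h0
        obtain ⟨j, φ'', h3, h4⟩ := ih (by omega) (φ := φ') (fun x => by
          rw [← h1.comp_eq]
          exact h x) (by
          have e : (⟨mono k (-(1, -((i + 1 : ℕ) : ℤ))), mono_mem_monoAlg.mpr (mem_fan.mpr (by simp))⟩ :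
              fanAlg k i) = coordV k i := Subtype.ext (by simp [coordV])
          rw [← e]
          refine h2 ▸ hU)
        exact ⟨j, φ'', Eq.trans h1 h3, h4⟩

/-- The mirror image, ascending to the last chart, where the second coordinate is z = x^(-1) y^p.
The number `n` counts the charts above the current one. -/
theorem exists_agree_integer_of_coordU {n i : ℕ} (hi : i < p) (hn : i + 1 + n = p)
    {φ : fanAlg k (⟨i, hi⟩ : Fin p) →+* K}
    (h : ∀ x, IsLocalization.IsInteger R (φ (Subalgebra.inclusion (chartRing_zero_le_fanAlg k hi) x)))
    (hU : IsLocalization.IsInteger R (φ (coordU k i))) :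
    ∃ (j : Fin p) (φ' : fanAlg k j →+* K), F.Agree φ φ' ∧ ∀ x, IsLocalization.IsInteger R (φ' x) := by
  induction n generalizing i with
  | zero =>
    refine ⟨_, φ, rfl, isInteger_of_coord (fun c => h (algebraMap k _ c)) hU ?_⟩
    have hx : mono k (-1, p) ∈ chartRing k p 0 := by
      rw [chartRing_eq]
      exact mono_mem_monoAlg.mpr (mem_dualCone.mpr (by simp))
    have e : coordV k i = Subalgebra.inclusion (chartRing_zero_le_fanAlg k hi) ⟨_, hx⟩ :=
      Subtype.ext (by simp [coordV, ← hn])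
    rw [e]
    exact h _
  | succ n ih =>
    rcases ValuationRing.isInteger_or_isInteger R (φ (coordV k i)) with hV | hV
    · exact ⟨_, φ, rfl, isInteger_of_coord (fun c => h (algebraMap k _ c)) hU hV⟩
    · by_cases h0 : φ (coordV k i) = 0
      · refine ⟨_, φ, rfl, isInteger_of_coord (fun c => h (algebraMap k _ c)) hU ?_⟩
        rw [h0]
        exact IsLocalization.isInteger_zero
      · obtain ⟨φ', h1, h2⟩ := exists_agree (F := F) (i := ⟨i, hi⟩) (j := ⟨i + 1, by omega⟩)
          (u := (-1, (i : ℤ) + 1)) (mem_fan.mpr (by simp)) (mem_fan.mpr (by simp))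
          (fun m hm => exists_nsmul_add_mem_fan hm) h0
        obtain ⟨j, φ'', h3, h4⟩ := ih (i := i + 1) (by omega) (by omega) (φ := φ') (fun x => by
          rw [← h1.comp_eq]
          exact h x) (by
          have e : (⟨mono k (-(-1, (i : ℤ) + 1)), mono_mem_monoAlg.mpr (mem_fan.mpr (by simp))⟩ :
              fanAlg k (i + 1)) = coordU k (i + 1) := Subtype.ext (by simp [coordU])
          rw [← e]
          refine h2 ▸ hV)
        exact ⟨j, φ'', Eq.trans h1 h3, h4⟩

/-- The product of the two coordinates is y, which is integral. If the second coordinate is not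
integral, its inverse is, and therefore so is the first coordinate. -/
theorem exists_agree_integer {i : Fin p} {φ : fanAlg k i →+* K}
    (h : ∀ x, IsLocalization.IsInteger R (φ (Subalgebra.inclusion (chartRing_zero_le_fanAlg k i.2) x))) :
    ∃ (j : Fin p) (φ' : fanAlg k j →+* K), F.Agree φ φ' ∧ ∀ x, IsLocalization.IsInteger R (φ' x) := by
  obtain ⟨i, hi⟩ := i
  rcases ValuationRing.isInteger_or_isInteger R (φ (coordV k i)) with hV | hV
  · exact exists_agree_integer_of_coordV hi h hV
  · by_cases h0 : φ (coordV k i) = 0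
    · refine exists_agree_integer_of_coordV hi h ?_
      rw [h0]
      exact IsLocalization.isInteger_zero
    · have hU : IsLocalization.IsInteger R (φ (coordU k i)) := by
        have hy : mono k (0, 1) ∈ chartRing k p 0 := by
          rw [chartRing_eq]
          exact mono_mem_monoAlg.mpr (mem_dualCone.mpr (by simp))
        have e : coordU k i * coordV k i = Subalgebra.inclusion (chartRing_zero_le_fanAlg k hi) ⟨_, hy⟩ :=
          Subtype.ext ((mono_mul _ _).trans (by simp))
        have e1 : φ (coordU k i) = φ (coordU k i * coordV k i) * (φ (coordV k i))⁻¹ := by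
          rw [map_mul, mul_assoc, mul_inv_cancel₀ h0, mul_one]
        rw [e1, e]
        exact IsLocalization.isInteger_mul (h _) hV
      exact exists_agree_integer_of_coordU (n := p - (i + 1)) hi (by omega) h hU

variable (F)

/-- By the valuative criterion: a field-valued point lies in a single chart, and moving along the
chain of charts reaches one in which all functions take values in the valuation ring. -/
instance : IsProper F.q := by
  have h : ValuativeCriterion.Existence F.q := by
    rintro ⟨R, K, i₁, i₂, ⟨w⟩⟩
    let o : Spec (.of K) := (⊥ : PrimeSpectrum K)
    obtain ⟨i, hi⟩ := F.covers (i₁ o)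
    have hrange : Set.range i₁ ⊆ Set.range (F.g i) := by
      rintro _ ⟨z, rfl⟩
      rwa [Subsingleton.elim (α := PrimeSpectrum K) z o]
    obtain ⟨φ, hφ⟩ := Spec.map_surjective (IsOpenImmersion.lift (F.g i) i₁ hrange)
    obtain ⟨ψ, rfl⟩ := Spec.map_surjective i₂
    have hφ1 : Spec.map φ ≫ F.g i = i₁ := by rw [hφ, IsOpenImmersion.lift_fac]
    have hφψ : ∀ x, φ.hom (Subalgebra.inclusion (chartRing_zero_le_fanAlg k i.2) x) =
        algebraMap R K (ψ.hom x) := fun x => by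
      rw [← hφ1, Category.assoc, F.g_q, ← Spec.map_comp, ← Spec.map_comp] at w
      exact congrArg (fun f => f.hom x) (Spec.map_injective w)
    obtain ⟨j, φ', h1, h2⟩ := exists_agree_integer (F := F) (R := R) (φ := φ.hom)
      fun x => ⟨ψ.hom x, (hφψ x).symm⟩
    -- A homomorphism to `K` with integral values is made into one to `R` through the isomorphism of
    -- `R` with its image.
    let e : R ≃+* (algebraMap R K).range := RingEquiv.ofBijective (algebraMap R K).rangeRestrict
      ⟨fun a b hab => IsFractionRing.injective R K (congrArg Subtype.val hab),
        (algebraMap R K).rangeRestrict_surjective⟩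
    let χ : fanAlg k j →+* R := (e.symm : _ →+* R).comp (φ'.codRestrict (algebraMap R K).range h2)
    have hχ : ∀ x, algebraMap R K (χ x) = φ' x := fun x =>
      congrArg Subtype.val (e.apply_symm_apply ⟨φ' x, h2 x⟩)
    refine ⟨⟨⟨Spec.map (CommRingCat.ofHom χ) ≫ F.g j, ?_, ?_⟩⟩⟩
    · refine Eq.trans ?_ hφ1
      rw [← Category.assoc, ← Spec.map_comp]
      have : CommRingCat.ofHom χ ≫ CommRingCat.ofHom (algebraMap R K) = CommRingCat.ofHom φ' := by
        ext x
        exact hχ x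
      rw [this]
      exact h1.symm
    · rw [Category.assoc, F.g_q, ← Spec.map_comp]
      congr 1
      ext x
      apply IsFractionRing.injective R K
      exact (hχ _).trans ((h1.comp_eq x).symm.trans (hφψ x))
  have : UniversallyClosed F.q := .of_valuativeCriterion _ h
  exact ⟨⟩

end FanSurface

/-! ### The resolution is birational -/

section Torus

variable {k : Type u} [Field k]

/-- Both linear forms take the value 1 on the exponent of y, so multiplication by a large power of y
brings any monomial into the cone. -/
theorem isOpenImmersion_torus {B : Subalgebra k (Laurent k)} {a b : ℤ}
    (hB : B = monoAlg k (dualCone (a, 1) (b, 1))) :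
    ∃ hy : mono k (0, 1) ∈ B, IsOpenImmersion (specIncl (le_top : B ≤ ⊤)) ∧
      Set.range (specIncl (le_top : B ≤ ⊤)) =
        (PrimeSpectrum.basicOpen (⟨mono k (0, 1), hy⟩ : B) : Set (PrimeSpectrum B)) := by
  subst hB
  have hy : mono k (0, 1) ∈ monoAlg k (dualCone (a, 1) (b, 1)) :=
    mono_mem_monoAlg.mpr (mem_dualCone.mpr (by simp))
  refine ⟨hy, specIncl_isLocStep le_top hy (g := mono k (0, -1)) trivial
    (by rw [mono_mul]; exact mono_zero) fun c _ => ?_⟩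
  have h : (⊤ : Subalgebra k (Laurent k)) ≤ saturation _ (mono k (0, 1)) hy := by
    rw [← monoAlg_top, monoAlg_le_iff]
    intro m _
    refine ⟨(a * m.1 + m.2).natAbs + (b * m.1 + m.2).natAbs, ?_⟩
    rw [mono_pow, mono_mul]
    refine mono_mem_monoAlg.mpr (mem_dualCone.mpr ?_)
    simp only [Prod.smul_mk, smul_zero, nsmul_eq_mul, mul_one, Prod.fst_add, Prod.snd_add, zero_add, one_mul]
    push_cast
    have h1 := neg_abs_le (a * m.1 + m.2)
    have h2 := neg_abs_le (b * m.1 + m.2)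
    have h3 := abs_nonneg (a * m.1 + m.2)
    have h4 := abs_nonneg (b * m.1 + m.2)
    constructor <;> linarith
  exact h trivial

theorem denseRange_of_isOpenImmersion {X Y : Scheme.{u}} (f : X ⟶ Y) [IsOpenImmersion f] [Nonempty X]
    [IrreducibleSpace Y] : DenseRange f :=
  f.opensRange.2.dense (Set.range_nonempty f)

end Torus

namespace FanSurface

variable {k : Type u} [Field k] {p : ℕ} [NeZero p] (F : FanSurface k p)

theorem isOpenImmersion_torusIncl (i : ℕ) : IsOpenImmersion (specIncl (le_top : fanAlg k i ≤ ⊤)) :=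
  (isOpenImmersion_torus rfl).2.1

variable (k p) in
/-- The torus of the surface `xz = y^p`. -/
def torusBase : Spec (.of (⊤ : Subalgebra k (Laurent k))) ⟶ Spec (.of (chartRing k p 0)) :=
  specIncl le_top

variable (k p) in
theorem isOpenImmersion_torusBase_range : ∃ hy : mono k (0, 1) ∈ chartRing k p 0,
    IsOpenImmersion (torusBase k p) ∧ Set.range (torusBase k p) =
      (PrimeSpectrum.basicOpen (⟨mono k (0, 1), hy⟩ : chartRing k p 0) : Set (PrimeSpectrum _)) :=
  isOpenImmersion_torus (chartRing_eq k p 0)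

instance : IsOpenImmersion (torusBase k p) := (isOpenImmersion_torusBase_range k p).2.1

/-- The torus of the resolution. -/
def torus : Spec (.of (⊤ : Subalgebra k (Laurent k))) ⟶ F.Z :=
  specIncl (le_top : fanAlg k 0 ≤ ⊤) ≫ F.g ⟨0, NeZero.pos p⟩

instance : IsOpenImmersion F.torus := by
  have := isOpenImmersion_torusIncl (k := k) 0
  have := F.isOpenImmersion ⟨0, NeZero.pos p⟩
  unfold torus
  exact IsOpenImmersion.comp _ _

theorem torus_eq (i : Fin p) : specIncl (le_top : fanAlg k i ≤ ⊤) ≫ F.g i = F.torus := by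
  have h := congrArg (fun f => specIncl (le_top : fanAlg k 0 ⊔ fanAlg k i ≤ ⊤) ≫ f)
    (F.isPullback ⟨0, NeZero.pos p⟩ i).w
  simp only [← Category.assoc] at h
  rw [specIncl_comp, specIncl_comp] at h
  exact h.symm

theorem torus_eq_sup (i j : Fin p) : specIncl (le_top : fanAlg k i ⊔ fanAlg k j ≤ ⊤) ≫
    specIncl (le_sup_left : fanAlg k i ≤ fanAlg k i ⊔ fanAlg k j) ≫ F.g i = F.torus := by
  rw [← Category.assoc, specIncl_comp, torus_eq]

theorem torus_q : F.torus ≫ F.q = torusBase k p := by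
  rw [torus, Category.assoc, F.g_q, specIncl_comp, torusBase]

theorem preimage_torusBase : F.q ⁻¹ᵁ (torusBase k p).opensRange = F.torus.opensRange := by
  obtain ⟨hy, -, hr⟩ := isOpenImmersion_torusBase_range k p
  ext z
  change F.q z ∈ Set.range (torusBase k p) ↔ z ∈ Set.range F.torus
  constructor
  · intro hz
    obtain ⟨i, w, rfl⟩ := F.covers z
    have h1 : (F.g i ≫ F.q) w ∈ Set.range (torusBase k p) := hz
    rw [F.g_q, hr] at h1
    obtain ⟨hy', -, hr'⟩ := isOpenImmersion_torus (k := k) (B := fanAlg k i) rfl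
    have h2 : w ∈ Set.range (specIncl (le_top : fanAlg k i ≤ ⊤)) := by
      rw [hr']
      exact h1
    obtain ⟨v, rfl⟩ := h2
    rw [← F.torus_eq i]
    exact ⟨v, rfl⟩
  · rintro ⟨v, rfl⟩
    rw [← F.torus_q]
    exact ⟨v, rfl⟩

theorem isPullback_torus : IsPullback F.torus (𝟙 _) F.q (torusBase k p) :=
  (IsOpenImmersion.isPullback _ _ _ _ (by rw [torus_q, Category.id_comp]) F.preimage_torusBase).flip

theorem denseRange_torus : DenseRange F.torus := by
  intro z
  obtain ⟨i, w, rfl⟩ := F.covers z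
  have := isOpenImmersion_torusIncl (k := k) i
  have h := image_closure_subset_closure_image (F.g i).continuous
    ⟨w, denseRange_of_isOpenImmersion (specIncl (le_top : fanAlg k i ≤ ⊤)) w, rfl⟩
  rw [← F.torus_eq i]
  refine closure_mono ?_ h
  rintro _ ⟨_, ⟨v, rfl⟩, rfl⟩
  exact ⟨v, rfl⟩

variable (k p) in
theorem denseRange_torusBase : DenseRange (torusBase k p) := denseRange_of_isOpenImmersion _

/-- Above and below, the torus is the locus where y does not vanish; it is dense in both surfaces,
and the morphism is the identity over it. -/
theorem isResolution {U : Scheme.{u}} (e : Spec (.of (chartRing k p 0)) ⟶ U) [IsIso e] :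
    IsResolution (F.q ≫ e) where
  regular := F.isRegularScheme
  proper := inferInstance
  birational := by
    have hp : IsPullback F.torus (𝟙 _) (F.q ≫ e) (torusBase k p ≫ e) :=
      F.isPullback_torus.paste_vert (IsPullback.of_vert_isIso ⟨(Category.id_comp _).symm⟩)
    refine ⟨(torusBase k p ≫ e).opensRange, ?_, ?_, ?_⟩
    · have h := (e.homeomorph.surjective.denseRange).comp (denseRange_torusBase k p) e.continuous
      exact h
    · have h : (F.q ≫ e) ⁻¹ᵁ (torusBase k p ≫ e).opensRange = F.torus.opensRange := by
        rw [← F.preimage_torusBase]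
        ext z
        change e (F.q z) ∈ Set.range (torusBase k p ≫ e) ↔ F.q z ∈ Set.range (torusBase k p)
        constructor
        · rintro ⟨v, hv⟩
          exact ⟨v, e.homeomorph.injective hv⟩
        · rintro ⟨v, hv⟩
          exact ⟨v, congrArg (fun w => e w) hv⟩
      rw [h]
      exact F.denseRange_torus
    · have h1 : IsIso (pullback.snd (F.q ≫ e) (torusBase k p ≫ e)) := by
        have h2 := hp.isoPullback_inv_snd
        rw [Category.comp_id] at h2
        rw [← h2]
        infer_instance
      exact ((MorphismProperty.isomorphisms Scheme.{u}).arrow_mk_iso_iff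
        (morphismRestrictOpensRange (F.q ≫ e) (torusBase k p ≫ e))).mpr h1

end FanSurface

/-! ### The cohomology of the resolution -/

section Coboundary

variable {k : Type u} [Field k]

/-- Two adjacent cones both lie in the half plane dual to their common ray (i+1,1). -/
theorem coeff_eq_zero_of_mem_sup {i : ℕ} {f : Laurent k} (hf : f ∈ fanAlg k i ⊔ fanAlg k (i + 1))
    {m : ℤ × ℤ} (hm : (i + 1) * m.1 + m.2 < 0) : f.coeff m = 0 := by
  by_contra h
  rw [monoAlg_sup] at hf
  have h1 : fan i ⊔ fan (i + 1) ≤ dualCone (i + 1, 1) (i + 1, 1) := by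
    refine sup_le (fun n hn => ?_) fun n hn => ?_
    · have := (mem_fan.mp hn).2
      exact mem_dualCone.mpr (by simpa using this)
    · have := (mem_fan.mp hn).1
      exact mem_dualCone.mpr (by simpa using this)
  have h2 := (mem_dualCone.mp (h1 (hf m h))).1
  rw [one_mul] at h2
  linarith

/-- Work one monomial at a time. If a ≥ 0, the values ia + b increase with i. A monomial missing
from chart i then has negative pairing with every ray (l,1) for 1 ≤ l ≤ i, and so is missing from
every overlap between chart 0 and chart i, where the cocycle has no such term. If a < 0, the same
holds on the way from the last chart. -/
theorem exists_coboundary {n : ℕ} {C : Fin (n + 1) → Fin (n + 1) → Laurent k}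
    (hC : ∀ i j : Fin (n + 1), C i j ∈ fanAlg k i ⊔ fanAlg k j) (hc : ∀ i j l, C j l - C i l + C i j = 0) :
    ∃ B : Fin (n + 1) → Laurent k, (∀ i : Fin (n + 1), B i ∈ fanAlg k i) ∧ ∀ i j, C i j = B j - B i := by
  have hadd (i j l m) : (C i l).coeff m = (C i j).coeff m + (C j l).coeff m := by
    have h := congrArg (fun f : Laurent k => f.coeff m) (hc i j l)
    simp only [AddMonoidAlgebra.coeff_add, AddMonoidAlgebra.coeff_sub, AddMonoidAlgebra.coeff_zero, Finsupp.add_apply,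
      Finsupp.sub_apply, Finsupp.zero_apply] at h
    linear_combination -h
  have hself (i m) : (C i i).coeff m = 0 := by
    have := hadd i i i m
    linear_combination -this
  have h0 (i : Fin (n + 1)) (m : ℤ × ℤ) (hm : 0 ≤ m.1) (hi : m ∉ fan i) : (C 0 i).coeff m = 0 := by
    induction i using Fin.induction with
    | zero => exact hself 0 m
    | succ i ih =>
      rw [mem_fan] at hi
      simp only [Fin.val_succ] at hi
      push_cast at hi
      have h1 : ((i : ℕ) + 1 : ℤ) * m.1 + m.2 < 0 := by
        by_contra! h
        exact hi ⟨h, by linarith⟩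
      rw [hadd 0 i.castSucc, coeff_eq_zero_of_mem_sup (i := i) (hC i.castSucc i.succ) h1, add_zero]
      refine ih fun h => ?_
      rw [mem_fan] at h
      simp only [Fin.val_castSucc] at h
      linarith [h.1]
  have h1 (i : Fin (n + 1)) (m : ℤ × ℤ) (hm : m.1 < 0) (hi : m ∉ fan i) : (C (Fin.last n) i).coeff m = 0 := by
    induction i using Fin.reverseInduction with
    | last => exact hself _ m
    | cast i ih =>
      rw [mem_fan] at hi
      simp only [Fin.val_castSucc] at hi
      have h1 : ((i : ℕ) + 1 : ℤ) * m.1 + m.2 < 0 := by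
        by_contra! h
        exact hi ⟨by linarith, h⟩
      have h2 : C i.succ i.castSucc ∈ fanAlg k i ⊔ fanAlg k (i + 1) := by
        rw [sup_comm]
        exact hC i.succ i.castSucc
      rw [hadd _ i.succ, coeff_eq_zero_of_mem_sup h2 h1, add_zero]
      refine ih fun h => ?_
      rw [mem_fan] at h
      simp only [Fin.val_succ] at h
      push_cast at h
      linarith [h.1]
  -- The cochain is the cocycle based at chart 0 on monomials with a ≥ 0 and at the last chart on
  -- the others. Either choice of base gives the right coboundary, and this split makes the result
  -- regular on each chart.
  let B (i : Fin (n + 1)) : Laurent k := AddMonoidAlgebra.ofCoeff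
    ((C 0 i).coeff.filter (fun m => 0 ≤ m.1) + (C (Fin.last n) i).coeff.filter (fun m => ¬ 0 ≤ m.1))
  have hB (i m) : (B i).coeff m = if 0 ≤ m.1 then (C 0 i).coeff m else (C (Fin.last n) i).coeff m := by
    simp only [B, Finsupp.add_apply, Finsupp.filter_apply]
    split_ifs <;> simp
  refine ⟨B, fun i m hm => ?_, fun i j => ?_⟩
  · rw [hB] at hm
    by_contra h
    split_ifs at hm with hs
    · exact hm (h0 i m hs h)
    · exact hm (h1 i m (not_le.mp hs) h)
  · ext m
    rw [AddMonoidAlgebra.coeff_sub, Finsupp.sub_apply, hB, hB]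
    split_ifs
    · linear_combination - hadd 0 i j m
    · linear_combination - hadd (Fin.last n) i j m

end Coboundary

namespace FanSurface

variable {k : Type u} [Field k] {p : ℕ} [NeZero p] (F : FanSurface k p)

theorem top_le_preimage {X Y : Scheme.{u}} (f : X ⟶ Y) [IsOpenImmersion f] {O : Y.Opens} (h : f.opensRange ≤ O) : ⊤ ≤ f ⁻¹ᵁ O :=
  fun x _ => h ⟨x, rfl⟩

/-- The restriction of functions to the torus. -/
def toTorus {O : F.Z.Opens} (h : F.torus.opensRange ≤ O) : Γ(F.Z, O) →+* (⊤ : Subalgebra k (Laurent k)) :=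
  (F.torus.appLE O ⊤ (top_le_preimage _ h) ≫ (Scheme.ΓSpecIso _).hom).hom

theorem toTorus_restr {O O' : F.Z.Opens} (h : F.torus.opensRange ≤ O) (h' : O ≤ O') (a : Γ(F.Z, O')) :
    F.toTorus h (restr h' a) = F.toTorus (h.trans h') a := by
  have h1 := F.torus.map_appLE (V := ⊤) (top_le_preimage _ h) (homOfLE h').op
  have h2 := ConcreteCategory.congr_hom h1 a
  exact congrArg (fun x => (Scheme.ΓSpecIso _).hom x) h2

/-- Restriction to the torus turns sections over a chart or an overlap into elements of the
corresponding monomial algebra. -/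
theorem exists_equiv_of_opensRange {B : Subalgebra k (Laurent k)} (o : Spec (.of B) ⟶ F.Z) [IsOpenImmersion o]
    (ho : specIncl (le_top : B ≤ ⊤) ≫ o = F.torus) {O : F.Z.Opens} (hO : o.opensRange = O)
    (h : F.torus.opensRange ≤ O) :
    ∃ e : Γ(F.Z, O) ≃+* B, ∀ a, F.toTorus h a = Subalgebra.inclusion le_top (e a) := by
  subst hO
  have hiso : IsIso (o.appLE o.opensRange ⊤ (top_le_preimage o le_rfl)) := by
    have h1 := o.isIso_app o.opensRange le_rfl
    have h2 : (⊤ : (Spec (.of B)).Opens) = o ⁻¹ᵁ o.opensRange := by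
      ext x
      exact ⟨fun _ => ⟨x, rfl⟩, fun _ => trivial⟩
    rw [← o.appLE_map' (V' := o ⁻¹ᵁ o.opensRange) (V := ⊤) (top_le_preimage o le_rfl) h2, Scheme.Hom.appLE_eq_app]
    infer_instance
  have h1 : F.torus.appLE o.opensRange ⊤ (top_le_preimage _ h) ≫ (Scheme.ΓSpecIso _).hom =
      (o.appLE o.opensRange ⊤ (top_le_preimage o le_rfl) ≫ (Scheme.ΓSpecIso _).hom) ≫
        CommRingCat.ofHom (Subalgebra.inclusion (le_top : B ≤ ⊤)).toRingHom := by
    have key : ∀ (f : Spec (.of (⊤ : Subalgebra k (Laurent k))) ⟶ F.Z) (hf : specIncl (le_top : B ≤ ⊤) ≫ o = f)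
        (h' : ⊤ ≤ f ⁻¹ᵁ o.opensRange), f.appLE o.opensRange ⊤ h' =
          o.appLE o.opensRange ⊤ (top_le_preimage o le_rfl) ≫ (specIncl (le_top : B ≤ ⊤)).appTop := by
      rintro _ rfl h'
      rw [← (specIncl (le_top : B ≤ ⊤)).appLE_comp_appLE o o.opensRange ⊤ ⊤ (top_le_preimage o le_rfl) le_rfl]
      congr 1
    rw [key _ ho (top_le_preimage _ h), Category.assoc, Category.assoc, ← Scheme.ΓSpecIso_naturality]
  refine ⟨(asIso (o.appLE o.opensRange ⊤ (top_le_preimage o le_rfl) ≫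
    (Scheme.ΓSpecIso _).hom)).commRingCatIsoToRingEquiv, fun a => ?_⟩
  exact ConcreteCategory.congr_hom h1 a

instance (i j : ℕ) :
    IsOpenImmersion (specIncl (le_sup_left : fanAlg k i ≤ fanAlg k i ⊔ fanAlg k j)) := by
  obtain ⟨hle, f, hf, g, hg, hfg, hs⟩ := isLocStep_fanAlg k i j
  exact (specIncl_isLocStep hle hf hg hfg hs).1

theorem range_specIncl_sup (i j : Fin p) :
    Set.range (specIncl (le_sup_left : fanAlg k i ≤ fanAlg k i ⊔ fanAlg k j) ≫ F.g i) =
      Set.range (F.g i) ∩ Set.range (F.g j) := by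
  ext z
  constructor
  · rintro ⟨v, rfl⟩
    exact ⟨⟨_, rfl⟩, _, (congrArg (fun f => f v) (F.isPullback i j).w).symm⟩
  · rintro ⟨⟨x, rfl⟩, y, hy⟩
    obtain ⟨v, rfl, -⟩ := Scheme.exists_preimage_of_isPullback (F.isPullback i j) x y hy.symm
    exact ⟨v, rfl⟩

/-- Restriction to the dense torus is injective on sections and identifies the Čech complex of the
charts with a complex of subspaces of the Laurent ring, where `exists_coboundary` applies. -/
theorem h1Vanishes : H1Vanishes F.Z := by
  obtain ⟨n, rfl⟩ := Nat.exists_eq_succ_of_ne_zero (NeZero.ne p)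
  have hle (i) : F.torus.opensRange ≤ (F.g i).opensRange := by
    rintro _ ⟨v, rfl⟩
    rw [← F.torus_eq i]
    exact ⟨_, rfl⟩
  refine ⟨_, fun i => (F.g i).opensRange, fun i => isAffineOpen_opensRange (F.g i), ?_, fun c hc => ?_⟩
  · ext z
    simpa using F.covers z
  have hsup (i j : Fin (n + 1)) := F.exists_equiv_of_opensRange (specIncl le_sup_left ≫ F.g i) (F.torus_eq_sup i j)
    (O := (F.g i).opensRange ⊓ (F.g j).opensRange) (Opens.ext (F.range_specIncl_sup i j)) (le_inf (hle i) (hle j))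
  obtain ⟨B, hB, hCB⟩ := exists_coboundary (k := k)
    (C := fun i j => (F.toTorus (le_inf (hle i) (hle j)) (c i j) : Laurent k))
    (fun i j => by
      obtain ⟨e, he⟩ := hsup i j
      exact (congrArg Subtype.val (he (c i j))).symm ▸ (e (c i j)).2)
    fun i j l => by
      have h := congrArg (F.toTorus (le_inf (le_inf (hle i) (hle j)) (hle l))) (hc i j l)
      simp only [map_add, map_sub, map_zero, toTorus_restr] at h
      exact congrArg Subtype.val h
  have hb (i) := F.exists_equiv_of_opensRange (F.g i) (F.torus_eq i) rfl (hle i)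
  choose e he using hb
  refine ⟨fun i => (e i).symm ⟨B i, hB i⟩, fun i j => ?_⟩
  obtain ⟨e', he'⟩ := hsup i j
  have hinj : Function.Injective (F.toTorus (le_inf (hle i) (hle j))) := fun a b hab => by
    rw [he', he'] at hab
    exact e'.injective (Subalgebra.inclusion_injective _ hab)
  refine hinj (Subtype.ext ?_)
  rw [map_sub, toTorus_restr, toTorus_restr, he, he, RingEquiv.apply_symm_apply, RingEquiv.apply_symm_apply]
  exact hCB i j

end FanSurface

/-! ### The rational double point and the failure of `(H₁)` -/

variable (k : Type u) [Field k] (p : ℕ)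

theorem X0.isRationalDoublePoint [Fact p.Prime] : IsRationalDoublePoint (X0 k p) (X0.sing k p) where
  noetherian := by
    rw [X0.sing]
    exact isNoetherianRing_stalk (X0.chartR0 k p) _
  domain := (X0.isNormalScheme k p _).1
  integrallyClosed := (X0.isNormalScheme k p _).2
  dim_eq_two := X0.ringKrullDim_stalk_sing k p
  multiplicity_eq_two := X0.multiplicity_sing k p (Fact.out : p.Prime).two_le
  rational := by
    obtain ⟨F⟩ := FanSurface.nonempty k p
    refine ⟨(X0.chart k p 0).opensRange, ?_, isAffineOpen_opensRange _, F.Z,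
      F.q ≫ (X0.chart k p 0).isoOpensRange.hom, F.isResolution _, F.h1Vanishes⟩
    have h : X0.sing k p ∈ Set.range (X0.chartR0 k p) := ⟨_, rfl⟩
    rwa [X0.range_chartR0] at h

/-- The kernel consists of the multiples of λ^p, and λ annihilates λ^p, so only scalar multiples
remain. -/
theorem isSmallExtension_truncMap [NeZero p] : IsSmallExtension (ArtAlg.truncMap k p) := by
  refine ⟨fun a => ?_, ?_⟩
  · obtain ⟨f, rfl⟩ : ∃ f, AdjoinRoot.mk ((Polynomial.X : Polynomial k) ^ p) f = a :=
      AdjoinRoot.mk_surjective a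
    exact ⟨AdjoinRoot.mk ((Polynomial.X : Polynomial k) ^ (p + 1)) f, AdjoinRoot.aeval_eq f⟩
  · have ht : ArtAlg.Hom.toAlgHom (ArtAlg.truncMap k p) (ArtAlg.t k (p + 1) ^ p) = 0 := by
      rw [map_pow, toAlgHom_truncMap_t, ArtAlg.t_pow]
    refine (finrank_eq_one_iff_of_nonzero' (⟨_, ht⟩ : LinearMap.ker
      (ArtAlg.Hom.toAlgHom (ArtAlg.truncMap k p)).toLinearMap)
      fun h => t_pow_ne_zero (congrArg Subtype.val h)).mpr ?_
    rintro ⟨a, ha⟩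
    obtain ⟨b, rfl⟩ := exists_eq_mul_of_truncMap_eq_zero ha
    obtain ⟨c, hc⟩ := exists_trunc_eq b
    refine ⟨(kl k p).aug b, Subtype.ext ?_⟩
    change (kl k p).aug b • ArtAlg.t k (p + 1) ^ p = ArtAlg.t k (p + 1) ^ p * b
    conv_rhs => rw [hc]
    rw [mul_add, ← mul_assoc, ← pow_succ, ArtAlg.t_pow, zero_mul, add_zero, Algebra.smul_def, mul_comm]

/-- Apply the condition to the square in which both maps are the truncation. The classes of the
glued and of the trivial deformation agree over `k[ε]`, but no locally trivial class over the fibre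
product restricts to both. -/
theorem not_schlessingerH1 [Fact p.Prime] [CharP k p] :
    ¬ SchlessingerH1 (DefLT (X0.toSpecK k p)).toFunctor := by
  intro h
  obtain ⟨D, hD⟩ := exists_isGluedDeformation (k := k) (p := p)
  have hT := Deformation.isTrivial_trivial (X0.toSpecK k p) (kl k p)
  obtain ⟨⟨_, Xb, hXb, rfl⟩, h1, h2⟩ := h _ _ _ _
    (ArtAlg.fibreProd_isPullback (ArtAlg.truncMap k p) (ArtAlg.truncMap k p)) (isSmallExtension_truncMap k p)
    ⟨_, D, hD.isLocallyTrivial, rfl⟩ ⟨_, Deformation.trivial (X0.toSpecK k p) (kl k p), hT.isLocallyTrivial, rfl⟩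
    (Subtype.ext (Quotient.sound (hD.baseChange_isomorphic (hT.baseChange _))))
  exact hD.not_exists hT ⟨Xb, hXb, Quotient.exact (congrArg Subtype.val h1), Quotient.exact (congrArg Subtype.val h2)⟩

end LocTrivDef

end

theorem theorem4p2 (k : Type u) [Field k] (p : ℕ) [Fact p.Prime] [CharP k p] :
    (IsProjectiveOver (X0.toSpecK k p) ∧ IsIntegral (X0 k p) ∧ IsNormalScheme (X0 k p) ∧
      topologicalKrullDim (X0 k p) = 2 ∧
      Scheme.BirationalOver (X0.toSpecK k p)
        (𝔸(ULift.{u} (Fin 2); Spec (.of k)) ↘ Spec (.of k)) ∧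
      ∃ P : X0 k p, IsRationalDoublePoint (X0 k p) P ∧
        (∀ Q : X0 k p, Q ≠ P → IsRegularLocalRing ((X0 k p).presheaf.stalk Q)) ∧
        ∃ U : (X0 k p).Opens, (U : Set (X0 k p)) = {P}ᶜ ∧ Smooth (U.ι ≫ X0.toSpecK k p)) ∧
    (∃ c : (i : Fin 5) → (Spec (.of (chartRing k p i)) ⟶ X0 k p), IsCharts k p c ∧
      (∃ X'' : Deformation (X0.toSpecK k p) (ArtAlg.trunc k (p + 1)),
        IsGluedDeformation k p c X'') ∧
      ∀ X'' : Deformation (X0.toSpecK k p) (ArtAlg.trunc k (p + 1)),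
        IsGluedDeformation k p c X'' →
          X''.IsLocallyTrivial ∧
          (X''.baseChange (ArtAlg.truncMap k p)).Isomorphic
            ((Deformation.trivial (X0.toSpecK k p) (ArtAlg.trunc k (p + 1))).baseChange
              (ArtAlg.truncMap k p)) ∧
          ¬ ∃ Xb : Deformation (X0.toSpecK k p)
              (ArtAlg.fibreProd (ArtAlg.truncMap k p) (ArtAlg.truncMap k p)),
            Xb.IsLocallyTrivial ∧
            (Xb.baseChange (ArtAlg.fibreProdFst (ArtAlg.truncMap k p)
              (ArtAlg.truncMap k p))).Isomorphic X'' ∧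
            (Xb.baseChange (ArtAlg.fibreProdSnd (ArtAlg.truncMap k p)
              (ArtAlg.truncMap k p))).Isomorphic
                (Deformation.trivial (X0.toSpecK k p) (ArtAlg.trunc k (p + 1)))) ∧
    ¬ SchlessingerH1 (DefLT (X0.toSpecK k p)).toFunctor := by
  have hT := Deformation.isTrivial_trivial (X0.toSpecK k p) (ArtAlg.trunc k (p + 1))
  refine ⟨⟨X0.isProjectiveOver k p, X0.isIntegral k p, X0.isNormalScheme k p,
    X0.topologicalKrullDim_eq k p, X0.birationalOver k p, X0.sing k p, X0.isRationalDoublePoint k p,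
    fun Q hQ => X0.isRegularLocalRing_stalk k p hQ,
    X0.regularLocus k p, X0.coe_regularLocus k p, X0.smooth_regularLocus k p⟩,
    ⟨X0.chart k p, X0.isCharts k p, exists_isGluedDeformation, fun D hD =>
      ⟨hD.isLocallyTrivial, hD.baseChange_isomorphic (hT.baseChange _), hD.not_exists hT⟩⟩,
    not_schlessingerH1 k p⟩
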